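/- **Conventions.** For $F=\sum A_nz^n$ and $G=\sum B_nz^n$ put $F\odot G=\sum A_nB_nz^n$. A *singular set* is a set $S\subset\mathbb C\setminus\{0\}$ having finitely many points in each disk. The *principal branch* of a power series $F$ with positive radius of convergence is its holomorphic continuation to the star $\{z:[0,z]\cap S=\emptyset\}$. Near $\alpha\neq0$ write $z=\alpha(1+e^{w})$ with $\operatorname{Re}w\to-\infty$. A multivalued function near $\alpha$ is then a germ, at $\operatorname{Re}w\to-\infty$, of a function of $w$. Set $(\Sigma f)(w)=f(w+2\pi i)$ and $\Delta=\Sigma-\mathrm{Id}$; write $\Sigma_\alpha,\Delta_\alpha$ for these operators at $\alpha$. A germ $f$ holomorphic on a half-plane $\operatorname{Re}w<\rho$ is *integrable* if $e^{w}f(w)\to0$ as $\operatorname{Re} w\to-\infty$, uniformly for $\operatorname{Im}w$ bounded (i.e. $(z-\alpha)f\to0$ in the Stolz sense). A power series $F$ *has isolated integrable singularities in $S$* if it has a principal branch on the star of the singular set $S$ and if, starting from either side ($0<\operatorname{Im}w<\pi$ or $\pi<\operatorname{Im}w<2\pi$) of the ray $\mathbb R_{>0}\,\alpha$ near $\alpha$,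 that branch continues to an integrable germ in $w$ at each $\alpha\in S$, and continues analytically to a neighbourhood of $\alpha$ for each $\alpha\notin S$. (When no point of $S$ precedes $\alpha$ on the ray, both sides give the same branch.) Fix a side; $\Delta_\alpha\Sigma_\alpha^kF$ is computed from the branch at $\alpha$ on that side. Let $\mathcal H$ be the space of all $F$ having isolated integrable singularities in some singular set. Let $\mathcal M$ be the space of all $\Delta f$, $f$ integrable (in the coordinate $w$ it is the same for every $\alpha$; the monodromy space at $\alpha$ is $\mathcal M_\alpha=\mathcal M$). Let $\mathcal A$ be the space of families $(m_\gamma)_{\gamma\in\mathbb C}$ in $\mathcal M$ that vanish outside a singular set. For $f\in\mathcal M_\alpha$, $g\in\mathcal M_\beta$ define $$(f\,\bar\star\,g)(z)=-\frac1{2\pi i}\int_\alpha^{z/\beta}f(u)\,g(z/u)\,\frac{du}{u},\qquad z\text{ near }\gamma=\alpha\beta,$$ an improper integral along the segment $u=\alpha(1+e^{w-\tau})$, $0<\tau<\infty$, where $z=\gamma(1+e^{w})$ and $z/u=\beta(1+e^{t})$ with $t=w+\log(1-e^{-\tau})-\log(1+e^{w-\tau})$. **Proposition.** 1. Let $F$,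 $G$ have isolated integrable singularities in $S$, $T$ respectively. Then $F\odot G$ has isolated integrable singularities in $ST=\{\alpha\beta:\alpha\in S,\ \beta\in T\}$. For each side, each $k\in\mathbb Z$ and all $\alpha\in S$, $\beta\in T$ the integral $\Delta_\alpha\Sigma_\alpha^kF\,\bar\star\,\Delta_\beta\Sigma_\beta^kG$ converges, and for every $\gamma\in\mathbb C$ $$\Delta_\gamma\Sigma_\gamma^k(F\odot G)=\sum_{\alpha\in S,\ \beta\in T,\ \alpha\beta=\gamma}\Delta_\alpha\Sigma_\alpha^kF\ \bar\star\ \Delta_\beta\Sigma_\beta^kG ,$$ the sum being finite. 2. For $f,g\in\mathcal M$ the integral $f\,\bar\star\,g$ converges and belongs to $\mathcal M$. The Hadamard product is a bilinear product on $\mathcal H$, and $(m\,\bar\star\,n)_\gamma=\sum_{\alpha\beta=\gamma}m_\alpha\,\bar\star\,n_\beta$ is a bilinear product on $\mathcal A$. For each side and each $k\in\mathbb Z$, the linear map $D_k:\mathcal H\to\mathcal A$, $D_kF=(\Delta_\gamma\Sigma_\gamma^kF)_\gamma$, satisfies $D_k(F\odot G)=D_kF\,\bar\star\,D_kG$; that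 is, it is a morphism from the Hadamard algebra to the integral-convolution algebra. -/

import Mathlib

open Filter Topology Complex
open scoped Pointwise

namespace HadamardMonodromy

noncomputable section

/-! ### The logarithmic covering of a punctured neighbourhood

A point `z ≠ α` near `α ≠ 0` is written `z = α * (1 + exp w)`, so `w` is a logarithm of
`(z - α) / α`.  Functions of `w`, considered for `Re w → -∞`, are (possibly multivalued) functions
of `z` near `α`, and `w ↦ w + 2 π i` is one positive turn of `z` around `α`. -/

/-- The filter `Re w → -∞`, with no condition on `Im w`. -/
def logFilter : Filter ℂ := comap Complex.re atBot

/-- Germs, at `Re w → -∞`, of functions on the logarithmic covering. -/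
abbrev LogGerm : Type := Germ logFilter ℂ

/-- The point of the plane lying under the point `w` of the logarithmic covering at `α`. -/
def pt (α w : ℂ) : ℂ := α * (1 + exp w)

lemma eventually_logFilter {p : ℂ → Prop} :
    (∀ᶠ w in logFilter, p w) ↔ ∃ ρ : ℝ, ∀ w : ℂ, w.re < ρ → p w := by
  unfold logFilter
  rw [(atBot_basis_Iio (α := ℝ)).comap Complex.re |>.eventually_iff]
  simp

instance : NeBot logFilter := by
  unfold logFilter
  exact Filter.NeBot.comap_of_surj inferInstance Complex.re_surjective

lemma tendsto_exp_logFilter : Tendsto Complex.exp logFilter (𝓝 0) := by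
  rw [tendsto_zero_iff_norm_tendsto_zero]
  simp only [Complex.norm_exp]
  exact Real.tendsto_exp_atBot.comp tendsto_comap

lemma tendsto_pt (α : ℂ) : Tendsto (pt α) logFilter (𝓝 α) := by
  have := (tendsto_exp_logFilter.const_add 1).const_mul α
  have h : (fun w => α * (1 + exp w)) = pt α := rfl
  rw [h] at this
  simpa using this

lemma tendsto_turn (k : ℤ) :
    Tendsto (fun w : ℂ => w + k * (2 * Real.pi * I)) logFilter logFilter := by
  intro s hs
  obtain ⟨ρ, hρ⟩ := eventually_logFilter.1 hs
  refine eventually_logFilter.2 ⟨ρ, fun w hw => hρ _ ?_⟩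
  simpa using hw

/-- Analytic continuation along `k` positive turns. -/
def turn (k : ℤ) : LogGerm →ₗ[ℂ] LogGerm where
  toFun f := f.compTendsto (fun w : ℂ => w + k * (2 * Real.pi * I)) (tendsto_turn k)
  map_add' f g := by
    induction f using Germ.inductionOn
    induction g using Germ.inductionOn
    rfl
  map_smul' c f := by
    induction f using Germ.inductionOn
    rfl

lemma turn_coe (k : ℤ) (f : ℂ → ℂ) :
    turn k (f : LogGerm) = ((fun w => f (w + k * (2 * Real.pi * I)) : ℂ → ℂ) : LogGerm) := rfl

lemma turn_turn (j k : ℤ) (f : LogGerm) : turn j (turn k f) = turn (j + k) f := by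
  induction f using Germ.inductionOn with
  | _ f =>
    simp only [turn_coe]
    congr 1
    funext w
    push_cast
    ring_nf

lemma turn_zero (f : LogGerm) : turn 0 f = f := by
  induction f using Germ.inductionOn with
  | _ f => simp [turn_coe]

/-- The operator `Σ`: analytic continuation along one positive turn. -/
def Sig : LogGerm ≃ₗ[ℂ] LogGerm :=
  LinearEquiv.ofLinearMap (turn 1) (turn (-1))
    (by ext f; simp [turn_turn, turn_zero]) (by ext f; simp [turn_turn, turn_zero])

/-- The monodromy operator `Δ = Σ - Id`. -/
def Del : LogGerm →ₗ[ℂ] LogGerm := (Sig : LogGerm →ₗ[ℂ] LogGerm) - LinearMap.id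

lemma Sig_zpow (k : ℤ) (f : LogGerm) : (Sig ^ k) f = turn k f := by
  induction k using Int.induction_on generalizing f with
  | zero => simp [turn_zero]
  | succ n ih =>
    rw [zpow_add_one, LinearEquiv.mul_apply, ih]
    exact turn_turn _ _ _
  | pred n ih =>
    rw [zpow_sub_one, LinearEquiv.mul_apply, ih]
    exact turn_turn _ _ _

/-- Germs on the logarithmic covering that are holomorphic with an integrable singularity:
`(z - α) f → 0` in the Stolz sense, i.e. with `Im w = arg ((z - α) / α)` staying bounded. -/
def integrableGerms : Submodule ℂ LogGerm where
  carrier := {f | ∃ f₀ : ℂ → ℂ, (f₀ : LogGerm) = f ∧ (∀ᶠ w in logFilter, AnalyticAt ℂ f₀ w) ∧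
    ∀ M : ℝ, Tendsto (fun w => exp w * f₀ w) (logFilter ⊓ 𝓟 {w | |w.im| ≤ M}) (𝓝 0)}
  add_mem' := by
    rintro _ _ ⟨f, rfl, hf, hf'⟩ ⟨g, rfl, hg, hg'⟩
    refine ⟨f + g, rfl, ?_, fun M => ?_⟩
    · filter_upwards [hf, hg] with w h1 h2 using h1.add h2
    · simpa [mul_add] using (hf' M).add (hg' M)
  zero_mem' := ⟨0, rfl, Eventually.of_forall fun w => analyticAt_const,
    fun M => by simpa using tendsto_const_nhds⟩
  smul_mem' := by
    rintro c _ ⟨f, rfl, hf, hf'⟩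
    refine ⟨c • f, rfl, ?_, fun M => ?_⟩
    · filter_upwards [hf] with w h1 using h1.const_smul
    · simpa [mul_left_comm] using (hf' M).const_mul c

/-- The monodromy space: all monodromies `Δ f` of integrable singularities. -/
def monodromySpace : Submodule ℂ LogGerm := integrableGerms.map Del

lemma turn_mem (k : ℤ) {f : LogGerm} (hf : f ∈ integrableGerms) : turn k f ∈ integrableGerms := by
  obtain ⟨f, rfl, hf, hf'⟩ := hf
  refine ⟨_, (turn_coe k f).symm, ?_, fun M => ?_⟩
  · filter_upwards [(tendsto_turn k).eventually hf] with w hw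
    exact hw.comp_of_eq (by fun_prop) rfl
  · have h1 : Tendsto (fun w : ℂ => w + k * (2 * Real.pi * I))
        (logFilter ⊓ 𝓟 {w | |w.im| ≤ M})
        (logFilter ⊓ 𝓟 {w | |w.im| ≤ M + |k * (2 * Real.pi)|}) := by
      refine (tendsto_turn k).inf (tendsto_principal_principal.2 fun w hw => ?_)
      have : (w + k * (2 * Real.pi * I)).im = w.im + k * (2 * Real.pi) := by simp
      simp only [Set.mem_ofPred_eq] at hw ⊢
      rw [this]
      exact (abs_add_le _ _).trans (by gcongr)
    refine ((hf' _).comp h1).congr fun w => ?_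
    simp only [Function.comp]
    rw [Complex.exp_periodic.int_mul k w]

/-! ### The integral convolution -/

/-- If `u = α (1 + exp (w - τ))` and `z = α β (1 + exp w)`, then `z / u = β (1 + exp t)` with
`t = cofactor w τ`, on the sheet obtained by continuity from `t ≈ w` when `τ` is large. -/
def cofactor (w : ℂ) (τ : ℝ) : ℂ := w + log (1 - exp (-τ)) - log (1 + exp (w - τ))

/-- The integral `-1/(2πi) ∫ f(u) g(z/u) du/u` along the segment from `α` to `z/β` with both ends
cut off: at `z = α β (1 + exp w)` the segment is `u = α (1 + exp (w - τ))`, `0 < τ < ∞`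
(`τ = ∞` is `u = α` and `τ = 0` is `u = z/β`), and `p.1 < τ < p.2` is kept. -/
def truncatedConv (f g : ℂ → ℂ) (w : ℂ) (p : ℝ × ℝ) : ℂ :=
  -(1 / (2 * Real.pi * I)) * ∫ τ in p.1..p.2,
    f (w - τ) * g (cofactor w τ) * (exp (w - τ) / (1 + exp (w - τ)))

/-- The (improper) integral defining the convolution of `f` and `g` converges, with value `h`. -/
def HasConv (f g h : LogGerm) : Prop :=
  ∃ f₀ g₀ h₀ : ℂ → ℂ, (f₀ : LogGerm) = f ∧ (g₀ : LogGerm) = g ∧ (h₀ : LogGerm) = h ∧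
    ∀ᶠ w in logFilter, Tendsto (truncatedConv f₀ g₀ w) (𝓝[>] 0 ×ˢ atTop) (𝓝 (h₀ w))

open Classical in
/-- The integral convolution `f ⋆̄ g` (zero if the integral does not converge). -/
def intConv (f g : LogGerm) : LogGerm := if h : ∃ c, HasConv f g c then h.choose else 0

lemma cofactor_spec {w : ℂ} {τ : ℝ} (hw : w.re < 0) (hτ : 0 < τ) :
    (1 + exp (cofactor w τ)) * (1 + exp (w - τ)) = 1 + exp w := by
  have h2 : (1 : ℂ) - exp (-τ) ≠ 0 := by
    intro h
    have h' : ‖exp (-(τ : ℂ))‖ = 1 := by rw [← sub_eq_zero.1 h]; simp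
    rw [Complex.norm_exp] at h'
    simp at h'
    exact hτ.ne' h'
  have h3 : (1 : ℂ) + exp (w - τ) ≠ 0 := by
    intro h
    have h' : ‖exp (w - τ)‖ = 1 := by rw [← neg_eq_of_add_eq_zero_right h]; simp
    rw [Complex.norm_exp] at h'
    simp at h'
    linarith
  have h4 : exp w * exp (-(τ : ℂ)) = exp (w - τ) := by rw [← exp_add, sub_eq_add_neg]
  rw [cofactor, exp_sub, exp_add, exp_log h2, exp_log h3]
  field_simp
  rw [mul_sub, h4]
  ring

lemma cofactor_re_le {w : ℂ} {τ : ℝ} (hw : w.re < -1) (hτ : 0 < τ) :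
    (cofactor w τ).re ≤ w.re + 1 := by
  have h1 : ‖(1 : ℂ) - exp (-τ)‖ ≤ 1 := by
    have h : (1 : ℂ) - exp (-τ) = ((1 - Real.exp (-τ) : ℝ) : ℂ) := by push_cast; rfl
    have h0 : Real.exp (-τ) < 1 := Real.exp_lt_one_iff.2 (by linarith)
    rw [h, Complex.norm_real, Real.norm_of_nonneg (by linarith)]
    linarith [Real.exp_pos (-τ)]
  have h2 : Real.exp (-1) ≤ ‖(1 : ℂ) + exp (w - τ)‖ := by
    have hn : ‖exp (w - τ)‖ ≤ Real.exp (-1) := by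
      rw [Complex.norm_exp]
      apply Real.exp_le_exp.2
      simp
      linarith
    have h3 : (1 : ℝ) - ‖exp (w - τ)‖ ≤ ‖(1 : ℂ) + exp (w - τ)‖ := by
      have := norm_sub_le_norm_add (1 : ℂ) (exp (w - τ))
      simpa using this
    have h4 : Real.exp (-1) ≤ 1 / 2 := by
      rw [Real.exp_neg, one_div]
      apply inv_anti₀ (by norm_num)
      linarith [Real.add_one_le_exp (1 : ℝ)]
    linarith
  have h5 : Real.log ‖(1 : ℂ) - exp (-τ)‖ ≤ 0 := Real.log_nonpos (norm_nonneg _) h1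
  have h6 : -1 ≤ Real.log ‖(1 : ℂ) + exp (w - τ)‖ := by
    rw [Real.le_log_iff_exp_le (lt_of_lt_of_le (Real.exp_pos _) h2)]
    exact h2
  simp only [cofactor, sub_re, add_re, log_re]
  linarith

/-- The value of the convolution does not depend on the chosen representatives. -/
lemma HasConv.unique {f g h h' : LogGerm} (H : HasConv f g h) (H' : HasConv f g h') : h = h' := by
  obtain ⟨f₀, g₀, h₀, rfl, rfl, rfl, H⟩ := H
  obtain ⟨f₁, g₁, h₁, hf, hg, rfl, H'⟩ := H'
  obtain ⟨ρ₁, hf⟩ := eventually_logFilter.1 (Germ.coe_eq.1 hf)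
  obtain ⟨ρ₂, hg⟩ := eventually_logFilter.1 (Germ.coe_eq.1 hg)
  refine Germ.coe_eq.2 ?_
  have hρ : ∀ᶠ w in logFilter, w.re < ρ₁ ∧ w.re < ρ₂ - 1 ∧ w.re < -1 :=
    eventually_logFilter.2 ⟨min ρ₁ (min (ρ₂ - 1) (-1)), fun w hw => by simpa using hw⟩
  filter_upwards [H, H', hρ] with w hw hw' ⟨hw1, hw2, hw3⟩
  refine tendsto_nhds_unique hw (hw'.congr' ?_)
  have h0 : ∀ᶠ δ : ℝ in 𝓝[>] 0, 0 < δ ∧ δ < 1 := Ioo_mem_nhdsGT one_pos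
  filter_upwards [h0.prod_mk (eventually_gt_atTop (1 : ℝ))] with p hp
  unfold truncatedConv
  congr 1
  refine intervalIntegral.integral_congr fun τ hτ => ?_
  have hτ0 : 0 < τ := by
    rw [Set.uIcc_of_le (by linarith [hp.1.2, hp.2])] at hτ
    exact hp.1.1.trans_le hτ.1
  have e1 : f₁ (w - τ) = f₀ (w - τ) := hf _ (by simp; linarith)
  have e2 : g₁ (cofactor w τ) = g₀ (cofactor w τ) :=
    hg _ (by linarith [cofactor_re_le hw3 hτ0])
  simp only [e1, e2]

lemma HasConv.intConv_eq {f g h : LogGerm} (H : HasConv f g h) : intConv f g = h := by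
  have hex : ∃ c, HasConv f g c := ⟨h, H⟩
  rw [intConv, dif_pos hex]
  exact hex.choose_spec.unique H

/-! ### Principal branches and their singularities -/

/-- The Hadamard product of power series. -/
def hadamardProduct (F G : PowerSeries ℂ) : PowerSeries ℂ :=
  PowerSeries.mk fun n => PowerSeries.coeff n F * PowerSeries.coeff n G

/-- A set of isolated points of the plane (finitely many in each disk) not containing `0`. -/
def IsSingularSet (S : Set ℂ) : Prop :=
  (0 : ℂ) ∉ S ∧ ∀ R : ℝ, (S ∩ Metric.closedBall 0 R).Finite

/-- The star of `S`: the points seen from `0` without meeting `S`, that is, the plane without the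
rays going from the points of `S` to infinity. -/
def principalStar (S : Set ℂ) : Set ℂ := {z | Disjoint (segment ℝ 0 z) S}

/-- `Φ` is the principal branch of `F`: the sum of `F` near `0`, continued radially. -/
structure IsPrincipalBranch (F : PowerSeries ℂ) (S : Set ℂ) (Φ : ℂ → ℂ) : Prop where
  analytic : AnalyticOnNhd ℂ Φ (principalStar S)
  hasSum : ∀ᶠ z in 𝓝 (0 : ℂ), HasSum (fun n => PowerSeries.coeff n F * z ^ n) (Φ z)

/-- The two sides of the ray from `0` through `α` near `α`, the left side being reached first when
turning positively around `α` from the part of the ray beyond `α`. If no other singularity lies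
on the ray before `α`, both sides give the same branch, over `0 < Im w < 2 π`. -/
inductive Side
  | left
  | right

/-- The values of `Im w` over the given side. -/
def Side.args : Side → Set ℝ
  | .left => Set.Ioo 0 Real.pi
  | .right => Set.Ioo Real.pi (2 * Real.pi)

/-- The germ `f` on the logarithmic covering at `α` is the analytic continuation around `α` of `Φ`,
starting from the given side. -/
def IsBranchAt (Φ : ℂ → ℂ) (σ : Side) (α : ℂ) (f : LogGerm) : Prop :=
  ∃ f₀ : ℂ → ℂ, (f₀ : LogGerm) = f ∧
    ∀ᶠ w in logFilter, AnalyticAt ℂ f₀ w ∧ (w.im ∈ σ.args → f₀ w = Φ (pt α w))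

/-- Starting from the given side, `Φ` extends analytically to a neighbourhood of `α`. -/
def IsRegularAt (Φ : ℂ → ℂ) (σ : Side) (α : ℂ) : Prop :=
  ∃ φ : ℂ → ℂ, AnalyticAt ℂ φ α ∧ ∀ᶠ w in logFilter, w.im ∈ σ.args → Φ (pt α w) = φ (pt α w)

/-- `F` is a holomorphic germ at `0` whose principal branch has all its singularities in `S`, all
of them isolated and integrable. -/
def HasIntegrableSingularities (F : PowerSeries ℂ) (S : Set ℂ) : Prop :=
  IsSingularSet S ∧ ∃ Φ, IsPrincipalBranch F S Φ ∧ ∀ σ : Side,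
    (∀ α ∈ S, ∃ f ∈ integrableGerms, IsBranchAt Φ σ α f) ∧ (∀ α ∉ S, IsRegularAt Φ σ α)

/-- `f` is the local branch at `α`, on the given side, of the principal branch of `F`. -/
def IsLocalBranch (σ : Side) (α : ℂ) (F : PowerSeries ℂ) (f : LogGerm) : Prop :=
  ∃ S Φ, IsSingularSet S ∧ IsPrincipalBranch F S Φ ∧ IsBranchAt Φ σ α f

open Classical in
/-- The local branch at `α` of the principal branch of `F` (it is unique). -/
def localBranch (σ : Side) (α : ℂ) (F : PowerSeries ℂ) : LogGerm :=
  if h : ∃ f, IsLocalBranch σ α F f then h.choose else 0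

lemma IsSingularSet.union {S T : Set ℂ} (hS : IsSingularSet S) (hT : IsSingularSet T) :
    IsSingularSet (S ∪ T) :=
  ⟨fun h => h.elim hS.1 hT.1, fun R => by
    rw [Set.union_inter_distrib_right]
    exact (hS.2 R).union (hT.2 R)⟩

lemma IsSingularSet.subset {S T : Set ℂ} (hT : IsSingularSet T) (h : S ⊆ T) : IsSingularSet S :=
  ⟨fun h0 => hT.1 (h h0), fun R => (hT.2 R).subset (Set.inter_subset_inter_left _ h)⟩

lemma star_anti {S T : Set ℂ} (h : S ⊆ T) : principalStar T ⊆ principalStar S :=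
  fun _ hz => Set.disjoint_of_subset_right h hz

lemma zero_mem_star {S : Set ℂ} (hS : IsSingularSet S) : (0 : ℂ) ∈ principalStar S := by
  simp only [principalStar, segment_same, Set.mem_ofPred_eq, Set.disjoint_singleton_left]
  exact hS.1

lemma isPreconnected_star (S : Set ℂ) (hS : IsSingularSet S) : IsPreconnected (principalStar S) := by
  have h : StarConvex ℝ (0 : ℂ) (principalStar S) := by
    rw [starConvex_iff_segment_subset]
    intro z hz y hy
    refine Set.disjoint_of_subset_left ?_ hz
    exact (convex_segment (0 : ℂ) z).segment_subset (left_mem_segment ℝ 0 z) hy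
  exact (h.isPathConnected (zero_mem_star hS)).isConnected.isPreconnected

lemma Side.sin_ne_zero {σ : Side} {x : ℝ} (hx : x ∈ σ.args) : Real.sin x ≠ 0 := by
  cases σ with
  | left => exact (Real.sin_pos_of_mem_Ioo hx).ne'
  | right =>
    have h1 : Real.sin (x - Real.pi) = -Real.sin x := Real.sin_sub_pi x
    have h2 : 0 < Real.sin (x - Real.pi) :=
      Real.sin_pos_of_pos_of_lt_pi (by linarith [hx.1]) (by linarith [hx.2])
    intro h
    rw [h1, h] at h2
    simp at h2

/-- Near `α`, each side of the ray is contained in the star. -/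
lemma eventually_pt_mem_star {S : Set ℂ} (hS : IsSingularSet S) (σ : Side) (α : ℂ) :
    ∀ᶠ w in logFilter, w.im ∈ σ.args → pt α w ∈ principalStar S := by
  rcases eq_or_ne α 0 with rfl | hα
  · exact Eventually.of_forall fun w _ => by simpa [pt] using zero_mem_star hS
  have hfin := hS.2 (‖α‖ + 1)
  have h1 : ∀ᶠ w in logFilter, ∀ s ∈ S ∩ Metric.closedBall 0 (‖α‖ + 1),
      (s / α).im ≠ 0 → Real.exp w.re < |(s / α).im| := by
    refine (hfin.eventually_all).2 fun s _ => ?_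
    by_cases h : (s / α).im = 0
    · simp [h]
    · have := (Real.tendsto_exp_atBot.comp (tendsto_comap (f := Complex.re))).eventually
        (gt_mem_nhds (abs_pos.2 h))
      filter_upwards [this] with w hw _ using hw
  have h2 : ∀ᶠ w in logFilter, ‖pt α w‖ < ‖α‖ + 1 :=
    (tendsto_pt α).norm.eventually (gt_mem_nhds (by linarith))
  filter_upwards [h1, h2] with w h1 h2 hw
  refine Set.disjoint_left.2 fun s hs hsS => ?_
  rw [segment_eq_image] at hs
  obtain ⟨t, ht, rfl⟩ := hs
  simp only [smul_zero, zero_add, real_smul] at hsS h1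
  have ht0 : t ≠ 0 := by
    rintro rfl
    apply hS.1
    simpa using hsS
  have him : ((t : ℂ) * pt α w / α).im = t * (Real.exp w.re * Real.sin w.im) := by
    have : (t : ℂ) * pt α w / α = (t : ℂ) * (1 + exp w) := by
      unfold pt
      field_simp
    rw [this, Complex.im_ofReal_mul]
    simp [Complex.exp_im]
  have hball : (t : ℂ) * pt α w ∈ Metric.closedBall 0 (‖α‖ + 1) := by
    simp only [mem_closedBall_zero_iff, norm_mul, Complex.norm_real, Real.norm_of_nonneg ht.1]
    nlinarith [norm_nonneg (pt α w), ht.1, ht.2]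
  have hne : t * (Real.exp w.re * Real.sin w.im) ≠ 0 :=
    mul_ne_zero ht0 (mul_ne_zero (Real.exp_ne_zero _) (Side.sin_ne_zero hw))
  have h3 := h1 _ ⟨hsS, hball⟩ (by rw [him]; exact hne)
  rw [him, abs_mul, abs_mul, abs_of_nonneg ht.1, abs_of_pos (Real.exp_pos _)] at h3
  have h4 : t * (Real.exp w.re * |Real.sin w.im|) ≤ 1 * (Real.exp w.re * 1) := by
    gcongr
    · exact ht.2
    · exact Real.abs_sin_le_one _
  linarith

lemma IsPrincipalBranch.eqOn {F : PowerSeries ℂ} {S T : Set ℂ} {Φ Ψ : ℂ → ℂ}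
    (hS : IsSingularSet S) (hT : IsSingularSet T)
    (h : IsPrincipalBranch F S Φ) (h' : IsPrincipalBranch F T Ψ) :
    Set.EqOn Φ Ψ (principalStar (S ∪ T)) := by
  refine AnalyticOnNhd.eqOn_of_preconnected_of_eventuallyEq
    (h.analytic.mono (star_anti Set.subset_union_left))
    (h'.analytic.mono (star_anti Set.subset_union_right))
    (isPreconnected_star _ (hS.union hT)) (zero_mem_star (hS.union hT)) ?_
  filter_upwards [h.hasSum, h'.hasSum] with z h1 h2 using h1.unique h2

lemma IsLocalBranch.unique {σ : Side} {α : ℂ} {F : PowerSeries ℂ} {f g : LogGerm}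
    (hf : IsLocalBranch σ α F f) (hg : IsLocalBranch σ α F g) : f = g := by
  obtain ⟨S, Φ, hS, hΦ, f, rfl, hf⟩ := hf
  obtain ⟨T, Ψ, hT, hΨ, g, rfl, hg⟩ := hg
  refine Germ.coe_eq.2 ?_
  obtain ⟨ρ, hρ⟩ := eventually_logFilter.1
    (hf.and (hg.and (eventually_pt_mem_star (hS.union hT) σ α)))
  refine eventually_logFilter.2 ⟨ρ, ?_⟩
  have hopen : ∃ U : Set ℂ, IsOpen U ∧ (∃ w₀ ∈ U, w₀.re < ρ) ∧ ∀ w ∈ U, w.im ∈ σ.args := by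
    cases σ with
    | left =>
      refine ⟨Complex.im ⁻¹' Set.Ioo 0 Real.pi, isOpen_Ioo.preimage Complex.continuous_im,
        ⟨⟨ρ - 1, Real.pi / 2⟩, ?_, by simp⟩, fun w hw => hw⟩
      constructor <;> dsimp <;> linarith [Real.pi_pos]
    | right =>
      refine ⟨Complex.im ⁻¹' Set.Ioo Real.pi (2 * Real.pi),
        isOpen_Ioo.preimage Complex.continuous_im,
        ⟨⟨ρ - 1, 3 * Real.pi / 2⟩, ?_, by simp⟩, fun w hw => hw⟩
      constructor <;> dsimp <;> linarith [Real.pi_pos]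
  obtain ⟨U, hU, ⟨w₀, hw₀, hw₀'⟩, hUσ⟩ := hopen
  have hHopen : IsOpen {w : ℂ | w.re < ρ} := isOpen_lt Complex.continuous_re continuous_const
  have key : Set.EqOn f g {w : ℂ | w.re < ρ} := by
    refine AnalyticOnNhd.eqOn_of_preconnected_of_eventuallyEq (z₀ := w₀)
      (fun w hw => (hρ w hw).1.1) (fun w hw => (hρ w hw).2.1.1)
      (convex_halfSpace_re_lt ρ).isPreconnected hw₀' ?_
    filter_upwards [hU.mem_nhds hw₀, hHopen.mem_nhds hw₀'] with w h1 h2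
    have h3 := hρ w h2
    have h4 := hUσ w h1
    rw [h3.1.2 h4, h3.2.1.2 h4]
    exact hΦ.eqOn hS hT hΨ (h3.2.2 h4)
  exact fun w hw => key hw

lemma IsLocalBranch.localBranch_eq {σ : Side} {α : ℂ} {F : PowerSeries ℂ} {f : LogGerm}
    (hf : IsLocalBranch σ α F f) : localBranch σ α F = f := by
  have hex : ∃ f, IsLocalBranch σ α F f := ⟨f, hf⟩
  rw [localBranch, dif_pos hex]
  exact hex.choose_spec.unique hf

lemma IsRegularAt.exists_branch {Φ : ℂ → ℂ} {σ : Side} {α : ℂ} (h : IsRegularAt Φ σ α) :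
    ∃ f ∈ integrableGerms, IsBranchAt Φ σ α f ∧ ∀ k, turn k f = f := by
  obtain ⟨φ, hφ, h⟩ := h
  have han : ∀ᶠ w in logFilter, AnalyticAt ℂ (fun w => φ (pt α w)) w := by
    filter_upwards [(tendsto_pt α).eventually hφ.eventually_analyticAt] with w hw
    refine hw.comp_of_eq ?_ rfl
    unfold pt
    fun_prop
  refine ⟨((fun w => φ (pt α w) : ℂ → ℂ) : LogGerm), ⟨_, rfl, han, fun M => ?_⟩,
    ⟨_, rfl, ?_⟩, fun k => ?_⟩
  · have := tendsto_exp_logFilter.mul (hφ.continuousAt.tendsto.comp (tendsto_pt α))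
    rw [zero_mul] at this
    exact this.mono_left inf_le_left
  · filter_upwards [han, h] with w h1 h2 using ⟨h1, fun hw => (h2 hw).symm⟩
  · rw [turn_coe]
    congr 1
    funext w
    rw [pt, Complex.exp_periodic.int_mul k w, pt]

lemma exists_branch {F : PowerSeries ℂ} {S : Set ℂ} (hF : HasIntegrableSingularities F S) :
    ∃ Φ, IsPrincipalBranch F S Φ ∧ ∀ σ α, ∃ f ∈ integrableGerms, IsBranchAt Φ σ α f ∧
      (α ∉ S → ∀ k, turn k f = f) := by
  obtain ⟨hS, Φ, hΦ, h⟩ := hF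
  refine ⟨Φ, hΦ, fun σ α => ?_⟩
  by_cases hα : α ∈ S
  · obtain ⟨f, hf, hf'⟩ := (h σ).1 α hα
    exact ⟨f, hf, hf', fun h => absurd hα h⟩
  · obtain ⟨f, hf, hf', hk⟩ := ((h σ).2 α hα).exists_branch
    exact ⟨f, hf, hf', fun _ => hk⟩

lemma localBranch_spec {F : PowerSeries ℂ} {S : Set ℂ} (hF : HasIntegrableSingularities F S)
    (σ : Side) (α : ℂ) : IsLocalBranch σ α F (localBranch σ α F) ∧
      localBranch σ α F ∈ integrableGerms ∧
      (α ∉ S → ∀ k, turn k (localBranch σ α F) = localBranch σ α F) := by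
  obtain ⟨Φ, hΦ, h⟩ := exists_branch hF
  obtain ⟨f, hf, hf', hk⟩ := h σ α
  have hl : IsLocalBranch σ α F f := ⟨S, Φ, hF.1, hΦ, hf'⟩
  rw [hl.localBranch_eq]
  exact ⟨hl, hf, hk⟩

lemma IsPrincipalBranch.add {F G : PowerSeries ℂ} {S T : Set ℂ} {Φ Ψ : ℂ → ℂ}
    (h : IsPrincipalBranch F S Φ) (h' : IsPrincipalBranch G T Ψ) :
    IsPrincipalBranch (F + G) (S ∪ T) (Φ + Ψ) where
  analytic := (h.analytic.mono (star_anti Set.subset_union_left)).add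
    (h'.analytic.mono (star_anti Set.subset_union_right))
  hasSum := by
    filter_upwards [h.hasSum, h'.hasSum] with z h1 h2
    simpa [add_mul] using h1.add h2

lemma IsPrincipalBranch.smul {F : PowerSeries ℂ} {S : Set ℂ} {Φ : ℂ → ℂ} (c : ℂ)
    (h : IsPrincipalBranch F S Φ) : IsPrincipalBranch (c • F) S (c • Φ) where
  analytic := fun z hz => (h.analytic z hz).const_smul
  hasSum := by
    filter_upwards [h.hasSum] with z h1
    simpa [mul_assoc] using h1.mul_left c

lemma IsBranchAt.add {Φ Ψ : ℂ → ℂ} {σ : Side} {α : ℂ} {f g : LogGerm}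
    (hf : IsBranchAt Φ σ α f) (hg : IsBranchAt Ψ σ α g) : IsBranchAt (Φ + Ψ) σ α (f + g) := by
  obtain ⟨f, rfl, hf⟩ := hf
  obtain ⟨g, rfl, hg⟩ := hg
  refine ⟨f + g, rfl, ?_⟩
  filter_upwards [hf, hg] with w h1 h2
  exact ⟨h1.1.add h2.1, fun hw => by simp [h1.2 hw, h2.2 hw]⟩

lemma IsBranchAt.smul {Φ : ℂ → ℂ} {σ : Side} {α : ℂ} {f : LogGerm} (c : ℂ)
    (hf : IsBranchAt Φ σ α f) : IsBranchAt (c • Φ) σ α (c • f) := by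
  obtain ⟨f, rfl, hf⟩ := hf
  refine ⟨c • f, rfl, ?_⟩
  filter_upwards [hf] with w h1
  exact ⟨h1.1.const_smul, fun hw => by simp [h1.2 hw]⟩

lemma IsRegularAt.add {Φ Ψ : ℂ → ℂ} {σ : Side} {α : ℂ} (hΦ : IsRegularAt Φ σ α)
    (hΨ : IsRegularAt Ψ σ α) : IsRegularAt (Φ + Ψ) σ α := by
  obtain ⟨φ, h1, h2⟩ := hΦ
  obtain ⟨ψ, h3, h4⟩ := hΨ
  refine ⟨φ + ψ, h1.add h3, ?_⟩
  filter_upwards [h2, h4] with w h5 h6 hw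
  simp [h5 hw, h6 hw]

lemma IsRegularAt.smul {Φ : ℂ → ℂ} {σ : Side} {α : ℂ} (c : ℂ) (hΦ : IsRegularAt Φ σ α) :
    IsRegularAt (c • Φ) σ α := by
  obtain ⟨φ, h1, h2⟩ := hΦ
  refine ⟨c • φ, h1.const_smul, ?_⟩
  filter_upwards [h2] with w h5 hw
  simp [h5 hw]

lemma HasIntegrableSingularities.add {F G : PowerSeries ℂ} {S T : Set ℂ}
    (hF : HasIntegrableSingularities F S) (hG : HasIntegrableSingularities G T) :
    HasIntegrableSingularities (F + G) (S ∪ T) := by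
  have hF' := hF
  have hG' := hG
  obtain ⟨hS, Φ, hΦ, h⟩ := hF
  obtain ⟨hT, Ψ, hΨ, h'⟩ := hG
  have aux : ∀ {S : Set ℂ} {Φ : ℂ → ℂ} {σ : Side},
      ((∀ α ∈ S, ∃ f ∈ integrableGerms, IsBranchAt Φ σ α f) ∧ (∀ α ∉ S, IsRegularAt Φ σ α)) →
      ∀ α, ∃ f ∈ integrableGerms, IsBranchAt Φ σ α f := by
    intro S Φ σ h α
    by_cases hα : α ∈ S
    · exact h.1 α hα
    · obtain ⟨f, hf, hf', -⟩ := (h.2 α hα).exists_branch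
      exact ⟨f, hf, hf'⟩
  refine ⟨hS.union hT, Φ + Ψ, hΦ.add hΨ, fun σ => ⟨fun α _ => ?_, fun α hα => ?_⟩⟩
  · obtain ⟨f, hf, hf'⟩ := aux (h σ) α
    obtain ⟨g, hg, hg'⟩ := aux (h' σ) α
    exact ⟨f + g, integrableGerms.add_mem hf hg, hf'.add hg'⟩
  · exact ((h σ).2 α fun hs => hα (Or.inl hs)).add ((h' σ).2 α fun hs => hα (Or.inr hs))

/-! ### The two algebras and the operators between them -/

/-- The space underlying the Hadamard algebra: germs at `0` whose principal branch has only isolated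
integrable singularities. -/
def hadamardSpace : Submodule ℂ (PowerSeries ℂ) where
  carrier := {F | ∃ S, HasIntegrableSingularities F S}
  add_mem' := by
    rintro F G ⟨S, hS⟩ ⟨T, hT⟩
    exact ⟨S ∪ T, hS.add hT⟩
  zero_mem' := by
    refine ⟨∅, ⟨by simp, by simp⟩, 0, ⟨fun z _ => analyticAt_const, ?_⟩,
      fun σ => ⟨by simp, fun α _ => ⟨0, analyticAt_const, by simp⟩⟩⟩
    exact Eventually.of_forall fun z => by simp
  smul_mem' := by
    rintro c F ⟨S, hS, Φ, hΦ, h⟩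
    refine ⟨S, hS, c • Φ, hΦ.smul c, fun σ => ⟨fun α hα => ?_, fun α hα => ?_⟩⟩
    · obtain ⟨f, hf, hf'⟩ := (h σ).1 α hα
      exact ⟨c • f, integrableGerms.smul_mem c hf, hf'.smul c⟩
    · exact ((h σ).2 α hα).smul c

/-- The space underlying the convolution algebra: families `(m γ)` of elements of the monodromy
spaces at the points `γ`, vanishing outside a set of isolated nonzero points. -/
def convolutionSpace : Submodule ℂ (ℂ → LogGerm) where
  carrier := {m | (∀ γ, m γ ∈ monodromySpace) ∧ IsSingularSet {γ | m γ ≠ 0}}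
  add_mem' := by
    rintro m n ⟨hm, hm'⟩ ⟨hn, hn'⟩
    refine ⟨fun γ => monodromySpace.add_mem (hm γ) (hn γ), (hm'.union hn').subset fun γ hγ => ?_⟩
    by_contra h
    simp only [Set.mem_union, Set.mem_ofPred_eq, not_or, not_not] at h
    exact hγ (by simp [h.1, h.2])
  zero_mem' := ⟨fun γ => monodromySpace.zero_mem, by simp [IsSingularSet]⟩
  smul_mem' := by
    rintro c m ⟨hm, hm'⟩
    refine ⟨fun γ => monodromySpace.smul_mem c (hm γ), hm'.subset fun γ hγ h => hγ ?_⟩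
    simp [h]

/-- `Δ_γ Σ_γ^k F`, for the branch of `F` at `γ` on the given side. -/
def iteratedMonodromy (σ : Side) (k : ℤ) (γ : ℂ) (F : PowerSeries ℂ) : LogGerm :=
  Del ((Sig ^ k) (localBranch σ γ F))

/-- The operator `F ↦ (Δ_γ Σ_γ^k F)_γ`. -/
def monodromyOperator (σ : Side) (k : ℤ) : hadamardSpace →ₗ[ℂ] convolutionSpace where
  toFun F := ⟨fun γ => iteratedMonodromy σ k γ F, by
    obtain ⟨F, S, hF⟩ := F
    refine ⟨fun γ => ?_, hF.1.subset fun γ hγ => ?_⟩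
    · refine Submodule.mem_map_of_mem ?_
      rw [Sig_zpow]
      exact turn_mem k (localBranch_spec hF σ γ).2.1
    · by_contra h
      refine hγ ?_
      have h1 := (localBranch_spec hF σ γ).2.2 h
      have h2 : Sig (localBranch σ γ F) = localBranch σ γ F := h1 1
      change Del ((Sig ^ k) (localBranch σ γ F)) = 0
      rw [Sig_zpow, h1 k]
      simp [Del, h2]⟩
  map_add' F G := by
    obtain ⟨F, S, hF⟩ := F
    obtain ⟨G, T, hG⟩ := G
    ext γ : 2
    obtain ⟨Φ, hΦ, h⟩ := exists_branch hF
    obtain ⟨Ψ, hΨ, h'⟩ := exists_branch hG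
    obtain ⟨f, -, hf, -⟩ := h σ γ
    obtain ⟨g, -, hg, -⟩ := h' σ γ
    have e1 : localBranch σ γ F = f := IsLocalBranch.localBranch_eq ⟨S, Φ, hF.1, hΦ, hf⟩
    have e2 : localBranch σ γ G = g := IsLocalBranch.localBranch_eq ⟨T, Ψ, hG.1, hΨ, hg⟩
    have e3 : localBranch σ γ (F + G) = f + g := IsLocalBranch.localBranch_eq
      ⟨S ∪ T, Φ + Ψ, hF.1.union hG.1, hΦ.add hΨ, hf.add hg⟩
    simp [iteratedMonodromy, e1, e2, e3]
  map_smul' c F := by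
    obtain ⟨F, S, hF⟩ := F
    ext γ : 2
    obtain ⟨Φ, hΦ, h⟩ := exists_branch hF
    obtain ⟨f, -, hf, -⟩ := h σ γ
    have e1 : localBranch σ γ F = f := IsLocalBranch.localBranch_eq ⟨S, Φ, hF.1, hΦ, hf⟩
    have e2 : localBranch σ γ (c • F) = c • f := IsLocalBranch.localBranch_eq
      ⟨S, c • Φ, hF.1, hΦ.smul c, hf.smul c⟩
    simp [iteratedMonodromy, e1, e2]

end

end HadamardMonodromy

open HadamardMonodromy

open Filter Topology Complex MeasureTheory
open scoped Pointwise

namespace HadamardMonodromy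

/-! ### Holomorphic parameter integrals and primitives -/

/-- A dominated integral of functions holomorphic in a parameter is holomorphic in it. -/
theorem hasDerivAt_integral_of_dominated_holomorphic {X : Type*} [MeasurableSpace X] {μ : Measure X}
    {F : ℂ → X → ℂ} {bound : X → ℝ} {z₀ : ℂ} {r : ℝ} (hr : 0 < r)
    (hm : ∀ z ∈ Metric.ball z₀ r, AEStronglyMeasurable (F z) μ)
    (hd : ∀ᵐ t ∂μ, DifferentiableOn ℂ (fun z => F z t) (Metric.ball z₀ r))
    (hb : ∀ᵐ t ∂μ, ∀ z ∈ Metric.ball z₀ r, ‖F z t‖ ≤ bound t) (hbi : Integrable bound μ) :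
    Integrable (fun t => deriv (fun z => F z t) z₀) μ ∧
      HasDerivAt (fun z => ∫ t, F z t ∂μ) (∫ t, deriv (fun z => F z t) z₀ ∂μ) z₀ := by
  have hz₀ : z₀ ∈ Metric.ball z₀ r := Metric.mem_ball_self hr
  have hda : ∀ᵐ t ∂μ, HasDerivAt (fun z => F z t) (deriv (fun z => F z t) z₀) z₀ := by
    filter_upwards [hd] with t ht
    exact (ht.differentiableAt (Metric.isOpen_ball.mem_nhds hz₀)).hasDerivAt
  refine hasDerivAt_integral_of_dominated_loc_of_lip (𝕜 := ℂ) (μ := μ)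
    (F := F) (F' := fun t => deriv (fun z => F z t) z₀)
    (bound := fun t => bound t / (r / 2)) (s := Metric.ball z₀ (r / 2))
    (Metric.ball_mem_nhds _ (by positivity)) ?_ ?_ ?_ ?_ (hbi.div_const _) hda
  · filter_upwards [Metric.ball_mem_nhds z₀ hr] with z hz using hm z hz
  · exact hbi.mono' (hm z₀ hz₀) (by filter_upwards [hb] with t ht using ht z₀ hz₀)
  · let u : ℕ → ℂ := fun n => ((r / 2 / (n + 1) : ℝ) : ℂ)
    have hu0 : ∀ n, u n ≠ 0 := fun n => by
      simp only [u, ne_eq, ofReal_eq_zero]; positivity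
    have hub : ∀ n, z₀ + u n ∈ Metric.ball z₀ r := fun n => by
      simp only [Metric.mem_ball, dist_self_add_left, u, Complex.norm_real]
      rw [Real.norm_of_nonneg (by positivity)]
      have : r / 2 / ((n : ℝ) + 1) ≤ r / 2 := div_le_self (by positivity) (by simp)
      linarith
    have hu : Tendsto u atTop (𝓝[≠] 0) := by
      refine tendsto_nhdsWithin_iff.2 ⟨?_, Eventually.of_forall hu0⟩
      have h1 : Tendsto (fun n : ℕ => r / 2 / ((n : ℝ) + 1)) atTop (𝓝 0) := by
        have := (tendsto_one_div_add_atTop_nhds_zero_nat (𝕜 := ℝ)).const_mul (r / 2)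
        simpa [div_eq_mul_inv] using this
      exact (Complex.continuous_ofReal.tendsto' 0 0 (by simp)).comp h1
    refine aestronglyMeasurable_of_tendsto_ae atTop
      (f := fun n t => (u n)⁻¹ * (F (z₀ + u n) t - F z₀ t)) (fun n => ?_) ?_
    · exact ((hm _ (hub n)).sub (hm z₀ hz₀)).const_mul _
    · filter_upwards [hda] with t ht
      exact (hasDerivAt_iff_tendsto_slope_zero.1 ht).comp hu
  · filter_upwards [hd, hb] with t ht hbt
    have hbt0 : 0 ≤ bound t := (norm_nonneg _).trans (hbt z₀ hz₀)
    refine Convex.lipschitzOnWith_of_nnnorm_deriv_le (𝕜 := ℂ) (fun z hz => ?_) (fun z hz => ?_)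
      (convex_ball _ _)
    · refine ht.differentiableAt (Metric.isOpen_ball.mem_nhds ?_)
      exact Metric.ball_subset_ball (by linarith) hz
    · have hsub : Metric.closedBall z (r / 2) ⊆ Metric.ball z₀ r := by
        intro y hy
        have h1 := Metric.mem_closedBall.1 hy
        have h2 := Metric.mem_ball.1 hz
        have := dist_triangle y z z₀
        exact Metric.mem_ball.2 (by linarith)
      have h1 := Complex.norm_deriv_le_of_forall_mem_sphere_norm_le (c := z) (R := r / 2)
        (C := bound t) (f := fun z => F z t) (by positivity)
        ((ht.mono hsub).diffContOnCl_ball (by exact subset_rfl))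
        (fun y hy => hbt y (hsub (Metric.sphere_subset_closedBall hy)))
      rw [← NNReal.coe_le_coe, coe_nnnorm, Real.coe_nnabs,
        abs_of_nonneg (div_nonneg hbt0 (by positivity))]
      exact h1

theorem differentiableOn_integral_of_dominated {X : Type*} [MeasurableSpace X] {μ : Measure X}
    {F : ℂ → X → ℂ} {U : Set ℂ} (hU : IsOpen U)
    (hm : ∀ z ∈ U, AEStronglyMeasurable (F z) μ)
    (hd : ∀ᵐ t ∂μ, DifferentiableOn ℂ (fun z => F z t) U)
    (hb : ∀ z₀ ∈ U, ∃ r > 0, ∃ bound : X → ℝ, Integrable bound μ ∧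
      ∀ᵐ t ∂μ, ∀ z ∈ Metric.ball z₀ r, z ∈ U → ‖F z t‖ ≤ bound t) :
    DifferentiableOn ℂ (fun z => ∫ t, F z t ∂μ) U := by
  intro z₀ hz₀
  obtain ⟨r, hr, bound, hbi, hb⟩ := hb z₀ hz₀
  obtain ⟨r', hr', hsub⟩ := Metric.isOpen_iff.1 hU z₀ hz₀
  have h1 : Metric.ball z₀ (min r r') ⊆ U :=
    (Metric.ball_subset_ball (min_le_right _ _)).trans hsub
  refine (hasDerivAt_integral_of_dominated_holomorphic (lt_min hr hr')
    (fun z hz => hm z (h1 hz)) ?_ ?_ hbi).2.differentiableAt.differentiableWithinAt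
  · filter_upwards [hd] with t ht using ht.mono h1
  · filter_upwards [hb] with t ht z hz
    exact ht z (Metric.ball_subset_ball (min_le_left _ _) hz) (h1 hz)

/-- Holomorphic functions on open star-shaped sets have primitives. -/
theorem exists_primitive_of_starConvex {U : Set ℂ} {z₀ : ℂ} (hU : IsOpen U)
    (hs : StarConvex ℝ z₀ U) {f : ℂ → ℂ} (hf : DifferentiableOn ℂ f U) :
    ∃ F : ℂ → ℂ, ∀ z ∈ U, HasDerivAt F (f z) z := by
  have hmem : ∀ z ∈ U, ∀ t ∈ Set.Icc (0 : ℝ) 1, z₀ + t * (z - z₀) ∈ U := fun z hz t ht => by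
    have := hs.add_smul_sub_mem hz ht.1 ht.2
    simpa using this
  refine ⟨fun z => ∫ t in (0 : ℝ)..1, f (z₀ + t * (z - z₀)) * (z - z₀), fun z hz => ?_⟩
  have hcont : ContinuousOn f U := hf.continuousOn
  have hda : ∀ z ∈ U, HasDerivAt f (deriv f z) z := fun z hz =>
    (hf.differentiableAt (hU.mem_nhds hz)).hasDerivAt
  -- a uniform neighbourhood of the segment
  have hK : IsCompact ((fun t : ℝ => z₀ + t * (z - z₀)) '' Set.Icc 0 1) :=
    isCompact_Icc.image (by fun_prop)
  obtain ⟨δ, hδ, hδU⟩ := hK.exists_cthickening_subset_open hU (by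
    rintro _ ⟨t, ht, rfl⟩
    exact hmem z hz t ht)
  have hKδ : IsCompact (Metric.cthickening δ ((fun t : ℝ => z₀ + t * (z - z₀)) '' Set.Icc 0 1)) :=
    hK.cthickening
  obtain ⟨C, hC⟩ := hKδ.exists_bound_of_continuousOn (hcont.mono hδU)
  have hball : ∀ y ∈ Metric.ball z δ, ∀ t ∈ Set.Icc (0 : ℝ) 1,
      z₀ + t * (y - z₀) ∈ Metric.cthickening δ ((fun t : ℝ => z₀ + t * (z - z₀)) '' Set.Icc 0 1) := by
    intro y hy t ht
    refine Metric.mem_cthickening_of_dist_le _ (z₀ + t * (z - z₀)) _ _ ⟨t, ht, rfl⟩ ?_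
    rw [dist_eq_norm]
    have : z₀ + t * (y - z₀) - (z₀ + t * (z - z₀)) = t * (y - z) := by ring
    rw [this, norm_mul, Complex.norm_real, Real.norm_of_nonneg ht.1]
    have h1 := Metric.mem_ball.1 hy
    rw [dist_eq_norm] at h1
    nlinarith [norm_nonneg (y - z), ht.1, ht.2]
  have hC0 : 0 ≤ C := (norm_nonneg _).trans (hC _ (hball z (Metric.mem_ball_self hδ) 0 (by simp)))
  have key := hasDerivAt_integral_of_dominated_holomorphic (z₀ := z) (r := δ) hδ
    (μ := volume.restrict (Set.uIoc (0 : ℝ) 1))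
    (F := fun y t => f (z₀ + t * (y - z₀)) * (y - z₀)) (bound := fun _ => C * (‖z - z₀‖ + δ))
    (fun y hy => ?_) ?_ ?_ ?_
  · have key2 := key.2
    simp only [intervalIntegral.intervalIntegral_eq_integral_uIoc, zero_le_one, if_true, one_smul]
    convert key2 using 1
    have e : ∫ t in (0 : ℝ)..1, deriv (fun y => f (z₀ + t * (y - z₀)) * (y - z₀)) z
        = (1 : ℝ) * f (z₀ + (1 : ℝ) * (z - z₀)) - (0 : ℝ) * f (z₀ + (0 : ℝ) * (z - z₀)) := by
      refine intervalIntegral.integral_eq_sub_of_hasDerivAt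
        (f := fun t : ℝ => (t : ℂ) * f (z₀ + t * (z - z₀))) (fun t ht => ?_) ?_
      · rw [Set.uIcc_of_le zero_le_one] at ht
        have h1 := hda _ (hmem z hz t ht)
        have h2 : HasDerivAt (fun y : ℂ => z₀ + t * (y - z₀)) t z := by
          simpa using (((hasDerivAt_id z).sub_const z₀).const_mul (t : ℂ)).const_add z₀
        have h3 : HasDerivAt (fun y : ℂ => f (z₀ + t * (y - z₀))) (deriv f (z₀ + t * (z - z₀)) * t) z :=
          HasDerivAt.comp z (h₂ := f) h1 h2
        have h4 : deriv (fun y : ℂ => f (z₀ + t * (y - z₀)) * (y - z₀)) z = _ :=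
          (h3.mul ((hasDerivAt_id z).sub_const z₀)).deriv
        have h5 : HasDerivAt (fun x : ℂ => z₀ + x * (z - z₀)) (z - z₀) (t : ℂ) := by
          simpa using ((hasDerivAt_id (t : ℂ)).mul_const (z - z₀)).const_add z₀
        have h6 := HasDerivAt.comp (t : ℂ) (h₂ := f) h1 h5
        have h7 := ((hasDerivAt_id (t : ℂ)).mul h6).comp_ofReal
        refine HasDerivAt.congr_deriv (f := fun t : ℝ => (t : ℂ) * f (z₀ + t * (z - z₀))) h7 ?_
        rw [h4]
        simp
        ring
      · rw [intervalIntegrable_iff]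
        exact key.1
    rw [intervalIntegral.intervalIntegral_eq_integral_uIoc] at e
    simp only [zero_le_one, if_true, one_smul] at e
    rw [e]
    simp
  · rw [Set.uIoc_of_le zero_le_one]
    refine ContinuousOn.aestronglyMeasurable ?_ measurableSet_Ioc
    refine ContinuousOn.mul (hcont.comp (by fun_prop) fun t ht => ?_) (by fun_prop)
    exact hδU (hball y hy t (Set.Ioc_subset_Icc_self ht))
  · refine (ae_restrict_iff' measurableSet_uIoc).2 (Eventually.of_forall fun t ht => ?_)
    rw [Set.uIoc_of_le zero_le_one] at ht
    refine DifferentiableOn.mul (hf.comp (by fun_prop) fun y hy => ?_) (by fun_prop)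
    exact hδU (hball y hy t (Set.Ioc_subset_Icc_self ht))
  · refine (ae_restrict_iff' measurableSet_uIoc).2 (Eventually.of_forall fun t ht y hy => ?_)
    rw [Set.uIoc_of_le zero_le_one] at ht
    rw [norm_mul]
    refine mul_le_mul (hC _ (hball y hy t (Set.Ioc_subset_Icc_self ht))) ?_ (norm_nonneg _) hC0
    have h1 := Metric.mem_ball.1 hy
    rw [dist_eq_norm] at h1
    calc ‖y - z₀‖ = ‖(y - z) + (z - z₀)‖ := by ring_nf
      _ ≤ _ := (norm_add_le _ _).trans (by linarith)
  · rw [Set.uIoc_of_le zero_le_one]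
    exact integrable_const _

/-! ### Functions tending to zero in the Stolz sense -/

/-- Convergence to `0` as `Re w → -∞` with `Im w` bounded. -/
def StolzZero (f : ℂ → ℂ) : Prop :=
  ∀ M : ℝ, Tendsto f (logFilter ⊓ 𝓟 {w | |w.im| ≤ M}) (𝓝 0)

theorem stolzZero_iff {f : ℂ → ℂ} : StolzZero f ↔
    ∀ M : ℝ, ∀ ε > 0, ∃ ρ : ℝ, ∀ w : ℂ, w.re < ρ → |w.im| ≤ M → ‖f w‖ < ε := by
  refine forall_congr' fun M => ?_
  rw [Metric.tendsto_nhds]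
  refine forall₂_congr fun ε hε => ?_
  rw [eventually_inf_principal, eventually_logFilter]
  simp

theorem eventually_analyticAt_iff {f : ℂ → ℂ} : (∀ᶠ w in logFilter, AnalyticAt ℂ f w) ↔
    ∃ ρ : ℝ, DifferentiableOn ℂ f {w | w.re < ρ} := by
  rw [eventually_logFilter]
  refine exists_congr fun ρ => ?_
  have h : IsOpen {w : ℂ | w.re < ρ} := isOpen_lt Complex.continuous_re continuous_const
  refine ⟨fun H w hw => (H w hw).differentiableAt.differentiableWithinAt,
    fun H w hw => H.analyticAt (h.mem_nhds hw)⟩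

theorem isOpen_re_lt (ρ : ℝ) : IsOpen {w : ℂ | w.re < ρ} :=
  isOpen_lt Complex.continuous_re continuous_const

theorem eventually_re_lt (ρ : ℝ) : ∀ᶠ w in logFilter, w.re < ρ :=
  eventually_logFilter.2 ⟨ρ, fun _ h => h⟩

theorem StolzZero.add {f g : ℂ → ℂ} (hf : StolzZero f) (hg : StolzZero g) :
    StolzZero (fun w => f w + g w) := fun M => by simpa using (hf M).add (hg M)

theorem StolzZero.const_mul {f : ℂ → ℂ} (c : ℂ) (hf : StolzZero f) :
    StolzZero (fun w => c * f w) := fun M => by simpa using (hf M).const_mul c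

theorem StolzZero.sub {f g : ℂ → ℂ} (hf : StolzZero f) (hg : StolzZero g) :
    StolzZero (fun w => f w - g w) := fun M => by simpa using (hf M).sub (hg M)

theorem StolzZero.congr {f g : ℂ → ℂ} (hf : StolzZero f) (h : ∀ᶠ w in logFilter, f w = g w) :
    StolzZero g := fun M => (hf M).congr' (h.filter_mono inf_le_left)

theorem stolzZero_of_tendsto {f : ℂ → ℂ} (hf : Tendsto f logFilter (𝓝 0)) : StolzZero f :=
  fun _ => hf.mono_left inf_le_left

/-- Precomposition with a bounded perturbation of the identity. -/
theorem StolzZero.comp {f g : ℂ → ℂ} (hf : StolzZero f) {C : ℝ}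
    (hg : ∀ᶠ w in logFilter, ‖g w - w‖ ≤ C) : StolzZero (fun w => f (g w)) := by
  rw [stolzZero_iff] at *
  intro M ε hε
  obtain ⟨ρ, hρ⟩ := hf (M + C) ε hε
  obtain ⟨ρ', hρ'⟩ := eventually_logFilter.1 hg
  refine ⟨min (ρ - C) ρ', fun w hw hM => hρ _ ?_ ?_⟩
  · have h1 := hρ' w (hw.trans_le (min_le_right _ _))
    have h2 := (le_abs_self _).trans ((abs_re_le_norm (g w - w)).trans h1)
    have h3 := hw.trans_le (min_le_left _ _)
    simp only [sub_re] at h2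
    linarith
  · have h1 := hρ' w (hw.trans_le (min_le_right _ _))
    have h2 := (abs_im_le_norm (g w - w)).trans h1
    have : (g w).im = w.im + (g w - w).im := by simp
    rw [this]
    exact (abs_add_le _ _).trans (by linarith)

theorem tendsto_logFilter_of_bounded {g : ℂ → ℂ} {C : ℝ}
    (hg : ∀ᶠ w in logFilter, ‖g w - w‖ ≤ C) : Tendsto g logFilter logFilter := by
  intro s hs
  obtain ⟨ρ, hρ⟩ := eventually_logFilter.1 hs
  refine mem_map.2 ?_
  filter_upwards [hg, eventually_re_lt (ρ - C)] with w h1 h3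
  refine hρ _ ?_
  have h2 := (le_abs_self _).trans ((abs_re_le_norm (g w - w)).trans h1)
  simp only [sub_re] at h2
  linarith

theorem StolzZero.exists_bound {f : ℂ → ℂ} (hf : StolzZero f) {ρ ρ' : ℝ} (hρ : ρ' < ρ)
    (hc : ContinuousOn f {w | w.re < ρ}) (M : ℝ) :
    ∃ C : ℝ, 0 ≤ C ∧ ∀ w : ℂ, w.re ≤ ρ' → |w.im| ≤ M → ‖f w‖ ≤ C := by
  obtain ⟨r, hr⟩ := stolzZero_iff.1 hf M 1 one_pos
  have hK : IsCompact (Set.Icc r ρ' ×ℂ Set.Icc (-M) M) := isCompact_Icc.reProdIm isCompact_Icc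
  obtain ⟨C, hC⟩ := hK.exists_bound_of_continuousOn
    (hc.mono fun w hw => hw.1.2.trans_lt hρ)
  refine ⟨max C 1, le_max_of_le_right zero_le_one, fun w h1 h2 => ?_⟩
  rcases lt_or_ge w.re r with h | h
  · exact (hr w h h2).le.trans (le_max_right _ _)
  · exact (hC w ⟨⟨h, h1⟩, abs_le.1 h2⟩).trans (le_max_left _ _)

/-- A germ, holomorphic on a half-plane, that tends to `0` in the Stolz sense. -/
structure Tame (P : ℂ → ℂ) : Prop where
  analytic : ∀ᶠ w in logFilter, AnalyticAt ℂ P w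
  stolz : StolzZero P

theorem Tame.add {P Q : ℂ → ℂ} (hP : Tame P) (hQ : Tame Q) : Tame (fun w => P w + Q w) :=
  ⟨by filter_upwards [hP.analytic, hQ.analytic] with w h1 h2 using h1.add h2, hP.stolz.add hQ.stolz⟩

theorem Tame.const_mul {P : ℂ → ℂ} (c : ℂ) (hP : Tame P) : Tame (fun w => c * P w) :=
  ⟨by filter_upwards [hP.analytic] with w h1 using analyticAt_const.mul h1, hP.stolz.const_mul c⟩

theorem Tame.deriv {P : ℂ → ℂ} (hP : Tame P) : Tame (deriv P) := by
  refine ⟨by filter_upwards [hP.analytic] with w h1 using h1.deriv, stolzZero_iff.2 ?_⟩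
  intro M ε hε
  obtain ⟨ρ, hρ⟩ := stolzZero_iff.1 hP.stolz (M + 1) (ε / 2) (by positivity)
  obtain ⟨ρ', hρ'⟩ := eventually_logFilter.1 hP.analytic
  refine ⟨min ρ ρ' - 1, fun w hw hM => ?_⟩
  have hb : ∀ y ∈ Metric.closedBall w 1, y.re < min ρ ρ' ∧ |y.im| ≤ M + 1 := by
    intro y hy
    rw [Metric.mem_closedBall, dist_eq_norm] at hy
    have h1 := (le_abs_self _).trans ((abs_re_le_norm (y - w)).trans hy)
    have h2 := (abs_im_le_norm (y - w)).trans hy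
    simp only [sub_re] at h1
    refine ⟨by linarith, ?_⟩
    have : y.im = w.im + (y - w).im := by simp
    rw [this]
    exact (abs_add_le _ _).trans (by linarith)
  have := Complex.norm_deriv_le_of_forall_mem_sphere_norm_le (c := w) (R := 1)
    (C := ε / 2) (f := P) one_pos
    (DifferentiableOn.diffContOnCl_ball (U := Metric.closedBall w 1) (fun y hy =>
      (hρ' y ((hb y hy).1.trans_le (min_le_right _ _))).differentiableAt.differentiableWithinAt)
      subset_rfl)
    (fun y hy => (hρ y ((hb y (Metric.sphere_subset_closedBall hy)).1.trans_le (min_le_left _ _))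
      (hb y (Metric.sphere_subset_closedBall hy)).2).le)
  linarith

/-! ### The logarithmic coordinate

The coordinate `σ`, with `z = α * exp (exp σ)`, is better suited to multiplicative convolution than
`w`, with `z = α * (1 + exp w)`. -/

/-- A perturbation of the identity commuting with the translation by `2 π i`. -/
noncomputable def perturb (E : ℂ → ℂ) (w : ℂ) : ℂ := w + log (E (exp w))

section perturb
variable {E : ℂ → ℂ} (hE : AnalyticAt ℂ E 0) (hE0 : E 0 = 1)

theorem perturb_add_int (E : ℂ → ℂ) (w : ℂ) (k : ℤ) :
    perturb E (w + k * (2 * Real.pi * I)) = perturb E w + k * (2 * Real.pi * I) := by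
  simp only [perturb, Complex.exp_periodic.int_mul k w]
  ring

include hE hE0

theorem tendsto_perturb_sub : Tendsto (fun w => perturb E w - w) logFilter (𝓝 0) := by
  have h1 : Tendsto (fun w => E (exp w)) logFilter (𝓝 1) := by
    rw [← hE0]
    exact hE.continuousAt.tendsto.comp tendsto_exp_logFilter
  have h2 : Tendsto (fun w => log (E (exp w))) logFilter (𝓝 (log 1)) :=
    h1.clog (by simp)
  simpa [perturb] using h2

theorem eventually_perturb_sub_le {c : ℝ} (hc : 0 < c) :
    ∀ᶠ w in logFilter, ‖perturb E w - w‖ ≤ c := by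
  have := (tendsto_perturb_sub hE hE0).norm
  rw [norm_zero] at this
  filter_upwards [this.eventually (gt_mem_nhds hc)] with w hw using hw.le

theorem tendsto_perturb : Tendsto (perturb E) logFilter logFilter :=
  tendsto_logFilter_of_bounded (eventually_perturb_sub_le hE hE0 one_pos)

theorem eventually_analyticAt_perturb : ∀ᶠ w in logFilter, AnalyticAt ℂ (perturb E) w := by
  have h1 : Tendsto (fun w => E (exp w)) logFilter (𝓝 1) := by
    rw [← hE0]
    exact hE.continuousAt.tendsto.comp tendsto_exp_logFilter
  filter_upwards [tendsto_exp_logFilter.eventually hE.eventually_analyticAt,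
    h1.eventually (isOpen_slitPlane.mem_nhds (by simp : (1 : ℂ) ∈ slitPlane))] with w h2 h3
  exact analyticAt_id.add ((h2.comp_of_eq analyticAt_cexp rfl).clog h3)

theorem eventually_exp_perturb : ∀ᶠ w in logFilter, exp (perturb E w) = exp w * E (exp w) := by
  have h1 : Tendsto (fun w => E (exp w)) logFilter (𝓝 1) := by
    rw [← hE0]
    exact hE.continuousAt.tendsto.comp tendsto_exp_logFilter
  filter_upwards [h1.eventually_ne one_ne_zero] with w h2
  rw [perturb, exp_add, exp_log h2]

end perturb

/-- The coordinate `w` in terms of the logarithmic coordinate. -/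
noncomputable def wOf : ℂ → ℂ := perturb (dslope exp 0)

/-- The logarithmic coordinate in terms of `w`. -/
noncomputable def sOf : ℂ → ℂ := perturb (dslope (fun u => log (1 + u)) 0)

theorem analyticAt_dslope_exp : AnalyticAt ℂ (dslope exp 0) 0 :=
  ((differentiableOn_dslope univ_mem).2 differentiable_exp.differentiableOn).analyticAt univ_mem

theorem analyticAt_log_one_add : AnalyticAt ℂ (fun u : ℂ => log (1 + u)) 0 := by
  refine (analyticAt_const.add analyticAt_id).clog ?_
  simp

theorem analyticAt_dslope {f : ℂ → ℂ} {c : ℂ} (hf : AnalyticAt ℂ f c) :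
    AnalyticAt ℂ (dslope f c) c := by
  obtain ⟨s, hs, hf'⟩ := hf.eventually_analyticAt.exists_mem
  have : DifferentiableOn ℂ f s := fun z hz => (hf' z hz).differentiableAt.differentiableWithinAt
  exact ((differentiableOn_dslope hs).2 this).analyticAt hs

theorem dslope_exp_zero : dslope exp 0 0 = 1 := by simp [dslope_same]

theorem dslope_log_zero : dslope (fun u : ℂ => log (1 + u)) 0 0 = 1 := by
  rw [dslope_same]
  have := ((hasDerivAt_id (0 : ℂ)).const_add 1).clog (by simp)
  simpa using this.deriv

theorem mul_dslope_zero {f : ℂ → ℂ} (u : ℂ) : u * dslope f 0 u = f u - f 0 := by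
  have := sub_smul_dslope f 0 u
  simpa using this

theorem sOf_add_int (w : ℂ) (k : ℤ) :
    sOf (w + k * (2 * Real.pi * I)) = sOf w + k * (2 * Real.pi * I) := perturb_add_int _ _ _

theorem eventually_exp_wOf : ∀ᶠ w in logFilter, exp (wOf w) = exp (exp w) - 1 := by
  filter_upwards [eventually_exp_perturb analyticAt_dslope_exp dslope_exp_zero] with w hw
  rw [wOf, hw, mul_dslope_zero]
  simp

theorem eventually_exp_sOf : ∀ᶠ w in logFilter, exp (sOf w) = log (1 + exp w) := by
  filter_upwards [eventually_exp_perturb (analyticAt_dslope analyticAt_log_one_add)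
    dslope_log_zero] with w hw
  rw [sOf, hw, mul_dslope_zero]
  simp

theorem tendsto_wOf : Tendsto wOf logFilter logFilter :=
  tendsto_perturb analyticAt_dslope_exp dslope_exp_zero

theorem tendsto_sOf : Tendsto sOf logFilter logFilter :=
  tendsto_perturb (analyticAt_dslope analyticAt_log_one_add) dslope_log_zero

theorem eventually_wOf_sub_le {c : ℝ} (hc : 0 < c) : ∀ᶠ w in logFilter, ‖wOf w - w‖ ≤ c :=
  eventually_perturb_sub_le analyticAt_dslope_exp dslope_exp_zero hc

theorem eventually_sOf_sub_le {c : ℝ} (hc : 0 < c) : ∀ᶠ w in logFilter, ‖sOf w - w‖ ≤ c :=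
  eventually_perturb_sub_le (analyticAt_dslope analyticAt_log_one_add) dslope_log_zero hc

theorem eventually_analyticAt_wOf : ∀ᶠ w in logFilter, AnalyticAt ℂ wOf w :=
  eventually_analyticAt_perturb analyticAt_dslope_exp dslope_exp_zero

theorem eventually_analyticAt_sOf : ∀ᶠ w in logFilter, AnalyticAt ℂ sOf w :=
  eventually_analyticAt_perturb (analyticAt_dslope analyticAt_log_one_add) dslope_log_zero

theorem eq_of_exp_eq_of_norm_sub_lt {a b : ℂ} (h : exp a = exp b) (h' : ‖a - b‖ < Real.pi) :
    a = b := by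
  have h1 : exp (a - b) = 1 := by rw [exp_sub, h, div_self (exp_ne_zero _)]
  have h2 := abs_lt.1 ((abs_im_le_norm (a - b)).trans_lt h')
  have h3 := log_exp h2.1 h2.2.le
  rw [h1, log_one] at h3
  exact sub_eq_zero.1 h3.symm

theorem eventually_wOf_sOf : ∀ᶠ w in logFilter, wOf (sOf w) = w := by
  have h0 : Tendsto (fun w : ℂ => 1 + exp w) logFilter (𝓝 1) := by
    simpa using tendsto_exp_logFilter.const_add 1
  filter_upwards [eventually_exp_sOf, tendsto_sOf.eventually eventually_exp_wOf,
    eventually_sOf_sub_le one_pos, tendsto_sOf.eventually (eventually_wOf_sub_le one_pos),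
    h0.eventually_ne one_ne_zero] with w h1 h2 h3 h4 h5
  refine eq_of_exp_eq_of_norm_sub_lt ?_ ?_
  · rw [h2, h1, exp_log h5]
    ring
  · calc ‖wOf (sOf w) - w‖ = ‖(wOf (sOf w) - sOf w) + (sOf w - w)‖ := by ring_nf
      _ ≤ 1 + 1 := (norm_add_le _ _).trans (add_le_add h4 h3)
      _ < Real.pi := by linarith [Real.pi_gt_three]

theorem eventually_sOf_wOf : ∀ᶠ w in logFilter, sOf (wOf w) = w := by
  filter_upwards [eventually_exp_wOf, tendsto_wOf.eventually eventually_exp_sOf,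
    eventually_wOf_sub_le one_pos, tendsto_wOf.eventually (eventually_sOf_sub_le one_pos),
    (tendsto_exp_logFilter.norm).eventually (gt_mem_nhds (by simp : ‖(0 : ℂ)‖ < 1))]
    with w h1 h2 h3 h4 h5
  refine eq_of_exp_eq_of_norm_sub_lt ?_ ?_
  · rw [h2, h1]
    have h6 := abs_le.1 ((abs_im_le_norm (exp w)).trans h5.le)
    rw [add_sub_cancel, log_exp (by linarith [Real.pi_gt_three]) (by linarith [Real.pi_gt_three])]
  · calc ‖sOf (wOf w) - w‖ = ‖(sOf (wOf w) - wOf w) + (wOf w - w)‖ := by ring_nf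
      _ ≤ 1 + 1 := (norm_add_le _ _).trans (add_le_add h4 h3)
      _ < Real.pi := by linarith [Real.pi_gt_three]

theorem eventually_pt_wOf (α : ℂ) : ∀ᶠ w in logFilter, pt α (wOf w) = α * exp (exp w) := by
  filter_upwards [eventually_exp_wOf] with w h
  rw [pt, h]
  ring

/-- The germ in the coordinate `w` of a function of the logarithmic coordinate. -/
noncomputable def chart (P : ℂ → ℂ) : LogGerm := ((fun w => P (sOf w) : ℂ → ℂ) : LogGerm)

theorem chart_eq_iff {P Q : ℂ → ℂ} : chart P = chart Q ↔ ∀ᶠ w in logFilter, P w = Q w := by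
  refine Germ.coe_eq.trans ⟨fun h => ?_, fun h => tendsto_sOf.eventually h⟩
  filter_upwards [tendsto_wOf.eventually h, eventually_sOf_wOf] with w h1 h2
  rwa [h2] at h1

theorem chart_comp_wOf (f : ℂ → ℂ) : chart (fun w => f (wOf w)) = (f : LogGerm) := by
  refine Germ.coe_eq.2 ?_
  filter_upwards [eventually_wOf_sOf] with w h
  rw [h]

theorem turn_chart (k : ℤ) (P : ℂ → ℂ) :
    turn k (chart P) = chart (fun w => P (w + k * (2 * Real.pi * I))) := by
  rw [chart, turn_coe]
  simp only [sOf_add_int]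
  rfl

theorem Del_chart (P : ℂ → ℂ) :
    Del (chart P) = chart (fun w => P (w + 2 * Real.pi * I) - P w) := by
  change turn 1 (chart P) - chart P = _
  rw [turn_chart]
  simp only [Int.cast_one, one_mul]
  rfl

theorem chart_add (P Q : ℂ → ℂ) : chart (fun w => P w + Q w) = chart P + chart Q := rfl

theorem eventually_analyticAt_comp {f g : ℂ → ℂ} (hf : ∀ᶠ w in logFilter, AnalyticAt ℂ f w)
    (hg : ∀ᶠ w in logFilter, AnalyticAt ℂ g w) (hg' : Tendsto g logFilter logFilter) :
    ∀ᶠ w in logFilter, AnalyticAt ℂ (fun w => f (g w)) w := by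
  filter_upwards [hg'.eventually hf, hg] with w h1 h2 using h1.comp_of_eq h2 rfl

theorem StolzZero.comp_exp {f g : ℂ → ℂ} (hf : StolzZero (fun w => exp w * f w))
    (hg : ∀ᶠ w in logFilter, ‖g w - w‖ ≤ 1) : StolzZero (fun w => exp w * f (g w)) := by
  have h1 := hf.comp hg
  rw [stolzZero_iff] at *
  intro M ε hε
  obtain ⟨ρ, hρ⟩ := h1 M (ε / Real.exp 1) (by positivity)
  obtain ⟨ρ', hρ'⟩ := eventually_logFilter.1 hg
  refine ⟨min ρ ρ', fun w hw hM => ?_⟩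
  have h2 := hρ w (hw.trans_le (min_le_left _ _)) hM
  have h3 := hρ' w (hw.trans_le (min_le_right _ _))
  rw [lt_div_iff₀ (by positivity)] at h2
  rw [norm_mul, Complex.norm_exp] at h2 ⊢
  refine lt_of_le_of_lt ?_ h2
  have h4 := (neg_abs_le _).trans' (neg_le_neg ((abs_re_le_norm (g w - w)).trans h3))
  simp only [sub_re] at h4
  have h5 : Real.exp w.re ≤ Real.exp (g w).re * Real.exp 1 := by
    rw [← Real.exp_add]
    exact Real.exp_le_exp.2 (by linarith)
  calc Real.exp w.re * ‖f (g w)‖ ≤ (Real.exp (g w).re * Real.exp 1) * ‖f (g w)‖ := by gcongr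
    _ = _ := by ring

theorem chart_mem_integrableGerms {φ : ℂ → ℂ} (h1 : ∀ᶠ w in logFilter, AnalyticAt ℂ φ w)
    (h2 : StolzZero (fun w => exp w * φ w)) : chart φ ∈ integrableGerms :=
  ⟨_, rfl, eventually_analyticAt_comp h1 eventually_analyticAt_sOf tendsto_sOf,
    h2.comp_exp (eventually_sOf_sub_le one_pos)⟩

theorem exists_chart_of_mem_integrableGerms {f : LogGerm} (hf : f ∈ integrableGerms) :
    ∃ φ : ℂ → ℂ, chart φ = f ∧ (∀ᶠ w in logFilter, AnalyticAt ℂ φ w) ∧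
      StolzZero (fun w => exp w * φ w) := by
  obtain ⟨f, rfl, h1, h2⟩ := hf
  exact ⟨fun w => f (wOf w), chart_comp_wOf f,
    eventually_analyticAt_comp h1 eventually_analyticAt_wOf tendsto_wOf,
    StolzZero.comp_exp h2 (eventually_wOf_sub_le one_pos)⟩

/-- The derivation `z d/dz` in the logarithmic coordinate. -/
noncomputable def logDer (P : ℂ → ℂ) (w : ℂ) : ℂ := exp (-w) * deriv P w

theorem eventually_analyticAt_logDer {P : ℂ → ℂ} (hP : ∀ᶠ w in logFilter, AnalyticAt ℂ P w) :
    ∀ᶠ w in logFilter, AnalyticAt ℂ (logDer P) w := by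
  filter_upwards [hP] with w h
  exact (analyticAt_cexp.comp_of_eq analyticAt_id.neg rfl).mul h.deriv

theorem stolzZero_exp_mul_logDer {P : ℂ → ℂ} (hP : StolzZero (deriv P)) :
    StolzZero (fun w => exp w * logDer P w) := by
  refine hP.congr (Eventually.of_forall fun w => ?_)
  rw [logDer, ← mul_assoc, ← exp_add]
  simp

theorem exists_primitive_re_lt {ρ : ℝ} {f : ℂ → ℂ} (hf : DifferentiableOn ℂ f {w | w.re < ρ}) :
    ∃ F : ℂ → ℂ, ∀ w : ℂ, w.re < ρ → HasDerivAt F (f w) w := by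
  have hc : Convex ℝ {w : ℂ | w.re < ρ} := convex_halfSpace_re_lt ρ
  have hm : ((ρ - 1 : ℝ) : ℂ) ∈ {w : ℂ | w.re < ρ} := by simp
  obtain ⟨F, hF⟩ := exists_primitive_of_starConvex (isOpen_re_lt ρ) (hc.starConvex hm) hf
  exact ⟨F, hF⟩

/-- The variation of a primitive of an integrable germ. -/
theorem tame_variation {ρ : ℝ} {φ Ψ : ℂ → ℂ} (h2 : StolzZero (fun w => exp w * φ w))
    (hΨ : ∀ w : ℂ, w.re < ρ → HasDerivAt Ψ (exp w * φ w) w) :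
    Tame (fun w => Ψ (w + 2 * Real.pi * I) - Ψ w) ∧
      ∀ᶠ w in logFilter, logDer (fun w => Ψ (w + 2 * Real.pi * I) - Ψ w) w =
        φ (w + 2 * Real.pi * I) - φ w := by
  have hder : ∀ w : ℂ, w.re < ρ → HasDerivAt (fun w => Ψ (w + 2 * Real.pi * I) - Ψ w)
      (exp (w + 2 * Real.pi * I) * φ (w + 2 * Real.pi * I) - exp w * φ w) w := by
    intro w hw
    have h3 : HasDerivAt (fun w : ℂ => w + 2 * Real.pi * I) 1 w := (hasDerivAt_id w).add_const _
    have h4 := HasDerivAt.comp w (h₂ := Ψ) (hΨ (w + 2 * Real.pi * I) (by simpa using hw)) h3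
    rw [mul_one] at h4
    exact h4.sub (hΨ w hw)
  refine ⟨⟨eventually_analyticAt_iff.2 ⟨ρ, fun w hw =>
    (hder w hw).differentiableAt.differentiableWithinAt⟩, stolzZero_iff.2 fun M ε hε => ?_⟩, ?_⟩
  · obtain ⟨r, hr⟩ := stolzZero_iff.1 h2 (M + 2 * Real.pi) (ε / (2 * Real.pi + 1))
      (by have := Real.pi_pos; positivity)
    refine ⟨min r ρ, fun w hw hM => ?_⟩
    have hpi := Real.pi_pos
    have hconv : Convex ℝ {y : ℂ | y.re < min r ρ ∧ |y.im| ≤ M + 2 * Real.pi} := by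
      have h5 : {y : ℂ | y.re < min r ρ ∧ |y.im| ≤ M + 2 * Real.pi} =
        {y : ℂ | y.re < min r ρ} ∩ ({y | -(M + 2 * Real.pi) ≤ y.im} ∩ {y | y.im ≤ M + 2 * Real.pi}) := by
        ext y; simp [abs_le]
      rw [h5]
      exact (convex_halfSpace_re_lt _).inter
        ((convex_halfSpace_im_ge _).inter (convex_halfSpace_im_le _))
    have := hconv.norm_image_sub_le_of_norm_hasDerivWithin_le (f := Ψ)
      (f' := fun w => exp w * φ w) (C := ε / (2 * Real.pi + 1))
      (fun y hy => (hΨ y (hy.1.trans_le (min_le_right _ _))).hasDerivWithinAt)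
      (fun y hy => (hr y (hy.1.trans_le (min_le_left _ _)) hy.2).le)
      (x := w) (y := w + 2 * Real.pi * I) ⟨hw, by linarith⟩ ⟨by simpa using hw, by
        have : (w + 2 * Real.pi * I).im = w.im + 2 * Real.pi := by simp
        rw [this]
        exact (abs_add_le _ _).trans (by rw [abs_of_pos (by positivity : (0:ℝ) < 2 * Real.pi)]; linarith)⟩
    refine this.trans_lt ?_
    have h6 : ‖w + 2 * Real.pi * I - w‖ = 2 * Real.pi := by
      simp [abs_of_pos hpi]
    rw [h6, div_mul_eq_mul_div, div_lt_iff₀ (by positivity)]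
    nlinarith
  · filter_upwards [eventually_re_lt ρ] with w hw
    rw [logDer, (hder w hw).deriv, mul_sub, ← mul_assoc, ← mul_assoc, ← exp_add, ← exp_add]
    have : -w + (w + 2 * Real.pi * I) = 2 * Real.pi * I := by ring
    rw [this, exp_two_pi_mul_I]
    simp

theorem exists_tame_of_mem_monodromySpace {f : LogGerm} (hf : f ∈ monodromySpace) :
    ∃ P, Tame P ∧ chart (logDer P) = f := by
  obtain ⟨f, hf, rfl⟩ := hf
  obtain ⟨φ, rfl, h1, h2⟩ := exists_chart_of_mem_integrableGerms hf
  obtain ⟨ρ, hρ⟩ := eventually_analyticAt_iff.1 h1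
  obtain ⟨Ψ, hΨ⟩ := exists_primitive_re_lt (f := fun w => exp w * φ w)
    (differentiable_exp.differentiableOn.mul hρ)
  obtain ⟨h3, h4⟩ := tame_variation h2 hΨ
  refine ⟨_, h3, ?_⟩
  rw [Del_chart, chart_eq_iff]
  exact h4

/-! ### Convolution of bounded germs along a straight segment -/

section straight
variable {u v : ℂ → ℂ} {ρ : ℝ}

theorem re_add_log_lt {σ : ℂ} (hσ : σ.re < ρ) {r : ℝ} (hr : r ∈ Set.Ioo (0 : ℝ) 1) :
    (σ + Real.log r).re < ρ ∧ (σ + Real.log (1 - r)).re < ρ := by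
  have h1 := Real.log_nonpos hr.1.le hr.2.le
  have h2 := Real.log_nonpos (sub_nonneg.2 hr.2.le) (by linarith [hr.1])
  rw [add_re, add_re, ofReal_re, ofReal_re]
  constructor <;> linarith

theorem hasDerivAt_add_log (hu : DifferentiableOn ℂ u {w | w.re < ρ}) {σ : ℂ} (hσ : σ.re < ρ)
    {r : ℝ} (hr : r ∈ Set.Ioo (0 : ℝ) 1) :
    HasDerivAt (fun r : ℝ => u (σ + Real.log r)) (deriv u (σ + Real.log r) * (r : ℂ)⁻¹) r := by
  have h1 := (hu.differentiableAt ((isOpen_re_lt ρ).mem_nhds (re_add_log_lt hσ hr).1)).hasDerivAt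
  have h2 : HasDerivAt (fun r : ℝ => σ + (Real.log r : ℂ)) ((r⁻¹ : ℝ) : ℂ) r :=
    ((Real.hasDerivAt_log hr.1.ne').ofReal_comp).const_add σ
  rw [ofReal_inv] at h2
  exact HasDerivAt.comp_of_eq r h1 h2 rfl

theorem hasDerivAt_add_log_one_sub (hv : DifferentiableOn ℂ v {w | w.re < ρ}) {σ : ℂ}
    (hσ : σ.re < ρ) {r : ℝ} (hr : r ∈ Set.Ioo (0 : ℝ) 1) :
    HasDerivAt (fun r : ℝ => v (σ + Real.log (1 - r)))
      (-(deriv v (σ + Real.log (1 - r)) * (1 - r : ℂ)⁻¹)) r := by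
  have hr' : 1 - r ∈ Set.Ioo (0 : ℝ) 1 := ⟨by linarith [hr.2], by linarith [hr.1]⟩
  have h1 := hasDerivAt_add_log hv hσ hr'
  have h2 : HasDerivAt (fun r : ℝ => 1 - r) (-1) r := by
    simpa using (hasDerivAt_id r).const_sub 1
  have := HasDerivAt.scomp r h1 h2
  refine this.congr_deriv ?_
  simp

theorem continuousOn_add_log (hu : ContinuousOn u {w | w.re < ρ}) {σ : ℂ}
    (hσ : σ.re < ρ) : ContinuousOn (fun r : ℝ => u (σ + Real.log r)) (Set.Ioo 0 1) := by
  refine hu.comp (continuousOn_const.add (continuous_ofReal.comp_continuousOn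
    (Real.continuousOn_log.mono fun r hr => hr.1.ne'))) fun r hr => (re_add_log_lt hσ hr).1

theorem continuousOn_add_log_one_sub (hu : ContinuousOn u {w | w.re < ρ}) {σ : ℂ}
    (hσ : σ.re < ρ) : ContinuousOn (fun r : ℝ => u (σ + Real.log (1 - r))) (Set.Ioo 0 1) :=
  (continuousOn_add_log hu hσ).comp (f := fun r : ℝ => 1 - r) (by fun_prop)
    fun r hr => ⟨by linarith [hr.2], by linarith [hr.1]⟩

theorem Icc_subset_Ioo_zero_one {a b : ℝ} (ha : 0 < a) (hb : b < 1) :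
    Set.Icc a b ⊆ Set.Ioo (0 : ℝ) 1 := fun _ hr => ⟨ha.trans_le hr.1, hr.2.trans_lt hb⟩

theorem hasDerivAt_integral_mul (hu : DifferentiableOn ℂ u {w | w.re < ρ})
    (hv : DifferentiableOn ℂ v {w | w.re < ρ}) {c : ℝ → ℂ} {a b : ℝ} (ha : 0 < a) (hab : a ≤ b)
    (hb : b < 1) (hc : ContinuousOn c (Set.Icc a b)) {σ : ℂ} (hσ : σ.re < ρ) :
    HasDerivAt (fun σ => ∫ r in a..b, u (σ + Real.log r) * v (σ + Real.log (1 - r)) * c r)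
      (∫ r in a..b, (deriv u (σ + Real.log r) * v (σ + Real.log (1 - r)) +
        u (σ + Real.log r) * deriv v (σ + Real.log (1 - r))) * c r) σ := by
  have hI := Icc_subset_Ioo_zero_one ha hb
  obtain ⟨δ, hδ, hδρ⟩ : ∃ δ : ℝ, 0 < δ ∧ σ.re + δ < ρ := ⟨(ρ - σ.re) / 2, by linarith, by linarith⟩
  have hre : ∀ y ∈ Metric.closedBall σ δ, y.re < ρ := fun y hy => by
    rw [Metric.mem_closedBall, dist_eq_norm] at hy
    have h1 := (le_abs_self _).trans ((abs_re_le_norm (y - σ)).trans hy)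
    simp only [sub_re] at h1
    linarith
  have hK : IsCompact (Metric.closedBall σ δ ×ˢ Set.Icc a b) :=
    (isCompact_closedBall _ _).prod isCompact_Icc
  have hlog : ContinuousOn (fun p : ℂ × ℝ => p.1 + (Real.log p.2 : ℂ))
      (Metric.closedBall σ δ ×ˢ Set.Icc a b) :=
    continuousOn_fst.add (continuous_ofReal.comp_continuousOn
      (continuousOn_snd.log fun p hp => (hI hp.2).1.ne'))
  have hlog' : ContinuousOn (fun p : ℂ × ℝ => p.1 + (Real.log (1 - p.2) : ℂ))
      (Metric.closedBall σ δ ×ˢ Set.Icc a b) :=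
    continuousOn_fst.add (continuous_ofReal.comp_continuousOn
      ((continuousOn_const.sub continuousOn_snd).log fun p hp => by
        have := (hI hp.2).2
        simp only [Pi.sub_apply, ne_eq]; linarith))
  have hcont : ContinuousOn (fun p : ℂ × ℝ =>
      u (p.1 + Real.log p.2) * v (p.1 + Real.log (1 - p.2)) * c p.2)
      (Metric.closedBall σ δ ×ˢ Set.Icc a b) := by
    refine ((hu.continuousOn.comp hlog fun p hp => (re_add_log_lt (hre _ hp.1) (hI hp.2)).1).mul
      (hv.continuousOn.comp hlog' fun p hp => (re_add_log_lt (hre _ hp.1) (hI hp.2)).2)).mul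
      (hc.comp continuousOn_snd fun p hp => hp.2)
  obtain ⟨C, hC⟩ := hK.exists_bound_of_continuousOn hcont
  have hball : Metric.ball σ δ ⊆ Metric.closedBall σ δ := Metric.ball_subset_closedBall
  have key := hasDerivAt_integral_of_dominated_holomorphic (z₀ := σ) (r := δ) hδ
    (μ := volume.restrict (Set.Ioc a b))
    (F := fun σ r => u (σ + Real.log r) * v (σ + Real.log (1 - r)) * c r)
    (bound := fun _ => C) (fun y hy => ?_) ?_ ?_ (integrable_const _)
  · simp only [intervalIntegral.integral_of_le hab]
    refine key.2.congr_deriv ?_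
    refine setIntegral_congr_fun measurableSet_Ioc fun r hr => ?_
    have hr' := hI (Set.Ioc_subset_Icc_self hr)
    have h1 : HasDerivAt (fun y => u (y + Real.log r)) (deriv u (σ + Real.log r)) σ :=
      HasDerivAt.comp_add_const σ _ (hu.differentiableAt
        ((isOpen_re_lt ρ).mem_nhds (re_add_log_lt hσ hr').1)).hasDerivAt
    have h2 : HasDerivAt (fun y => v (y + Real.log (1 - r))) (deriv v (σ + Real.log (1 - r))) σ :=
      HasDerivAt.comp_add_const σ _ (hv.differentiableAt
        ((isOpen_re_lt ρ).mem_nhds (re_add_log_lt hσ hr').2)).hasDerivAt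
    exact ((h1.mul h2).mul_const (c r)).deriv
  · refine ContinuousOn.aestronglyMeasurable ?_ measurableSet_Ioc
    refine (hcont.comp (f := fun r => (y, r)) (by fun_prop) fun r hr => ?_)
    exact ⟨hball hy, Set.Ioc_subset_Icc_self hr⟩
  · refine (ae_restrict_iff' measurableSet_Ioc).2 (Eventually.of_forall fun r hr => ?_)
    have hr' := hI (Set.Ioc_subset_Icc_self hr)
    refine ((hu.comp (by fun_prop) fun y hy => ?_).mul (hv.comp (by fun_prop) fun y hy => ?_)).mul_const _
    · exact (re_add_log_lt (hre _ (hball hy)) hr').1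
    · exact (re_add_log_lt (hre _ (hball hy)) hr').2
  · refine (ae_restrict_iff' measurableSet_Ioc).2 (Eventually.of_forall fun r hr y hy => ?_)
    exact hC (y, r) ⟨hball hy, Set.Ioc_subset_Icc_self hr⟩

end straight

/-- The convolution along a straight segment, cut off at both ends. -/
noncomputable def cutConv (P Q : ℂ → ℂ) (a b : ℝ) (σ : ℂ) : ℂ :=
  exp σ * ∫ r in a..b, P (σ + Real.log r) * Q (σ + Real.log (1 - r))

section
variable {P Q : ℂ → ℂ} {ρ : ℝ}

theorem differentiableOn_deriv_re_lt (hP : DifferentiableOn ℂ P {w | w.re < ρ}) :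
    DifferentiableOn ℂ (deriv P) {w | w.re < ρ} := hP.deriv (isOpen_re_lt ρ)

/-- First derivative of the truncated convolution. -/
theorem hasDerivAt_cutConv (hP : DifferentiableOn ℂ P {w | w.re < ρ})
    (hQ : DifferentiableOn ℂ Q {w | w.re < ρ}) {a b : ℝ} (ha : 0 < a) (hab : a ≤ b)
    (hb : b < 1) {σ : ℂ} (hσ : σ.re < ρ) :
    HasDerivAt (cutConv P Q a b)
      (exp σ * ((b - 1) * (P (σ + Real.log b) * Q (σ + Real.log (1 - b))) -
        (a - 1) * (P (σ + Real.log a) * Q (σ + Real.log (1 - a))) +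
        ∫ r in a..b, deriv P (σ + Real.log r) * Q (σ + Real.log (1 - r)) * (r : ℂ)⁻¹)) σ := by
  have hI := Icc_subset_Ioo_zero_one ha hb
  have hIcc : Set.uIcc a b = Set.Icc a b := Set.uIcc_of_le hab
  have h1 := hasDerivAt_integral_mul hP hQ (c := fun _ => 1) ha hab hb continuousOn_const hσ
  simp only [mul_one] at h1
  have h2 := (Complex.hasDerivAt_exp σ).mul h1
  refine h2.congr_deriv ?_
  rw [← mul_add]
  congr 1
  have cP := continuousOn_add_log hP.continuousOn hσ
  have cQ := continuousOn_add_log_one_sub hQ.continuousOn hσ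
  have cP' := continuousOn_add_log (differentiableOn_deriv_re_lt hP).continuousOn hσ
  have cQ' := continuousOn_add_log_one_sub (differentiableOn_deriv_re_lt hQ).continuousOn hσ
  have cinv : ContinuousOn (fun r : ℝ => (r : ℂ)⁻¹) (Set.Ioo 0 1) :=
    (continuous_ofReal.continuousOn).inv₀ fun r hr => by exact_mod_cast hr.1.ne'
  have ii : ∀ {f : ℝ → ℂ}, ContinuousOn f (Set.Ioo 0 1) → IntervalIntegrable f volume a b :=
    fun hf => (hf.mono (hIcc ▸ hI)).intervalIntegrable
  have ftc : ∫ r in a..b, ((P (σ + Real.log r) * Q (σ + Real.log (1 - r)) +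
      (deriv P (σ + Real.log r) * Q (σ + Real.log (1 - r)) +
        P (σ + Real.log r) * deriv Q (σ + Real.log (1 - r)))) -
        deriv P (σ + Real.log r) * Q (σ + Real.log (1 - r)) * (r : ℂ)⁻¹) =
      (b - 1) * (P (σ + Real.log b) * Q (σ + Real.log (1 - b))) -
        (a - 1) * (P (σ + Real.log a) * Q (σ + Real.log (1 - a))) := by
    refine intervalIntegral.integral_eq_sub_of_hasDerivAt
      (f := fun r : ℝ => ((r : ℂ) - 1) * (P (σ + Real.log r) * Q (σ + Real.log (1 - r))))
      (fun r hr => ?_) (ii ((cP.mul cQ).add ((cP'.mul cQ).add (cP.mul cQ')) |>.sub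
        ((cP'.mul cQ).mul cinv)))
    have hr' := hI (hIcc ▸ hr)
    have hr0 : (r : ℂ) ≠ 0 := by exact_mod_cast hr'.1.ne'
    have hr1 : (1 - r : ℂ) ≠ 0 := by
      have : (1 - r : ℝ) ≠ 0 := by linarith [hr'.2]
      exact_mod_cast this
    have h3 : HasDerivAt (fun r : ℝ => (r : ℂ) - 1) 1 r := by
      simpa using (hasDerivAt_id r).ofReal_comp.sub_const 1
    refine (h3.fun_mul ((hasDerivAt_add_log hP hσ hr').fun_mul
      (hasDerivAt_add_log_one_sub hQ hσ hr'))).congr_deriv ?_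
    field_simp
    ring
  have i1 : IntervalIntegrable (fun r : ℝ => P (σ + Real.log r) * Q (σ + Real.log (1 - r)))
    volume a b := ii (cP.mul cQ)
  have i2 : IntervalIntegrable (fun r : ℝ => deriv P (σ + Real.log r) * Q (σ + Real.log (1 - r)) +
      P (σ + Real.log r) * deriv Q (σ + Real.log (1 - r))) volume a b :=
    ii ((cP'.mul cQ).add (cP.mul cQ'))
  have i3 : IntervalIntegrable (fun r : ℝ => deriv P (σ + Real.log r) *
      Q (σ + Real.log (1 - r)) * (r : ℂ)⁻¹) volume a b := ii ((cP'.mul cQ).mul cinv)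
  rw [intervalIntegral.integral_sub (i1.add i2) i3, intervalIntegral.integral_add i1 i2] at ftc
  rw [← ftc]
  ring

/-- Second logarithmic derivative of the truncated convolution. -/
theorem logDer_logDer_cutConv (hP : DifferentiableOn ℂ P {w | w.re < ρ})
    (hQ : DifferentiableOn ℂ Q {w | w.re < ρ}) {a b : ℝ} (ha : 0 < a) (hab : a ≤ b)
    (hb : b < 1) {σ : ℂ} (hσ : σ.re < ρ) :
    logDer (logDer (cutConv P Q a b)) σ = cutConv (logDer P) (logDer Q) a b σ +
      exp (-σ) * ((b * (deriv P (σ + Real.log b) * Q (σ + Real.log (1 - b))) -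
        (1 - b) * (P (σ + Real.log b) * deriv Q (σ + Real.log (1 - b)))) -
        (a * (deriv P (σ + Real.log a) * Q (σ + Real.log (1 - a))) -
        (1 - a) * (P (σ + Real.log a) * deriv Q (σ + Real.log (1 - a))))) := by
  have hI := Icc_subset_Ioo_zero_one ha hb
  have hIcc : Set.uIcc a b = Set.Icc a b := Set.uIcc_of_le hab
  have hP' := differentiableOn_deriv_re_lt hP
  have hQ' := differentiableOn_deriv_re_lt hQ
  have cP := continuousOn_add_log hP.continuousOn hσ
  have cQ := continuousOn_add_log_one_sub hQ.continuousOn hσ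
  have cP' := continuousOn_add_log hP'.continuousOn hσ
  have cQ' := continuousOn_add_log_one_sub hQ'.continuousOn hσ
  have cP'' := continuousOn_add_log (differentiableOn_deriv_re_lt hP').continuousOn hσ
  have cinv : ContinuousOn (fun r : ℝ => (r : ℂ)⁻¹) (Set.Ioo 0 1) :=
    (continuous_ofReal.continuousOn).inv₀ fun r hr => by exact_mod_cast hr.1.ne'
  have cinv' : ContinuousOn (fun r : ℝ => (1 - r : ℂ)⁻¹) (Set.Ioo 0 1) :=
    (by fun_prop : ContinuousOn (fun r : ℝ => (1 - r : ℂ)) (Set.Ioo 0 1)).inv₀ fun r hr => by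
      have : (1 - r : ℝ) ≠ 0 := by linarith [hr.2]
      exact_mod_cast this
  have ii : ∀ {f : ℝ → ℂ}, ContinuousOn f (Set.Ioo 0 1) → IntervalIntegrable f volume a b :=
    fun hf => (hf.mono (hIcc ▸ hI)).intervalIntegrable
  -- the first logarithmic derivative, near `σ`
  have e1 : logDer (cutConv P Q a b) =ᶠ[𝓝 σ] fun σ =>
      ((b - 1) * (P (σ + Real.log b) * Q (σ + Real.log (1 - b))) -
        (a - 1) * (P (σ + Real.log a) * Q (σ + Real.log (1 - a))) +
        ∫ r in a..b, deriv P (σ + Real.log r) * Q (σ + Real.log (1 - r)) * (r : ℂ)⁻¹) := by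
    filter_upwards [(isOpen_re_lt ρ).mem_nhds hσ] with y hy
    rw [logDer, (hasDerivAt_cutConv hP hQ ha hab hb hy).deriv, ← mul_assoc, ← exp_add]
    simp
  have hda : ∀ r ∈ Set.Icc a b,
      HasDerivAt (fun y => P (y + Real.log r) * Q (y + Real.log (1 - r)))
        (deriv P (σ + Real.log r) * Q (σ + Real.log (1 - r)) +
          P (σ + Real.log r) * deriv Q (σ + Real.log (1 - r))) σ := fun r hr =>
    (HasDerivAt.comp_add_const σ _ (hP.differentiableAt
      ((isOpen_re_lt ρ).mem_nhds (re_add_log_lt hσ (hI hr)).1)).hasDerivAt).mul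
    (HasDerivAt.comp_add_const σ _ (hQ.differentiableAt
      ((isOpen_re_lt ρ).mem_nhds (re_add_log_lt hσ (hI hr)).2)).hasDerivAt)
  have h1 := hasDerivAt_integral_mul hP' hQ (c := fun r => (r : ℂ)⁻¹) ha hab hb (cinv.mono hI) hσ
  have h2 := ((((hda b ⟨hab, le_rfl⟩).const_mul ((b : ℂ) - 1)).sub
    ((hda a ⟨le_rfl, hab⟩).const_mul ((a : ℂ) - 1))).add h1).congr_of_eventuallyEq e1
  have ftc : ∫ r in a..b, ((deriv (deriv P) (σ + Real.log r) * Q (σ + Real.log (1 - r)) +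
        deriv P (σ + Real.log r) * deriv Q (σ + Real.log (1 - r))) * (r : ℂ)⁻¹ -
        deriv P (σ + Real.log r) * deriv Q (σ + Real.log (1 - r)) *
          ((r : ℂ)⁻¹ * (1 - r : ℂ)⁻¹)) =
      deriv P (σ + Real.log b) * Q (σ + Real.log (1 - b)) -
        deriv P (σ + Real.log a) * Q (σ + Real.log (1 - a)) := by
    refine intervalIntegral.integral_eq_sub_of_hasDerivAt
      (f := fun r : ℝ => deriv P (σ + Real.log r) * Q (σ + Real.log (1 - r)))
      (fun r hr => ?_) (ii (((cP''.mul cQ).add (cP'.mul cQ')).mul cinv |>.sub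
        ((cP'.mul cQ').mul (cinv.mul cinv'))))
    have hr' := hI (hIcc ▸ hr)
    have hr0 : (r : ℂ) ≠ 0 := by exact_mod_cast hr'.1.ne'
    have hr1 : (1 - r : ℂ) ≠ 0 := by
      have : (1 - r : ℝ) ≠ 0 := by linarith [hr'.2]
      exact_mod_cast this
    refine ((hasDerivAt_add_log hP' hσ hr').mul
      (hasDerivAt_add_log_one_sub hQ hσ hr')).congr_deriv ?_
    field_simp
    ring
  have i1 : IntervalIntegrable (fun r : ℝ => (deriv (deriv P) (σ + Real.log r) *
      Q (σ + Real.log (1 - r)) + deriv P (σ + Real.log r) * deriv Q (σ + Real.log (1 - r))) *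
      (r : ℂ)⁻¹) volume a b := ii (((cP''.mul cQ).add (cP'.mul cQ')).mul cinv)
  have i2 : IntervalIntegrable (fun r : ℝ => deriv P (σ + Real.log r) *
      deriv Q (σ + Real.log (1 - r)) * ((r : ℂ)⁻¹ * (1 - r : ℂ)⁻¹)) volume a b :=
    ii ((cP'.mul cQ').mul (cinv.mul cinv'))
  rw [intervalIntegral.integral_sub i1 i2] at ftc
  have e3 : cutConv (logDer P) (logDer Q) a b σ = exp (-σ) *
      ∫ r in a..b, deriv P (σ + Real.log r) * deriv Q (σ + Real.log (1 - r)) *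
          ((r : ℂ)⁻¹ * (1 - r : ℂ)⁻¹) := by
    rw [cutConv, ← intervalIntegral.integral_const_mul, ← intervalIntegral.integral_const_mul]
    refine intervalIntegral.integral_congr fun r hr => ?_
    have hr' := hI (hIcc ▸ hr)
    simp only [logDer]
    have h5 : exp (-(σ + (Real.log r : ℂ))) = exp (-σ) * (r : ℂ)⁻¹ := by
      rw [neg_add, exp_add, exp_neg (Real.log r : ℂ), ← ofReal_exp, Real.exp_log hr'.1]
    have h6 : exp (-(σ + (Real.log (1 - r) : ℂ))) = exp (-σ) * (1 - r : ℂ)⁻¹ := by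
      rw [neg_add, exp_add, exp_neg (Real.log (1 - r) : ℂ), ← ofReal_exp,
        Real.exp_log (by linarith [hr'.2])]
      push_cast
      rfl
    rw [h5, h6]
    have h7 : exp σ * exp (-σ) = 1 := by rw [← exp_add]; simp
    linear_combination (exp (-σ) * (r : ℂ)⁻¹ * (1 - r : ℂ)⁻¹ *
      deriv P (σ + Real.log r) * deriv Q (σ + Real.log (1 - r))) * h7
  rw [logDer, h2.deriv, e3, sub_eq_iff_eq_add.1 ftc]
  ring

end

/-- The convolution along a straight segment. -/
noncomputable def conv (P Q : ℂ → ℂ) (σ : ℂ) : ℂ :=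
  exp σ * ∫ r in (0 : ℝ)..1, P (σ + Real.log r) * Q (σ + Real.log (1 - r))

section limits
variable {u : ℂ → ℂ} {ρ : ℝ}

theorem tendsto_add_log_zero (σ : ℂ) : Tendsto (fun r : ℝ => σ + Real.log r) (𝓝[>] 0)
    (logFilter ⊓ 𝓟 {w | |w.im| ≤ |σ.im|}) := by
  refine tendsto_inf.2 ⟨?_, tendsto_principal.2 (Eventually.of_forall fun r => by simp)⟩
  refine tendsto_comap_iff.2 ?_
  have : (Complex.re ∘ fun r : ℝ => σ + Real.log r) = fun r => σ.re + Real.log r := by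
    ext r; simp
  rw [this]
  exact tendsto_atBot_add_const_left _ _ Real.tendsto_log_nhdsGT_zero

theorem StolzZero.tendsto_add_log (hu : StolzZero u) (σ : ℂ) :
    Tendsto (fun r : ℝ => u (σ + Real.log r)) (𝓝[>] 0) (𝓝 0) :=
  (hu _).comp (tendsto_add_log_zero σ)

theorem tendsto_one_sub_nhdsLT : Tendsto (fun r : ℝ => 1 - r) (𝓝[<] 1) (𝓝[>] 0) := by
  refine tendsto_nhdsWithin_iff.2 ⟨?_, ?_⟩
  · exact ((continuous_const.sub continuous_id).tendsto' 1 (0 : ℝ) (by simp)).mono_left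
      nhdsWithin_le_nhds
  · filter_upwards [self_mem_nhdsWithin] with r hr
    simpa using hr

theorem tendsto_add_log_one (hu : DifferentiableOn ℂ u {w | w.re < ρ}) {σ : ℂ} (hσ : σ.re < ρ) :
    Tendsto (fun r : ℝ => u (σ + Real.log r)) (𝓝 1) (𝓝 (u σ)) := by
  have h1 : ContinuousAt u σ :=
    (hu.differentiableAt ((isOpen_re_lt ρ).mem_nhds hσ)).continuousAt
  have h2 : Tendsto (fun r : ℝ => σ + (Real.log r : ℂ)) (𝓝 1) (𝓝 σ) := by
    have := (continuous_ofReal.continuousAt.comp (Real.continuousAt_log one_ne_zero)).const_add σ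
    simpa [ContinuousAt] using this
  exact h1.tendsto.comp h2

theorem tendsto_one_sub_nhds_zero : Tendsto (fun r : ℝ => 1 - r) (𝓝 0) (𝓝 1) :=
  (continuous_const.sub continuous_id).tendsto' 0 (1 : ℝ) (by simp)

end limits

section
variable {P Q : ℂ → ℂ} {ρ : ℝ}

theorem exists_bound_mul (hP : DifferentiableOn ℂ P {w | w.re < ρ}) (hP0 : StolzZero P)
    (hQ : DifferentiableOn ℂ Q {w | w.re < ρ}) (hQ0 : StolzZero Q) {ρ' : ℝ} (hρ : ρ' < ρ) (M : ℝ) :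
    ∃ C : ℝ, 0 ≤ C ∧ ∀ σ : ℂ, σ.re ≤ ρ' → |σ.im| ≤ M → ∀ r ∈ Set.Ioo (0 : ℝ) 1,
      ‖P (σ + Real.log r) * Q (σ + Real.log (1 - r))‖ ≤ C := by
  obtain ⟨C, hC0, hC⟩ := hP0.exists_bound hρ hP.continuousOn M
  obtain ⟨C', hC0', hC'⟩ := hQ0.exists_bound hρ hQ.continuousOn M
  refine ⟨C * C', by positivity, fun σ h1 h2 r hr => ?_⟩
  have h3 := Real.log_nonpos hr.1.le hr.2.le
  have h4 := Real.log_nonpos (sub_nonneg.2 hr.2.le) (by linarith [hr.1])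
  rw [norm_mul]
  refine mul_le_mul (hC _ ?_ ?_) (hC' _ ?_ ?_) (norm_nonneg _) hC0
  · rw [add_re, ofReal_re]; linarith
  · simpa using h2
  · rw [add_re, ofReal_re]; linarith
  · simpa using h2

theorem intervalIntegrable_conv (hP : DifferentiableOn ℂ P {w | w.re < ρ}) (hP0 : StolzZero P)
    (hQ : DifferentiableOn ℂ Q {w | w.re < ρ}) (hQ0 : StolzZero Q) {σ : ℂ} (hσ : σ.re < ρ) :
    IntervalIntegrable (fun r : ℝ => P (σ + Real.log r) * Q (σ + Real.log (1 - r))) volume 0 1 := by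
  obtain ⟨C, hC0, hC⟩ := exists_bound_mul hP hP0 hQ hQ0 hσ |σ.im|
  rw [intervalIntegrable_iff, Set.uIoc_of_le zero_le_one, integrableOn_Ioc_iff_integrableOn_Ioo]
  refine Integrable.mono' (g := fun _ => C) (integrable_const _) ?_
    ((ae_restrict_iff' measurableSet_Ioo).2 (Eventually.of_forall fun r hr => hC σ le_rfl le_rfl r hr))
  exact ((continuousOn_add_log hP.continuousOn hσ).mul
    (continuousOn_add_log_one_sub hQ.continuousOn hσ)).aestronglyMeasurable measurableSet_Ioo

theorem norm_integral_sub_le (hP : DifferentiableOn ℂ P {w | w.re < ρ}) (hP0 : StolzZero P)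
    (hQ : DifferentiableOn ℂ Q {w | w.re < ρ}) (hQ0 : StolzZero Q) {σ : ℂ} (hσ : σ.re < ρ)
    {C : ℝ} (hC : ∀ r ∈ Set.Ioo (0 : ℝ) 1, ‖P (σ + Real.log r) * Q (σ + Real.log (1 - r))‖ ≤ C)
    {a b : ℝ} (ha : 0 < a) (hab : a ≤ b) (hb : b < 1) :
    ‖conv P Q σ - cutConv P Q a b σ‖ ≤ Real.exp σ.re * (C * a + C * (1 - b)) := by
  have hi := intervalIntegrable_conv hP hP0 hQ hQ0 hσ
  have hsub : ∀ {x y : ℝ}, 0 ≤ x → x ≤ y → y ≤ 1 → IntervalIntegrable (fun r : ℝ =>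
      P (σ + Real.log r) * Q (σ + Real.log (1 - r))) volume x y := fun h1 h2 h3 =>
    hi.mono_set (by
      rw [Set.uIcc_of_le h2, Set.uIcc_of_le zero_le_one]
      exact Set.Icc_subset_Icc h1 h3)
  have e1 := intervalIntegral.integral_add_adjacent_intervals
    (hsub le_rfl ha.le (hab.trans hb.le)) (hsub ha.le hab hb.le)
  have e2 := intervalIntegral.integral_add_adjacent_intervals
    (hsub le_rfl (ha.le.trans hab) hb.le) (hsub (ha.le.trans hab) hb.le le_rfl)
  have e3 : conv P Q σ - cutConv P Q a b σ = exp σ *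
      ((∫ r in (0 : ℝ)..a, P (σ + Real.log r) * Q (σ + Real.log (1 - r))) +
        ∫ r in b..(1 : ℝ), P (σ + Real.log r) * Q (σ + Real.log (1 - r))) := by
    rw [conv, cutConv, ← e2, ← e1]
    ring
  have hb1 : ∀ {x y : ℝ}, 0 ≤ x → x ≤ y → y ≤ 1 → ‖∫ r in x..y,
      P (σ + Real.log r) * Q (σ + Real.log (1 - r))‖ ≤ C * (y - x) := by
    intro x y h1 h2 h3
    rw [intervalIntegral.integral_of_le h2, integral_Ioc_eq_integral_Ioo]
    have := norm_setIntegral_le_of_norm_le_const (μ := volume) (s := Set.Ioo x y)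
      (f := fun r : ℝ => P (σ + Real.log r) * Q (σ + Real.log (1 - r))) (C := C) (by simp)
      (fun r hr => hC r ⟨h1.trans_lt hr.1, hr.2.trans_le h3⟩)
    simpa [h2] using this
  rw [e3, norm_mul, Complex.norm_exp]
  refine mul_le_mul_of_nonneg_left ((norm_add_le _ _).trans (add_le_add ?_ ?_)) (Real.exp_pos _).le
  · simpa using hb1 le_rfl ha.le (hab.trans hb.le)
  · exact hb1 (ha.le.trans hab) hb.le le_rfl

theorem eventually_cut : ∀ᶠ p : ℝ × ℝ in 𝓝[>] (0 : ℝ) ×ˢ 𝓝[<] (1 : ℝ),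
    0 < p.1 ∧ p.1 ≤ p.2 ∧ p.2 < 1 := by
  have h1 : ∀ᶠ a : ℝ in 𝓝[>] 0, 0 < a ∧ a < 1 / 2 := Ioo_mem_nhdsGT (by norm_num)
  have h2 : ∀ᶠ b : ℝ in 𝓝[<] 1, 1 / 2 < b ∧ b < 1 := Ioo_mem_nhdsLT (by norm_num)
  filter_upwards [h1.prod_mk h2] with p hp
  exact ⟨hp.1.1, (hp.1.2.trans hp.2.1).le, hp.2.2⟩

theorem tendstoLocallyUniformlyOn_cutConv (hP : DifferentiableOn ℂ P {w | w.re < ρ})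
    (hP0 : StolzZero P) (hQ : DifferentiableOn ℂ Q {w | w.re < ρ}) (hQ0 : StolzZero Q) :
    TendstoLocallyUniformlyOn (fun p : ℝ × ℝ => cutConv P Q p.1 p.2) (conv P Q)
      (𝓝[>] (0 : ℝ) ×ˢ 𝓝[<] (1 : ℝ)) {w | w.re < ρ} := by
  rw [Metric.tendstoLocallyUniformlyOn_iff]
  intro ε hε σ hσ
  obtain ⟨ρ', h1, h2⟩ := exists_between (show σ.re < ρ from hσ)
  obtain ⟨C, hC0, hC⟩ := exists_bound_mul hP hP0 hQ hQ0 h2 (|σ.im| + 1)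
  refine ⟨{y | y.re < ρ' ∧ |y.im| < |σ.im| + 1}, mem_nhdsWithin_of_mem_nhds ?_, ?_⟩
  · refine IsOpen.mem_nhds ?_ ⟨h1, by linarith⟩
    exact (isOpen_lt Complex.continuous_re continuous_const).inter
      (isOpen_lt (Complex.continuous_im.abs) continuous_const)
  have hlim : Tendsto (fun p : ℝ × ℝ => Real.exp ρ' * (C * p.1 + C * (1 - p.2)))
      (𝓝[>] (0 : ℝ) ×ˢ 𝓝[<] (1 : ℝ)) (𝓝 0) := by
    have h3 : Tendsto (fun p : ℝ × ℝ => Real.exp ρ' * (C * p.1 + C * (1 - p.2)))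
      (𝓝 ((0 : ℝ), (1 : ℝ))) (𝓝 0) := Continuous.tendsto' (by fun_prop) _ _ (by simp)
    refine h3.mono_left ?_
    rw [nhds_prod_eq]
    exact Filter.prod_mono nhdsWithin_le_nhds nhdsWithin_le_nhds
  filter_upwards [eventually_cut, hlim.eventually (gt_mem_nhds hε)] with p ⟨ha, hab, hb⟩ hp y hy
  rw [dist_eq_norm]
  refine (norm_integral_sub_le hP hP0 hQ hQ0 (hy.1.trans h2)
    (hC y hy.1.le hy.2.le) ha hab hb).trans_lt (lt_of_le_of_lt ?_ hp)
  refine mul_le_mul_of_nonneg_right (Real.exp_le_exp.2 hy.1.le) ?_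
  have : 0 ≤ 1 - p.2 := by linarith
  positivity

theorem differentiableOn_cutConv (hP : DifferentiableOn ℂ P {w | w.re < ρ})
    (hQ : DifferentiableOn ℂ Q {w | w.re < ρ}) {a b : ℝ} (ha : 0 < a) (hab : a ≤ b)
    (hb : b < 1) : DifferentiableOn ℂ (cutConv P Q a b) {w | w.re < ρ} := fun _ hσ =>
  (hasDerivAt_cutConv hP hQ ha hab hb hσ).differentiableAt.differentiableWithinAt

theorem differentiableOn_conv (hP : DifferentiableOn ℂ P {w | w.re < ρ})
    (hP0 : StolzZero P) (hQ : DifferentiableOn ℂ Q {w | w.re < ρ}) (hQ0 : StolzZero Q) :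
    DifferentiableOn ℂ (conv P Q) {w | w.re < ρ} :=
  (tendstoLocallyUniformlyOn_cutConv hP hP0 hQ hQ0).differentiableOn
    (by filter_upwards [eventually_cut] with p hp
        using differentiableOn_cutConv hP hQ hp.1 hp.2.1 hp.2.2) (isOpen_re_lt ρ)

theorem logDer_logDer_eq {N : ℂ → ℂ} (hN : DifferentiableOn ℂ N {w | w.re < ρ}) {σ : ℂ}
    (hσ : σ.re < ρ) : logDer (logDer N) σ =
      exp (-σ) * (exp (-σ) * (deriv (deriv N) σ - deriv N σ)) := by
  have h1 := ((differentiableOn_deriv_re_lt hN).differentiableAt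
    ((isOpen_re_lt ρ).mem_nhds hσ)).hasDerivAt
  have h2 : HasDerivAt (fun σ : ℂ => exp (-σ)) (-exp (-σ)) σ := by
    simpa using (hasDerivAt_neg σ).cexp
  have h3 : HasDerivAt (logDer N) _ σ := h2.fun_mul h1
  rw [logDer, h3.deriv]
  ring

/-- The improper convolution of the logarithmic derivatives converges to the second logarithmic
derivative of the convolution. -/
theorem tendsto_cutConv_logDer (hP : DifferentiableOn ℂ P {w | w.re < ρ})
    (hP0 : StolzZero P) (hQ : DifferentiableOn ℂ Q {w | w.re < ρ}) (hQ0 : StolzZero Q)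
    {σ : ℂ} (hσ : σ.re < ρ) :
    Tendsto (fun p : ℝ × ℝ => cutConv (logDer P) (logDer Q) p.1 p.2 σ)
      (𝓝[>] (0 : ℝ) ×ˢ 𝓝[<] (1 : ℝ)) (𝓝 (logDer (logDer (conv P Q)) σ)) := by
  have hLU := tendstoLocallyUniformlyOn_cutConv hP hP0 hQ hQ0
  have hev : ∀ᶠ p : ℝ × ℝ in 𝓝[>] (0 : ℝ) ×ˢ 𝓝[<] (1 : ℝ),
      DifferentiableOn ℂ (cutConv P Q p.1 p.2) {w | w.re < ρ} := by
    filter_upwards [eventually_cut] with p hp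
      using differentiableOn_cutConv hP hQ hp.1 hp.2.1 hp.2.2
  have hLU1 := hLU.deriv hev (isOpen_re_lt ρ)
  have hLU2 := hLU1.deriv (by
    filter_upwards [hev] with p hp using differentiableOn_deriv_re_lt hp) (isOpen_re_lt ρ)
  have t1 := hLU1.tendsto_at hσ
  have t2 := hLU2.tendsto_at hσ
  have t3 : Tendsto (fun p : ℝ × ℝ => logDer (logDer (cutConv P Q p.1 p.2)) σ)
      (𝓝[>] (0 : ℝ) ×ˢ 𝓝[<] (1 : ℝ)) (𝓝 (logDer (logDer (conv P Q)) σ)) := by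
    rw [logDer_logDer_eq (differentiableOn_conv hP hP0 hQ hQ0) hσ]
    refine (((t2.sub t1).const_mul _).const_mul _).congr' ?_
    filter_upwards [hev] with p hp
    rw [logDer_logDer_eq hp hσ]
    rfl
  have hev1 := eventually_analyticAt_iff.2 ⟨ρ, hP⟩
  have hev2 := eventually_analyticAt_iff.2 ⟨ρ, hQ⟩
  have hP1 := (Tame.mk hev1 hP0).deriv.stolz
  have hQ1 := (Tame.mk hev2 hQ0).deriv.stolz
  have hP' := differentiableOn_deriv_re_lt hP
  have hQ' := differentiableOn_deriv_re_lt hQ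
  -- boundary terms
  have id1 : Tendsto (fun b : ℝ => (b : ℂ)) (𝓝[<] 1) (𝓝 1) :=
    (continuous_ofReal.tendsto' 1 1 (by simp)).mono_left nhdsWithin_le_nhds
  have id0 : Tendsto (fun b : ℝ => (b : ℂ)) (𝓝[>] 0) (𝓝 0) :=
    (continuous_ofReal.tendsto' 0 0 (by simp)).mono_left nhdsWithin_le_nhds
  have b1 : Tendsto (fun b : ℝ => (b : ℂ) * (deriv P (σ + Real.log b) * Q (σ + Real.log (1 - b))) -
        (1 - b) * (P (σ + Real.log b) * deriv Q (σ + Real.log (1 - b)))) (𝓝[<] 1) (𝓝 0) := by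
    have := (id1.mul (((tendsto_add_log_one hP' hσ).mono_left nhdsWithin_le_nhds).mul
      ((hQ0.tendsto_add_log σ).comp tendsto_one_sub_nhdsLT))).sub ((id1.const_sub 1).mul
      (((tendsto_add_log_one hP hσ).mono_left nhdsWithin_le_nhds).mul
      ((hQ1.tendsto_add_log σ).comp tendsto_one_sub_nhdsLT)))
    simpa using this
  have b0 : Tendsto (fun a : ℝ => (a : ℂ) * (deriv P (σ + Real.log a) * Q (σ + Real.log (1 - a))) -
        (1 - a) * (P (σ + Real.log a) * deriv Q (σ + Real.log (1 - a)))) (𝓝[>] 0) (𝓝 0) := by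
    have := (id0.mul ((hP1.tendsto_add_log σ).mul
      (((tendsto_add_log_one hQ hσ).comp tendsto_one_sub_nhds_zero).mono_left
        nhdsWithin_le_nhds))).sub ((id0.const_sub 1).mul ((hP0.tendsto_add_log σ).mul
      (((tendsto_add_log_one hQ' hσ).comp tendsto_one_sub_nhds_zero).mono_left
        nhdsWithin_le_nhds)))
    simpa using this
  have t4 := t3.sub (((b1.comp tendsto_snd).sub (b0.comp tendsto_fst)).const_mul (exp (-σ)))
  simp only [sub_zero, mul_zero] at t4
  refine t4.congr' ?_
  filter_upwards [eventually_cut] with p hp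
  rw [logDer_logDer_cutConv hP hQ hp.1 hp.2.1 hp.2.2 hσ]
  simp only [Function.comp]
  ring

end

theorem Tame.exists_common {P Q : ℂ → ℂ} (hP : Tame P) (hQ : Tame Q) :
    ∃ ρ : ℝ, DifferentiableOn ℂ P {w | w.re < ρ} ∧ DifferentiableOn ℂ Q {w | w.re < ρ} := by
  obtain ⟨ρ, h1⟩ := eventually_analyticAt_iff.1 hP.analytic
  obtain ⟨ρ', h2⟩ := eventually_analyticAt_iff.1 hQ.analytic
  exact ⟨min ρ ρ', h1.mono fun w (hw : w.re < _) => lt_of_lt_of_le hw (min_le_left _ _),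
    h2.mono fun w (hw : w.re < _) => lt_of_lt_of_le hw (min_le_right _ _)⟩

theorem tame_exp_neg_mul_conv {P Q : ℂ → ℂ} (hP : Tame P) (hQ : Tame Q) :
    Tame (fun σ => exp (-σ) * conv P Q σ) := by
  obtain ⟨ρ, h1, h2⟩ := hP.exists_common hQ
  refine ⟨eventually_analyticAt_iff.2 ⟨ρ, (differentiable_exp.comp differentiable_neg).differentiableOn.mul
    (differentiableOn_conv h1 hP.stolz h2 hQ.stolz)⟩, stolzZero_iff.2 fun M ε hε => ?_⟩
  obtain ⟨r, hr⟩ := stolzZero_iff.1 hP.stolz M (ε / 2) (by positivity)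
  obtain ⟨r', hr'⟩ := stolzZero_iff.1 hQ.stolz M 1 one_pos
  refine ⟨min r r', fun σ hσ hM => ?_⟩
  have e : exp (-σ) * conv P Q σ =
      ∫ r in (0 : ℝ)..1, P (σ + Real.log r) * Q (σ + Real.log (1 - r)) := by
    rw [conv, ← mul_assoc, ← exp_add]
    simp
  rw [e, intervalIntegral.integral_of_le zero_le_one, integral_Ioc_eq_integral_Ioo]
  have := norm_setIntegral_le_of_norm_le_const (μ := volume) (s := Set.Ioo (0 : ℝ) 1)
    (f := fun r : ℝ => P (σ + Real.log r) * Q (σ + Real.log (1 - r))) (C := ε / 2) (by simp)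
    (fun t ht => by
      have h3 := Real.log_nonpos ht.1.le ht.2.le
      have h4 := Real.log_nonpos (sub_nonneg.2 ht.2.le) (by linarith [ht.1])
      have h5 := hr (σ + Real.log t) (by
        rw [add_re, ofReal_re]; linarith [min_le_left r r']) (by simpa using hM)
      have h6 := hr' (σ + Real.log (1 - t)) (by
        rw [add_re, ofReal_re]; linarith [min_le_right r r']) (by simpa using hM)
      rw [norm_mul]
      nlinarith [norm_nonneg (P (σ + Real.log t)), norm_nonneg (Q (σ + Real.log (1 - t)))])
  simp only [Real.volume_real_Ioo_of_le zero_le_one, sub_zero, mul_one] at this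
  linarith

theorem tame_logDer_conv {P Q : ℂ → ℂ} (hP : Tame P) (hQ : Tame Q) :
    Tame (logDer (conv P Q)) := by
  obtain ⟨ρ, h1, h2⟩ := hP.exists_common hQ
  have hT := tame_exp_neg_mul_conv hP hQ
  have hN := differentiableOn_conv h1 hP.stolz h2 hQ.stolz
  have hA := eventually_analyticAt_iff.2 ⟨ρ, hN⟩
  refine ⟨eventually_analyticAt_logDer hA, (hT.deriv.stolz.add hT.stolz).congr ?_⟩
  filter_upwards [hA] with σ hσ
  have h3 : HasDerivAt (fun σ : ℂ => exp (-σ)) (-exp (-σ)) σ := by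
    simpa using (hasDerivAt_neg σ).cexp
  rw [(h3.fun_mul hσ.differentiableAt.hasDerivAt).deriv, logDer]
  ring

/-! ### Comparison of the straight segment in the logarithmic coordinate with the segment in the
plane -/

theorem norm_log_one_add_le {z : ℂ} (hz : ‖z‖ ≤ 1 / 2) : ‖log (1 + z)‖ ≤ 3 / 4 :=
  (norm_log_one_add_half_le_self hz).trans (by linarith)

/-- The point of the segment in the plane, in the logarithmic coordinate divided by its end. -/
noncomputable def segPath (w : ℂ) (τ : ℝ) : ℂ := log (1 + exp (w - τ)) / exp (sOf w)

theorem eventually_dslope_log : ∀ᶠ v in 𝓝 (0 : ℂ), ∀ t ∈ Set.Icc (0 : ℝ) 1,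
    ‖dslope (fun u => log (1 + u)) 0 (t * v) - 1‖ ≤ 1 / 16 ∧
    ‖dslope (fun u => log (1 + u)) 0 (t * v) - dslope (fun u => log (1 + u)) 0 v‖
      ≤ (1 - t) / 16 := by
  have hE := analyticAt_dslope analyticAt_log_one_add
  have hE0 := dslope_log_zero
  set E := dslope (fun u : ℂ => log (1 + u)) 0
  obtain ⟨K, s, hs, hK⟩ := (hE.contDiffAt (n := 1)).exists_lipschitzOnWith
  have h1 : ∀ᶠ u in 𝓝 (0 : ℂ), u ∈ s ∧ ‖E u - 1‖ ≤ 1 / 16 := by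
    refine Filter.Eventually.and hs ?_
    have : Tendsto (fun u => ‖E u - 1‖) (𝓝 0) (𝓝 ‖E 0 - 1‖) :=
      (hE.continuousAt.tendsto.sub_const 1).norm
    rw [hE0, sub_self, norm_zero] at this
    filter_upwards [this.eventually (gt_mem_nhds (by norm_num : (0 : ℝ) < 1 / 16))] with u hu
      using le_of_lt hu
  obtain ⟨r, hr, hball⟩ := Metric.eventually_nhds_iff_ball.1 h1
  have h2 : ∀ᶠ v in 𝓝 (0 : ℂ), K * ‖v‖ < 1 / 16 := by
    refine ContinuousAt.eventually_lt (by fun_prop) (by fun_prop) (by simp)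
  filter_upwards [Metric.ball_mem_nhds _ hr, h2] with v hv hv' t ht
  have htv : (t : ℂ) * v ∈ Metric.ball 0 r := by
    simp only [mem_ball_zero_iff, norm_mul, Complex.norm_real, Real.norm_of_nonneg ht.1] at hv ⊢
    nlinarith [norm_nonneg v, ht.2]
  refine ⟨(hball _ htv).2, ?_⟩
  have h3 := hK.dist_le_mul _ (hball _ htv).1 _ (hball _ hv).1
  rw [dist_eq_norm, dist_eq_norm] at h3
  have h4 : (t : ℂ) * v - v = -((1 - t : ℝ) : ℂ) * v := by push_cast; ring
  rw [h4, norm_mul, norm_neg, Complex.norm_real, Real.norm_of_nonneg (by linarith [ht.2])] at h3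
  refine h3.trans ?_
  nlinarith [ht.2]

theorem exp_neg_mem_Ioo {τ : ℝ} (hτ : 0 < τ) : Real.exp (-τ) ∈ Set.Ioo (0 : ℝ) 1 :=
  ⟨Real.exp_pos _, by simpa using hτ⟩

theorem eventually_segPath : ∀ᶠ w in logFilter, ∀ τ : ℝ, 0 < τ →
    ‖segPath w τ - Real.exp (-τ)‖ ≤ Real.exp (-τ) * (1 - Real.exp (-τ)) / 8 ∧
    sOf (w - τ) = sOf w + log (segPath w τ) ∧
    sOf (cofactor w τ) = sOf w + log (1 - segPath w τ) ∧
    HasDerivAt (segPath w) (-(exp (w - τ) / (1 + exp (w - τ))) / exp (sOf w)) τ := by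
  obtain ⟨ρ₁, h₁⟩ := eventually_logFilter.1 (eventually_exp_sOf.and
    (eventually_sOf_sub_le (c := 1 / 4) (by norm_num)))
  have hv0 := tendsto_exp_logFilter.eventually eventually_dslope_log
  filter_upwards [hv0, eventually_re_lt (min (ρ₁ - 1) (-2))] with w hE hw τ hτ
  have hw1 : w.re < ρ₁ - 1 := hw.trans_le (min_le_left _ _)
  have hw2 : w.re < -2 := hw.trans_le (min_le_right _ _)
  have hE0 := fun t ht => (hE t ht).1
  obtain ⟨ht0, ht1⟩ := exp_neg_mem_Ioo hτ
  set t := Real.exp (-τ) with ht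
  have htI : t ∈ Set.Icc (0 : ℝ) 1 := ⟨ht0.le, ht1.le⟩
  obtain ⟨h2, h3⟩ := hE t htI
  have h1 := (hE 1 (by simp)).1
  have hnv : ‖exp w‖ ≤ 1 / 4 := by
    rw [Complex.norm_exp]
    have h5 : Real.exp w.re ≤ Real.exp (-2) := Real.exp_le_exp.2 hw2.le
    have h6 : Real.exp (-2) ≤ 1 / 4 := by
      rw [show (-2 : ℝ) = -1 + -1 by norm_num, Real.exp_add]
      have : Real.exp (-1) ≤ 1 / 2 := by
        rw [Real.exp_neg, one_div]
        exact inv_anti₀ (by norm_num) (by linarith [Real.add_one_le_exp (1 : ℝ)])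
      nlinarith [Real.exp_pos (-1)]
    linarith
  simp only [ofReal_one, one_mul] at h1
  have hexpt : exp (w - τ) = t * exp w := by
    rw [ht, ofReal_exp, ← exp_add]
    push_cast
    ring_nf
  have hσ := (h₁ w (by linarith)).1
  have hsp : segPath w τ = t * (dslope (fun u => log (1 + u)) 0 (t * exp w) /
      dslope (fun u => log (1 + u)) 0 (exp w)) := by
    have e1 := mul_dslope_zero (f := fun u => log (1 + u)) (exp w)
    have e2 := mul_dslope_zero (f := fun u => log (1 + u)) (t * exp w)
    simp only [add_zero, log_one, sub_zero] at e1 e2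
    rw [segPath, hσ, hexpt, ← e1, ← e2]
    field_simp
  set E := dslope (fun u : ℂ => log (1 + u)) 0 with hEdef
  have hEv : 15 / 16 ≤ ‖E (exp w)‖ := by
    have := norm_sub_norm_le (1 : ℂ) (E (exp w))
    rw [norm_one, norm_sub_rev] at this
    linarith
  have hEv0 : E (exp w) ≠ 0 := by
    rw [← norm_pos_iff]; linarith
  set d := E (t * exp w) / E (exp w) - 1 with hd
  have hdle : ‖d‖ ≤ (1 - t) / 8 := by
    have e1 : d = (E (t * exp w) - E (exp w)) / E (exp w) := by
      rw [hd]; field_simp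
    rw [e1, norm_div, div_le_iff₀ (by linarith)]
    refine h3.trans ?_
    nlinarith
  have hspd : segPath w τ = t * (1 + d) := by rw [hsp, hd]; ring
  have hd1 : ‖d‖ ≤ 1 / 2 := hdle.trans (by linarith)
  have hd_ne : 1 + d ≠ 0 := by
    intro h
    have : ‖(1 : ℂ)‖ = ‖d‖ := by rw [eq_neg_of_add_eq_zero_left h, norm_neg]
    rw [norm_one] at this
    linarith
  have hsOfw : sOf w = w + log (E (exp w)) := rfl
  have hlogE : ‖log (E (exp w))‖ ≤ 3 / 4 := by
    have := norm_log_one_add_le (z := E (exp w) - 1) (h1.trans (by norm_num))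
    rwa [add_sub_cancel] at this
  refine ⟨?_, ?_, ?_, ?_⟩
  · have e1 : segPath w τ - t = t * d := by rw [hspd]; ring
    rw [e1, norm_mul, Complex.norm_real, Real.norm_of_nonneg ht0.le]
    calc t * ‖d‖ ≤ t * ((1 - t) / 8) := by gcongr
      _ = _ := by ring
  · refine eq_of_exp_eq_of_norm_sub_lt ?_ ?_
    · have hne : segPath w τ ≠ 0 := by
        rw [hspd]
        exact mul_ne_zero (by exact_mod_cast ht0.ne') hd_ne
      rw [exp_add, exp_log hne, (h₁ (w - τ) (by simp; linarith)).1, segPath,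
        mul_div_cancel₀ _ (exp_ne_zero _)]
    · have hlog : log (segPath w τ) = -τ + log (1 + d) := by
        rw [hspd, log_ofReal_mul ht0 hd_ne, ht, Real.log_exp]
        push_cast
        rfl
      have e1 : sOf (w - τ) - (sOf w + log (segPath w τ)) =
          (sOf (w - τ) - (w - τ)) - log (E (exp w)) - log (1 + d) := by
        rw [hlog, hsOfw]; ring
      rw [e1]
      have h7 := (h₁ (w - τ) (by simp; linarith)).2
      have h8 := norm_log_one_add_le hd1
      calc _ ≤ ‖sOf (w - τ) - (w - τ)‖ + ‖log (E (exp w))‖ + ‖log (1 + d)‖ :=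
            (norm_sub_le _ _).trans (add_le_add_left (norm_sub_le _ _) _)
        _ < Real.pi := by linarith [Real.pi_gt_three]
  · -- the complementary point
    have hc1 := cofactor_re_le (w := w) (by linarith) hτ
    have hc := h₁ (cofactor w τ) (by linarith)
    have hspec := cofactor_spec (w := w) (by linarith) hτ
    set d' := d / (1 - t : ℝ) with hd'
    have h1t : (0 : ℝ) < 1 - t := by linarith
    have h1t' : ((1 - t : ℝ) : ℂ) ≠ 0 := by exact_mod_cast h1t.ne'
    have hd'le : ‖-(t * d')‖ ≤ 1 / 2 := by
      rw [norm_neg, norm_mul, hd', norm_div, Complex.norm_real, Complex.norm_real,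
        Real.norm_of_nonneg ht0.le, Real.norm_of_nonneg h1t.le]
      have : ‖d‖ / (1 - t) ≤ 1 / 8 := by
        rw [div_le_iff₀ h1t]; linarith
      have h0 : 0 ≤ ‖d‖ / (1 - t) := by positivity
      nlinarith
    have hone : 1 - segPath w τ = (1 - t : ℝ) * (1 + -(t * d')) := by
      rw [hspd, hd']
      field_simp
      push_cast
      ring
    have hd'ne : 1 + -(t * d') ≠ 0 := by
      intro h
      have : ‖(1 : ℂ)‖ = ‖-(t * d')‖ := by rw [eq_neg_of_add_eq_zero_left h, norm_neg]
      rw [norm_one] at this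
      linarith
    have hlog : log (1 - segPath w τ) = Real.log (1 - t) + log (1 + -(t * d')) := by
      rw [hone, log_ofReal_mul h1t hd'ne]
    have hexp1 : log (1 - exp (-(τ : ℂ))) = Real.log (1 - t) := by
      rw [ofReal_log h1t.le, ht]
      push_cast
      rfl
    have hnt : ‖exp (w - τ)‖ ≤ 1 / 4 := by
      rw [hexpt, norm_mul, Complex.norm_real, Real.norm_of_nonneg ht0.le]
      nlinarith [norm_nonneg (exp w)]
    have hl1 : ‖log (1 + exp (w - τ))‖ ≤ 3 / 8 :=
      (norm_log_one_add_half_le_self (by linarith)).trans (by linarith)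
    have hl2 : ‖log (1 + exp w)‖ ≤ 3 / 8 :=
      (norm_log_one_add_half_le_self (by linarith)).trans (by linarith)
    have hn3 : ‖exp (cofactor w τ)‖ ≤ 1 / 2 := by
      rw [Complex.norm_exp]
      have h5 : Real.exp (cofactor w τ).re ≤ Real.exp (-1) := Real.exp_le_exp.2 (by linarith)
      have : Real.exp (-1) ≤ 1 / 2 := by
        rw [Real.exp_neg, one_div]
        exact inv_anti₀ (by norm_num) (by linarith [Real.add_one_le_exp (1 : ℝ)])
      linarith
    have hl3 := norm_log_one_add_le hn3
    have hne : ∀ {z : ℂ}, ‖z‖ ≤ 1 / 2 → 1 + z ≠ 0 := by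
      intro z hz h
      have : ‖(1 : ℂ)‖ = ‖z‖ := by rw [eq_neg_of_add_eq_zero_left h, norm_neg]
      rw [norm_one] at this
      linarith
    have hsum : log (1 + exp (cofactor w τ)) = log (1 + exp w) - log (1 + exp (w - τ)) := by
      refine eq_of_exp_eq_of_norm_sub_lt ?_ ?_
      · rw [exp_sub, exp_log (hne hn3), exp_log (hne (by linarith)), exp_log (hne (by linarith)),
          ← hspec, mul_div_cancel_right₀ _ (hne (by linarith))]
      · calc _ ≤ ‖log (1 + exp (cofactor w τ))‖ + ‖log (1 + exp w) - log (1 + exp (w - τ))‖ :=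
              norm_sub_le _ _
          _ ≤ ‖log (1 + exp (cofactor w τ))‖ + (‖log (1 + exp w)‖ + ‖log (1 + exp (w - τ))‖) := by
              gcongr; exact norm_sub_le _ _
          _ < Real.pi := by linarith [Real.pi_gt_three]
    refine eq_of_exp_eq_of_norm_sub_lt ?_ ?_
    · have hne1 : 1 - segPath w τ ≠ 0 := by rw [hone]; exact mul_ne_zero h1t' hd'ne
      rw [exp_add, exp_log hne1, hc.1, hsum, mul_sub, mul_one, segPath,
        mul_div_cancel₀ _ (exp_ne_zero _), hσ]
    · have e1 : sOf (cofactor w τ) - (sOf w + log (1 - segPath w τ)) =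
          (sOf (cofactor w τ) - cofactor w τ) - log (1 + exp (w - τ)) -
            log (E (exp w)) - log (1 + -(t * d')) := by
        rw [hlog, hsOfw]
        have : cofactor w τ = w + Real.log (1 - t) - log (1 + exp (w - τ)) := by
          rw [cofactor, hexp1]
        rw [this]; ring
      rw [e1]
      have h8 := norm_log_one_add_le hd'le
      calc _ ≤ ‖sOf (cofactor w τ) - cofactor w τ‖ + ‖log (1 + exp (w - τ))‖ +
            ‖log (E (exp w))‖ + ‖log (1 + -(t * d'))‖ :=
            (norm_sub_le _ _).trans (add_le_add_left ((norm_sub_le _ _).trans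
              (add_le_add_left (norm_sub_le _ _) _)) _)
        _ < Real.pi := by linarith [Real.pi_gt_three, hc.2]
  · have hslit : 1 + exp (w - τ) ∈ slitPlane := by
      refine mem_slitPlane_of_norm_lt_one ?_
      rw [hexpt, norm_mul, Complex.norm_real, Real.norm_of_nonneg ht0.le]
      nlinarith [norm_nonneg (exp w)]
    have e1 : HasDerivAt (fun τ : ℝ => w - (τ : ℂ)) (-1) τ := by
      simpa using ((hasDerivAt_id τ).ofReal_comp).const_sub w
    have e2 : HasDerivAt (fun τ : ℝ => 1 + exp (w - (τ : ℂ))) (exp (w - τ) * -1) τ := by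
      exact (e1.cexp).const_add 1
    have e3 := (e2.clog_real hslit).div_const (exp (sOf w))
    refine e3.congr_deriv ?_
    ring

/-! ### Ends of the path -/

theorem ofReal_mem_ball {t : ℝ} (ht : t ∈ Set.Ioo (0 : ℝ) 1) :
    (t : ℂ) ∈ Metric.ball (1 / 2 : ℂ) (1 / 2) := by
  have h2 : (t : ℂ) - 1 / 2 = ((t - 1 / 2 : ℝ) : ℂ) := by push_cast; ring
  rw [Metric.mem_ball, dist_eq_norm, h2, Complex.norm_real, Real.norm_eq_abs, abs_lt]
  constructor <;> linarith [ht.1, ht.2]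

theorem mem_ball_of_norm_sub_le {t : ℝ} (ht : t ∈ Set.Ioo (0 : ℝ) 1) {ξ : ℂ}
    (h : ‖ξ - t‖ ≤ t * (1 - t) / 8) : ξ ∈ Metric.ball (1 / 2 : ℂ) (1 / 2) := by
  rw [Metric.mem_ball, dist_eq_norm]
  have e : ξ - 1 / 2 = (ξ - t) + ((t - 1 / 2 : ℝ) : ℂ) := by push_cast; ring
  rw [e]
  refine (norm_add_le _ _).trans_lt ?_
  rw [Complex.norm_real, Real.norm_eq_abs]
  rcases abs_cases (t - 1 / 2) with h1 | h1 <;> nlinarith [ht.1, ht.2]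

theorem primitive_near_zero {K k : ℂ → ℂ}
    (hK : ∀ y ∈ Metric.ball (1 / 2 : ℂ) (1 / 2), HasDerivAt K (k y) y)
    (hk : Tendsto (fun y => y * k y) (𝓝[≠] 0) (𝓝 0)) {ε : ℝ} (hε : 0 < ε) :
    ∃ r > 0, ∀ t : ℝ, 0 < t → t < r → t < 1 → ∀ ξ ∈ Metric.ball (1 / 2 : ℂ) (1 / 2),
      ‖ξ - t‖ ≤ t / 8 → ‖K ξ - K t‖ < ε := by
  rw [Metric.tendsto_nhdsWithin_nhds] at hk
  obtain ⟨r, hr, hk⟩ := hk ε hε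
  refine ⟨r / 2, by positivity, fun t ht htr ht1 ξ hξ h => ?_⟩
  have hconv : Convex ℝ (Metric.ball (1 / 2 : ℂ) (1 / 2) ∩ Metric.closedBall (t : ℂ) (t / 8)) :=
    (convex_ball _ _).inter (convex_closedBall _ _)
  have := hconv.norm_image_sub_le_of_norm_hasDerivWithin_le (f := K) (f' := k) (C := 2 * ε / t)
    (fun y hy => (hK y hy.1).hasDerivWithinAt) (fun y hy => ?_)
    (x := (t : ℂ)) (y := ξ) ⟨ofReal_mem_ball ⟨ht, ht1⟩, by simp; positivity⟩
    ⟨hξ, by rw [Metric.mem_closedBall, dist_eq_norm]; exact h⟩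
  · refine this.trans_lt ?_
    calc 2 * ε / t * ‖ξ - t‖ ≤ 2 * ε / t * (t / 8) := by gcongr
      _ = ε / 4 := by field_simp; norm_num
      _ < ε := by linarith
  · have h1 := hy.2
    rw [Metric.mem_closedBall, dist_eq_norm] at h1
    have hnt : ‖(t : ℂ)‖ = t := by rw [Complex.norm_real, Real.norm_of_nonneg ht.le]
    have h2 := norm_sub_norm_le (t : ℂ) y
    rw [norm_sub_rev, hnt] at h2
    have h3 := norm_sub_norm_le y (t : ℂ)
    rw [hnt] at h3
    have hy2 : t / 2 ≤ ‖y‖ := by linarith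
    have h4 := hk (x := y) (by
      simp only [Set.mem_compl_iff, Set.mem_singleton_iff]
      rintro rfl
      simp at hy2
      linarith) (by rw [dist_zero_right]; linarith)
    rw [dist_zero_right, norm_mul] at h4
    rw [le_div_iff₀ ht]
    nlinarith [norm_nonneg (k y)]

section
variable {P Q : ℂ → ℂ} {ρ : ℝ} {σ : ℂ}

theorem ball_half {y : ℂ} (hy : y ∈ Metric.ball (1 / 2 : ℂ) (1 / 2)) :
    y ∈ slitPlane ∧ 0 < ‖y‖ ∧ ‖y‖ < 1 := by
  rw [Metric.mem_ball, dist_eq_norm] at hy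
  have h1 := (abs_re_le_norm (y - 1 / 2)).trans_lt hy
  rw [abs_lt] at h1
  simp only [sub_re, one_div] at h1
  have h2 : (2⁻¹ : ℂ).re = 1 / 2 := by norm_num
  rw [h2] at h1
  have h3 : 0 < y.re := by linarith [h1.1]
  refine ⟨Or.inl h3, h3.trans_le (re_le_norm y), ?_⟩
  calc ‖y‖ = ‖(y - 1 / 2) + 1 / 2‖ := by ring_nf
    _ ≤ ‖y - 1 / 2‖ + ‖(1 / 2 : ℂ)‖ := norm_add_le _ _
    _ < 1 := by
      have : ‖(1 / 2 : ℂ)‖ = 1 / 2 := by norm_num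
      linarith

theorem one_sub_mem_ball {y : ℂ} (hy : y ∈ Metric.ball (1 / 2 : ℂ) (1 / 2)) :
    1 - y ∈ Metric.ball (1 / 2 : ℂ) (1 / 2) := by
  rw [Metric.mem_ball, dist_eq_norm] at hy ⊢
  have : 1 - y - 1 / 2 = -(y - 1 / 2) := by ring
  rwa [this, norm_neg]

theorem re_add_clog_lt (hσ : σ.re < ρ) {y : ℂ} (hy : y ∈ Metric.ball (1 / 2 : ℂ) (1 / 2)) :
    (σ + log y).re < ρ := by
  obtain ⟨-, h1, h2⟩ := ball_half hy
  rw [add_re, log_re]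
  linarith [Real.log_neg h1 h2]

theorem differentiableOn_logDer (hP : DifferentiableOn ℂ P {w | w.re < ρ}) :
    DifferentiableOn ℂ (logDer P) {w | w.re < ρ} :=
  (differentiable_exp.comp differentiable_neg).differentiableOn.mul (differentiableOn_deriv_re_lt hP)

theorem differentiableOn_comp_clog (hP : DifferentiableOn ℂ P {w | w.re < ρ}) (hσ : σ.re < ρ) :
    DifferentiableOn ℂ (fun y => P (σ + log y)) (Metric.ball (1 / 2 : ℂ) (1 / 2)) := by
  refine hP.comp (fun y hy => ?_) fun y hy => re_add_clog_lt hσ hy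
  exact ((differentiableAt_id.clog (ball_half hy).1).const_add σ).differentiableWithinAt

theorem tendsto_mul_logDer (hP0 : StolzZero (deriv P)) (σ : ℂ) :
    Tendsto (fun y => y * logDer P (σ + log y)) (𝓝[≠] 0) (𝓝 0) := by
  have h1 : Tendsto (fun y => σ + log y) (𝓝[≠] 0)
      (logFilter ⊓ 𝓟 {w | |w.im| ≤ |σ.im| + Real.pi}) := by
    refine tendsto_inf.2 ⟨tendsto_comap_iff.2 ?_,
      tendsto_principal.2 (Eventually.of_forall fun y => ?_)⟩
    · have : (Complex.re ∘ fun y : ℂ => σ + log y) = fun y => σ.re + Real.log ‖y‖ := by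
        ext r; simp [log_re]
      rw [this]
      refine tendsto_atBot_add_const_left _ _ (Real.tendsto_log_nhdsNE_zero.comp ?_)
      exact tendsto_norm_nhdsNE_zero.mono_right (nhdsWithin_mono _ fun x hx => ne_of_gt hx)
    · simp only [Set.mem_ofPred_eq, add_im, log_im]
      exact (abs_add_le _ _).trans (by gcongr; exact abs_arg_le_pi y)
  have h2 := ((hP0 _).comp h1).const_mul (exp (-σ))
  rw [mul_zero] at h2
  refine h2.congr' ?_
  filter_upwards [self_mem_nhdsWithin] with y hy
  have hy0 : y ≠ 0 := hy
  simp only [Function.comp, logDer]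
  rw [neg_add, exp_add, exp_neg (log y), exp_log hy0]
  field_simp

theorem tendsto_mul_kernel (hP0 : StolzZero (deriv P)) (hQ : DifferentiableOn ℂ Q {w | w.re < ρ})
    (hσ : σ.re < ρ) : Tendsto (fun y => y * (logDer P (σ + log y) * logDer Q (σ + log (1 - y)) *
      exp σ)) (𝓝[≠] 0) (𝓝 0) := by
  have h1 := tendsto_mul_logDer hP0 σ
  have h2 : Tendsto (fun y : ℂ => logDer Q (σ + log (1 - y))) (𝓝[≠] 0) (𝓝 (logDer Q σ)) := by
    refine Tendsto.mono_left ?_ nhdsWithin_le_nhds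
    have h3 : ContinuousAt (logDer Q) σ :=
      ((differentiableOn_logDer hQ).differentiableAt ((isOpen_re_lt ρ).mem_nhds hσ)).continuousAt
    have h4 : Tendsto (fun y : ℂ => σ + log (1 - y)) (𝓝 0) (𝓝 σ) := by
      have : ContinuousAt (fun y : ℂ => σ + log (1 - y)) 0 :=
        continuousAt_const.add (ContinuousAt.clog (by fun_prop) (by simp))
      simpa [ContinuousAt] using this
    exact h3.tendsto.comp h4
  have h5 := (h1.mul h2).mul_const (exp σ)
  simp only [zero_mul] at h5
  refine h5.congr fun y => ?_
  ring

end

theorem tendsto_exp_neg_prod : Tendsto (fun p : ℝ × ℝ => (Real.exp (-p.2), Real.exp (-p.1)))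
    (𝓝[>] 0 ×ˢ atTop) (𝓝[>] (0 : ℝ) ×ˢ 𝓝[<] (1 : ℝ)) := by
  refine Tendsto.prodMk ?_ ?_
  · refine (tendsto_nhdsWithin_iff.2 ⟨?_, Eventually.of_forall fun x => Real.exp_pos _⟩).comp
      tendsto_snd
    exact Real.tendsto_exp_neg_atTop_nhds_zero
  · refine Tendsto.comp (g := fun x : ℝ => Real.exp (-x)) ?_ tendsto_fst
    refine tendsto_nhdsWithin_iff.2 ⟨?_, ?_⟩
    · exact (Continuous.tendsto' (by fun_prop) 0 (1 : ℝ) (by simp)).mono_left nhdsWithin_le_nhds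
    · filter_upwards [self_mem_nhdsWithin] with x hx using (exp_neg_mem_Ioo hx).2

/-- The normalized convolution of two tame germs. -/
noncomputable def nconv (P Q : ℂ → ℂ) (σ : ℂ) : ℂ := -(1 / (2 * Real.pi * I)) * conv P Q σ

theorem logDer_const_mul (c : ℂ) (P : ℂ → ℂ) :
    logDer (fun σ => c * P σ) = fun σ => c * logDer P σ := by
  funext σ
  simp only [logDer, deriv_const_mul_field]
  ring

theorem hasConv_chart {P Q : ℂ → ℂ} (hP : Tame P) (hQ : Tame Q) :
    HasConv (chart (logDer P)) (chart (logDer Q)) (chart (logDer (logDer (nconv P Q)))) := by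
  obtain ⟨ρ, hP1, hQ1⟩ := hP.exists_common hQ
  refine ⟨_, _, _, rfl, rfl, rfl, ?_⟩
  filter_upwards [eventually_segPath, tendsto_sOf.eventually (eventually_re_lt ρ)] with w hw hσ
  set σ := sOf w with hσdef
  set k : ℂ → ℂ := fun y => logDer P (σ + log y) * logDer Q (σ + log (1 - y)) * exp σ with hk
  have hkd : DifferentiableOn ℂ k (Metric.ball (1 / 2 : ℂ) (1 / 2)) :=
    ((differentiableOn_comp_clog (differentiableOn_logDer hP1) hσ).mul
      ((differentiableOn_comp_clog (differentiableOn_logDer hQ1) hσ).comp (by fun_prop)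
        fun y hy => one_sub_mem_ball hy)).mul_const _
  obtain ⟨K, hK⟩ := hkd.isExactOn_ball
  have hlim := tendsto_cutConv_logDer hP1 hP.stolz hQ1 hQ.stolz hσ
  have hcut : ∀ a b : ℝ, 0 < a → a ≤ b → b < 1 →
      cutConv (logDer P) (logDer Q) a b σ = K b - K a := by
    intro a b ha hab hb
    rw [cutConv, ← intervalIntegral.integral_const_mul]
    have hI : ∀ r ∈ Set.uIcc a b, r ∈ Set.Ioo (0 : ℝ) 1 := fun r hr =>
      Icc_subset_Ioo_zero_one ha hb (Set.uIcc_of_le hab ▸ hr)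
    have e1 : ∀ r ∈ Set.uIcc a b, exp σ * (logDer P (σ + Real.log r) *
        logDer Q (σ + Real.log (1 - r))) = k r := by
      intro r hr
      have h1 := hI r hr
      simp only [hk]
      rw [ofReal_log h1.1.le, ofReal_log (by linarith [h1.2] : (0 : ℝ) ≤ 1 - r)]
      push_cast
      ring
    rw [intervalIntegral.integral_congr e1]
    refine intervalIntegral.integral_eq_sub_of_hasDerivAt (f := fun r : ℝ => K r)
      (fun r hr => (hK _ (ofReal_mem_ball (hI r hr))).comp_ofReal) ?_
    refine ContinuousOn.intervalIntegrable ?_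
    exact hkd.continuousOn.comp continuous_ofReal.continuousOn
      fun r hr => ofReal_mem_ball (hI r hr)
  have htr : ∀ p : ℝ × ℝ, 0 < p.1 → p.1 ≤ p.2 →
      truncatedConv (fun w => logDer P (sOf w)) (fun w => logDer Q (sOf w)) w p =
        -(1 / (2 * Real.pi * I)) * (K (segPath w p.1) - K (segPath w p.2)) := by
    intro p h0 h1
    rw [truncatedConv]
    congr 1
    have hpos : ∀ τ ∈ Set.uIcc p.1 p.2, 0 < τ := fun τ hτ => by
      rw [Set.uIcc_of_le h1] at hτ
      exact h0.trans_le hτ.1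
    have hmem : ∀ τ ∈ Set.uIcc p.1 p.2, segPath w τ ∈ Metric.ball (1 / 2 : ℂ) (1 / 2) :=
      fun τ hτ => mem_ball_of_norm_sub_le (exp_neg_mem_Ioo (hpos τ hτ)) (hw τ (hpos τ hτ)).1
    have e1 : ∀ τ ∈ Set.uIcc p.1 p.2, logDer P (sOf (w - τ)) * logDer Q (sOf (cofactor w τ)) *
        (exp (w - τ) / (1 + exp (w - τ))) = -(k (segPath w τ) *
          (-(exp (w - τ) / (1 + exp (w - τ))) / exp (sOf w))) := by
      intro τ hτ
      obtain ⟨-, h2, h3, -⟩ := hw τ (hpos τ hτ)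
      rw [h2, h3]
      simp only [hk]
      rw [← hσdef]
      field_simp [exp_ne_zero]
    have e2 : ∫ τ in p.1..p.2, k (segPath w τ) *
        (-(exp (w - τ) / (1 + exp (w - τ))) / exp (sOf w)) =
        K (segPath w p.2) - K (segPath w p.1) := by
      refine intervalIntegral.integral_eq_sub_of_hasDerivAt (f := fun τ : ℝ => K (segPath w τ))
        (fun τ hτ => HasDerivAt.comp τ (h₂ := K) (hK _ (hmem τ hτ)) (hw τ (hpos τ hτ)).2.2.2) ?_
      refine ContinuousOn.intervalIntegrable ?_
      have hc : ContinuousOn (segPath w) (Set.uIcc p.1 p.2) := fun τ hτ =>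
        (hw τ (hpos τ hτ)).2.2.2.continuousAt.continuousWithinAt
      refine (hkd.continuousOn.comp hc hmem).mul ?_
      refine (ContinuousOn.neg (ContinuousOn.div (by fun_prop) (by fun_prop) ?_)).div_const _
      intro τ hτ h4
      have h5 : exp (w - τ) / (1 + exp (w - τ)) = 0 := by rw [h4, div_zero]
      have h6 := (hw τ (hpos τ hτ)).2.1
      have h7 := (hw τ (hpos τ hτ)).1
      have h8 : segPath w τ = 0 := by rw [segPath, h4, log_zero, zero_div]
      exact (norm_pos_iff.1 (ball_half (hmem τ hτ)).2.1) h8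
    rw [intervalIntegral.integral_congr e1, intervalIntegral.integral_neg, e2]
    ring
  have hposev : ∀ᶠ p : ℝ × ℝ in 𝓝[>] (0 : ℝ) ×ˢ atTop, 0 < p.1 ∧ p.1 < 1 ∧ 1 < p.2 := by
    have h1 : ∀ᶠ δ : ℝ in 𝓝[>] 0, 0 < δ ∧ δ < 1 := Ioo_mem_nhdsGT one_pos
    filter_upwards [h1.prod_mk (eventually_gt_atTop (1 : ℝ))] with p hp
    exact ⟨hp.1.1, hp.1.2, hp.2⟩
  have hP' := hP.deriv.stolz
  have hQ' := hQ.deriv.stolz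
  -- the two ends
  have end1 : Tendsto (fun R : ℝ => K (segPath w R) - K (Real.exp (-R))) atTop (𝓝 0) := by
    rw [Metric.tendsto_nhds]
    intro ε hε
    obtain ⟨r, hr, h⟩ := primitive_near_zero hK (tendsto_mul_kernel hP' hQ1 hσ) hε
    filter_upwards [eventually_gt_atTop 0,
      Real.tendsto_exp_neg_atTop_nhds_zero.eventually (gt_mem_nhds hr)] with R hR hR'
    have hI := exp_neg_mem_Ioo hR
    have h1 := (hw R hR).1
    rw [dist_zero_right]
    refine h _ hI.1 hR' hI.2 _ (mem_ball_of_norm_sub_le hI h1) (h1.trans ?_)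
    nlinarith [hI.1, hI.2]
  have end0 : Tendsto (fun δ : ℝ => K (segPath w δ) - K (Real.exp (-δ))) (𝓝[>] 0) (𝓝 0) := by
    rw [Metric.tendsto_nhds]
    intro ε hε
    have hK' : ∀ y ∈ Metric.ball (1 / 2 : ℂ) (1 / 2),
        HasDerivAt (fun y => -K (1 - y)) (logDer Q (σ + log y) * logDer P (σ + log (1 - y)) *
          exp σ) y := by
      intro y hy
      have h1 : HasDerivAt (fun y : ℂ => 1 - y) (-1) y := by
        simpa using (hasDerivAt_id y).const_sub 1
      refine ((HasDerivAt.comp y (h₂ := K) (hK _ (one_sub_mem_ball hy)) h1).neg).congr_deriv ?_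
      simp only [hk, sub_sub_cancel]
      ring
    obtain ⟨r, hr, h⟩ := primitive_near_zero hK' (tendsto_mul_kernel hQ' hP1 hσ) hε
    have h0 : Tendsto (fun δ : ℝ => 1 - Real.exp (-δ)) (𝓝[>] 0) (𝓝 0) :=
      (Continuous.tendsto' (by fun_prop) 0 (0 : ℝ) (by simp)).mono_left nhdsWithin_le_nhds
    filter_upwards [self_mem_nhdsWithin, h0.eventually (gt_mem_nhds hr)] with δ hδ hδ'
    have hI := exp_neg_mem_Ioo hδ
    have h1 := (hw δ hδ).1
    rw [dist_zero_right]
    have h2 := h (1 - Real.exp (-δ)) (by linarith [hI.2]) hδ' (by linarith [hI.1])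
      (1 - segPath w δ) (one_sub_mem_ball (mem_ball_of_norm_sub_le hI h1)) (by
        have e : 1 - segPath w δ - ((1 - Real.exp (-δ) : ℝ) : ℂ) =
          -(segPath w δ - Real.exp (-δ)) := by push_cast; ring
        rw [e, norm_neg]
        refine h1.trans ?_
        nlinarith [hI.1, hI.2])
    rw [← norm_neg]
    have e3 : (1 : ℂ) - ((1 - Real.exp (-δ) : ℝ) : ℂ) = (Real.exp (-δ) : ℂ) := by push_cast; ring
    simp only [sub_sub_cancel, e3] at h2
    refine lt_of_eq_of_lt (congrArg norm ?_) h2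
    ring
  have hmain := ((hlim.comp tendsto_exp_neg_prod).add
    ((end0.comp tendsto_fst).sub (end1.comp tendsto_snd))).const_mul (-(1 / (2 * Real.pi * I)))
  have hval : logDer (logDer (nconv P Q)) σ =
      -(1 / (2 * Real.pi * I)) * (logDer (logDer (conv P Q)) σ + (0 - 0)) := by
    have : nconv P Q = fun σ => -(1 / (2 * Real.pi * I)) * conv P Q σ := rfl
    rw [this, logDer_const_mul, logDer_const_mul]
    simp
  rw [hval]
  refine hmain.congr' ?_
  filter_upwards [hposev] with p ⟨h0, h1, h2⟩
  rw [htr p h0 (by linarith)]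
  simp only [Function.comp]
  rw [hcut _ _ (Real.exp_pos _) (Real.exp_le_exp.2 (by linarith)) (exp_neg_mem_Ioo h0).2]
  ring

/-! ### Germs with prescribed variation -/

/-- The periodic Cauchy kernel. -/
noncomputable def kern (u : ℂ) : ℂ := (1 - exp u)⁻¹

theorem norm_one_sub_exp_ge (u : ℂ) :
    |Real.sin (u.im / 2)| / 2 * (1 + Real.exp u.re) ≤ ‖1 - exp u‖ := by
  refine abs_le_of_sq_le_sq' ?_ (norm_nonneg _) |>.2
  rw [← Complex.normSq_eq_norm_sq, Complex.normSq_apply]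
  have h1 : (exp u).re = Real.exp u.re * Real.cos u.im := exp_re u
  have h2 : (exp u).im = Real.exp u.re * Real.sin u.im := exp_im u
  have h3 : Real.cos u.im = 1 - 2 * Real.sin (u.im / 2) ^ 2 := by
    have := Real.cos_two_mul' (u.im / 2)
    rw [mul_div_cancel₀ _ (two_ne_zero)] at this
    nlinarith [Real.sin_sq_add_cos_sq (u.im / 2)]
  have h4 := Real.sin_sq_add_cos_sq u.im
  simp only [sub_re, one_re, sub_im, one_im, h1, h2]
  have h5 : Real.sin (u.im / 2) ^ 2 ≤ 1 := Real.sin_sq_le_one _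
  rw [mul_pow, div_pow, sq_abs]
  set c := Real.cos u.im
  set s := Real.sin u.im
  set r := Real.exp u.re
  set S := Real.sin (u.im / 2)
  have h6 : (1 - r * c) * (1 - r * c) + (0 - r * s) * (0 - r * s) = 1 - 2 * r * c + r ^ 2 := by
    nlinarith
  rw [h6, h3]
  nlinarith [mul_nonneg (sub_nonneg.2 h5) (sq_nonneg (1 - r)), mul_nonneg (sq_nonneg S) (sq_nonneg (1 + r))]

theorem one_sub_exp_ne_zero {u : ℂ} (h : Real.sin (u.im / 2) ≠ 0) : 1 - exp u ≠ 0 := by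
  rw [← norm_pos_iff]
  refine lt_of_lt_of_le ?_ (norm_one_sub_exp_ge u)
  have := abs_pos.2 h
  have := Real.exp_pos u.re
  positivity

theorem norm_kern_le {u : ℂ} (h : Real.sin (u.im / 2) ≠ 0) :
    ‖kern u‖ ≤ 2 / |Real.sin (u.im / 2)| * Real.exp (-u.re) := by
  rw [kern, norm_inv]
  have h1 := abs_pos.2 h
  have h2 := Real.exp_pos u.re
  calc ‖1 - exp u‖⁻¹ ≤ (|Real.sin (u.im / 2)| / 2 * Real.exp u.re)⁻¹ := by
        refine inv_anti₀ (by positivity) (le_trans ?_ (norm_one_sub_exp_ge u))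
        gcongr
        linarith
    _ = _ := by rw [Real.exp_neg]; field_simp

theorem hasDerivAt_kern {u : ℂ} (h : 1 - exp u ≠ 0) :
    HasDerivAt kern (exp u / (1 - exp u) ^ 2) u := by
  have h1 : HasDerivAt (fun u => 1 - exp u) (-exp u) u := (Complex.hasDerivAt_exp u).const_sub 1
  refine (h1.inv h).congr_deriv ?_
  ring

theorem kern_periodic (u : ℂ) : kern (u + 2 * Real.pi * I) = kern u := by
  rw [kern, kern, Complex.exp_periodic u]

theorem kern_periodic_sub (u : ℂ) : kern (u - 2 * Real.pi * I) = kern u := by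
  rw [← kern_periodic (u - 2 * Real.pi * I), sub_add_cancel]

theorem sin_half_pos {x : ℝ} (h0 : 0 < x) (h1 : x < 2 * Real.pi) : 0 < Real.sin (x / 2) :=
  Real.sin_pos_of_pos_of_lt_pi (by linarith) (by linarith)

theorem norm_one_sub_exp_ge_of_neg {u : ℂ} : 1 - Real.exp u.re ≤ ‖1 - exp u‖ := by
  have := norm_sub_norm_le (1 : ℂ) (exp u)
  rwa [norm_one, Complex.norm_exp] at this

theorem one_sub_exp_ne_zero_of_neg {u : ℂ} (hu : u.re < 0) : 1 - exp u ≠ 0 := by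
  rw [← norm_pos_iff]
  have := norm_one_sub_exp_ge_of_neg (u := u)
  have := Real.exp_lt_one_iff.2 hu
  linarith

/-- The mean value of the periodic Cauchy kernel over a period. -/
theorem integral_kern {a : ℂ} (ha : a.re < 0) (θ : ℝ) :
    ∫ y in θ..θ + 2 * Real.pi, kern (a - y * I) = 2 * Real.pi := by
  have hper : Function.Periodic (fun y : ℝ => kern (a - y * I)) (2 * Real.pi) := fun y => by
    have : a - ((y + 2 * Real.pi : ℝ) : ℂ) * I = a - y * I - 2 * Real.pi * I := by push_cast; ring
    simp only [this, kern_periodic_sub]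
  rw [hper.intervalIntegral_add_eq θ 0, zero_add]
  have h1 : exp a ∈ Metric.ball (0 : ℂ) 1 := by
    rw [mem_ball_zero_iff, Complex.norm_exp]
    exact Real.exp_lt_one_iff.2 ha
  have h2 := circleIntegral.integral_sub_inv_of_mem_ball h1
  simp only [circleIntegral, deriv_circleMap, circleMap_zero, ofReal_one, one_mul, smul_eq_mul] at h2
  have h3 : ∀ y : ℝ, exp (y * I) * I * (exp (y * I) - exp a)⁻¹ = I * kern (a - y * I) := by
    intro y
    have h4 := one_sub_exp_ne_zero_of_neg (u := a - y * I) (by simpa using ha)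
    have h5 : exp (y * I) - exp a = exp (y * I) * (1 - exp (a - y * I)) := by
      rw [mul_sub, ← exp_add]
      ring_nf
    rw [h5, kern, mul_inv]
    field_simp [exp_ne_zero]
  simp only [h3] at h2
  rw [intervalIntegral.integral_const_mul] at h2
  have : (2 * Real.pi * I : ℂ) = I * (2 * Real.pi) := by ring
  rw [this] at h2
  exact mul_left_cancel₀ I_ne_zero h2

section cousin
variable {P : ℂ → ℂ} {ρ ρ₁ : ℝ}

/-- The Cauchy integral of `P` along a horizontal half-line. -/
noncomputable def horInt (P : ℂ → ℂ) (ρ₁ θ : ℝ) (σ : ℂ) : ℂ :=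
  ∫ x in Set.Iic ρ₁, P (x + θ * I) * kern (σ - (x + θ * I))

/-- The Cauchy integral of `P` along a vertical segment. -/
noncomputable def vertInt (P : ℂ → ℂ) (ρ₁ θ θ' : ℝ) (σ : ℂ) : ℂ :=
  I * ∫ y in θ..θ', P (ρ₁ + y * I) * kern (σ - (ρ₁ + y * I))

theorem continuous_line (θ : ℝ) : Continuous (fun x : ℝ => (x + θ * I : ℂ)) := by fun_prop

theorem integrand_bound {C s r : ℝ} {σ : ℂ} {x θ : ℝ} (hs : 0 < s)
    (hC : ‖P (x + θ * I)‖ ≤ C) (hsin : s ≤ Real.sin ((σ.im - θ) / 2)) (hr : r ≤ σ.re) :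
    ‖P (x + θ * I) * kern (σ - (x + θ * I))‖ ≤ C * (2 / s) * Real.exp (-r) * Real.exp x := by
  have him : (σ - (x + θ * I)).im = σ.im - θ := by simp
  have hre : (σ - (x + θ * I)).re = σ.re - x := by simp
  have h1 := norm_kern_le (u := σ - (x + θ * I)) (by rw [him]; linarith)
  rw [him, hre, abs_of_pos (by linarith)] at h1
  have hC0 : 0 ≤ C := (norm_nonneg _).trans hC
  rw [norm_mul]
  calc _ ≤ C * (2 / Real.sin ((σ.im - θ) / 2) * Real.exp (-(σ.re - x))) := by gcongr
    _ ≤ C * (2 / s * (Real.exp (-r) * Real.exp x)) := by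
      rw [← Real.exp_add]
      gcongr
      linarith
    _ = _ := by ring

theorem continuousOn_hor (hP : DifferentiableOn ℂ P {w | w.re < ρ}) (hρ : ρ₁ < ρ) (θ : ℝ) {σ : ℂ}
    (hσ : Real.sin ((σ.im - θ) / 2) ≠ 0) :
    ContinuousOn (fun x : ℝ => P (x + θ * I) * kern (σ - (x + θ * I))) (Set.Iic ρ₁) := by
  refine (hP.continuousOn.comp (continuous_line θ).continuousOn fun x hx => ?_).mul ?_
  · simpa using lt_of_le_of_lt hx hρ
  · refine ContinuousOn.inv₀ (by fun_prop) fun x _ => one_sub_exp_ne_zero ?_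
    simpa using hσ

theorem horInt_aux (hP : DifferentiableOn ℂ P {w | w.re < ρ}) (hP0 : StolzZero P) (hρ : ρ₁ < ρ)
    (θ : ℝ) {σ : ℂ} (h0 : θ < σ.im) (h1 : σ.im < θ + 2 * Real.pi) :
    ∃ r > 0, ∃ bound : ℝ → ℝ, IntegrableOn bound (Set.Iic ρ₁) ∧
      ∀ x ∈ Set.Iic ρ₁, ∀ y ∈ Metric.ball σ r, θ < y.im ∧ y.im < θ + 2 * Real.pi ∧
        ‖P (x + θ * I) * kern (y - (x + θ * I))‖ ≤ bound x := by
  obtain ⟨C, hC0, hC⟩ := hP0.exists_bound hρ hP.continuousOn |θ|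
  have hs := sin_half_pos (x := σ.im - θ) (by linarith) (by linarith)
  set s := Real.sin ((σ.im - θ) / 2) / 2 with hsdef
  have hev : ∀ᶠ y in 𝓝 σ, s < Real.sin ((y.im - θ) / 2) ∧ σ.re - 1 < y.re ∧ θ < y.im ∧
      y.im < θ + 2 * Real.pi := by
    refine Filter.Eventually.and ?_ (Filter.Eventually.and ?_ (Filter.Eventually.and ?_ ?_))
    · exact ContinuousAt.eventually_lt (by fun_prop) (by fun_prop) (by rw [hsdef]; linarith)
    · exact ContinuousAt.eventually_lt (by fun_prop) (by fun_prop) (by linarith)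
    · exact ContinuousAt.eventually_lt (by fun_prop) (by fun_prop) h0
    · exact ContinuousAt.eventually_lt (by fun_prop) (by fun_prop) h1
  obtain ⟨r, hr, hball⟩ := Metric.eventually_nhds_iff_ball.1 hev
  refine ⟨r, hr, fun x => C * (2 / s) * Real.exp (-(σ.re - 1)) * Real.exp x,
    (integrableOn_exp_Iic _).const_mul _, fun x hx y hy => ?_⟩
  obtain ⟨h2, h3, h4, h5⟩ := hball y hy
  refine ⟨h4, h5, integrand_bound (by rw [hsdef]; linarith) (hC _ ?_ ?_) h2.le h3.le⟩
  · simpa using hx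
  · simp

theorem hasDerivAt_horInt (hP : DifferentiableOn ℂ P {w | w.re < ρ}) (hP0 : StolzZero P)
    (hρ : ρ₁ < ρ) (θ : ℝ) {σ : ℂ} (h0 : θ < σ.im) (h1 : σ.im < θ + 2 * Real.pi) :
    IntegrableOn (fun x : ℝ => P (x + θ * I) * kern (σ - (x + θ * I))) (Set.Iic ρ₁) ∧
    HasDerivAt (horInt P ρ₁ θ) (∫ x in Set.Iic ρ₁, P (x + θ * I) *
      (exp (σ - (x + θ * I)) / (1 - exp (σ - (x + θ * I))) ^ 2)) σ := by
  obtain ⟨r, hr, bound, hbi, hb⟩ := horInt_aux hP hP0 hρ θ h0 h1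
  have hmeas : ∀ y : ℂ, θ < y.im → y.im < θ + 2 * Real.pi → AEStronglyMeasurable
      (fun x : ℝ => P (x + θ * I) * kern (y - (x + θ * I))) (volume.restrict (Set.Iic ρ₁)) :=
    fun y h2 h3 => (continuousOn_hor hP hρ θ
      (sin_half_pos (by linarith) (by linarith)).ne').aestronglyMeasurable measurableSet_Iic
  have hsinx : ∀ y : ℂ, θ < y.im → y.im < θ + 2 * Real.pi → ∀ x : ℝ,
      1 - exp (y - (x + θ * I)) ≠ 0 := fun y h2 h3 x => one_sub_exp_ne_zero (by
    have := (sin_half_pos (x := y.im - θ) (by linarith) (by linarith)).ne'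
    simpa using this)
  have hder : ∀ y : ℂ, θ < y.im → y.im < θ + 2 * Real.pi → ∀ x : ℝ,
      HasDerivAt (fun y => P (x + θ * I) * kern (y - (x + θ * I))) (P (x + θ * I) *
        (exp (y - (x + θ * I)) / (1 - exp (y - (x + θ * I))) ^ 2)) y := fun y h2 h3 x =>
    (HasDerivAt.comp_sub_const y _ (hasDerivAt_kern (hsinx y h2 h3 x))).const_mul _
  refine ⟨hbi.mono' (hmeas σ h0 h1) ((ae_restrict_iff' measurableSet_Iic).2
    (Eventually.of_forall fun x hx => (hb x hx σ (Metric.mem_ball_self hr)).2.2)), ?_⟩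
  have hmem : ∀ y ∈ Metric.ball σ r, θ < y.im ∧ y.im < θ + 2 * Real.pi := fun y hy =>
    ⟨(hb ρ₁ (Set.mem_Iic.2 le_rfl) y hy).1, (hb ρ₁ (Set.mem_Iic.2 le_rfl) y hy).2.1⟩
  have key := (hasDerivAt_integral_of_dominated_holomorphic (z₀ := σ) hr
    (μ := volume.restrict (Set.Iic ρ₁))
    (F := fun y (x : ℝ) => P (x + θ * I) * kern (y - (x + θ * I)))
    (bound := bound) (fun y hy => hmeas y (hmem y hy).1 (hmem y hy).2)
    (Eventually.of_forall fun x y hy =>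
      (hder y (hmem y hy).1 (hmem y hy).2 x).differentiableAt.differentiableWithinAt)
    ((ae_restrict_iff' measurableSet_Iic).2
      (Eventually.of_forall fun x hx y hy => (hb x hx y hy).2.2)) hbi).2
  refine key.congr_deriv ?_
  refine integral_congr_ae (Eventually.of_forall fun x => ?_)
  exact (hder σ h0 h1 x).deriv

theorem hasDerivAt_vertInt (hP : DifferentiableOn ℂ P {w | w.re < ρ}) (hρ : ρ₁ < ρ) (θ θ' : ℝ)
    {σ : ℂ} (hσ : σ.re < ρ₁) :
    HasDerivAt (vertInt P ρ₁ θ θ') (I * ∫ y in θ..θ', P (ρ₁ + y * I) *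
      (exp (σ - (ρ₁ + y * I)) / (1 - exp (σ - (ρ₁ + y * I))) ^ 2)) σ := by
  have hcP : Continuous (fun y : ℝ => P (ρ₁ + y * I)) := by
    refine hP.continuousOn.comp_continuous (by fun_prop) fun y => ?_
    simpa using hρ
  have hne : ∀ z : ℂ, z.re < ρ₁ → ∀ y : ℝ, 1 - exp (z - (ρ₁ + y * I)) ≠ 0 := fun z hz y =>
    one_sub_exp_ne_zero_of_neg (by simpa using hz)
  have hder : ∀ z : ℂ, z.re < ρ₁ → ∀ y : ℝ,
      HasDerivAt (fun z => P (ρ₁ + y * I) * kern (z - (ρ₁ + y * I))) (P (ρ₁ + y * I) *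
        (exp (z - (ρ₁ + y * I)) / (1 - exp (z - (ρ₁ + y * I))) ^ 2)) z := fun z hz y =>
    (HasDerivAt.comp_sub_const z _ (hasDerivAt_kern (hne z hz y))).const_mul _
  obtain ⟨C, hC⟩ := (isCompact_uIcc (a := θ) (b := θ')).exists_bound_of_continuousOn
    hcP.continuousOn
  have hC0 : 0 ≤ C := (norm_nonneg _).trans (hC θ Set.left_mem_uIcc)
  obtain ⟨ρ₂, h2, h3⟩ := exists_between hσ
  have hq : 0 < 1 - Real.exp (ρ₂ - ρ₁) := by
    have := Real.exp_lt_one_iff.2 (sub_neg.2 h3)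
    linarith
  have hball : ∀ z ∈ Metric.ball σ (ρ₂ - σ.re), z.re < ρ₂ := fun z hz => by
    rw [Metric.mem_ball, dist_eq_norm] at hz
    have := (le_abs_self _).trans_lt ((abs_re_le_norm (z - σ)).trans_lt hz)
    simp only [sub_re] at this
    linarith
  have key := (hasDerivAt_integral_of_dominated_holomorphic (z₀ := σ) (r := ρ₂ - σ.re)
    (by linarith) (μ := volume.restrict (Set.uIoc θ θ'))
    (F := fun z (y : ℝ) => P (ρ₁ + y * I) * kern (z - (ρ₁ + y * I)))
    (bound := fun _ => C * (1 - Real.exp (ρ₂ - ρ₁))⁻¹) (fun z hz => ?_)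
    (Eventually.of_forall fun y z hz =>
      (hder z ((hball z hz).trans h3) y).differentiableAt.differentiableWithinAt)
    ((ae_restrict_iff' measurableSet_uIoc).2
      (Eventually.of_forall fun y hy z hz => ?_)) ?_).2
  · have e : vertInt P ρ₁ θ θ' = fun z => I * (((if θ ≤ θ' then (1 : ℝ) else -1 : ℝ) : ℂ) *
        ∫ y in Set.uIoc θ θ', P (ρ₁ + y * I) * kern (z - (ρ₁ + y * I))) := by
      funext z
      rw [vertInt, intervalIntegral.intervalIntegral_eq_integral_uIoc, real_smul]
    rw [e, intervalIntegral.intervalIntegral_eq_integral_uIoc, real_smul]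
    refine ((key.const_mul _).const_mul I).congr_deriv ?_
    congr 2
    refine integral_congr_ae (Eventually.of_forall fun y => ?_)
    exact (hder σ hσ y).deriv
  · refine Continuous.aestronglyMeasurable (hcP.mul ?_)
    exact Continuous.inv₀ (by fun_prop) (hne z ((hball z hz).trans h3))
  · rw [norm_mul]
    refine mul_le_mul (hC y (Set.uIoc_subset_uIcc hy)) ?_ (norm_nonneg _) hC0
    rw [kern, norm_inv]
    refine inv_anti₀ hq (le_trans ?_ norm_one_sub_exp_ge_of_neg)
    have : (z - (ρ₁ + y * I)).re = z.re - ρ₁ := by simp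
    rw [this]
    have := Real.exp_le_exp.2 (sub_le_sub_right (hball z hz).le ρ₁)
    linarith
  · rw [Set.uIoc]
    exact integrable_const _

theorem tendsto_vert_left {s r θ₁ θ₂ : ℝ} {g : ℂ → ℂ}
    (hb : ∀ R : ℝ, R < r → ∀ y ∈ Set.uIoc θ₁ θ₂, ‖g (R + y * I)‖ ≤ s * Real.exp R) :
    Tendsto (fun R : ℝ => ∫ y in θ₁..θ₂, g (R + y * I)) atBot (𝓝 0) := by
  have h2 : Tendsto (fun R : ℝ => s * Real.exp R * |θ₂ - θ₁|) atBot (𝓝 0) := by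
    simpa using (Real.tendsto_exp_atBot.const_mul s).mul_const |θ₂ - θ₁|
  refine squeeze_zero_norm' ?_ h2
  filter_upwards [eventually_lt_atBot r] with R hR
  exact intervalIntegral.norm_integral_le_of_norm_le_const fun y hy => hb R hR y hy

theorem hor_vert_eq_of_le (hP : DifferentiableOn ℂ P {w | w.re < ρ}) (hP0 : StolzZero P)
    (hρ : ρ₁ < ρ) {θ₁ θ₂ : ℝ} (h12 : θ₁ ≤ θ₂) {σ : ℂ} (h0 : θ₂ < σ.im)
    (h1 : σ.im < θ₁ + 2 * Real.pi) :
    horInt P ρ₁ θ₁ σ = horInt P ρ₁ θ₂ σ - vertInt P ρ₁ θ₁ θ₂ σ := by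
  set g : ℂ → ℂ := fun ζ => P ζ * kern (σ - ζ) with hg
  have hne : ∀ y ∈ Set.Icc θ₁ θ₂, 0 < Real.sin ((σ.im - y) / 2) := fun y hy =>
    sin_half_pos (by linarith [hy.2]) (by linarith [hy.1])
  have hi1 := (hasDerivAt_horInt hP hP0 hρ θ₁ (σ := σ) (by linarith) h1).1
  have hi2 := (hasDerivAt_horInt hP hP0 hρ θ₂ (σ := σ) h0 (by linarith)).1
  have t1 := intervalIntegral_tendsto_integral_Iic ρ₁ hi1 tendsto_id
  have t2 := intervalIntegral_tendsto_integral_Iic ρ₁ hi2 tendsto_id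
  -- minimum of the sine
  obtain ⟨y₀, hy₀, hmin⟩ := isCompact_Icc.exists_isMinOn (Set.nonempty_Icc.2 h12)
    (f := fun y : ℝ => Real.sin ((σ.im - y) / 2)) (by fun_prop)
  have hs := hne y₀ hy₀
  obtain ⟨C, hC0, hC⟩ := hP0.exists_bound hρ hP.continuousOn (max |θ₁| |θ₂|)
  have t3 : Tendsto (fun R : ℝ => ∫ y in θ₁..θ₂, g (R + y * I)) atBot (𝓝 0) := by
    refine tendsto_vert_left (r := ρ₁) (s := C * (2 / Real.sin ((σ.im - y₀) / 2)) *
      Real.exp (-σ.re)) fun R hR y hy => ?_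
    rw [Set.uIoc_of_le h12] at hy
    refine integrand_bound hs (hC _ (by simpa using hR.le) ?_)
      (hmin (Set.Ioc_subset_Icc_self hy)) le_rfl
    simpa using abs_le_max_abs_abs hy.1.le hy.2
  have hrect : ∀ R : ℝ, R ≤ ρ₁ → (∫ x in R..ρ₁, g (x + θ₁ * I)) - (∫ x in R..ρ₁, g (x + θ₂ * I)) +
      I * (∫ y in θ₁..θ₂, g (ρ₁ + y * I)) - I * (∫ y in θ₁..θ₂, g (R + y * I)) = 0 := by
    intro R hR
    have := Complex.integral_boundary_rect_eq_zero_of_differentiableOn g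
      (R + θ₁ * I) (ρ₁ + θ₂ * I) (fun ζ hζ => ?_)
    · simpa using this
    · rw [mem_reProdIm] at hζ
      simp only [add_re, ofReal_re, mul_re, I_re, mul_zero, ofReal_im, I_im, mul_one, sub_self,
        add_zero, add_im, mul_im, zero_add, Set.uIcc_of_le hR, Set.uIcc_of_le h12] at hζ
      refine DifferentiableAt.differentiableWithinAt ?_
      refine (hP.differentiableAt ((isOpen_re_lt ρ).mem_nhds (hζ.1.2.trans_lt hρ))).mul ?_
      have h4 : 1 - exp (σ - ζ) ≠ 0 := one_sub_exp_ne_zero (by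
        rw [sub_im]; exact (hne _ hζ.2).ne')
      exact (hasDerivAt_kern h4).differentiableAt.comp ζ (by fun_prop)
  have t4 := ((t1.sub t2).add (tendsto_const_nhds (x := I * ∫ y in θ₁..θ₂, g (ρ₁ + y * I)))).sub
    (t3.const_mul I)
  have t5 := tendsto_nhds_unique (t4.congr' (by
    filter_upwards [eventually_le_atBot ρ₁] with R hR using hrect R hR)) tendsto_const_nhds
  rw [mul_zero, sub_zero] at t5
  rw [horInt, horInt, vertInt]
  linear_combination t5

theorem vertInt_add (hP : DifferentiableOn ℂ P {w | w.re < ρ}) (hρ : ρ₁ < ρ) (θ₁ θ₂ θ₃ : ℝ)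
    {σ : ℂ} (hσ : σ.re < ρ₁) :
    vertInt P ρ₁ θ₁ θ₂ σ + vertInt P ρ₁ θ₂ θ₃ σ = vertInt P ρ₁ θ₁ θ₃ σ := by
  have hcont : Continuous (fun y : ℝ => P (ρ₁ + y * I) * kern (σ - (ρ₁ + y * I))) := by
    refine (hP.continuousOn.comp_continuous (by fun_prop) fun y => by simpa using hρ).mul
      (Continuous.inv₀ (by fun_prop) fun y => one_sub_exp_ne_zero_of_neg (by simpa using hσ))
  rw [vertInt, vertInt, vertInt, ← mul_add, intervalIntegral.integral_add_adjacent_intervals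
    (hcont.intervalIntegrable _ _) (hcont.intervalIntegrable _ _)]

theorem hor_vert_eq (hP : DifferentiableOn ℂ P {w | w.re < ρ}) (hP0 : StolzZero P)
    (hρ : ρ₁ < ρ) (θ₀ : ℝ) {θ₁ θ₂ : ℝ} {σ : ℂ} (hσ : σ.re < ρ₁) (h1 : θ₁ < σ.im)
    (h1' : σ.im < θ₁ + 2 * Real.pi) (h2 : θ₂ < σ.im) (h2' : σ.im < θ₂ + 2 * Real.pi) :
    horInt P ρ₁ θ₁ σ + vertInt P ρ₁ θ₁ θ₀ σ = horInt P ρ₁ θ₂ σ + vertInt P ρ₁ θ₂ θ₀ σ := by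
  rcases le_total θ₁ θ₂ with h | h
  · rw [hor_vert_eq_of_le hP hP0 hρ h h2 h1', ← vertInt_add hP hρ θ₁ θ₂ θ₀ hσ]
    ring
  · rw [hor_vert_eq_of_le hP hP0 hρ h h1 h2', ← vertInt_add hP hρ θ₂ θ₁ θ₀ hσ]
    ring

/-- The residue of the periodic Cauchy kernel. -/
theorem hor_vert_residue (hP : DifferentiableOn ℂ P {w | w.re < ρ}) (hP0 : StolzZero P)
    (hρ : ρ₁ < ρ) {θ : ℝ} {σ : ℂ} (hσ : σ.re < ρ₁) (h0 : θ < σ.im)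
    (h1 : σ.im < θ + 2 * Real.pi) :
    horInt P ρ₁ θ σ - horInt P ρ₁ (θ + 2 * Real.pi) (σ + 2 * Real.pi * I) +
      vertInt P ρ₁ θ (θ + 2 * Real.pi) σ = 2 * Real.pi * I * P σ := by
  have hpi := Real.pi_pos
  set θ' := θ + 2 * Real.pi with hθ'
  have him' : (σ + 2 * Real.pi * I).im = σ.im + 2 * Real.pi := by simp
  have hU := isOpen_re_lt ρ
  set q : ℂ → ℂ := fun ζ => 1 - exp (σ - ζ) with hq
  have hqd : Differentiable ℂ q := by fun_prop
  have hq' : deriv q σ = 1 := by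
    have h3 : HasDerivAt (fun ζ : ℂ => σ - ζ) (-1) σ := by simpa using (hasDerivAt_id σ).const_sub σ
    have h2 : HasDerivAt q (-(exp (σ - σ) * -1)) σ := (h3.cexp).const_sub 1
    rw [h2.deriv]; simp
  set g : ℂ → ℂ := fun ζ => dslope P σ ζ / dslope q σ ζ with hg
  have hgeq : ∀ ζ : ℂ, ζ ≠ σ → g ζ = (P ζ - P σ) * kern (σ - ζ) := by
    intro ζ hζ
    have hζ' : ζ - σ ≠ 0 := sub_ne_zero.2 hζ
    simp only [hg, dslope_of_ne _ hζ, slope, vsub_eq_sub, smul_eq_mul, hq, kern]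
    simp only [sub_self, exp_zero, sub_zero]
    rw [div_eq_mul_inv, mul_inv, inv_inv]
    field_simp
  have hi1 := (hasDerivAt_horInt hP hP0 hρ θ (σ := σ) h0 h1).1
  have hi2 := (hasDerivAt_horInt hP hP0 hρ θ' (σ := σ + 2 * Real.pi * I)
    (by rw [him', hθ']; linarith) (by rw [him', hθ']; linarith)).1
  have t1 := intervalIntegral_tendsto_integral_Iic ρ₁ hi1 tendsto_id
  have t2 := intervalIntegral_tendsto_integral_Iic ρ₁ hi2 tendsto_id
  obtain ⟨C, hC0, hC⟩ := hP0.exists_bound hρ hP.continuousOn (max |θ| |θ'|)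
  have hle : θ ≤ θ' := by rw [hθ']; linarith
  have t3 : Tendsto (fun R : ℝ => ∫ y in θ..θ', g (R + y * I)) atBot (𝓝 0) := by
    refine tendsto_vert_left (r := min ρ₁ (σ.re - 1)) (s := (C + ‖P σ‖) * 2 * Real.exp (-σ.re))
      fun R hR y hy => ?_
    have hR1 := hR.trans_le (min_le_left _ _)
    have hR2 := hR.trans_le (min_le_right _ _)
    rw [Set.uIoc_of_le hle] at hy
    rw [hgeq _ (fun h => by have := congrArg Complex.re h; simp at this; linarith), norm_mul]
    have h4 : ‖P (R + y * I) - P σ‖ ≤ C + ‖P σ‖ := by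
      refine (norm_sub_le _ _).trans (add_le_add_left (hC _ (by simpa using hR1.le) ?_) _)
      simpa using abs_le_max_abs_abs hy.1.le hy.2
    have h5 : ‖kern (σ - (R + y * I))‖ ≤ 2 * (Real.exp (-σ.re) * Real.exp R) := by
      have hre : (σ - (R + y * I)).re = σ.re - R := by simp
      have h6 : Real.exp (σ.re - R) / 2 ≤ ‖1 - exp (σ - (R + y * I))‖ := by
        have := norm_sub_norm_le (exp (σ - (R + y * I))) 1
        rw [norm_one, Complex.norm_exp, hre, norm_sub_rev] at this
        have h7 : 2 ≤ Real.exp (σ.re - R) := by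
          have := Real.add_one_le_exp (σ.re - R)
          linarith
        linarith
      rw [kern, norm_inv]
      calc _ ≤ (Real.exp (σ.re - R) / 2)⁻¹ := inv_anti₀ (by positivity) h6
        _ = _ := by rw [← Real.exp_add, inv_div, div_eq_mul_inv, ← Real.exp_neg]; ring_nf
    calc _ ≤ (C + ‖P σ‖) * (2 * (Real.exp (-σ.re) * Real.exp R)) := by gcongr
      _ = _ := by ring
  have hne : ∀ ζ : ℂ, ζ.im = θ ∨ ζ.im = θ' ∨ ζ.re = ρ₁ → ζ ≠ σ := by
    rintro ζ h rfl
    rcases h with h | h | h <;> linarith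
  have hcontP1 : ∀ R : ℝ, IntervalIntegrable (fun x : ℝ => kern (σ - (x + θ * I))) volume R ρ₁ := by
    intro R
    refine ContinuousOn.intervalIntegrable (ContinuousOn.inv₀ (by fun_prop) fun x _ =>
      one_sub_exp_ne_zero ?_)
    have := (sin_half_pos (x := σ.im - θ) (by linarith) (by linarith)).ne'
    simpa using this
  have hkshift : ∀ x : ℝ, kern (σ + 2 * Real.pi * I - (x + θ' * I)) = kern (σ - (x + θ * I)) := by
    intro x
    congr 1
    rw [hθ']; push_cast; ring
  have hkshift' : ∀ x : ℝ, kern (σ - (x + θ' * I)) = kern (σ - (x + θ * I)) := by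
    intro x
    rw [← hkshift, ← kern_periodic (σ - (x + θ' * I))]
    congr 1; ring
  have hPline : ∀ (R : ℝ) (_ : R ≤ ρ₁) (t : ℝ), IntervalIntegrable
      (fun x : ℝ => P (x + t * I) * kern (σ - (x + θ * I))) volume R ρ₁ := by
    intro R hR t
    refine (hcontP1 R).continuousOn_mul (hP.continuousOn.comp (by fun_prop) fun x hx => ?_)
    rw [Set.uIcc_of_le hR] at hx
    simpa using hx.2.trans_lt hρ
  have e1 : ∀ R : ℝ, R ≤ ρ₁ → ∫ x in R..ρ₁, g (x + θ * I) =
      (∫ x in R..ρ₁, P (x + θ * I) * kern (σ - (x + θ * I))) -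
        P σ * ∫ x in R..ρ₁, kern (σ - (x + θ * I)) := by
    intro R hR
    rw [← intervalIntegral.integral_const_mul, ← intervalIntegral.integral_sub (hPline R hR θ)
      ((hcontP1 R).const_mul _)]
    refine intervalIntegral.integral_congr fun x _ => ?_
    rw [hgeq _ (hne _ (Or.inl (by simp)))]
    ring
  have e2 : ∀ R : ℝ, R ≤ ρ₁ → ∫ x in R..ρ₁, g (x + θ' * I) =
      (∫ x in R..ρ₁, P (x + θ' * I) * kern (σ + 2 * Real.pi * I - (x + θ' * I))) -
        P σ * ∫ x in R..ρ₁, kern (σ - (x + θ * I)) := by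
    intro R hR
    simp only [hkshift]
    rw [← intervalIntegral.integral_const_mul, ← intervalIntegral.integral_sub (hPline R hR θ')
      ((hcontP1 R).const_mul _)]
    refine intervalIntegral.integral_congr fun x _ => ?_
    rw [hgeq _ (hne _ (Or.inr (Or.inl (by simp)))), hkshift']
    ring
  have hker : ∀ y : ℝ, kern (σ - (ρ₁ + y * I)) = kern ((σ - ρ₁) - y * I) := fun y => by
    congr 1; ring
  have hkc : Continuous (fun y : ℝ => kern (σ - (ρ₁ + y * I))) :=
    Continuous.inv₀ (by fun_prop) fun y => one_sub_exp_ne_zero_of_neg (by simpa using hσ)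
  have e3 : ∫ y in θ..θ', g (ρ₁ + y * I) =
      (∫ y in θ..θ', P (ρ₁ + y * I) * kern (σ - (ρ₁ + y * I))) - P σ * (2 * Real.pi) := by
    have h4 := integral_kern (a := σ - ρ₁) (by simpa using hσ) θ
    rw [← hθ'] at h4
    simp only [← hker] at h4
    have hPc : Continuous (fun y : ℝ => P (ρ₁ + y * I)) :=
      hP.continuousOn.comp_continuous (by fun_prop) fun y => by simpa using hρ
    have j1 : IntervalIntegrable (fun y : ℝ => P (ρ₁ + y * I) * kern (σ - (ρ₁ + y * I)))
      volume θ θ' := (hPc.mul hkc).intervalIntegrable _ _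
    have j2 : IntervalIntegrable (fun y : ℝ => P σ * kern (σ - (ρ₁ + y * I)))
      volume θ θ' := (continuous_const.mul hkc).intervalIntegrable _ _
    rw [← h4, ← intervalIntegral.integral_const_mul, ← intervalIntegral.integral_sub j1 j2]
    refine intervalIntegral.integral_congr fun y _ => ?_
    rw [hgeq _ (hne _ (Or.inr (Or.inr (by simp))))]
    ring
  have hrect : ∀ R : ℝ, R ≤ ρ₁ → (∫ x in R..ρ₁, g (x + θ * I)) - (∫ x in R..ρ₁, g (x + θ' * I)) +
      I * (∫ y in θ..θ', g (ρ₁ + y * I)) - I * (∫ y in θ..θ', g (R + y * I)) = 0 := by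
    intro R hR
    have := Complex.integral_boundary_rect_eq_zero_of_differentiableOn g
      (R + θ * I) (ρ₁ + θ' * I) (fun ζ hζ => ?_)
    · simpa using this
    · rw [mem_reProdIm] at hζ
      simp only [add_re, ofReal_re, mul_re, I_re, mul_zero, ofReal_im, I_im, mul_one, sub_self,
        add_zero, add_im, mul_im, zero_add, Set.uIcc_of_le hR, Set.uIcc_of_le hle] at hζ
      refine DifferentiableAt.differentiableWithinAt ?_
      have hUσ : {w : ℂ | w.re < ρ} ∈ 𝓝 σ := hU.mem_nhds (hσ.trans hρ)
      refine DifferentiableAt.div ?_ ?_ ?_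
      · exact ((differentiableOn_dslope hUσ).2 hP).differentiableAt
          (hU.mem_nhds (hζ.1.2.trans_lt hρ))
      · exact ((differentiableOn_dslope (univ_mem : Set.univ ∈ 𝓝 σ)).2
          hqd.differentiableOn).differentiableAt univ_mem
      · rcases eq_or_ne ζ σ with rfl | h
        · rw [dslope_same, hq']
          exact one_ne_zero
        · rw [dslope_of_ne _ h, slope]
          simp only [vsub_eq_sub, smul_eq_mul, hq, sub_self, exp_zero, sub_zero]
          refine mul_ne_zero (inv_ne_zero (sub_ne_zero.2 h)) fun h4 => h ?_
          have h5 : exp ζ = exp σ := by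
            have := (sub_eq_zero.1 h4).symm
            rw [exp_sub, div_eq_one_iff_eq (exp_ne_zero _)] at this
            exact this.symm
          obtain ⟨n, hn⟩ := exp_eq_exp_iff_exists_int.1 h5
          have h6 := congrArg Complex.im hn
          simp only [add_im, mul_im, intCast_re, intCast_im, re_ofNat, ofReal_re, im_ofNat,
            ofReal_im, I_re, I_im, mul_zero, mul_one, add_zero, sub_zero,
            mul_re, zero_mul] at h6
          have h7 : (n : ℝ) < 1 := by
            by_contra hcon
            push Not at hcon
            nlinarith [hζ.2.2]
          have h8 : (-1 : ℝ) < n := by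
            by_contra hcon
            push Not at hcon
            nlinarith [hζ.2.1]
          have h9 : n = 0 := by
            have a1 : n < 1 := by exact_mod_cast h7
            have a2 : -1 < n := by exact_mod_cast h8
            omega
          rw [hn, h9]; simp
  have t4 := ((t1.sub t2).add (tendsto_const_nhds (x := I * ∫ y in θ..θ', g (ρ₁ + y * I)))).sub
    (t3.const_mul I)
  have t5 := tendsto_nhds_unique (t4.congr' (by
    filter_upwards [eventually_le_atBot ρ₁] with R hR
    have h5 := hrect R hR
    rw [e1 R hR, e2 R hR] at h5
    simp only [id]
    linear_combination h5)) (tendsto_const_nhds (x := (0 : ℂ)))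
  rw [mul_zero, sub_zero, e3] at t5
  rw [horInt, horInt, vertInt]
  linear_combination t5

end cousin

theorem integrable_exp_neg_abs : Integrable (fun t : ℝ => Real.exp (-|t|)) := by
  rw [← integrableOn_univ, ← Set.Iic_union_Ioi (a := (0 : ℝ))]
  refine IntegrableOn.union ?_ ?_
  · refine (integrableOn_exp_Iic 0).congr_fun (fun t ht => ?_) measurableSet_Iic
    rw [abs_of_nonpos ht, neg_neg]
  · refine (exp_neg_integrableOn_Ioi 0 one_pos).congr_fun (fun t ht => ?_) measurableSet_Ioi
    simp only
    rw [abs_of_pos ht, neg_one_mul]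

theorem exp_div_one_add_exp_sq_le (t : ℝ) :
    Real.exp t / (1 + Real.exp t) ^ 2 ≤ Real.exp (-|t|) := by
  have h := Real.exp_pos t
  rw [div_le_iff₀ (by positivity)]
  rcases le_total t 0 with h1 | h1
  · rw [abs_of_nonpos h1, neg_neg]
    have h2 : (1 : ℝ) ≤ (1 + Real.exp t) ^ 2 := by nlinarith
    nlinarith
  · rw [abs_of_nonneg h1, Real.exp_neg]
    have h2 : Real.exp t ^ 2 ≤ (1 + Real.exp t) ^ 2 := by nlinarith
    calc Real.exp t = (Real.exp t)⁻¹ * Real.exp t ^ 2 := by field_simp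
      _ ≤ _ := by gcongr

/-- A holomorphic function whose variation along one turn is `P`, normalised so that it is a Cauchy
integral of `P` along the half-line at height `θ₀`, above that half-line. -/
noncomputable def cousin (P : ℂ → ℂ) (ρ₁ θ₀ : ℝ) (σ : ℂ) : ℂ :=
  -(1 / (2 * Real.pi * I)) *
    (horInt P ρ₁ (σ.im - Real.pi) σ + vertInt P ρ₁ (σ.im - Real.pi) θ₀ σ)

section cousin
variable {P : ℂ → ℂ} {ρ ρ₁ : ℝ}

theorem cousin_eq (hP : DifferentiableOn ℂ P {w | w.re < ρ}) (hP0 : StolzZero P) (hρ : ρ₁ < ρ)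
    (θ₀ : ℝ) {θ : ℝ} {σ : ℂ} (hσ : σ.re < ρ₁) (h1 : θ < σ.im) (h1' : σ.im < θ + 2 * Real.pi) :
    cousin P ρ₁ θ₀ σ = -(1 / (2 * Real.pi * I)) * (horInt P ρ₁ θ σ + vertInt P ρ₁ θ θ₀ σ) := by
  have := Real.pi_pos
  rw [cousin, hor_vert_eq hP hP0 hρ θ₀ hσ (by linarith) (by linarith) h1 h1']

theorem cousin_eq_horInt (hP : DifferentiableOn ℂ P {w | w.re < ρ}) (hP0 : StolzZero P)
    (hρ : ρ₁ < ρ) {θ₀ : ℝ} {σ : ℂ} (hσ : σ.re < ρ₁) (h1 : θ₀ < σ.im)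
    (h1' : σ.im < θ₀ + 2 * Real.pi) :
    cousin P ρ₁ θ₀ σ = -(1 / (2 * Real.pi * I)) * horInt P ρ₁ θ₀ σ := by
  rw [cousin_eq hP hP0 hρ θ₀ hσ h1 h1', vertInt, intervalIntegral.integral_same, mul_zero, add_zero]

theorem hasDerivAt_cousin (hP : DifferentiableOn ℂ P {w | w.re < ρ}) (hP0 : StolzZero P)
    (hρ : ρ₁ < ρ) (θ₀ : ℝ) {σ : ℂ} (hσ : σ.re < ρ₁) :
    HasDerivAt (cousin P ρ₁ θ₀) (-(1 / (2 * Real.pi * I)) *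
      ((∫ x in Set.Iic ρ₁, P (x + (σ.im - Real.pi : ℝ) * I) *
        (exp (σ - (x + (σ.im - Real.pi : ℝ) * I)) /
          (1 - exp (σ - (x + (σ.im - Real.pi : ℝ) * I))) ^ 2)) +
      I * ∫ y in (σ.im - Real.pi)..θ₀, P (ρ₁ + y * I) *
      (exp (σ - (ρ₁ + y * I)) / (1 - exp (σ - (ρ₁ + y * I))) ^ 2))) σ := by
  have hpi := Real.pi_pos
  have h1 := (hasDerivAt_horInt hP hP0 hρ (σ.im - Real.pi) (σ := σ) (by linarith) (by linarith)).2
  have h2 := hasDerivAt_vertInt hP hρ (σ.im - Real.pi) θ₀ hσ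
  refine ((h1.add h2).const_mul _).congr_of_eventuallyEq ?_
  have e1 : ∀ᶠ y in 𝓝 σ, σ.im - Real.pi < y.im :=
    ContinuousAt.eventually_lt (by fun_prop) (by fun_prop) (by linarith)
  have e2 : ∀ᶠ y in 𝓝 σ, y.im < σ.im - Real.pi + 2 * Real.pi :=
    ContinuousAt.eventually_lt (by fun_prop) (by fun_prop) (by linarith)
  filter_upwards [e1, e2, (isOpen_re_lt ρ₁).mem_nhds hσ] with y h3 h4 h5
  exact cousin_eq hP hP0 hρ θ₀ h5 h3 h4

theorem differentiableOn_cousin (hP : DifferentiableOn ℂ P {w | w.re < ρ}) (hP0 : StolzZero P)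
    (hρ : ρ₁ < ρ) (θ₀ : ℝ) : DifferentiableOn ℂ (cousin P ρ₁ θ₀) {w | w.re < ρ₁} := fun _ hσ =>
  (hasDerivAt_cousin hP hP0 hρ θ₀ hσ).differentiableAt.differentiableWithinAt

theorem cousin_turn_sub (hP : DifferentiableOn ℂ P {w | w.re < ρ}) (hP0 : StolzZero P)
    (hρ : ρ₁ < ρ) (θ₀ : ℝ) {σ : ℂ} (hσ : σ.re < ρ₁) :
    cousin P ρ₁ θ₀ (σ + 2 * Real.pi * I) - cousin P ρ₁ θ₀ σ = P σ := by
  have hpi := Real.pi_pos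
  set θ := σ.im - Real.pi with hθ
  have hre : (σ + 2 * Real.pi * I).re = σ.re := by simp
  have him : (σ + 2 * Real.pi * I).im = σ.im + 2 * Real.pi := by simp
  rw [cousin_eq hP hP0 hρ θ₀ (θ := θ + 2 * Real.pi) (by rw [hre]; exact hσ)
    (by rw [him]; linarith) (by rw [him]; linarith),
    cousin_eq hP hP0 hρ θ₀ (θ := θ) hσ (by linarith) (by linarith)]
  have h1 := hor_vert_residue hP hP0 hρ (θ := θ) hσ (by linarith) (by linarith)
  have h2 := vertInt_add hP hρ θ (θ + 2 * Real.pi) θ₀ hσ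
  have h3 : vertInt P ρ₁ (θ + 2 * Real.pi) θ₀ (σ + 2 * Real.pi * I) =
      vertInt P ρ₁ (θ + 2 * Real.pi) θ₀ σ := by
    rw [vertInt, vertInt]
    congr 1
    refine intervalIntegral.integral_congr fun y _ => ?_
    rw [show σ + 2 * Real.pi * I - (ρ₁ + y * I) = σ - (ρ₁ + y * I) + 2 * Real.pi * I by ring,
      kern_periodic]
  rw [h3]
  have hne : (2 * Real.pi * I : ℂ) ≠ 0 := by simp [Real.pi_ne_zero]
  have h4 : P σ = (1 / (2 * Real.pi * I)) * (2 * Real.pi * I * P σ) := by field_simp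
  rw [h4, ← h1, ← h2]
  ring

theorem stolzZero_hor (hP : DifferentiableOn ℂ P {w | w.re < ρ}) (hP0 : StolzZero P)
    (hρ : ρ₁ < ρ) : StolzZero (fun σ => ∫ x in Set.Iic ρ₁, P (x + (σ.im - Real.pi : ℝ) * I) *
        (exp (σ - (x + (σ.im - Real.pi : ℝ) * I)) /
          (1 - exp (σ - (x + (σ.im - Real.pi : ℝ) * I))) ^ 2)) := by
  intro M
  obtain ⟨C, hC0, hC⟩ := hP0.exists_bound hρ hP.continuousOn (M + Real.pi)
  set K : ℝ → ℂ := fun t => exp (-t + Real.pi * I) / (1 - exp (-t + Real.pi * I)) ^ 2 with hK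
  have hKval : ∀ t, K t = ((-(Real.exp (-t) / (1 + Real.exp (-t)) ^ 2) : ℝ) : ℂ) := by
    intro t
    simp only [hK]
    rw [exp_add, exp_pi_mul_I]
    push_cast
    ring
  have hKn : ∀ t, ‖K t‖ ≤ Real.exp (-|t|) := by
    intro t
    rw [hKval, norm_real, norm_neg, Real.norm_of_nonneg (by positivity)]
    simpa using exp_div_one_add_exp_sq_le (-t)
  set F : ℂ → ℝ → ℂ := fun σ t => (Set.Iic (ρ₁ - σ.re)).indicator
    (fun t : ℝ => P (σ + (t - Real.pi * I)) * K t) t with hF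
  have hKc : Continuous K := by
    have : K = fun t => ((-(Real.exp (-t) / (1 + Real.exp (-t)) ^ 2) : ℝ) : ℂ) := funext hKval
    rw [this]
    refine continuous_ofReal.comp (Continuous.neg (Continuous.div (by fun_prop) (by fun_prop) ?_))
    intro t
    positivity
  have heq : ∀ σ : ℂ, ∫ x in Set.Iic ρ₁, P (x + (σ.im - Real.pi : ℝ) * I) *
        (exp (σ - (x + (σ.im - Real.pi : ℝ) * I)) /
          (1 - exp (σ - (x + (σ.im - Real.pi : ℝ) * I))) ^ 2) = ∫ t, F σ t := by
    intro σ
    rw [← integral_indicator measurableSet_Iic, ← integral_add_right_eq_self _ σ.re]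
    refine integral_congr_ae (Eventually.of_forall fun t => ?_)
    simp only [hF, Set.indicator_apply, Set.mem_Iic, le_sub_iff_add_le]
    have e1 : (((t + σ.re : ℝ) : ℂ) + (σ.im - Real.pi : ℝ) * I) = σ + (t - Real.pi * I) := by
      apply Complex.ext <;> simp <;> ring
    have e2 : σ - (σ + (t - Real.pi * I)) = -t + Real.pi * I := by ring
    simp only [e1, e2, hK]
  simp only [heq]
  have hcg : (logFilter ⊓ 𝓟 {w : ℂ | |w.im| ≤ M}).IsCountablyGenerated := by
    have : logFilter.IsCountablyGenerated := by unfold logFilter; infer_instance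
    infer_instance
  have key := tendsto_integral_filter_of_dominated_convergence
    (l := logFilter ⊓ 𝓟 {w : ℂ | |w.im| ≤ M}) (F := F) (f := fun _ => 0) (μ := volume)
    (fun t => C * Real.exp (-|t|)) ?_ ?_ (integrable_exp_neg_abs.const_mul C) ?_
  · simpa using key
  · refine Eventually.of_forall fun σ => ?_
    refine (aestronglyMeasurable_indicator_iff measurableSet_Iic).2 ?_
    refine ContinuousOn.aestronglyMeasurable ?_ measurableSet_Iic
    refine (hP.continuousOn.comp (by fun_prop) fun t ht => ?_).mul hKc.continuousOn
    have : (σ + (t - Real.pi * I)).re = σ.re + t := by simp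
    simp only [Set.mem_ofPred_eq, this]
    have := Set.mem_Iic.1 ht
    linarith
  · refine eventually_inf_principal.2 (Eventually.of_forall fun σ hσ => Eventually.of_forall
      fun t => ?_)
    simp only [hF, Set.indicator_apply]
    split_ifs with h
    · rw [norm_mul]
      refine mul_le_mul (hC _ ?_ ?_) (hKn t) (norm_nonneg _) hC0
      · simp
        have := Set.mem_Iic.1 h
        linarith
      · simp only [Set.mem_ofPred_eq] at hσ
        have : (σ + (t - Real.pi * I)).im = σ.im + -Real.pi := by simp
        rw [this]
        refine (abs_add_le _ _).trans ?_
        rw [abs_neg, abs_of_pos Real.pi_pos]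
        linarith
    · simp only [norm_zero]
      positivity
  · refine Eventually.of_forall fun t => ?_
    have h1 := (hP0.comp (g := fun σ => σ + (t - Real.pi * I)) (C := ‖(t - Real.pi * I : ℂ)‖)
      (Eventually.of_forall fun w => by simp)) M
    have h2 := (h1.mul_const (K t))
    rw [zero_mul] at h2
    refine squeeze_zero_norm (fun σ => ?_) (tendsto_zero_iff_norm_tendsto_zero.1 h2)
    simp only [hF]
    exact norm_indicator_le_norm_self _ _

theorem stolzZero_vert (hP : DifferentiableOn ℂ P {w | w.re < ρ})
    (hρ : ρ₁ < ρ) (θ₀ : ℝ) : StolzZero (fun σ => ∫ y in (σ.im - Real.pi)..θ₀, P (ρ₁ + y * I) *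
      (exp (σ - (ρ₁ + y * I)) / (1 - exp (σ - (ρ₁ + y * I))) ^ 2)) := by
  intro M
  have hcP : Continuous (fun y : ℝ => P (ρ₁ + y * I)) := by
    refine hP.continuousOn.comp_continuous (by fun_prop) fun y => ?_
    simpa using hρ
  set A := M + Real.pi + |θ₀| with hA
  obtain ⟨C, hC⟩ := (isCompact_Icc (a := -A) (b := A)).exists_bound_of_continuousOn
    hcP.continuousOn
  have h0 : Tendsto (fun σ : ℂ => max C 0 * (4 * (‖exp σ‖ * Real.exp (-ρ₁))) * (A + A)) 
      (logFilter ⊓ 𝓟 {w : ℂ | |w.im| ≤ M}) (𝓝 0) := by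
    have := (tendsto_zero_iff_norm_tendsto_zero.1 tendsto_exp_logFilter).mono_left
      (inf_le_left : logFilter ⊓ 𝓟 {w : ℂ | |w.im| ≤ M} ≤ logFilter)
    simpa using ((((this.mul_const (Real.exp (-ρ₁))).const_mul 4).const_mul (max C 0)).mul_const
      (A + A))
  refine squeeze_zero_norm' ?_ h0
  refine eventually_inf_principal.2 ?_
  filter_upwards [eventually_re_lt (ρ₁ - 1)] with σ hσ hM
  have hpi := Real.pi_pos
  have habs := abs_le.1 hM
  have hth := neg_abs_le θ₀
  have hth' := le_abs_self θ₀
  have hθ₀ := abs_nonneg θ₀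
  have hsub : Set.uIoc (σ.im - Real.pi) θ₀ ⊆ Set.Icc (-A) A := by
    refine Set.uIoc_subset_uIcc.trans (Set.uIcc_subset_Icc ⟨?_, ?_⟩ ⟨?_, ?_⟩) <;> rw [hA] <;> linarith
  have hlen : |θ₀ - (σ.im - Real.pi)| ≤ A + A := by
    rw [abs_le]
    constructor <;> rw [hA] <;> linarith
  refine (intervalIntegral.norm_integral_le_of_norm_le_const (C := max C 0 *
    (4 * (‖exp σ‖ * Real.exp (-ρ₁)))) fun y hy => ?_).trans (by gcongr)
  rw [norm_mul]
  refine mul_le_mul ((hC y (hsub hy)).trans (le_max_left _ _)) ?_ (norm_nonneg _) (le_max_right _ _)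
  have hre : (σ - (ρ₁ + y * I)).re = σ.re - ρ₁ := by simp
  have e1 : ‖exp (σ - (ρ₁ + y * I))‖ = ‖exp σ‖ * Real.exp (-ρ₁) := by
    rw [norm_exp, norm_exp, ← Real.exp_add, hre]
    ring_nf
  have e2 : 1 / 2 ≤ ‖1 - exp (σ - (ρ₁ + y * I))‖ := by
    have h5 := norm_one_sub_exp_ge_of_neg (u := σ - (ρ₁ + y * I))
    have h4 : Real.exp (σ - (ρ₁ + y * I)).re ≤ 1 / 2 := by
      rw [hre]
      calc Real.exp (σ.re - ρ₁) ≤ Real.exp (-1) := Real.exp_le_exp.2 (by linarith)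
        _ ≤ 1 / 2 := by
          rw [Real.exp_neg, one_div]
          apply inv_anti₀ (by norm_num)
          linarith [Real.add_one_le_exp (1 : ℝ)]
    linarith
  rw [norm_div, norm_pow, e1, div_le_iff₀ (by positivity)]
  have h6 : (1 : ℝ) ≤ 4 * ‖1 - exp (σ - (ρ₁ + y * I))‖ ^ 2 := by nlinarith
  have h7 : 0 ≤ ‖exp σ‖ * Real.exp (-ρ₁) := by positivity
  nlinarith

theorem stolzZero_deriv_cousin (hP : DifferentiableOn ℂ P {w | w.re < ρ}) (hP0 : StolzZero P)
    (hρ : ρ₁ < ρ) (θ₀ : ℝ) : StolzZero (deriv (cousin P ρ₁ θ₀)) := by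
  refine (((stolzZero_hor hP hP0 hρ).add ((stolzZero_vert hP hρ θ₀).const_mul I)).const_mul
    (-(1 / (2 * Real.pi * I)))).congr ?_
  filter_upwards [eventually_re_lt ρ₁] with σ hσ
  exact (hasDerivAt_cousin hP hP0 hρ θ₀ hσ).deriv.symm

end cousin

theorem logDer_turn_sub {χ P : ℂ → ℂ} {ρ : ℝ} (hχ : DifferentiableOn ℂ χ {w | w.re < ρ})
    (h : ∀ σ : ℂ, σ.re < ρ → χ (σ + 2 * Real.pi * I) - χ σ = P σ) {σ : ℂ} (hσ : σ.re < ρ) :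
    logDer χ (σ + 2 * Real.pi * I) - logDer χ σ = logDer P σ := by
  have hU := isOpen_re_lt ρ
  have hre : (σ + 2 * Real.pi * I).re = σ.re := by simp
  have h1 := (hχ.differentiableAt (hU.mem_nhds hσ)).hasDerivAt
  have h2 := (hχ.differentiableAt (x := σ + 2 * Real.pi * I)
    (hU.mem_nhds (by rw [Set.mem_ofPred_eq, hre]; exact hσ))).hasDerivAt.comp_add_const σ _
  have h3 : HasDerivAt P (deriv χ (σ + 2 * Real.pi * I) - deriv χ σ) σ := by
    refine (h2.sub h1).congr_of_eventuallyEq ?_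
    filter_upwards [hU.mem_nhds hσ] with y hy using (h y hy).symm
  rw [logDer, logDer, logDer, h3.deriv]
  have : exp (-(σ + 2 * Real.pi * I)) = exp (-σ) := by
    rw [neg_add, ← sub_eq_add_neg]
    exact Complex.exp_periodic.sub_eq _
  rw [this]
  ring

theorem Tame.chart_logDer_mem {P : ℂ → ℂ} (hP : Tame P) :
    chart (logDer P) ∈ monodromySpace := by
  obtain ⟨ρ, hρ⟩ := eventually_analyticAt_iff.1 hP.analytic
  have hlt : ρ - 1 < ρ := by linarith
  have hd := differentiableOn_cousin hρ hP.stolz hlt 0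
  have ha := eventually_analyticAt_iff.2 ⟨_, hd⟩
  refine ⟨chart (logDer (cousin P (ρ - 1) 0)), chart_mem_integrableGerms
    (eventually_analyticAt_logDer ha)
    (stolzZero_exp_mul_logDer (stolzZero_deriv_cousin hρ hP.stolz hlt 0)), ?_⟩
  rw [Del_chart, chart_eq_iff]
  filter_upwards [eventually_re_lt (ρ - 1)] with σ hσ
  exact logDer_turn_sub hd (fun σ hσ => cousin_turn_sub hρ hP.stolz hlt 0 hσ) hσ

/-! ### The convolution on the monodromy space -/

theorem logDer_congr {P Q : ℂ → ℂ} (h : ∀ᶠ w in logFilter, P w = Q w) :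
    ∀ᶠ w in logFilter, logDer P w = logDer Q w := by
  obtain ⟨ρ, hρ⟩ := eventually_logFilter.1 h
  filter_upwards [eventually_re_lt ρ] with w hw
  have : P =ᶠ[𝓝 w] Q := by
    filter_upwards [(isOpen_re_lt ρ).mem_nhds hw] with y hy using hρ y hy
  rw [logDer, logDer, this.deriv_eq]

theorem logDer_add {P Q : ℂ → ℂ} (hP : ∀ᶠ w in logFilter, AnalyticAt ℂ P w)
    (hQ : ∀ᶠ w in logFilter, AnalyticAt ℂ Q w) :
    ∀ᶠ w in logFilter, logDer (fun w => P w + Q w) w = logDer P w + logDer Q w := by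
  filter_upwards [hP, hQ] with w h1 h2
  rw [logDer, deriv_fun_add h1.differentiableAt h2.differentiableAt, mul_add, logDer, logDer]

theorem tame_logDer_nconv {P Q : ℂ → ℂ} (hP : Tame P) (hQ : Tame Q) :
    Tame (logDer (nconv P Q)) := by
  have : logDer (nconv P Q) = fun σ => -(1 / (2 * Real.pi * I)) * logDer (conv P Q) σ :=
    logDer_const_mul _ _
  rw [this]
  exact (tame_logDer_conv hP hQ).const_mul _

theorem eventually_analyticAt_nconv {P Q : ℂ → ℂ} (hP : Tame P) (hQ : Tame Q) :
    ∀ᶠ w in logFilter, AnalyticAt ℂ (nconv P Q) w := by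
  obtain ⟨ρ, h1, h2⟩ := hP.exists_common hQ
  exact eventually_analyticAt_iff.2 ⟨ρ, (differentiableOn_conv h1 hP.stolz h2 hQ.stolz).const_mul _⟩

theorem intConv_chart {P Q : ℂ → ℂ} (hP : Tame P) (hQ : Tame Q) :
    intConv (chart (logDer P)) (chart (logDer Q)) = chart (logDer (logDer (nconv P Q))) :=
  (hasConv_chart hP hQ).intConv_eq

theorem hasConv_intConv {f g : LogGerm} (hf : f ∈ monodromySpace) (hg : g ∈ monodromySpace) :
    HasConv f g (intConv f g) ∧ intConv f g ∈ monodromySpace := by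
  obtain ⟨P, hP, rfl⟩ := exists_tame_of_mem_monodromySpace hf
  obtain ⟨Q, hQ, rfl⟩ := exists_tame_of_mem_monodromySpace hg
  rw [intConv_chart hP hQ]
  exact ⟨hasConv_chart hP hQ, (tame_logDer_nconv hP hQ).chart_logDer_mem⟩

theorem conv_comm (P Q : ℂ → ℂ) (σ : ℂ) : conv P Q σ = conv Q P σ := by
  have h := intervalIntegral.integral_comp_sub_left (a := 0) (b := 1)
    (fun r : ℝ => P (σ + Real.log r) * Q (σ + Real.log (1 - r))) (1 : ℝ)
  simp only [sub_self, sub_zero, sub_sub_cancel] at h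
  rw [conv, conv, ← h]
  congr 1
  refine intervalIntegral.integral_congr fun r _ => ?_
  exact mul_comm _ _

theorem intConv_comm {f g : LogGerm} (hf : f ∈ monodromySpace) (hg : g ∈ monodromySpace) :
    intConv f g = intConv g f := by
  obtain ⟨P, hP, rfl⟩ := exists_tame_of_mem_monodromySpace hf
  obtain ⟨Q, hQ, rfl⟩ := exists_tame_of_mem_monodromySpace hg
  rw [intConv_chart hP hQ, intConv_chart hQ hP]
  have : nconv P Q = nconv Q P := funext fun σ => by rw [nconv, nconv, conv_comm]
  rw [this]

theorem intConv_add_left {f f' g : LogGerm} (hf : f ∈ monodromySpace) (hf' : f' ∈ monodromySpace)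
    (hg : g ∈ monodromySpace) : intConv (f + f') g = intConv f g + intConv f' g := by
  obtain ⟨P, hP, rfl⟩ := exists_tame_of_mem_monodromySpace hf
  obtain ⟨P', hP', rfl⟩ := exists_tame_of_mem_monodromySpace hf'
  obtain ⟨Q, hQ, rfl⟩ := exists_tame_of_mem_monodromySpace hg
  have e1 : chart (logDer P) + chart (logDer P') = chart (logDer (fun w => P w + P' w)) := by
    rw [← chart_add, eq_comm, chart_eq_iff]
    exact logDer_add hP.analytic hP'.analytic
  rw [e1, intConv_chart hP hQ, intConv_chart hP' hQ, intConv_chart (hP.add hP') hQ, ← chart_add,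
    chart_eq_iff]
  have e2 : ∀ᶠ σ in logFilter, nconv (fun w => P w + P' w) Q σ = nconv P Q σ + nconv P' Q σ := by
    obtain ⟨ρ, h1, h2⟩ := hP.exists_common hQ
    obtain ⟨ρ', h1', h2'⟩ := hP'.exists_common hQ
    filter_upwards [eventually_re_lt ρ, eventually_re_lt ρ'] with σ hσ hσ'
    rw [nconv, nconv, nconv, ← mul_add, conv, conv, conv, ← mul_add,
      ← intervalIntegral.integral_add (intervalIntegrable_conv h1 hP.stolz h2 hQ.stolz hσ)
        (intervalIntegrable_conv h1' hP'.stolz h2' hQ.stolz hσ')]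
    simp only [add_mul]
  have e3 := logDer_add (eventually_analyticAt_nconv hP hQ) (eventually_analyticAt_nconv hP' hQ)
  have e4 := logDer_add (tame_logDer_nconv hP hQ).analytic (tame_logDer_nconv hP' hQ).analytic
  have e5 : ∀ᶠ σ in logFilter, logDer (nconv (fun w => P w + P' w) Q) σ =
      logDer (nconv P Q) σ + logDer (nconv P' Q) σ := by
    filter_upwards [logDer_congr e2, e3] with σ h1 h2 using h1.trans h2
  filter_upwards [logDer_congr e5, e4] with σ h1 h2 using h1.trans h2

theorem intConv_smul_left {f g : LogGerm} (c : ℂ) (hf : f ∈ monodromySpace)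
    (hg : g ∈ monodromySpace) : intConv (c • f) g = c • intConv f g := by
  obtain ⟨f₀, g₀, h₀, e1, e2, e3, h⟩ := (hasConv_intConv hf hg).1
  refine HasConv.intConv_eq ⟨c • f₀, g₀, c • h₀, ?_, e2, ?_, ?_⟩
  · rw [← e1]; rfl
  · rw [← e3]; rfl
  · filter_upwards [h] with w hw
    refine (hw.const_smul c).congr fun p => ?_
    simp only [truncatedConv, Pi.smul_apply, smul_eq_mul]
    rw [mul_left_comm, ← intervalIntegral.integral_const_mul]
    congr 1
    refine intervalIntegral.integral_congr fun τ _ => ?_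
    ring

theorem intConv_zero_left {g : LogGerm} (hg : g ∈ monodromySpace) : intConv 0 g = 0 := by
  have := intConv_smul_left 0 monodromySpace.zero_mem hg
  simpa using this

theorem intConv_zero_right {f : LogGerm} (hf : f ∈ monodromySpace) : intConv f 0 = 0 := by
  rw [intConv_comm hf monodromySpace.zero_mem, intConv_zero_left hf]

theorem cofactor_add_int (w : ℂ) (k : ℤ) (τ : ℝ) :
    cofactor (w + k * (2 * Real.pi * I)) τ = cofactor w τ + k * (2 * Real.pi * I) := by
  have : exp (w + k * (2 * Real.pi * I) - τ) = exp (w - τ) := by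
    rw [show w + k * (2 * Real.pi * I) - τ = w - τ + k * (2 * Real.pi * I) by ring]
    exact Complex.exp_periodic.int_mul k _
  rw [cofactor, cofactor, this]
  ring

theorem HasConv.turn {f g h : LogGerm} (k : ℤ) (H : HasConv f g h) :
    HasConv (turn k f) (turn k g) (turn k h) := by
  obtain ⟨f₀, g₀, h₀, rfl, rfl, rfl, H⟩ := H
  refine ⟨_, _, _, (turn_coe k f₀).symm, (turn_coe k g₀).symm, (turn_coe k h₀).symm, ?_⟩
  filter_upwards [(tendsto_turn k).eventually H] with w hw
  refine hw.congr fun p => ?_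
  rw [truncatedConv, truncatedConv]
  congr 1
  refine intervalIntegral.integral_congr fun τ _ => ?_
  have e1 : w + k * (2 * Real.pi * I) - τ = w - τ + k * (2 * Real.pi * I) := by ring
  have e2 : exp (w - τ + k * (2 * Real.pi * I)) = exp (w - τ) :=
    Complex.exp_periodic.int_mul k _
  simp only [cofactor_add_int, e1, e2]

theorem turn_mem_monodromySpace (k : ℤ) {f : LogGerm} (hf : f ∈ monodromySpace) :
    turn k f ∈ monodromySpace := by
  obtain ⟨f, hf, rfl⟩ := hf
  refine ⟨turn k f, turn_mem k hf, ?_⟩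
  change turn 1 (turn k f) - turn k f = turn k (turn 1 f - f)
  rw [map_sub, turn_turn, turn_turn, add_comm]

theorem turn_intConv (k : ℤ) {f g : LogGerm} (hf : f ∈ monodromySpace) (hg : g ∈ monodromySpace) :
    turn k (intConv f g) = intConv (turn k f) (turn k g) :=
  ((hasConv_intConv hf hg).1.turn k).intConv_eq.symm

theorem iteratedMonodromy_eq_turn (σ : Side) (k : ℤ) (γ : ℂ) (F : PowerSeries ℂ) :
    iteratedMonodromy σ k γ F = turn k (Del (localBranch σ γ F)) := by
  rw [iteratedMonodromy, Sig_zpow]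
  change turn 1 (turn k (localBranch σ γ F)) - turn k (localBranch σ γ F) =
    turn k (turn 1 (localBranch σ γ F) - localBranch σ γ F)
  rw [map_sub, turn_turn, turn_turn, add_comm]

/-! ### Products of singular sets -/

theorem IsSingularSet.exists_lower_bound {S : Set ℂ} (hS : IsSingularSet S) :
    ∃ δ > 0, ∀ α ∈ S, δ ≤ ‖α‖ := by
  have hc : IsClosed (S ∩ Metric.closedBall 0 1) := (hS.2 1).isClosed
  have h0 : (0 : ℂ) ∈ (S ∩ Metric.closedBall 0 1)ᶜ := fun h => hS.1 h.1
  obtain ⟨δ, hδ, hb⟩ := Metric.isOpen_iff.1 hc.isOpen_compl 0 h0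
  refine ⟨min δ 1, by positivity, fun α hα => ?_⟩
  by_contra h
  push Not at h
  refine hb (a := α) (by simpa using h.trans_le (min_le_left _ _)) ⟨hα, by
    simpa using (h.trans_le (min_le_right _ _)).le⟩

theorem IsSingularSet.finite_mul_mem {S T : Set ℂ} (hS : IsSingularSet S) (hT : IsSingularSet T)
    (R : ℝ) : {p : ℂ × ℂ | p.1 ∈ S ∧ p.2 ∈ T ∧ ‖p.1 * p.2‖ ≤ R}.Finite := by
  obtain ⟨δ, hδ, h1⟩ := hS.exists_lower_bound
  obtain ⟨δ', hδ', h1'⟩ := hT.exists_lower_bound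
  refine ((hS.2 (R / δ')).prod (hT.2 (R / δ))).subset ?_
  rintro ⟨α, β⟩ ⟨hα, hβ, h⟩
  rw [norm_mul] at h
  simp only [Set.mem_prod, Set.mem_inter_iff, mem_closedBall_zero_iff]
  refine ⟨⟨hα, ?_⟩, hβ, ?_⟩
  · rw [le_div_iff₀ hδ']
    exact (mul_le_mul_of_nonneg_left (h1' β hβ) (norm_nonneg _)).trans h
  · rw [le_div_iff₀ hδ, mul_comm]
    exact (mul_le_mul_of_nonneg_right (h1 α hα) (norm_nonneg _)).trans h

theorem IsSingularSet.finite_mul_eq {S T : Set ℂ} (hS : IsSingularSet S) (hT : IsSingularSet T)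
    (γ : ℂ) : {p : ℂ × ℂ | p.1 ∈ S ∧ p.2 ∈ T ∧ p.1 * p.2 = γ}.Finite :=
  (hS.finite_mul_mem hT ‖γ‖).subset fun _ h => ⟨h.1, h.2.1, by rw [h.2.2]⟩

theorem IsSingularSet.mul {S T : Set ℂ} (hS : IsSingularSet S) (hT : IsSingularSet T) :
    IsSingularSet (S * T) := by
  refine ⟨?_, fun R => ?_⟩
  · rintro ⟨α, hα, β, hβ, h⟩
    rcases mul_eq_zero.1 h with rfl | rfl
    · exact hS.1 hα
    · exact hT.1 hβ
  · refine ((hS.finite_mul_mem hT R).image fun p => p.1 * p.2).subset ?_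
    rintro _ ⟨⟨α, hα, β, hβ, rfl⟩, h⟩
    exact ⟨(α, β), ⟨hα, hβ, by simpa using h⟩, rfl⟩

/-! ### The convolution algebra -/

theorem finsum_intConv_eq {m n : ℂ → LogGerm} (hm : ∀ γ, m γ ∈ monodromySpace)
    (hn : ∀ γ, n γ ∈ monodromySpace) {S T : Set ℂ} (hS : ∀ γ ∉ S, m γ = 0)
    (hT : ∀ γ ∉ T, n γ = 0) (γ : ℂ) :
    ∑ᶠ p ∈ {p : ℂ × ℂ | p.1 * p.2 = γ}, intConv (m p.1) (n p.2) =
      ∑ᶠ p ∈ {p : ℂ × ℂ | p.1 ∈ S ∧ p.2 ∈ T ∧ p.1 * p.2 = γ}, intConv (m p.1) (n p.2) := by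
  refine finsum_mem_inter_support_eq' _ _ _ fun p hp => ?_
  have h1 : p.1 ∈ S := by
    by_contra h
    exact hp (by simp only [hS _ h, intConv_zero_left (hn _)])
  have h2 : p.2 ∈ T := by
    by_contra h
    exact hp (by simp only [hT _ h, intConv_zero_right (hm _)])
  simp [h1, h2]

/-- The convolution product of two families. -/
noncomputable def familyConv (m n : ℂ → LogGerm) (γ : ℂ) : LogGerm :=
  ∑ᶠ p ∈ {p : ℂ × ℂ | p.1 * p.2 = γ}, intConv (m p.1) (n p.2)

theorem familyConv_mem {m n : ℂ → LogGerm} (hm : m ∈ convolutionSpace)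
    (hn : n ∈ convolutionSpace) : familyConv m n ∈ convolutionSpace := by
  refine ⟨fun γ => finsum_mem_induction (· ∈ monodromySpace) monodromySpace.zero_mem
    (fun x y hx hy => monodromySpace.add_mem hx hy)
    fun p _ => (hasConv_intConv (hm.1 _) (hn.1 _)).2, (hm.2.mul hn.2).subset fun γ hγ => ?_⟩
  by_contra h
  refine hγ ?_
  rw [familyConv, finsum_intConv_eq hm.1 hn.1 (S := {γ | m γ ≠ 0}) (T := {γ | n γ ≠ 0})
    (fun γ h => not_not.1 h) (fun γ h => not_not.1 h)]
  have : {p : ℂ × ℂ | p.1 ∈ {γ | m γ ≠ 0} ∧ p.2 ∈ {γ | n γ ≠ 0} ∧ p.1 * p.2 = γ} = ∅ := by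
    refine Set.eq_empty_of_forall_notMem fun p hp => h ?_
    exact ⟨p.1, hp.1, p.2, hp.2.1, hp.2.2⟩
  rw [this, finsum_mem_empty]

theorem familyConv_add_left {m m' n : ℂ → LogGerm} (hm : m ∈ convolutionSpace)
    (hm' : m' ∈ convolutionSpace) (hn : n ∈ convolutionSpace) :
    familyConv (m + m') n = familyConv m n + familyConv m' n := by
  funext γ
  set S := {γ | m γ ≠ 0} ∪ {γ | m' γ ≠ 0} with hS
  have h1 : ∀ γ ∉ S, m γ = 0 := fun γ h => by
    by_contra h'
    exact h (Or.inl h')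
  have h2 : ∀ γ ∉ S, m' γ = 0 := fun γ h => by
    by_contra h'
    exact h (Or.inr h')
  have h3 : ∀ γ ∉ {γ | n γ ≠ 0}, n γ = 0 := fun γ h => not_not.1 h
  have h4 := (hm.2.union hm'.2).finite_mul_eq hn.2 γ
  rw [Pi.add_apply, familyConv, familyConv, familyConv,
    finsum_intConv_eq (convolutionSpace.add_mem hm hm').1 hn.1 (S := S)
      (fun γ h => by simp [h1 γ h, h2 γ h]) h3,
    finsum_intConv_eq hm.1 hn.1 h1 h3, finsum_intConv_eq hm'.1 hn.1 h2 h3,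
    ← finsum_mem_add_distrib h4]
  exact finsum_mem_congr rfl fun p _ => intConv_add_left (hm.1 _) (hm'.1 _) (hn.1 _)

theorem familyConv_smul_left {m n : ℂ → LogGerm} (c : ℂ) (hm : m ∈ convolutionSpace)
    (hn : n ∈ convolutionSpace) : familyConv (c • m) n = c • familyConv m n := by
  funext γ
  have h1 : ∀ γ ∉ {γ | m γ ≠ 0}, m γ = 0 := fun γ h => not_not.1 h
  have h3 : ∀ γ ∉ {γ | n γ ≠ 0}, n γ = 0 := fun γ h => not_not.1 h
  have h4 := hm.2.finite_mul_eq hn.2 γ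
  rw [Pi.smul_apply, familyConv, familyConv,
    finsum_intConv_eq (convolutionSpace.smul_mem c hm).1 hn.1 (S := {γ | m γ ≠ 0})
      (fun γ h => by simp [h1 γ h]) h3, finsum_intConv_eq hm.1 hn.1 h1 h3]
  rw [show c • ∑ᶠ p ∈ {p : ℂ × ℂ | p.1 ∈ {γ | m γ ≠ 0} ∧ p.2 ∈ {γ | n γ ≠ 0} ∧ p.1 * p.2 = γ},
    intConv (m p.1) (n p.2) = DistribSMul.toAddMonoidHom LogGerm c (∑ᶠ p ∈ {p : ℂ × ℂ |
      p.1 ∈ {γ | m γ ≠ 0} ∧ p.2 ∈ {γ | n γ ≠ 0} ∧ p.1 * p.2 = γ}, intConv (m p.1) (n p.2)) from rfl,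
    AddMonoidHom.map_finsum_mem _ _ h4]
  exact finsum_mem_congr rfl fun p _ => intConv_smul_left c (hm.1 _) (hn.1 _)

theorem familyConv_comm {m n : ℂ → LogGerm} (hm : m ∈ convolutionSpace)
    (hn : n ∈ convolutionSpace) : familyConv m n = familyConv n m := by
  funext γ
  rw [familyConv, familyConv]
  refine finsum_mem_eq_of_bijOn Prod.swap ⟨?_, Prod.swap_injective.injOn, ?_⟩ fun p _ =>
    intConv_comm (hm.1 _) (hn.1 _)
  · intro p hp
    simpa [mul_comm] using hp
  · intro p hp
    exact ⟨p.swap, by simpa [mul_comm] using hp, Prod.swap_swap p⟩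

/-- The integral convolution of families, as a bilinear map. -/
noncomputable def convolutionMul :
    convolutionSpace →ₗ[ℂ] convolutionSpace →ₗ[ℂ] convolutionSpace :=
  LinearMap.mk₂ ℂ (fun m n => ⟨familyConv m n, familyConv_mem m.2 n.2⟩)
    (fun m m' n => Subtype.ext (familyConv_add_left m.2 m'.2 n.2))
    (fun c m n => Subtype.ext (familyConv_smul_left c m.2 n.2))
    (fun m n n' => Subtype.ext (by
      have := familyConv_add_left n.2 n'.2 m.2
      rw [familyConv_comm n.2 m.2, familyConv_comm n'.2 m.2,
        familyConv_comm (add_mem n.2 n'.2) m.2] at this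
      exact this))
    (fun c m n => Subtype.ext (by
      have := familyConv_smul_left c n.2 m.2
      rw [familyConv_comm n.2 m.2, familyConv_comm (convolutionSpace.smul_mem c n.2) m.2] at this
      exact this))

/-- The statement from which both parts of the main theorem follow. -/
def HadamardProductFormula : Prop :=
  ∀ (F G : PowerSeries ℂ) (S T : Set ℂ),
    HasIntegrableSingularities F S → HasIntegrableSingularities G T →
      HasIntegrableSingularities (hadamardProduct F G) (S * T) ∧
      ∀ (σ : Side) (γ : ℂ), Del (localBranch σ γ (hadamardProduct F G)) =
        ∑ᶠ p ∈ {p : ℂ × ℂ | p.1 ∈ S ∧ p.2 ∈ T ∧ p.1 * p.2 = γ},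
          intConv (Del (localBranch σ p.1 F)) (Del (localBranch σ p.2 G))

theorem Del_localBranch_mem {F : PowerSeries ℂ} {S : Set ℂ} (hF : HasIntegrableSingularities F S)
    (σ : Side) (α : ℂ) : Del (localBranch σ α F) ∈ monodromySpace :=
  Submodule.mem_map_of_mem (localBranch_spec hF σ α).2.1

theorem iteratedMonodromy_mem {F : PowerSeries ℂ} {S : Set ℂ}
    (hF : HasIntegrableSingularities F S) (σ : Side) (k : ℤ) (α : ℂ) :
    iteratedMonodromy σ k α F ∈ monodromySpace := by
  rw [iteratedMonodromy_eq_turn]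
  exact turn_mem_monodromySpace k (Del_localBranch_mem hF σ α)

theorem iteratedMonodromy_eq_zero {F : PowerSeries ℂ} {S : Set ℂ}
    (hF : HasIntegrableSingularities F S) (σ : Side) (k : ℤ) {α : ℂ} (hα : α ∉ S) :
    iteratedMonodromy σ k α F = 0 := by
  rw [iteratedMonodromy_eq_turn]
  have := (localBranch_spec hF σ α).2.2 hα 1
  change turn k (turn 1 (localBranch σ α F) - localBranch σ α F) = 0
  rw [this, sub_self, map_zero]

theorem HadamardProductFormula.iteratedMonodromy_eq (hF : HadamardProductFormula)
    {F G : PowerSeries ℂ} {S T : Set ℂ}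
    (hS : HasIntegrableSingularities F S) (hT : HasIntegrableSingularities G T) (σ : Side) (k : ℤ)
    (γ : ℂ) : iteratedMonodromy σ k γ (hadamardProduct F G) =
      ∑ᶠ p ∈ {p : ℂ × ℂ | p.1 ∈ S ∧ p.2 ∈ T ∧ p.1 * p.2 = γ},
        intConv (iteratedMonodromy σ k p.1 F) (iteratedMonodromy σ k p.2 G) := by
  rw [iteratedMonodromy_eq_turn, (hF F G S T hS hT).2 σ γ]
  rw [show turn k (∑ᶠ p ∈ {p : ℂ × ℂ | p.1 ∈ S ∧ p.2 ∈ T ∧ p.1 * p.2 = γ},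
      intConv (Del (localBranch σ p.1 F)) (Del (localBranch σ p.2 G))) =
    (turn k).toAddMonoidHom (∑ᶠ p ∈ {p : ℂ × ℂ | p.1 ∈ S ∧ p.2 ∈ T ∧ p.1 * p.2 = γ},
      intConv (Del (localBranch σ p.1 F)) (Del (localBranch σ p.2 G))) from rfl,
    AddMonoidHom.map_finsum_mem _ _ (hS.1.finite_mul_eq hT.1 γ)]
  refine finsum_mem_congr rfl fun p _ => ?_
  rw [iteratedMonodromy_eq_turn, iteratedMonodromy_eq_turn]
  exact turn_intConv k (Del_localBranch_mem hS σ _) (Del_localBranch_mem hT σ _)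

/-- The Hadamard product as a bilinear map. -/
noncomputable def HadamardProductFormula.mul (hF : HadamardProductFormula) :
    hadamardSpace →ₗ[ℂ] hadamardSpace →ₗ[ℂ] hadamardSpace :=
  LinearMap.mk₂ ℂ (fun F G => ⟨hadamardProduct F G, by
      obtain ⟨S, hS⟩ := F.2
      obtain ⟨T, hT⟩ := G.2
      exact ⟨S * T, (hF _ _ S T hS hT).1⟩⟩)
    (fun F F' G => Subtype.ext (by ext n; simp [hadamardProduct, add_mul]))
    (fun c F G => Subtype.ext (by ext n; simp [hadamardProduct, mul_assoc]))
    (fun F G G' => Subtype.ext (by ext n; simp [hadamardProduct, mul_add]))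
    (fun c F G => Subtype.ext (by ext n; simp [hadamardProduct, mul_left_comm]))

theorem HadamardProductFormula.monodromyOperator_mul (hF : HadamardProductFormula)
    (σ : Side) (k : ℤ) (F G : hadamardSpace) :
    monodromyOperator σ k (hF.mul F G) =
      convolutionMul (monodromyOperator σ k F) (monodromyOperator σ k G) := by
  obtain ⟨F, S, hS⟩ := F
  obtain ⟨G, T, hT⟩ := G
  ext γ : 2
  change iteratedMonodromy σ k γ (hadamardProduct F G) =
    familyConv (fun γ => iteratedMonodromy σ k γ F) (fun γ => iteratedMonodromy σ k γ G) γ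
  rw [hF.iteratedMonodromy_eq hS hT, familyConv, finsum_intConv_eq
    (m := fun γ => iteratedMonodromy σ k γ F) (n := fun γ => iteratedMonodromy σ k γ G)
    (iteratedMonodromy_mem hS σ k) (iteratedMonodromy_mem hT σ k)
    (fun γ => iteratedMonodromy_eq_zero hS σ k) (fun γ => iteratedMonodromy_eq_zero hT σ k)]

/-! ### Moment sequences -/

/-- The sequence `a` consists of the moments `∫ k U⁻ⁿ` of a complex measure with compact support in
`W`. -/
def HasMoments (W : Set ℂ) (a : ℕ → ℂ) : Prop :=
  ∃ (X : Type) (_ : MeasurableSpace X) (μ : Measure X) (k U : X → ℂ) (K : Set ℂ),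
    SFinite μ ∧ IsCompact K ∧ K ⊆ W ∧ (0 : ℂ) ∉ K ∧ Integrable k μ ∧ Measurable U ∧
      (∀ᵐ x ∂μ, U x ∈ K) ∧ ∀ n, a n = ∫ x, k x * (U x)⁻¹ ^ n ∂μ

/-- Finite combinations of moment sequences. -/
def moments (W : Set ℂ) : Submodule ℂ (ℕ → ℂ) := Submodule.span ℂ {a | HasMoments W a}

theorem HasMoments.mem {W : Set ℂ} {a : ℕ → ℂ} (h : HasMoments W a) : a ∈ moments W :=
  Submodule.subset_span h

theorem HasMoments.mono {W W' : Set ℂ} (h : W ⊆ W') {a : ℕ → ℂ} (ha : HasMoments W a) :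
    HasMoments W' a := by
  obtain ⟨X, _, μ, k, U, K, h1, h2, h3, h4⟩ := ha
  exact ⟨X, _, μ, k, U, K, h1, h2, h3.trans h, h4⟩

theorem moments_mono {W W' : Set ℂ} (h : W ⊆ W') : moments W ≤ moments W' :=
  Submodule.span_mono fun _ ha => HasMoments.mono h ha

theorem HasMoments.mul {W W' : Set ℂ} {a b : ℕ → ℂ} (ha : HasMoments W a) (hb : HasMoments W' b) :
    HasMoments (W * W') (a * b) := by
  obtain ⟨X, _, μ, k, U, K, h1, h2, h3, h4, h5, h6, h7, h8⟩ := ha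
  obtain ⟨X', _, μ', k', U', K', h1', h2', h3', h4', h5', h6', h7', h8'⟩ := hb
  refine ⟨X × X', inferInstance, μ.prod μ', fun p => k p.1 * k' p.2, fun p => U p.1 * U' p.2,
    K * K', inferInstance, h2.mul h2', Set.mul_subset_mul h3 h3', ?_, h5.mul_prod h5',
    (h6.comp measurable_fst).mul (h6'.comp measurable_snd), ?_, fun n => ?_⟩
  · rintro ⟨x, hx, y, hy, h⟩
    rcases mul_eq_zero.1 h with rfl | rfl
    · exact h4 hx
    · exact h4' hy
  · filter_upwards [Measure.quasiMeasurePreserving_fst.ae h7,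
      Measure.quasiMeasurePreserving_snd.ae h7'] with p hp hp'
    exact Set.mul_mem_mul hp hp'
  · rw [Pi.mul_apply, h8, h8', ← integral_prod_mul]
    refine integral_congr_ae (Eventually.of_forall fun p => ?_)
    simp only [mul_inv, mul_pow]
    ring

theorem moments_mul {W W' : Set ℂ} {a b : ℕ → ℂ} (ha : a ∈ moments W) (hb : b ∈ moments W') :
    a * b ∈ moments (W * W') := by
  have h := Submodule.mul_mem_mul ha hb
  rw [moments, moments, Submodule.span_mul_span] at h
  refine Submodule.span_mono ?_ h
  rintro _ ⟨a, ha, b, hb, rfl⟩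
  exact ha.mul hb

/-- The moments of a density on an interval. -/
theorem moments_of_Ioo {W : Set ℂ} {a b : ℝ} {k U : ℝ → ℂ} (hk : IntegrableOn k (Set.Ioo a b))
    (hU : Continuous U) (hW : ∀ x ∈ Set.Icc a b, U x ∈ W) (h0 : ∀ x, U x ≠ 0) :
    (fun n => ∫ x in Set.Ioo a b, k x * (U x)⁻¹ ^ n) ∈ moments W := by
  refine HasMoments.mem ⟨ℝ, inferInstance, volume.restrict (Set.Ioo a b), k, U, U '' Set.Icc a b,
    inferInstance, isCompact_Icc.image hU, ?_, ?_, hk, hU.measurable, ?_, fun n => rfl⟩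
  · rintro _ ⟨x, hx, rfl⟩
    exact hW x hx
  · rintro ⟨x, hx, h⟩
    exact h0 x h
  · exact (ae_restrict_iff' measurableSet_Ioo).2 (Eventually.of_forall fun x hx =>
      ⟨x, Set.Ioo_subset_Icc_self hx, rfl⟩)

theorem moments_of_interval {W : Set ℂ} {a b : ℝ} {k U : ℝ → ℂ} (hk : IntervalIntegrable k volume a b)
    (hU : Continuous U) (hW : ∀ x ∈ Set.uIcc a b, U x ∈ W) (h0 : ∀ x, U x ≠ 0) :
    (fun n => ∫ x in a..b, k x * (U x)⁻¹ ^ n) ∈ moments W := by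
  rcases le_total a b with h | h
  · simp only [intervalIntegral.integral_of_le h, integral_Ioc_eq_integral_Ioo]
    rw [Set.uIcc_of_le h] at hW
    rw [intervalIntegrable_iff_integrableOn_Ioo_of_le h] at hk
    exact moments_of_Ioo hk hU hW h0
  · simp only [intervalIntegral.integral_of_ge h, integral_Ioc_eq_integral_Ioo]
    rw [Set.uIcc_of_ge h] at hW
    have := (intervalIntegrable_iff_integrableOn_Ioo_of_le h).1 hk.symm
    exact (moments W).neg_mem (moments_of_Ioo this hU hW h0)

theorem moments_dirac {W : Set ℂ} {u : ℂ} (hu : u ∈ W) (h0 : u ≠ 0) :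
    (fun n => u⁻¹ ^ n) ∈ moments W := by
  refine HasMoments.mem ⟨Unit, inferInstance, Measure.dirac (), fun _ => 1, fun _ => u, {u},
    inferInstance, isCompact_singleton, by simpa using hu, by simpa using h0.symm, ?_,
    measurable_const, by simp, by simp⟩
  exact integrable_const _

/-! ### Generating functions of moment sequences -/

/-- The generating function of `a` extends analytically outside the compact set `K`. -/
structure Continues (a : ℕ → ℂ) (K : Set ℂ) (h : ℂ → ℂ) : Prop where
  compact : IsCompact K
  zero : (0 : ℂ) ∉ K
  analytic : DifferentiableOn ℂ h Kᶜ
  hasSum : ∀ᶠ z in 𝓝 (0 : ℂ), HasSum (fun n => a n * z ^ n) (h z)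

theorem Continues.add {a b : ℕ → ℂ} {K L : Set ℂ} {h k : ℂ → ℂ} (ha : Continues a K h)
    (hb : Continues b L k) : Continues (a + b) (K ∪ L) (fun z => h z + k z) where
  compact := ha.compact.union hb.compact
  zero := fun h => h.elim ha.zero hb.zero
  analytic := (ha.analytic.mono (Set.compl_subset_compl.2 Set.subset_union_left)).add
    (hb.analytic.mono (Set.compl_subset_compl.2 Set.subset_union_right))
  hasSum := by
    filter_upwards [ha.hasSum, hb.hasSum] with z h1 h2
    simpa [add_mul] using h1.add h2

theorem Continues.smul {a : ℕ → ℂ} {K : Set ℂ} {h : ℂ → ℂ} (c : ℂ) (ha : Continues a K h) :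
    Continues (c • a) K (fun z => c * h z) where
  compact := ha.compact
  zero := ha.zero
  analytic := ha.analytic.const_mul c
  hasSum := by
    filter_upwards [ha.hasSum] with z h1
    simpa [mul_assoc] using h1.mul_left c

theorem continues_zero : Continues 0 ∅ 0 where
  compact := isCompact_empty
  zero := id
  analytic := differentiableOn_const 0
  hasSum := Eventually.of_forall fun z => by simp

/-- The generating function of the moments of `k` along `U`. -/
theorem continues_integral {X : Type*} [MeasurableSpace X] {μ : Measure X} {k U : X → ℂ} {K : Set ℂ}
    (hK : IsCompact K) (h0 : (0 : ℂ) ∉ K) (hk : Integrable k μ) (hU : Measurable U)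
    (hUK : ∀ᵐ x ∂μ, U x ∈ K) :
    Continues (fun n => ∫ x, k x * (U x)⁻¹ ^ n ∂μ) K (fun z => ∫ x, k x * (1 - z / U x)⁻¹ ∂μ) := by
  have hopen : IsOpen Kᶜ := hK.isClosed.isOpen_compl
  obtain ⟨B, hB⟩ := hK.isBounded.exists_norm_le
  obtain ⟨δ, hδ, hδK⟩ := Metric.isOpen_iff.1 hopen 0 h0
  have hlow : ∀ u ∈ K, δ ≤ ‖u‖ := fun u hu => by
    by_contra h
    push Not at h
    exact hδK (by simpa using h) hu
  refine ⟨hK, h0, ?_, ?_⟩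
  · refine differentiableOn_integral_of_dominated hopen (fun z _ => ?_) ?_ ?_
    · exact hk.aestronglyMeasurable.mul
        (Measurable.aestronglyMeasurable (by fun_prop))
    · filter_upwards [hUK] with x hx
      intro z hz
      have hne : U x ≠ 0 := fun h => h0 (h ▸ hx)
      have h1 : 1 - z / U x ≠ 0 := fun h => hz (by
        rw [sub_eq_zero, eq_comm, div_eq_one_iff_eq hne] at h
        rwa [h])
      refine DifferentiableAt.differentiableWithinAt ?_
      exact ((differentiableAt_const _).mul (DifferentiableAt.inv (by fun_prop) h1))
    · intro z₀ hz₀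
      obtain ⟨r, hr, hrK⟩ := Metric.isOpen_iff.1 hopen z₀ hz₀
      refine ⟨r / 2, by positivity, fun x => ‖k x‖ * (B / (r / 2)), hk.norm.mul_const _, ?_⟩
      filter_upwards [hUK] with x hx z hz _
      have hne : U x ≠ 0 := fun h => h0 (h ▸ hx)
      rw [norm_mul]
      refine mul_le_mul_of_nonneg_left ?_ (norm_nonneg _)
      have h2 : r / 2 ≤ ‖U x - z‖ := by
        by_contra h
        push Not at h
        refine hrK (a := U x) ?_ hx
        rw [Metric.mem_ball, dist_eq_norm] at hz ⊢
        calc ‖U x - z₀‖ = ‖(U x - z) + (z - z₀)‖ := by congr 1; ring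
          _ ≤ _ := norm_add_le _ _
          _ < r := by linarith
      have h3 : 1 - z / U x = (U x - z) / U x := by field_simp
      rw [h3, inv_div, norm_div]
      exact div_le_div₀ ((norm_nonneg _).trans (hB _ hx)) (hB _ hx) (by positivity) h2
  · filter_upwards [Metric.ball_mem_nhds (0 : ℂ) hδ] with z hz
    have hz' : ‖z‖ < δ := by simpa using hz
    have hq : ‖z‖ / δ < 1 := (div_lt_one hδ).2 hz'
    have hq0 : 0 ≤ ‖z‖ / δ := by positivity
    have hbd : ∀ n, ∀ᵐ x ∂μ, ‖k x * (U x)⁻¹ ^ n * z ^ n‖ ≤ (‖z‖ / δ) ^ n * ‖k x‖ := by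
      intro n
      filter_upwards [hUK] with x hx
      rw [norm_mul, norm_mul, norm_pow, norm_pow, norm_inv, mul_assoc, mul_comm, ← mul_pow]
      refine mul_le_mul_of_nonneg_right (pow_le_pow_left₀ (by positivity) ?_ n) (norm_nonneg _)
      rw [inv_mul_eq_div]
      exact div_le_div_of_nonneg_left (norm_nonneg _) hδ (hlow _ hx)
    have hint : ∀ n, Integrable (fun x => k x * (U x)⁻¹ ^ n * z ^ n) μ := fun n =>
      (hk.norm.const_mul _).mono' ((hk.aestronglyMeasurable.mul
        (Measurable.aestronglyMeasurable (by fun_prop))).mul_const _) (hbd n)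
    have hsum : Summable (fun n => ∫ x, ‖k x * (U x)⁻¹ ^ n * z ^ n‖ ∂μ) := by
      refine Summable.of_nonneg_of_le (fun n => integral_nonneg fun x => norm_nonneg _) (fun n =>
        integral_mono_ae (hint n).norm (hk.norm.const_mul _) (hbd n)) ?_
      simp only [integral_const_mul]
      exact (summable_geometric_of_lt_one hq0 hq).mul_right _
    have h1 := hasSum_integral_of_summable_integral_norm hint hsum
    simp only [integral_mul_const] at h1
    suffices h3 : ∫ x, k x * (1 - z / U x)⁻¹ ∂μ = ∫ x, ∑' n, k x * (U x)⁻¹ ^ n * z ^ n ∂μ by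
      rwa [h3]
    refine integral_congr_ae ?_
    filter_upwards [hUK] with x hx
    have hlt : ‖z / U x‖ < 1 := by
      rw [norm_div]
      exact (div_le_div_of_nonneg_left (norm_nonneg _) hδ (hlow _ hx)).trans_lt hq
    have h2 : ∀ n, k x * (U x)⁻¹ ^ n * z ^ n = k x * (z / U x) ^ n := fun n => by
      rw [div_eq_mul_inv, mul_pow]; ring
    simp only [h2]
    rw [tsum_mul_left, tsum_geometric_of_norm_lt_one hlt]

theorem exists_continues_of_mem_moments {W : Set ℂ} {a : ℕ → ℂ} (ha : a ∈ moments W) :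
    ∃ K ⊆ W, ∃ h, Continues a K h := by
  induction ha using Submodule.span_induction with
  | mem a ha =>
    obtain ⟨X, _, μ, k, U, K, h1, h2, h3, h4, h5, h6, h7, h8⟩ := ha
    have := continues_integral h2 h4 h5 h6 h7
    rw [← show a = _ from funext h8] at this
    exact ⟨K, h3, _, this⟩
  | zero => exact ⟨∅, Set.empty_subset _, 0, continues_zero⟩
  | add a b _ _ ha hb =>
    obtain ⟨K, hK, h, H⟩ := ha
    obtain ⟨L, hL, k, H'⟩ := hb
    exact ⟨K ∪ L, Set.union_subset hK hL, _, H.add H'⟩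
  | smul c a _ ha =>
    obtain ⟨K, hK, h, H⟩ := ha
    exact ⟨K, hK, _, H.smul c⟩

/-! ### Moments along short slits -/

/-- The point at angle `v` on the slit at `γ`. -/
noncomputable def slitPt (sg : ℝ) (γ : ℂ) (v : ℝ) : ℂ := γ * exp (-(sg * v) * I)

/-- The density of a slit, on the half-line of the logarithmic coordinate lying over the slit. -/
noncomputable def slitVal (sg : ℝ) (P : ℂ → ℂ) (v : ℝ) : ℂ :=
  P (Real.log v + (-(sg * (Real.pi / 2)) : ℝ) * I)

/-- The moments of `P` along the slit `slitPt sg γ`. -/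
noncomputable def slit (sg η : ℝ) (P : ℂ → ℂ) (γ : ℂ) (n : ℕ) : ℂ :=
  sg / (2 * Real.pi) * ∫ v in Set.Ioo 0 η, slitVal sg P v * (slitPt sg γ v)⁻¹ ^ n

theorem continuous_slitPt (sg : ℝ) (γ : ℂ) : Continuous (slitPt sg γ) := by
  unfold slitPt
  fun_prop

theorem slitPt_ne_zero {sg : ℝ} {γ : ℂ} (hγ : γ ≠ 0) (v : ℝ) : slitPt sg γ v ≠ 0 :=
  mul_ne_zero hγ (exp_ne_zero _)

theorem slitPt_zero (sg : ℝ) (γ : ℂ) : slitPt sg γ 0 = γ := by simp [slitPt]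

theorem slitPt_mul (sg : ℝ) (γ γ' : ℂ) (v v' : ℝ) :
    slitPt sg γ v * slitPt sg γ' v' = slitPt sg (γ * γ') (v + v') := by
  rw [slitPt, slitPt, slitPt, mul_mul_mul_comm, ← exp_add]
  push_cast
  ring_nf

section slit
variable {P Q : ℂ → ℂ} {ρ η sg : ℝ}

theorem log_lt_of_mem {v : ℝ} (hη' : Real.log η < ρ) (hv : v ∈ Set.Ioc 0 η) : Real.log v < ρ :=
  (Real.log_le_log hv.1 hv.2).trans_lt hη'

theorem continuousOn_slitVal (hP : DifferentiableOn ℂ P {w | w.re < ρ}) (hη' : Real.log η < ρ)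
    (sg : ℝ) : ContinuousOn (slitVal sg P) (Set.Ioc 0 η) := by
  unfold slitVal
  refine hP.continuousOn.comp (ContinuousOn.add (continuous_ofReal.comp_continuousOn
    (Real.continuousOn_log.mono fun v hv => hv.1.ne')) continuousOn_const) fun v hv => ?_
  simpa using log_lt_of_mem hη' hv

theorem exists_bound_slitVal (hP : DifferentiableOn ℂ P {w | w.re < ρ}) (hP0 : StolzZero P)
    (hη' : Real.log η < ρ) (sg : ℝ) : ∃ C, 0 ≤ C ∧ ∀ v ∈ Set.Ioc 0 η, ‖slitVal sg P v‖ ≤ C := by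
  obtain ⟨C, hC0, hC⟩ := hP0.exists_bound hη' hP.continuousOn |-(sg * (Real.pi / 2))|
  refine ⟨C, hC0, fun v hv => hC _ ?_ ?_⟩
  · simpa using Real.log_le_log hv.1 hv.2
  · simp

theorem integrableOn_slitVal (hP : DifferentiableOn ℂ P {w | w.re < ρ}) (hP0 : StolzZero P)
    (hη' : Real.log η < ρ) (sg : ℝ) : IntegrableOn (slitVal sg P) (Set.Ioc 0 η) := by
  obtain ⟨C, hC0, hC⟩ := exists_bound_slitVal hP hP0 hη' sg
  refine Integrable.mono' (g := fun _ => C) (integrable_const _)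
    ((continuousOn_slitVal hP hη' sg).aestronglyMeasurable measurableSet_Ioc)
    ((ae_restrict_iff' measurableSet_Ioc).2 (Eventually.of_forall hC))

theorem slit_mem_moments (hP : DifferentiableOn ℂ P {w | w.re < ρ}) (hP0 : StolzZero P)
    (hη' : Real.log η < ρ) (sg : ℝ) {γ : ℂ} (hγ : γ ≠ 0) {W : Set ℂ}
    (hW : ∀ v ∈ Set.Icc 0 η, slitPt sg γ v ∈ W) : slit sg η P γ ∈ moments W :=
  (moments W).smul_mem (sg / (2 * Real.pi) : ℂ) (moments_of_Ioo
    ((integrableOn_slitVal hP hP0 hη' sg).mono_set Set.Ioo_subset_Ioc_self)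
    (continuous_slitPt sg γ) hW (slitPt_ne_zero hγ))

theorem exp_sg (hsg : sg = 1 ∨ sg = -1) : exp ((sg * (Real.pi / 2) : ℝ) * I) = I * sg := by
  rcases hsg with rfl | rfl
  · simp [exp_pi_div_two_mul_I]
  · have : ((-1 * (Real.pi / 2) : ℝ) : ℂ) * I = -(Real.pi / 2 * I) := by push_cast; ring
    rw [this, exp_neg, exp_pi_div_two_mul_I]
    simp

theorem integral_slitVal_conv (hsg : sg = 1 ∨ sg = -1) (P Q : ℂ → ℂ) {V : ℝ} (hV : 0 < V) :
    ∫ v in Set.Ioo 0 V, slitVal sg P v * slitVal sg Q (V - v) =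
      I * sg * slitVal sg (conv P Q) V := by
  have h1 : ∫ v in Set.Ioo 0 V, slitVal sg P v * slitVal sg Q (V - v) =
      V * ∫ r in (0 : ℝ)..1, slitVal sg P (V * r) * slitVal sg Q (V - V * r) := by
    rw [← integral_Ioc_eq_integral_Ioo, ← intervalIntegral.integral_of_le hV.le]
    have := intervalIntegral.smul_integral_comp_mul_left (a := 0) (b := 1)
      (fun v => slitVal sg P v * slitVal sg Q (V - v)) V
    rw [mul_zero, mul_one] at this
    rw [← this, real_smul]
  rw [h1, slitVal, conv]
  have h2 : I * sg * (exp (Real.log V + (-(sg * (Real.pi / 2)) : ℝ) * I)) = V := by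
    rw [← exp_sg hsg, exp_add, ← ofReal_exp, Real.exp_log hV, mul_left_comm, ← exp_add]
    push_cast
    simp
  rw [← mul_assoc, h2]
  congr 1
  rw [intervalIntegral.integral_of_le zero_le_one, intervalIntegral.integral_of_le zero_le_one,
    integral_Ioc_eq_integral_Ioo, integral_Ioc_eq_integral_Ioo]
  refine setIntegral_congr_fun measurableSet_Ioo fun r hr => ?_
  simp only [slitVal]
  have h3 : 1 - r ≠ 0 := by linarith [hr.2]
  rw [show V - V * r = V * (1 - r) by ring, Real.log_mul hV.ne' hr.1.ne', Real.log_mul hV.ne' h3]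
  push_cast
  ring_nf

theorem nconv_slitVal (P Q : ℂ → ℂ) (v : ℝ) :
    slitVal sg (conv P Q) v = -(2 * Real.pi * I) * slitVal sg (nconv P Q) v := by
  rw [slitVal, slitVal, nconv]
  have : (Real.pi : ℂ) ≠ 0 := by simp [Real.pi_ne_zero]
  field_simp

/-- The product of the moments of two slits is the moment of the convolution along a slit, up to
moments away from the tip. -/
theorem slit_mul_slit_sub_mem (hsg : sg = 1 ∨ sg = -1)
    (hP : DifferentiableOn ℂ P {w | w.re < ρ}) (hP0 : StolzZero P)
    (hQ : DifferentiableOn ℂ Q {w | w.re < ρ}) (hQ0 : StolzZero Q)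
    (hη' : Real.log η < ρ) {γ γ' : ℂ} (hγ : γ ≠ 0) (hγ' : γ' ≠ 0) {W : Set ℂ}
    (hW : ∀ v ∈ Set.Icc η (2 * η), slitPt sg (γ * γ') v ∈ W) :
    slit sg η P γ * slit sg η Q γ' - slit sg η (nconv P Q) (γ * γ') ∈ moments W := by
  set p := slitVal sg P with hp
  set q := slitVal sg Q with hq
  set D : Set (ℝ × ℝ) := Set.Ioo 0 η ×ˢ Set.Ioo 0 η with hD
  set D₁ : Set (ℝ × ℝ) := {x | 0 < x.1 ∧ 0 < x.2 ∧ x.1 + x.2 < η} with hD₁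
  set D₂ : Set (ℝ × ℝ) := D \ D₁ with hD₂
  have hDm : MeasurableSet D := measurableSet_Ioo.prod measurableSet_Ioo
  have hD₁m : MeasurableSet D₁ := by
    refine IsOpen.measurableSet ?_
    exact (isOpen_lt continuous_const continuous_fst).inter
      ((isOpen_lt continuous_const continuous_snd).inter
        (isOpen_lt (continuous_fst.add continuous_snd) continuous_const))
  have hD₁D : D₁ ⊆ D := fun x hx => ⟨⟨hx.1, by linarith [hx.2.1, hx.2.2]⟩, hx.2.1, by
    linarith [hx.1, hx.2.2]⟩
  have hpi := (integrableOn_slitVal hP hP0 hη' sg).mono_set Set.Ioo_subset_Ioc_self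
  have hqi := (integrableOn_slitVal hQ hQ0 hη' sg).mono_set Set.Ioo_subset_Ioc_self
  have hpq : IntegrableOn (fun x : ℝ × ℝ => p x.1 * q x.2) D := by
    rw [IntegrableOn, Measure.volume_eq_prod, hD, ← Measure.prod_restrict]
    exact hpi.mul_prod hqi
  set e : ℕ → ℝ → ℂ := fun n v => (slitPt sg (γ * γ') v)⁻¹ ^ n with he
  have hec : ∀ n, Continuous (e n) := fun n =>
    ((continuous_slitPt sg _).inv₀ (slitPt_ne_zero (mul_ne_zero hγ hγ'))).pow n
  have hen : ∀ n v, ‖e n v‖ = (‖γ * γ'‖⁻¹) ^ n := by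
    intro n v
    simp only [he, slitPt, norm_pow, norm_inv, norm_mul]
    have : ‖exp (-(sg * v) * I)‖ = 1 := by
      have := norm_exp_ofReal_mul_I (-(sg * v))
      push_cast at this
      exact this
    rw [this, mul_one]
  have hG : ∀ n, IntegrableOn (fun x : ℝ × ℝ => p x.1 * q x.2 * e n (x.1 + x.2)) D := by
    intro n
    refine Integrable.mul_bdd (c := (‖γ * γ'‖⁻¹) ^ n) hpq ?_ ?_
    · exact ((hec n).comp (by fun_prop)).aestronglyMeasurable
    · exact Eventually.of_forall fun x => (hen n _).le
  have hprod : ∀ n, (∫ v in Set.Ioo 0 η, p v * (slitPt sg γ v)⁻¹ ^ n) *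
      (∫ v in Set.Ioo 0 η, q v * (slitPt sg γ' v)⁻¹ ^ n) =
      ∫ x in D, p x.1 * q x.2 * e n (x.1 + x.2) := by
    intro n
    rw [hD, Measure.volume_eq_prod, ← setIntegral_prod_mul]
    refine integral_congr_ae (Eventually.of_forall fun x => ?_)
    simp only [he, ← slitPt_mul, mul_inv, mul_pow]
    ring
  have htri : ∀ n, ∫ x in D₁, p x.1 * q x.2 * e n (x.1 + x.2) =
      ∫ V in Set.Ioo 0 η, (I * sg * slitVal sg (conv P Q) V) * e n V := by
    intro n
    set g : ℝ × ℝ → ℂ := ({x : ℝ × ℝ | 0 < x.1 ∧ x.1 < x.2 ∧ x.2 < η}).indicator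
      (fun x => p x.1 * q (x.2 - x.1) * e n x.2) with hg
    have hmp := measurePreserving_prod_add (volume : Measure ℝ) (volume : Measure ℝ)
    have hem : MeasurableEmbedding (fun z : ℝ × ℝ => (z.1, z.1 + z.2)) :=
      (MeasurableEquiv.shearAddRight ℝ).measurableEmbedding
    have hcomp : ∀ x : ℝ × ℝ, g (x.1, x.1 + x.2) =
        D₁.indicator (fun x => p x.1 * q x.2 * e n (x.1 + x.2)) x := by
      intro x
      simp only [hg, Set.indicator_apply, hD₁, Set.mem_ofPred_eq, lt_add_iff_pos_right,
        add_sub_cancel_left]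
    have hgi : Integrable g (volume.prod volume) := by
      rw [← hmp.integrable_comp_emb hem]
      have : (g ∘ fun z : ℝ × ℝ => (z.1, z.1 + z.2)) =
          D₁.indicator (fun x => p x.1 * q x.2 * e n (x.1 + x.2)) := funext hcomp
      rw [this, integrable_indicator_iff hD₁m]
      exact (hG n).mono_set hD₁D
    have h1 := hmp.integral_comp hem g
    simp only [hcomp] at h1
    rw [integral_indicator hD₁m] at h1
    rw [Measure.volume_eq_prod, h1, integral_prod_symm _ hgi, ← integral_indicator measurableSet_Ioo]
    refine integral_congr_ae (Eventually.of_forall fun V => ?_)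
    simp only [hg]
    by_cases hV : V ∈ Set.Ioo 0 η
    · rw [Set.indicator_of_mem hV, ← integral_slitVal_conv hsg P Q hV.1, ← integral_mul_const,
        ← integral_indicator measurableSet_Ioo]
      refine integral_congr_ae (Eventually.of_forall fun v => ?_)
      simp only [Set.indicator_apply, Set.mem_ofPred_eq, Set.mem_Ioo, hV.2, and_true]
      rfl
    · rw [Set.indicator_of_notMem hV]
      refine integral_eq_zero_of_ae (Eventually.of_forall fun v => ?_)
      refine Set.indicator_of_notMem (fun h => hV ⟨?_, h.2.2⟩) _
      exact h.1.trans h.2.1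
  have hrest : (fun n => ∫ x in D₂, p x.1 * q x.2 * e n (x.1 + x.2)) ∈ moments W := by
    refine HasMoments.mem ⟨ℝ × ℝ, inferInstance, volume.restrict D₂, fun x => p x.1 * q x.2,
      fun x => slitPt sg (γ * γ') (x.1 + x.2), slitPt sg (γ * γ') '' Set.Icc η (2 * η),
      inferInstance, isCompact_Icc.image (continuous_slitPt _ _), ?_, ?_,
      hpq.mono_set Set.sdiff_subset, ?_, ?_, fun n => rfl⟩
    · rintro _ ⟨v, hv, rfl⟩
      exact hW v hv
    · rintro ⟨v, hv, h⟩
      exact slitPt_ne_zero (mul_ne_zero hγ hγ') v h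
    · exact ((continuous_slitPt _ _).comp (by fun_prop)).measurable
    · refine (ae_restrict_iff' (hDm.diff hD₁m)).2 (Eventually.of_forall fun x hx => ?_)
      refine ⟨x.1 + x.2, ⟨?_, ?_⟩, rfl⟩
      · by_contra h
        push Not at h
        exact hx.2 ⟨hx.1.1.1, hx.1.2.1, h⟩
      · linarith [hx.1.1.2, hx.1.2.2]
  have hfinal : slit sg η P γ * slit sg η Q γ' - slit sg η (nconv P Q) (γ * γ') =
      (1 / (2 * Real.pi) ^ 2 : ℂ) • (fun n => ∫ x in D₂, p x.1 * q x.2 * e n (x.1 + x.2)) := by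
    funext n
    have h1 := setIntegral_sdiff hD₁m (hG n) hD₁D
    rw [htri] at h1
    simp only [Pi.sub_apply, Pi.mul_apply, Pi.smul_apply, smul_eq_mul]
    rw [h1, slit, slit, slit, mul_mul_mul_comm, hprod]
    have h2 : ∀ V, (I * sg * slitVal sg (conv P Q) V) * e n V =
        (2 * Real.pi * sg) * (slitVal sg (nconv P Q) V * (slitPt sg (γ * γ') V)⁻¹ ^ n) := by
      intro V
      rw [nconv_slitVal]
      simp only [he]
      linear_combination (-(2 * Real.pi * sg * slitVal sg (nconv P Q) V *
        (slitPt sg (γ * γ') V)⁻¹ ^ n)) * I_mul_I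
    simp only [h2]
    rw [integral_const_mul]
    have h3 : (sg : ℂ) * sg = 1 := by rcases hsg with rfl | rfl <;> simp
    have : (Real.pi : ℂ) ≠ 0 := by simp [Real.pi_ne_zero]
    field_simp
    linear_combination (∫ x in D, p x.1 * q x.2 * e n (x.1 + x.2)) * h3
  rw [hfinal]
  exact (moments W).smul_mem _ hrest

theorem norm_slitPt_inv_pow (sg : ℝ) (γ : ℂ) (v : ℝ) (n : ℕ) :
    ‖(slitPt sg γ v)⁻¹ ^ n‖ = ‖γ‖⁻¹ ^ n := by
  have := norm_exp_ofReal_mul_I (-(sg * v))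
  push_cast at this
  rw [slitPt, norm_pow, norm_inv, norm_mul, this, mul_one]

theorem hasDerivAt_slitPt (sg : ℝ) (γ : ℂ) (v : ℝ) :
    HasDerivAt (slitPt sg γ) (-(sg * I) * slitPt sg γ v) v := by
  have h1 : HasDerivAt (fun v : ℝ => (-(sg * v) * I : ℂ)) (-(sg * I)) v := by
    have := ((((hasDerivAt_id v).ofReal_comp).const_mul (sg : ℂ)).neg).mul_const I
    refine this.congr_deriv ?_
    simp
  refine (h1.cexp.const_mul γ).congr_deriv ?_
  rw [slitPt]
  ring

theorem hasDerivAt_slitPt_inv_pow (sg : ℝ) {γ : ℂ} (hγ : γ ≠ 0) (v : ℝ) (n : ℕ) :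
    HasDerivAt (fun v => (slitPt sg γ v)⁻¹ ^ n) (n * (sg * I) * (slitPt sg γ v)⁻¹ ^ n) v := by
  have h0 := slitPt_ne_zero (sg := sg) hγ v
  refine (((hasDerivAt_slitPt sg γ v).fun_inv h0).fun_pow n).congr_deriv ?_
  rcases n with _ | n
  · simp
  · have h1 : -(-(sg * I) * slitPt sg γ v) / slitPt sg γ v ^ 2 = sg * I * (slitPt sg γ v)⁻¹ := by
      field_simp
    rw [h1, Nat.add_sub_cancel, pow_succ]
    push_cast
    ring

theorem hasDerivAt_slitVal (hsg : sg = 1 ∨ sg = -1) (hP : DifferentiableOn ℂ P {w | w.re < ρ})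
    {v : ℝ} (h0 : 0 < v) (hv : Real.log v < ρ) :
    HasDerivAt (slitVal sg P) (-(sg * I) * slitVal sg (logDer P) v) v := by
  have h1 : HasDerivAt (fun v : ℝ => (Real.log v : ℂ) + (-(sg * (Real.pi / 2)) : ℝ) * I)
      ((v⁻¹ : ℝ) : ℂ) v := ((Real.hasDerivAt_log h0.ne').ofReal_comp).add_const _
  have h2 : HasDerivAt P (deriv P (Real.log v + (-(sg * (Real.pi / 2)) : ℝ) * I))
      (Real.log v + (-(sg * (Real.pi / 2)) : ℝ) * I) :=
    (hP.differentiableAt ((isOpen_re_lt ρ).mem_nhds (by simpa using hv))).hasDerivAt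
  refine (h2.comp v h1).congr_deriv ?_
  rw [slitVal, logDer, neg_add, exp_add, ← ofReal_neg, ← ofReal_exp, Real.exp_neg,
    Real.exp_log h0]
  have h3 : exp (-((-(sg * (Real.pi / 2)) : ℝ) * I)) = I * sg := by
    rw [← exp_sg hsg]
    push_cast
    ring_nf
  have h4 : (sg : ℂ) * sg = 1 := by rcases hsg with rfl | rfl <;> simp
  rw [h3]
  linear_combination (-((v⁻¹ : ℝ) : ℂ) * deriv P (Real.log v + (-(sg * (Real.pi / 2)) : ℝ) * I)) *
    (h4 - sg * sg * I_mul_I)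

/-- Integration by parts along a slit. -/
theorem mul_slit_sub_mem (hsg : sg = 1 ∨ sg = -1) (hP : DifferentiableOn ℂ P {w | w.re < ρ})
    (hP0 : StolzZero P) (hP1 : StolzZero (logDer P)) (hη : 0 < η) (hη' : Real.log η < ρ) {γ : ℂ}
    (hγ : γ ≠ 0) {W : Set ℂ} (hW : slitPt sg γ η ∈ W) :
    (fun n : ℕ => (n : ℂ) * slit sg η P γ n) - slit sg η (logDer P) γ ∈ moments W := by
  have key : (fun n : ℕ => (n : ℂ) * slit sg η P γ n) - slit sg η (logDer P) γ =
      (-(sg * I) * sg / (2 * Real.pi) * slitVal sg P η : ℂ) • fun n => (slitPt sg γ η)⁻¹ ^ n := by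
    funext n
    set e : ℝ → ℂ := fun v => (slitPt sg γ v)⁻¹ ^ n with he
    have hec : Continuous e := ((continuous_slitPt sg _).inv₀ (slitPt_ne_zero hγ)).pow n
    have hi : ∀ {R : ℂ → ℂ}, DifferentiableOn ℂ R {w | w.re < ρ} → StolzZero R →
        IntegrableOn (fun v => slitVal sg R v * e v) (Set.Ioo 0 η) := fun h1 h2 =>
      Integrable.mul_bdd (c := ‖γ‖⁻¹ ^ n)
        ((integrableOn_slitVal h1 h2 hη' sg).mono_set Set.Ioo_subset_Ioc_self)
        hec.aestronglyMeasurable (Eventually.of_forall fun v => (norm_slitPt_inv_pow sg γ v n).le)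
    have hi1 := hi hP hP0
    have hi2 := hi (differentiableOn_logDer hP) hP1
    have hint : IntegrableOn (fun v => -(sg * I) * (slitVal sg (logDer P) v * e v) +
        (n * (sg * I)) * (slitVal sg P v * e v)) (Set.Ioo 0 η) :=
      (hi2.const_mul _).add (hi1.const_mul _)
    have hz : Tendsto (fun v => slitVal sg P v * e v) (𝓝[>] 0) (𝓝 0) := by
      have h1 := hP0.tendsto_add_log (((-(sg * (Real.pi / 2)) : ℝ) : ℂ) * I)
      have h2 := h1.mul (hec.continuousAt.tendsto.mono_left (nhdsWithin_le_nhds (s := Set.Ioi 0)))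
      rw [zero_mul] at h2
      refine h2.congr fun v => ?_
      rw [slitVal, add_comm]
    have hb : Tendsto (fun v => slitVal sg P v * e v) (𝓝[<] η) (𝓝 (slitVal sg P η * e η)) := by
      refine Tendsto.mono_left ?_ nhdsWithin_le_nhds
      exact (hasDerivAt_slitVal hsg hP hη hη').continuousAt.tendsto.mul hec.continuousAt.tendsto
    have h3 := intervalIntegral.integral_eq_sub_of_hasDerivAt_of_tendsto hη
      (f := fun v => slitVal sg P v * e v)
      (f' := fun v => -(sg * I) * (slitVal sg (logDer P) v * e v) +
        (n * (sg * I)) * (slitVal sg P v * e v)) (fun v hv => ?_)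
      ((intervalIntegrable_iff_integrableOn_Ioo_of_le hη.le).2 hint) hz hb
    · rw [intervalIntegral.integral_of_le hη.le, integral_Ioc_eq_integral_Ioo,
        integral_add (hi2.const_mul _) (hi1.const_mul _), integral_const_mul, integral_const_mul,
        sub_zero] at h3
      simp only [Pi.sub_apply, Pi.smul_apply, smul_eq_mul, slit]
      have h4 : (sg : ℂ) * sg = 1 := by rcases hsg with rfl | rfl <;> simp
      change (n : ℂ) * (sg / (2 * Real.pi) * ∫ v in Set.Ioo 0 η, slitVal sg P v * e v) -
        sg / (2 * Real.pi) * (∫ v in Set.Ioo 0 η, slitVal sg (logDer P) v * e v) =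
        (-(sg * I) * sg / (2 * Real.pi) * slitVal sg P η : ℂ) * e η
      rw [mul_assoc _ (slitVal sg P η), ← h3]
      linear_combination (sg / (2 * Real.pi) *
        (n * (∫ v in Set.Ioo 0 η, slitVal sg P v * e v) -
          ∫ v in Set.Ioo 0 η, slitVal sg (logDer P) v * e v)) * (sg * sg * I_mul_I - h4)
    · have h6 := (hasDerivAt_slitVal hsg hP hv.1 (log_lt_of_mem hη' ⟨hv.1, hv.2.le⟩)).fun_mul
        (hasDerivAt_slitPt_inv_pow sg hγ v n)
      refine h6.congr_deriv ?_
      simp only [he]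
      ring
  rw [key]
  exact (moments W).smul_mem _ (moments_dirac hW (slitPt_ne_zero hγ _))

end slit

/-! ### The generating function of a slit near its tip -/

theorem dslope_exp_ne_zero {x : ℂ} (hx : ‖x‖ < 2 * Real.pi) : dslope exp 0 x ≠ 0 := by
  rcases eq_or_ne x 0 with rfl | h
  · rw [dslope_exp_zero]
    exact one_ne_zero
  · intro h0
    have h1 := mul_dslope_zero (f := exp) x
    rw [h0, mul_zero, exp_zero, eq_comm, sub_eq_zero, exp_eq_one_iff] at h1
    obtain ⟨n, rfl⟩ := h1
    have hn : n ≠ 0 := fun h' => h (by rw [h']; simp)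
    have : (1 : ℝ) ≤ |(n : ℝ)| := by exact_mod_cast Int.one_le_abs hn
    simp only [norm_mul, norm_intCast, Complex.norm_ofNat, norm_real, Real.norm_eq_abs,
      abs_of_pos Real.pi_pos, norm_I, mul_one] at hx
    nlinarith [Real.pi_pos]

/-- The regular part of `1 / (1 - exp x)` at `x = 0`, up to sign. -/
noncomputable def kernReg : ℂ → ℂ := dslope (fun x => (dslope exp 0 x)⁻¹) 0

theorem differentiableOn_kernReg :
    DifferentiableOn ℂ kernReg (Metric.ball 0 (2 * Real.pi)) := by
  have hpi : (0 : ℝ) < 2 * Real.pi := by positivity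
  refine (differentiableOn_dslope (Metric.ball_mem_nhds _ hpi)).2 ?_
  refine DifferentiableOn.inv ?_ fun x hx => dslope_exp_ne_zero (by simpa using hx)
  exact (differentiableOn_dslope (Metric.ball_mem_nhds _ hpi)).2 differentiable_exp.differentiableOn

theorem one_sub_exp_inv {x : ℂ} (hx : x ≠ 0) :
    (1 - exp x)⁻¹ = -x⁻¹ - kernReg x := by
  have h1 := mul_dslope_zero (f := exp) x
  have h2 := mul_dslope_zero (f := fun x => (dslope exp 0 x)⁻¹) x
  rw [exp_zero] at h1
  simp only [dslope_exp_zero, inv_one] at h2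
  have h3 : 1 - exp x = -(x * dslope exp 0 x) := by rw [h1]; ring
  have h4 : kernReg x = x⁻¹ * ((dslope exp 0 x)⁻¹ - 1) := by
    rw [← h2, kernReg, inv_mul_cancel_left₀ hx]
  rw [h3, h4, ← neg_inv, mul_inv]
  ring

section tip
variable {N : ℂ → ℂ} {ρ η sg : ℝ}

theorem integral_slitVal_kern (hsg : sg = 1 ∨ sg = -1) (N : ℂ → ℂ) (hη : 0 < η) (σ : ℂ) :
    ∫ v in Set.Ioo 0 η, slitVal sg N v * (exp σ + I * sg * v)⁻¹ =
      -(I * sg) * horInt N (Real.log η) (-(sg * (Real.pi / 2))) σ := by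
  have himg : Real.exp '' Set.Iio (Real.log η) = Set.Ioo 0 η := by
    ext v
    constructor
    · rintro ⟨x, hx, rfl⟩
      exact ⟨Real.exp_pos x, (Real.lt_log_iff_exp_lt hη).1 hx⟩
    · intro hv
      exact ⟨Real.log v, Real.log_lt_log hv.1 hv.2, Real.exp_log hv.1⟩
  have h := integral_image_eq_integral_abs_deriv_smul (measurableSet_Iio (a := Real.log η))
    (fun x _ => (Real.hasDerivAt_exp x).hasDerivWithinAt) Real.exp_injective.injOn
    (fun v : ℝ => slitVal sg N v * (exp σ + I * sg * v)⁻¹)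
  rw [himg] at h
  rw [h, horInt, integral_Iic_eq_integral_Iio, ← integral_const_mul]
  refine setIntegral_congr_fun measurableSet_Iio fun x _ => ?_
  simp only [slitVal, Real.log_exp, abs_of_pos (Real.exp_pos x), real_smul, kern]
  have h3 : exp (-((-(sg * (Real.pi / 2)) : ℝ) * I)) = I * sg := by
    rw [← exp_sg hsg]
    push_cast
    ring_nf
  have h4 : (sg : ℂ) * sg = 1 := by rcases hsg with rfl | rfl <;> simp
  have h5 : exp (σ - (x + (-(sg * (Real.pi / 2)) : ℝ) * I)) =
      exp σ * (Real.exp x : ℂ)⁻¹ * (I * sg) := by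
    rw [← h3, ofReal_exp, ← exp_neg, ← exp_add, ← exp_add]
    ring_nf
  have h6 : exp σ + I * sg * Real.exp x =
      (I * sg * Real.exp x) * (1 - exp σ * (Real.exp x : ℂ)⁻¹ * (I * sg)) := by
    have : (Real.exp x : ℂ) ≠ 0 := by exact_mod_cast (Real.exp_pos x).ne'
    have h7 : (I * sg * Real.exp x) * (1 - exp σ * (Real.exp x : ℂ)⁻¹ * (I * sg)) =
      I * sg * Real.exp x - exp σ * ((Real.exp x : ℂ) * (Real.exp x : ℂ)⁻¹) * (I * I) * (sg * sg) := by
      ring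
    rw [h7, mul_inv_cancel₀ this, h4, I_mul_I]
    ring
  rw [h5, h6, mul_inv, mul_inv, mul_inv]
  have : (Real.exp x : ℂ) ≠ 0 := by exact_mod_cast (Real.exp_pos x).ne'
  have h8 : (sg : ℂ)⁻¹ = sg := by rcases hsg with rfl | rfl <;> simp
  rw [inv_I, h8]
  field_simp

/-- The singular part at its tip of the generating function of a slit. -/
theorem exists_continues_slit (hsg : sg = 1 ∨ sg = -1)
    (hN : DifferentiableOn ℂ N {w | w.re < ρ}) (hN0 : StolzZero N)
    (hη : 0 < η) (hη1 : η ≤ 1) (hη' : Real.log η < ρ) {γ : ℂ} (hγ : γ ≠ 0) :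
    ∃ h A : ℂ → ℂ, Continues (slit sg η N γ) (slitPt sg γ '' Set.Icc 0 η) h ∧
      DifferentiableOn ℂ A (Metric.ball 0 1) ∧ ∀ σ : ℂ, σ.re < Real.log η →
        -(sg * (Real.pi / 2)) < σ.im → σ.im < -(sg * (Real.pi / 2)) + 2 * Real.pi →
        h (γ * exp (exp σ)) =
          cousin N (Real.log η) (-(sg * (Real.pi / 2))) σ + A (exp σ) := by
  have hi := (integrableOn_slitVal hN hN0 hη' sg).mono_set Set.Ioo_subset_Ioc_self
  have hKc : IsCompact (slitPt sg γ '' Set.Icc 0 η) := isCompact_Icc.image (continuous_slitPt sg γ)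
  have hcont := (continues_integral hKc (by
    rintro ⟨v, hv, h⟩
    exact slitPt_ne_zero hγ v h) hi (continuous_slitPt sg γ).measurable
    ((ae_restrict_iff' measurableSet_Ioo).2 (Eventually.of_forall fun v hv =>
      ⟨v, Set.Ioo_subset_Icc_self hv, rfl⟩))).smul (sg / (2 * Real.pi) : ℂ)
  have habs : |sg| = 1 := by rcases hsg with rfl | rfl <;> simp
  have hsmall : ∀ s ∈ Metric.ball (0 : ℂ) 1, ∀ v ∈ Set.Icc 0 η,
      s + I * sg * v ∈ Metric.closedBall (0 : ℂ) 2 := by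
    intro s hs v hv
    rw [mem_closedBall_zero_iff]
    rw [mem_ball_zero_iff] at hs
    refine (norm_add_le _ _).trans ?_
    simp only [norm_mul, norm_I, norm_real, Real.norm_eq_abs, habs, abs_of_nonneg hv.1]
    linarith [hv.2]
  have hsub : Metric.closedBall (0 : ℂ) 2 ⊆ Metric.ball 0 (2 * Real.pi) := by
    refine Metric.closedBall_subset_ball ?_
    linarith [Real.pi_gt_three]
  obtain ⟨C, hC⟩ := (isCompact_closedBall (0 : ℂ) 2).exists_bound_of_continuousOn
    (differentiableOn_kernReg.continuousOn.mono hsub)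
  have hintReg : ∀ s ∈ Metric.ball (0 : ℂ) 1, AEStronglyMeasurable
      (fun v : ℝ => slitVal sg N v * kernReg (s + I * sg * v)) (volume.restrict (Set.Ioo 0 η)) := by
    intro s hs
    refine hi.aestronglyMeasurable.mul (ContinuousOn.aestronglyMeasurable ?_ measurableSet_Ioo)
    exact differentiableOn_kernReg.continuousOn.comp (by fun_prop) fun v hv =>
      hsub (hsmall s hs v (Set.Ioo_subset_Icc_self hv))
  have hbReg : ∀ v ∈ Set.Ioo 0 η, ∀ s ∈ Metric.ball (0 : ℂ) 1,
      ‖slitVal sg N v * kernReg (s + I * sg * v)‖ ≤ ‖slitVal sg N v‖ * C := by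
    intro v hv s hs
    rw [norm_mul]
    exact mul_le_mul_of_nonneg_left (hC _ (hsmall s hs v (Set.Ioo_subset_Icc_self hv)))
      (norm_nonneg _)
  refine ⟨_, fun s => -(sg / (2 * Real.pi)) *
    ∫ v in Set.Ioo 0 η, slitVal sg N v * kernReg (s + I * sg * v), hcont, ?_, ?_⟩
  · refine DifferentiableOn.const_mul ?_ _
    refine differentiableOn_integral_of_dominated Metric.isOpen_ball hintReg ?_ ?_
    · refine (ae_restrict_iff' measurableSet_Ioo).2 (Eventually.of_forall fun v hv => ?_)
      refine DifferentiableOn.const_mul ?_ _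
      exact differentiableOn_kernReg.comp (by fun_prop) fun s hs =>
        hsub (hsmall s hs v (Set.Ioo_subset_Icc_self hv))
    · intro s hs
      refine ⟨1, one_pos, fun v => ‖slitVal sg N v‖ * C, hi.norm.mul_const C, ?_⟩
      exact (ae_restrict_iff' measurableSet_Ioo).2 (Eventually.of_forall fun v hv s _ hs' =>
        hbReg v hv s hs')
  · intro σ h1 h2 h3
    have hs : exp σ ∈ Metric.ball (0 : ℂ) 1 := by
      rw [mem_ball_zero_iff, norm_exp, Real.exp_lt_one_iff]
      exact h1.trans_le (Real.log_nonpos hη.le hη1)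
    rw [cousin_eq_horInt hN hN0 hη' h1 h2 h3]
    have hne : ∀ v ∈ Set.Icc 0 η, exp σ + I * sg * v ≠ 0 := by
      intro v hv h0
      rcases hv.1.eq_or_lt with rfl | hv0
      · simp [exp_ne_zero] at h0
      have e1 : exp σ = exp (Real.log v + (-(sg * (Real.pi / 2)) : ℝ) * I) := by
        have h3 : exp ((-(sg * (Real.pi / 2)) : ℝ) * I) = -(I * sg) := by
          rcases hsg with rfl | rfl
          · have : ((-(1 * (Real.pi / 2)) : ℝ) : ℂ) * I = -(Real.pi / 2 * I) := by push_cast; ring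
            rw [this, exp_neg, exp_pi_div_two_mul_I]
            simp
          · have : ((-(-1 * (Real.pi / 2)) : ℝ) : ℂ) * I = Real.pi / 2 * I := by push_cast; ring
            rw [this, exp_pi_div_two_mul_I]
            simp
        rw [exp_add, ← ofReal_exp, Real.exp_log hv0, h3]
        linear_combination h0
      obtain ⟨n, hn⟩ := exp_eq_exp_iff_exists_int.1 e1
      have h6 := congrArg Complex.im hn
      simp at h6
      have hpi := Real.pi_pos
      have h7 : (n : ℝ) < 1 := by
        by_contra hcon
        push Not at hcon
        nlinarith
      have h8 : (0 : ℝ) < n := by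
        by_contra hcon
        push Not at hcon
        nlinarith
      have a1 : n < 1 := by exact_mod_cast h7
      have a2 : 0 < n := by exact_mod_cast h8
      omega
    have hker : ∀ v ∈ Set.Ioo 0 η, slitVal sg N v * (1 - γ * exp (exp σ) / slitPt sg γ v)⁻¹ =
        -(slitVal sg N v * (exp σ + I * sg * v)⁻¹) - slitVal sg N v * kernReg (exp σ + I * sg * v) := by
      intro v hv
      have e1 : γ * exp (exp σ) / slitPt sg γ v = exp (exp σ + I * sg * v) := by
        rw [slitPt, mul_div_mul_left _ _ hγ, ← exp_sub]
        ring_nf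
      rw [e1, one_sub_exp_inv (hne v (Set.Ioo_subset_Icc_self hv))]
      ring
    have hiReg : IntegrableOn (fun v : ℝ => slitVal sg N v * kernReg (exp σ + I * sg * v))
        (Set.Ioo 0 η) := (hi.norm.mul_const C).mono' (hintReg _ hs)
      ((ae_restrict_iff' measurableSet_Ioo).2 (Eventually.of_forall fun v hv => hbReg v hv _ hs))
    have hiKer : IntegrableOn (fun v : ℝ => slitVal sg N v * (exp σ + I * sg * v)⁻¹)
        (Set.Ioo 0 η) := by
      have h4 : ContinuousOn (fun v : ℝ => (exp σ + I * sg * v)⁻¹) (Set.Icc 0 η) :=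
        ContinuousOn.inv₀ (by fun_prop) hne
      obtain ⟨B, hB⟩ := isCompact_Icc.exists_bound_of_continuousOn h4
      refine Integrable.mul_bdd (c := B) hi ((h4.mono Set.Ioo_subset_Icc_self).aestronglyMeasurable
        measurableSet_Ioo) ((ae_restrict_iff' measurableSet_Ioo).2 (Eventually.of_forall
        fun v hv => hB v (Set.Ioo_subset_Icc_self hv)))
    have hiNeg : IntegrableOn (fun v : ℝ => -(slitVal sg N v * (exp σ + I * sg * v)⁻¹))
        (Set.Ioo 0 η) := hiKer.neg
    rw [setIntegral_congr_fun measurableSet_Ioo hker, integral_sub hiNeg hiReg, integral_neg,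
      integral_slitVal_kern hsg N hη σ]
    have h4 : (sg : ℂ) * sg = 1 := by rcases hsg with rfl | rfl <;> simp
    have hpi : (Real.pi : ℂ) ≠ 0 := by simp [Real.pi_ne_zero]
    have h5 : (1 / (2 * Real.pi * I) : ℂ) = -I / (2 * Real.pi) := by
      field_simp
      rw [I_sq]
      norm_num
    rw [h5]
    linear_combination (I / (2 * Real.pi) * horInt N (Real.log η) (-(sg * (Real.pi / 2))) σ) * h4

end tip

/-! ### The star and the sides of a ray -/

theorem mem_principalStar {S : Set ℂ} {z : ℂ} :
    z ∈ principalStar S ↔ ∀ t ∈ Set.Icc (0 : ℝ) 1, (t : ℂ) * z ∉ S := by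
  simp only [principalStar, Set.mem_ofPred_eq, Set.disjoint_left]
  rw [segment_eq_image]
  constructor
  · intro h t ht
    exact h ⟨t, ht, by simp⟩
  · rintro h _ ⟨t, ht, rfl⟩
    simpa using h t ht

theorem isOpen_principalStar {S : Set ℂ} (hS : IsClosed S) : IsOpen (principalStar S) := by
  rw [isOpen_iff_mem_nhds]
  intro z hz
  rw [mem_principalStar] at hz
  have := (isCompact_Icc (a := (0 : ℝ)) (b := 1)).eventually_forall_of_forall_eventually
    (P := fun z t => ((t : ℝ) : ℂ) * z ∉ S) (x₀ := z) (fun t ht => by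
      have hc : Continuous (fun p : ℂ × ℝ => (p.2 : ℂ) * p.1) := by fun_prop
      have h1 : Sᶜ ∈ 𝓝 (((z, t).2 : ℂ) * (z, t).1) := hS.isOpen_compl.mem_nhds (hz t ht)
      exact hc.continuousAt.eventually h1)
  filter_upwards [this] with y hy
  exact mem_principalStar.2 hy

theorem starConvex_principalStar (S : Set ℂ) : StarConvex ℝ (0 : ℂ) (principalStar S) := by
  rw [starConvex_iff_segment_subset]
  intro z hz y hy
  refine Set.disjoint_of_subset_left ?_ hz
  exact (convex_segment (0 : ℂ) z).segment_subset (left_mem_segment ℝ 0 z) hy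

theorem IsSingularSet.isClosed {S : Set ℂ} (hS : IsSingularSet S) : IsClosed S := by
  rw [← isOpen_compl_iff, isOpen_iff_mem_nhds]
  intro z hz
  have h1 : (S ∩ Metric.closedBall 0 (‖z‖ + 1))ᶜ ∈ 𝓝 z :=
    (hS.2 _).isClosed.isOpen_compl.mem_nhds fun h => hz h.1
  have h2 : ∀ᶠ y in 𝓝 z, ‖y‖ < ‖z‖ + 1 :=
    continuous_norm.continuousAt.eventually (gt_mem_nhds (by linarith))
  filter_upwards [h1, h2] with y hy hy' hyS
  exact hy ⟨hyS, by simpa using hy'.le⟩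

/-- The sign of the imaginary part on a side. -/
def Side.sgn : Side → ℝ
  | .left => 1
  | .right => -1

theorem Side.sgn_eq (σ : Side) : σ.sgn = 1 ∨ σ.sgn = -1 := by
  cases σ <;> simp [Side.sgn]

theorem Side.sgn_mul_self (σ : Side) : σ.sgn * σ.sgn = 1 := by
  cases σ <;> simp [Side.sgn]

theorem Side.sin_pos {σ : Side} {x : ℝ} (hx : x ∈ σ.args) : 0 < σ.sgn * Real.sin x := by
  cases σ with
  | left => simpa [Side.sgn] using Real.sin_pos_of_mem_Ioo hx
  | right =>
    have h1 : Real.sin (x - Real.pi) = -Real.sin x := Real.sin_sub_pi x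
    have h2 : 0 < Real.sin (x - Real.pi) :=
      Real.sin_pos_of_pos_of_lt_pi (by linarith [hx.1]) (by linarith [hx.2])
    simp only [Side.sgn]
    linarith

theorem Side.mem_args_of_sin_pos {σ : Side} {x y : ℝ} (hy : y ∈ σ.args) (hxy : |x - y| ≤ 1)
    (hx : 0 < σ.sgn * Real.sin x) : x ∈ σ.args := by
  have hpi := Real.pi_gt_three
  rw [abs_le] at hxy
  cases σ with
  | left =>
    simp only [Side.sgn, one_mul] at hx
    refine ⟨?_, ?_⟩
    · by_contra h
      have := Real.sin_nonpos_of_nonpos_of_neg_pi_le (x := x) (by linarith)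
        (by linarith [hy.1, hxy.1])
      linarith
    · by_contra h
      push Not at h
      have := Real.sin_nonneg_of_nonneg_of_le_pi (x := x - Real.pi) (by linarith)
        (by linarith [hy.2, hxy.2])
      rw [Real.sin_sub_pi] at this
      linarith
  | right =>
    simp only [Side.sgn] at hx
    refine ⟨?_, ?_⟩
    · by_contra h
      push Not at h
      have := Real.sin_nonneg_of_nonneg_of_le_pi (x := x) (by linarith [hy.1, hxy.1]) (by linarith)
      linarith
    · by_contra h
      push Not at h
      have := Real.sin_nonneg_of_nonneg_of_le_pi (x := x - 2 * Real.pi) (by linarith)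
        (by linarith [hy.2, hxy.2])
      rw [Real.sin_sub_two_pi] at this
      linarith

theorem Side.exists_log (σ : Side) {u : ℂ} (hu : 0 < σ.sgn * u.im) :
    ∃ w : ℂ, exp w = u ∧ w.im ∈ σ.args ∧ w.re = Real.log ‖u‖ := by
  have hne : u ≠ 0 := by
    rintro rfl
    simp at hu
  cases σ with
  | left =>
    simp only [Side.sgn, one_mul] at hu
    refine ⟨log u, exp_log hne, ?_, log_re u⟩
    rw [log_im]
    refine ⟨(arg_nonneg_iff.2 hu.le).lt_of_ne fun h => ?_, (arg_le_pi u).lt_of_ne fun h => ?_⟩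
    · exact hu.ne' (arg_eq_zero_iff.1 h.symm).2
    · exact hu.ne' (arg_eq_pi_iff.1 h).2
  | right =>
    have hu' : u.im < 0 := by simp only [Side.sgn] at hu; linarith
    refine ⟨log u + 2 * Real.pi * I, ?_, ?_, ?_⟩
    · rw [exp_add, exp_log hne, exp_two_pi_mul_I, mul_one]
    · have h1 := arg_neg_iff.2 hu'
      have h2 := neg_pi_lt_arg u
      have : (log u + 2 * Real.pi * I).im = arg u + 2 * Real.pi := by simp [log_im]
      rw [this]
      constructor <;> linarith
    · simp [log_re]

/-- Points near `α` on one side, in the coordinate `z`. -/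
theorem eventually_side_of_eventually_pt {σ : Side} {α : ℂ} (hα : α ≠ 0) {Q : ℂ → Prop}
    (h : ∀ᶠ w in logFilter, w.im ∈ σ.args → Q (pt α w)) :
    ∀ᶠ z in 𝓝 α, 0 < σ.sgn * (z / α).im → Q z := by
  obtain ⟨ρ, hρ⟩ := eventually_logFilter.1 h
  have h1 : ∀ᶠ z in 𝓝 α, ‖z / α - 1‖ < Real.exp ρ := by
    have hc : ContinuousAt (fun z => ‖z / α - 1‖) α := by fun_prop
    refine hc.eventually (gt_mem_nhds ?_)
    simp [hα, Real.exp_pos]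
  filter_upwards [h1] with z hz him
  obtain ⟨w, hw1, hw2, hw3⟩ := σ.exists_log (u := z / α - 1) (by simpa using him)
  have hpt : pt α w = z := by
    rw [pt, hw1]
    field_simp
    ring
  rw [← hpt]
  refine hρ w ?_ hw2
  rw [hw3]
  refine (Real.log_lt_iff_lt_exp ?_).2 hz
  rw [← hw1]
  exact norm_pos_iff.2 (exp_ne_zero w)

theorem pt_div_im (σ : Side) {α w : ℂ} (hα : α ≠ 0) (hw : w.im ∈ σ.args) :
    0 < σ.sgn * (pt α w / α).im := by
  have : pt α w / α = 1 + exp w := by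
    rw [pt]
    field_simp
  rw [this, add_im, one_im, zero_add, exp_im, mul_left_comm]
  exact mul_pos (Real.exp_pos _) (Side.sin_pos hw)

theorem eventually_pt_of_eventually_side {σ : Side} {α : ℂ} (hα : α ≠ 0) {Q : ℂ → Prop}
    (h : ∀ᶠ z in 𝓝 α, 0 < σ.sgn * (z / α).im → Q z) :
    ∀ᶠ w in logFilter, w.im ∈ σ.args → Q (pt α w) := by
  filter_upwards [(tendsto_pt α).eventually h] with w h1 hw
  exact h1 (pt_div_im σ hα hw)

theorem eventually_exp_side {σ : Side} {p : ℂ} {Q : ℂ → Prop}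
    (h : ∀ᶠ z in 𝓝 (exp p), 0 < σ.sgn * (z / exp p).im → Q z) :
    ∀ᶠ s in 𝓝 p, 0 < σ.sgn * (s - p).im → Q (exp s) := by
  have h1 : ∀ᶠ s in 𝓝 p, ‖s - p‖ < Real.pi := by
    have hc : ContinuousAt (fun s => ‖s - p‖) p := by fun_prop
    exact hc.eventually (gt_mem_nhds (by simpa using Real.pi_pos))
  filter_upwards [continuous_exp.continuousAt.eventually h, h1] with s hs hs' him
  refine hs ?_
  rw [← exp_sub, exp_im, mul_left_comm]
  refine mul_pos (Real.exp_pos _) ?_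
  have h2 := abs_lt.1 ((abs_im_le_norm (s - p)).trans_lt hs')
  rcases σ.sgn_eq with h3 | h3 <;> rw [h3] at him ⊢
  · rw [one_mul] at him ⊢
    exact Real.sin_pos_of_pos_of_lt_pi him h2.2
  · have := Real.sin_neg_of_neg_of_neg_pi_lt (x := (s - p).im) (by linarith) h2.1
    linarith

theorem eventually_wOf_mem_args (σ : Side) :
    ∀ᶠ w in logFilter, w.im ∈ σ.args → (wOf w).im ∈ σ.args := by
  filter_upwards [eventually_wOf_sub_le one_pos, eventually_exp_wOf, eventually_re_lt 0]
    with w h1 h2 h3 hw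
  refine Side.mem_args_of_sin_pos hw (le_trans ?_ h1) ?_
  · rw [← sub_im]
    exact abs_im_le_norm _
  · have h4 := congrArg Complex.im h2
    rw [sub_im, one_im, sub_zero, exp_im, exp_im, exp_im] at h4
    have h5 := Side.sin_pos hw
    have hE : Real.exp w.re < 1 := Real.exp_lt_one_iff.2 h3
    have hE0 := Real.exp_pos w.re
    have h6 : 0 < σ.sgn * Real.sin (Real.exp w.re * Real.sin w.im) := by
      have hpi := Real.pi_gt_three
      have h7 := Real.sin_le_one w.im
      have h8 := Real.neg_one_le_sin w.im
      rcases σ.sgn_eq with h9 | h9 <;> rw [h9] at h5 ⊢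
      · rw [one_mul] at h5 ⊢
        exact Real.sin_pos_of_pos_of_lt_pi (by positivity) (by nlinarith)
      · have := Real.sin_neg_of_neg_of_neg_pi_lt
          (x := Real.exp w.re * Real.sin w.im) (by nlinarith) (by nlinarith)
        linarith
    have h7 : 0 < Real.exp (wOf w).re * (σ.sgn * Real.sin (wOf w).im) := by
      have := mul_pos (Real.exp_pos (exp w).re) h6
      have h10 : Real.exp (wOf w).re * (σ.sgn * Real.sin (wOf w).im) =
        σ.sgn * (Real.exp (wOf w).re * Real.sin (wOf w).im) := by ring
      rw [h10, h4]
      linarith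
    exact (pos_iff_pos_of_mul_pos h7).1 (Real.exp_pos _)

/-! ### The radial primitive of a principal branch -/

/-- A function on the star of `S` with, from the side of sign `sg`, analytic continuations across
the rays and, at the points of `S`, singularities of variation `P` that are weak enough to be
integrable along curves ending there. The coordinate is `s = log z`. -/
structure SeamData (σ : Side) (S : Set ℂ) (Φ : ℂ → ℂ) (P : ℂ → ℂ → ℂ) : Prop where
  differentiableOn : DifferentiableOn ℂ Φ (principalStar S)
  seam : ∀ p : ℂ, exp p ∉ S → ∃ φ : ℂ → ℂ, AnalyticAt ℂ φ p ∧
    ∀ᶠ s in 𝓝 p, 0 < σ.sgn * (s - p).im → Φ (exp s) = φ s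
  tip : ∀ α ∈ S, ∃ (ρ : ℝ) (φ : ℂ → ℂ) (C : ℝ), DifferentiableOn ℂ φ {w | w.re < ρ} ∧
    DifferentiableOn ℂ (P α) {w | w.re < ρ} ∧
    (∀ w : ℂ, w.re < ρ → |w.im| ≤ 3 * Real.pi → ‖φ w‖ ≤ C * Real.exp (-w.re / 2)) ∧
    (∀ w : ℂ, w.re < ρ → φ (w + 2 * Real.pi * I) - φ w = P α w) ∧
    ∀ w : ℂ, w.re < ρ → w.im ∈ σ.args → Φ (α * exp (exp w)) = φ w

theorem norm_primitive_le {Ψ g : ℂ → ℂ} {ρ ρ' : ℝ} (hρ : ρ' < ρ)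
    (hΨ : ∀ w : ℂ, w.re < ρ → HasDerivAt Ψ (g w) w) (hg : StolzZero g)
    (hgc : ContinuousOn g {w | w.re < ρ}) {M : ℝ} (hM : 0 ≤ M) :
    ∃ C, ∀ w : ℂ, w.re < ρ' → |w.im| ≤ M → ‖Ψ w‖ ≤ C * Real.exp (-w.re / 2) := by
  obtain ⟨C, hC0, hC⟩ := hg.exists_bound hρ hgc M
  have hconv : Convex ℝ {y : ℂ | y.re ≤ ρ' ∧ |y.im| ≤ M} := by
    have h5 : {y : ℂ | y.re ≤ ρ' ∧ |y.im| ≤ M} =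
      {y : ℂ | y.re ≤ ρ'} ∩ ({y | -M ≤ y.im} ∩ {y | y.im ≤ M}) := by
      ext y; simp [abs_le]
    rw [h5]
    exact (convex_halfSpace_re_le _).inter
      ((convex_halfSpace_im_ge _).inter (convex_halfSpace_im_le _))
  refine ⟨(‖Ψ ρ'‖ + C * (2 + M)) * Real.exp (ρ' / 2), fun w h1 h2 => ?_⟩
  have h3 := hconv.norm_image_sub_le_of_norm_hasDerivWithin_le (f := Ψ) (f' := g) (C := C)
    (x := (ρ' : ℂ)) (y := w)
    (fun y hy => (hΨ y (hy.1.trans_lt hρ)).hasDerivWithinAt) (fun y hy => hC y hy.1 hy.2)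
    ⟨by simp, by simpa using hM⟩ ⟨h1.le, h2⟩
  have h4 : ‖w - ρ'‖ ≤ (ρ' - w.re) + M := by
    refine (norm_le_abs_re_add_abs_im _).trans ?_
    simp only [sub_re, ofReal_re, sub_im, ofReal_im, sub_zero]
    rw [abs_sub_comm, abs_of_nonneg (by linarith)]
    linarith
  set x := ρ' - w.re with hx
  have hx0 : 0 ≤ x := by linarith
  have h5 : x + M ≤ (2 + M) * Real.exp (x / 2) := by
    have := Real.add_one_le_exp (x / 2)
    nlinarith
  have h6 : 1 ≤ Real.exp (x / 2) := Real.one_le_exp (by positivity)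
  have h7 : Real.exp (ρ' / 2) * Real.exp (-w.re / 2) = Real.exp (x / 2) := by
    rw [← Real.exp_add, hx]
    ring_nf
  have h8 : ‖Ψ w‖ ≤ ‖Ψ ρ'‖ + ‖Ψ w - Ψ ρ'‖ := by
    have := norm_add_le (Ψ ρ') (Ψ w - Ψ ρ')
    rwa [add_sub_cancel] at this
  rw [mul_assoc, h7]
  have h9 : ‖Ψ ρ'‖ ≤ ‖Ψ ρ'‖ * Real.exp (x / 2) := le_mul_of_one_le_right (norm_nonneg _) h6
  calc ‖Ψ w‖ ≤ ‖Ψ ρ'‖ * Real.exp (x / 2) + C * ((2 + M) * Real.exp (x / 2)) := by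
        refine h8.trans (add_le_add h9 (h3.trans ?_))
        exact mul_le_mul_of_nonneg_left (h4.trans h5) hC0
    _ = _ := by ring

theorem hasSum_of_hasDerivAt {F : ℕ → ℂ} {f Φ : ℂ → ℂ}
    (hf : ∀ᶠ z in 𝓝 (0 : ℂ), HasSum (fun n => F n * z ^ n) (f z))
    (hΦ : ∀ᶠ z in 𝓝 (0 : ℂ), HasDerivAt Φ (dslope f 0 z) z) :
    ∃ A : ℕ → ℂ, (∀ n, n ≠ 0 → F n = n * A n) ∧
      ∀ᶠ z in 𝓝 (0 : ℂ), HasSum (fun n => A n * z ^ n) (Φ z) := by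
  have hp : HasFPowerSeriesAt f (FormalMultilinearSeries.ofScalars ℂ F) 0 := by
    rw [hasFPowerSeriesAt_iff]
    filter_upwards [hf] with z hz
    simpa [mul_comm] using hz
  have hq := HasFPowerSeriesAt.has_fpower_series_dslope_fslope hp
  have hda : AnalyticAt ℂ Φ 0 := by
    obtain ⟨r, hr, hball⟩ := Metric.eventually_nhds_iff_ball.1 hΦ
    exact DifferentiableOn.analyticAt (s := Metric.ball 0 r)
      (fun z hz => (hball z hz).differentiableAt.differentiableWithinAt) (Metric.ball_mem_nhds _ hr)
  have hder : deriv Φ =ᶠ[𝓝 0] dslope f 0 := by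
    filter_upwards [hΦ] with z hz using hz.deriv
  have h1 := hda.hasFPowerSeriesAt
  have h2 : HasFPowerSeriesAt (dslope f 0) _ 0 := (hda.deriv.congr hder).hasFPowerSeriesAt
  have h3 := h2.eq_formalMultilinearSeries hq
  refine ⟨fun n => iteratedDeriv n Φ 0 / n.factorial, fun n hn => ?_, ?_⟩
  · obtain ⟨m, rfl⟩ := Nat.exists_eq_succ_of_ne_zero hn
    have h4 := congrArg (fun p => FormalMultilinearSeries.coeff p m) h3
    simp only [FormalMultilinearSeries.coeff_fslope, FormalMultilinearSeries.coeff_ofScalars] at h4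
    have h5 : iteratedDeriv m (dslope f 0) 0 = iteratedDeriv (m + 1) Φ 0 := by
      rw [iteratedDeriv_succ', (hder.iteratedDeriv_eq m)]
    simp only
    rw [Nat.succ_eq_add_one, ← h4, h5, Nat.factorial_succ]
    have : (m.factorial : ℂ) ≠ 0 := by exact_mod_cast m.factorial_ne_zero
    have h6 : ((m : ℂ) + 1) ≠ 0 := by exact_mod_cast m.succ_ne_zero
    push_cast
    field_simp
  · rw [hasFPowerSeriesAt_iff] at h1
    filter_upwards [h1] with z hz
    simpa [mul_comm, FormalMultilinearSeries.coeff_ofScalars] using hz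

section primitive
variable {F : PowerSeries ℂ} {S : Set ℂ} {f Φ : ℂ → ℂ} {σ : Side}

theorem seam_primitive (hS : IsSingularSet S)
    (hΦ : ∀ z ∈ principalStar S, HasDerivAt Φ (dslope f 0 z) z) {α : ℂ} (hα : α ≠ 0)
    (hreg : IsRegularAt f σ α) : ∃ ψ : ℂ → ℂ, AnalyticAt ℂ ψ α ∧
      ∀ᶠ z in 𝓝 α, 0 < σ.sgn * (z / α).im → Φ z = ψ z := by
  obtain ⟨φ, hφ, hφf⟩ := hreg
  have h1 := eventually_side_of_eventually_pt (Q := fun z => f z = φ z) hα hφf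
  have h2 := eventually_side_of_eventually_pt hα (eventually_pt_mem_star hS σ α)
  have h3 : ∀ᶠ z in 𝓝 α, z ≠ 0 := isOpen_ne.mem_nhds hα
  obtain ⟨r, hr, hball⟩ := Metric.eventually_nhds_iff_ball.1
    (h1.and (h2.and (h3.and hφ.eventually_analyticAt)))
  set B := Metric.ball α r with hB
  have hgd : DifferentiableOn ℂ (fun z => (φ z - f 0) / z) B := fun z hz =>
    (((hball z hz).2.2.2.differentiableAt.sub_const _).div differentiableAt_id
      (hball z hz).2.2.1).differentiableWithinAt
  obtain ⟨ψ, hψ⟩ := exists_primitive_of_starConvex Metric.isOpen_ball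
    ((convex_ball α r).starConvex (Metric.mem_ball_self hr)) hgd
  set D := B ∩ {z | 0 < σ.sgn * (z / α).im} with hD
  have hDo : IsOpen D := by
    refine Metric.isOpen_ball.inter (isOpen_lt continuous_const ?_)
    fun_prop
  have hDc : IsPreconnected D := by
    refine ((convex_ball α r).inter ?_).isPreconnected
    have hl : IsLinearMap ℝ (fun z : ℂ => σ.sgn * (z / α).im) :=
      { map_add := fun x y => by simp only [add_div, add_im]; ring
        map_smul := fun c x => by
          simp only [real_smul, mul_div_assoc, im_ofReal_mul, smul_eq_mul]; ring }
    exact convex_halfSpace_gt hl 0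
  have hDer : ∀ z ∈ D, HasDerivAt (fun z => Φ z - ψ z) 0 z := by
    intro z hz
    obtain ⟨e1, e2, e3, e4⟩ := hball z hz.1
    have h5 := (hΦ z (e2 hz.2)).sub (hψ z hz.1)
    refine h5.congr_deriv ?_
    rw [dslope_of_ne _ e3, slope, vsub_eq_sub, smul_eq_mul, e1 hz.2, sub_zero]
    field_simp
    ring
  have hconst : ∃ c, ∀ z ∈ D, Φ z - ψ z = c := by
    rcases D.eq_empty_or_nonempty with h | ⟨z₀, hz₀⟩
    · exact ⟨0, by simp [h]⟩
    · exact ⟨_, fun z hz => hDo.is_const_of_deriv_eq_zero hDc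
        (fun z hz => (hDer z hz).differentiableAt.differentiableWithinAt)
        (fun z hz => (hDer z hz).deriv) hz hz₀⟩
  obtain ⟨c, hc⟩ := hconst
  refine ⟨fun z => ψ z + c, ?_, ?_⟩
  · exact (DifferentiableOn.analyticAt (s := B) (fun z hz =>
      (hψ z hz).differentiableAt.differentiableWithinAt) (Metric.ball_mem_nhds _ hr)).add
      analyticAt_const
  · filter_upwards [Metric.ball_mem_nhds α hr] with z hz him
    rw [← hc z ⟨hz, him⟩]
    ring

theorem tip_primitive (hS : IsSingularSet S) 
    (hΦ : ∀ z ∈ principalStar S, HasDerivAt Φ (dslope f 0 z) z) {α : ℂ} (hα : α ≠ 0)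
    {g : LogGerm} (hg : g ∈ integrableGerms) (hb : IsBranchAt f σ α g) :
    ∃ (P : ℂ → ℂ) (ρ : ℝ) (φ : ℂ → ℂ) (C : ℝ), Tame P ∧ chart (logDer P) = Del g ∧
      DifferentiableOn ℂ φ {w | w.re < ρ} ∧ DifferentiableOn ℂ P {w | w.re < ρ} ∧
    (∀ w : ℂ, w.re < ρ → |w.im| ≤ 3 * Real.pi → ‖φ w‖ ≤ C * Real.exp (-w.re / 2)) ∧
    (∀ w : ℂ, w.re < ρ → φ (w + 2 * Real.pi * I) - φ w = P w) ∧
    ∀ w : ℂ, w.re < ρ → w.im ∈ σ.args → Φ (α * exp (exp w)) = φ w := by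
  have hpi := Real.pi_pos
  obtain ⟨q, hq, hqa, hq0⟩ := exists_chart_of_mem_integrableGerms hg
  obtain ⟨f₀, hf₀, hbr⟩ := hb
  have e1 : ∀ᶠ w in logFilter, f₀ (wOf w) = q w := by
    have : chart (fun w => f₀ (wOf w)) = chart q := by rw [chart_comp_wOf, hf₀, hq]
    exact chart_eq_iff.1 this
  have hstar : ∀ᶠ w in logFilter, w.im ∈ σ.args → α * exp (exp w) ∈ principalStar S := by
    filter_upwards [tendsto_wOf.eventually (eventually_pt_mem_star hS σ α), eventually_pt_wOf α,
      eventually_wOf_mem_args σ] with w h1 h2 h3 hw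
    rw [← h2]
    exact h1 (h3 hw)
  have hval : ∀ᶠ w in logFilter, w.im ∈ σ.args → f (α * exp (exp w)) = q w := by
    filter_upwards [tendsto_wOf.eventually hbr, eventually_pt_wOf α, eventually_wOf_mem_args σ, e1]
      with w h1 h2 h3 h4 hw
    rw [← h2, ← h1.2 (h3 hw), h4]
  obtain ⟨ρ₁, hρ₁⟩ := eventually_analyticAt_iff.1 hqa
  obtain ⟨ρ₂, hρ₂⟩ := eventually_logFilter.1 (hstar.and hval)
  set ρ := min ρ₁ ρ₂ with hρ
  obtain ⟨Ψ, hΨ⟩ := exists_primitive_re_lt (f := fun w => exp w * q w)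
    (differentiable_exp.differentiableOn.mul hρ₁)
  obtain ⟨hT, hT'⟩ := tame_variation hq0 hΨ
  set D : Set ℂ := {w : ℂ | w.re < ρ} ∩ {w | w.im ∈ σ.args} with hD
  have hDo : IsOpen D := by
    refine (isOpen_re_lt ρ).inter ?_
    cases σ
    · exact isOpen_Ioo.preimage Complex.continuous_im
    · exact isOpen_Ioo.preimage Complex.continuous_im
  have hDc : IsPreconnected D := by
    refine ((convex_halfSpace_re_lt ρ).inter ?_).isPreconnected
    cases σ
    · exact (convex_halfSpace_im_gt _).inter (convex_halfSpace_im_lt _)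
    · exact (convex_halfSpace_im_gt _).inter (convex_halfSpace_im_lt _)
  have hDer : ∀ w ∈ D, HasDerivAt (fun w => Φ (α * exp (exp w)) - (Ψ w - f 0 * exp w)) 0 w := by
    intro w hw
    have h1 : w.re < ρ₁ := lt_of_lt_of_le hw.1 (min_le_left _ _)
    obtain ⟨h2, h3⟩ := hρ₂ w (lt_of_lt_of_le hw.1 (min_le_right _ _))
    have h4 : HasDerivAt (fun w => α * exp (exp w)) (α * (exp (exp w) * exp w)) w :=
      ((Complex.hasDerivAt_exp w).cexp).const_mul α
    have h5 := (hΦ _ (h2 hw.2)).comp w h4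
    have h6 := h5.sub ((hΨ w h1).sub ((Complex.hasDerivAt_exp w).const_mul (f 0)))
    refine h6.congr_deriv ?_
    have hne : α * exp (exp w) ≠ 0 := mul_ne_zero hα (exp_ne_zero _)
    rw [dslope_of_ne _ hne, slope, vsub_eq_sub, smul_eq_mul, h3 hw.2, sub_zero]
    field_simp
    ring
  have hconst : ∃ c, ∀ w ∈ D, Φ (α * exp (exp w)) - (Ψ w - f 0 * exp w) = c := by
    rcases D.eq_empty_or_nonempty with h | ⟨z₀, hz₀⟩
    · exact ⟨0, by simp [h]⟩
    · exact ⟨_, fun z hz => hDo.is_const_of_deriv_eq_zero hDc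
        (fun z hz => (hDer z hz).differentiableAt.differentiableWithinAt)
        (fun z hz => (hDer z hz).deriv) hz hz₀⟩
  obtain ⟨c, hc⟩ := hconst
  have hφd : ∀ w : ℂ, w.re < ρ₁ → HasDerivAt (fun w => Ψ w - f 0 * exp w + c)
      (exp w * q w - f 0 * exp w) w := fun w hw =>
    ((hΨ w hw).sub ((Complex.hasDerivAt_exp w).const_mul (f 0))).add_const c
  obtain ⟨C, hC⟩ := norm_primitive_le (M := 3 * Real.pi) (show ρ₁ - 1 < ρ₁ by linarith) hφd
    (hq0.sub ((stolzZero_of_tendsto tendsto_exp_logFilter).const_mul (f 0)))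
    ((continuous_exp.continuousOn.mul hρ₁.continuousOn).sub (by fun_prop)) (by positivity)
  refine ⟨fun w => Ψ (w + 2 * Real.pi * I) - Ψ w, min ρ (ρ₁ - 1),
    fun w => Ψ w - f 0 * exp w + c, C, hT, ?_, ?_, ?_, ?_, ?_, ?_⟩
  · rw [← hq, Del_chart, chart_eq_iff]
    exact hT'
  · intro w hw
    have h1 : w.re < ρ₁ - 1 := lt_of_lt_of_le hw (min_le_right _ _)
    exact (hφd w (by linarith)).differentiableAt.differentiableWithinAt
  · intro w hw
    have h1 : w.re < ρ₁ - 1 := lt_of_lt_of_le hw (min_le_right _ _)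
    have h2 := (hΨ (w + 2 * Real.pi * I) (by simp; linarith)).comp_add_const w _
    exact (h2.sub (hΨ w (by linarith))).differentiableAt.differentiableWithinAt
  · intro w hw
    exact hC w (lt_of_lt_of_le hw (min_le_right _ _))
  · intro w _
    simp only
    rw [Complex.exp_periodic w]
    ring
  · intro w hw him
    rw [← hc w ⟨lt_of_lt_of_le hw (min_le_left _ _), him⟩]
    ring

end primitive

/-- The radial primitive of a function with integrable singularities, seen from one side. -/
theorem HasIntegrableSingularities.exists_seamData {F : PowerSeries ℂ} {S : Set ℂ}
    (hF : HasIntegrableSingularities F S) (σ : Side) :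
    ∃ (Φ : ℂ → ℂ) (A : ℕ → ℂ) (P : ℂ → ℂ → ℂ), SeamData σ S Φ P ∧
      (∀ n, n ≠ 0 → PowerSeries.coeff n F = n * A n) ∧
      (∀ᶠ z in 𝓝 (0 : ℂ), HasSum (fun n => A n * z ^ n) (Φ z)) ∧
      ∀ α ∈ S, Tame (P α) ∧ chart (logDer (P α)) = Del (localBranch σ α F) := by
  have hS := hF.1
  obtain ⟨-, f, hf, h⟩ := id hF
  have hopen := isOpen_principalStar hS.isClosed
  have h0 := zero_mem_star hS
  have hfd : DifferentiableOn ℂ f (principalStar S) := hf.analytic.differentiableOn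
  have hqd : DifferentiableOn ℂ (dslope f 0) (principalStar S) :=
    (differentiableOn_dslope (hopen.mem_nhds h0)).2 hfd
  obtain ⟨Φ₀, hΦ₀⟩ := exists_primitive_of_starConvex hopen (starConvex_principalStar S) hqd
  set Φ : ℂ → ℂ := fun z => Φ₀ z - Φ₀ 0
  have hΦ : ∀ z ∈ principalStar S, HasDerivAt Φ (dslope f 0 z) z := fun z hz =>
    (hΦ₀ z hz).sub_const _
  obtain ⟨A, hA, hA'⟩ := hasSum_of_hasDerivAt (F := fun n => PowerSeries.coeff n F) hf.hasSum
    (Φ := Φ) (by filter_upwards [hopen.mem_nhds h0] with z hz using hΦ z hz)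
  have hloc : ∀ α ∈ S, ∃ g ∈ integrableGerms, IsBranchAt f σ α g := (h σ).1
  have htip : ∀ α ∈ S, ∃ (P : ℂ → ℂ) (ρ : ℝ) (φ : ℂ → ℂ) (C : ℝ), Tame P ∧
      chart (logDer P) = Del (localBranch σ α F) ∧
      DifferentiableOn ℂ φ {w | w.re < ρ} ∧ DifferentiableOn ℂ P {w | w.re < ρ} ∧
    (∀ w : ℂ, w.re < ρ → |w.im| ≤ 3 * Real.pi → ‖φ w‖ ≤ C * Real.exp (-w.re / 2)) ∧
    (∀ w : ℂ, w.re < ρ → φ (w + 2 * Real.pi * I) - φ w = P w) ∧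
    ∀ w : ℂ, w.re < ρ → w.im ∈ σ.args → Φ (α * exp (exp w)) = φ w := by
    intro α hα
    obtain ⟨g, hg, hb⟩ := hloc α hα
    have hα0 : α ≠ 0 := fun h => hS.1 (h ▸ hα)
    have := tip_primitive hS hΦ hα0 hg hb
    rwa [IsLocalBranch.localBranch_eq ⟨S, f, hS, hf, hb⟩]
  choose! P hP using htip
  refine ⟨Φ, A, P, ⟨fun z hz => (hΦ z hz).differentiableAt.differentiableWithinAt, ?_, ?_⟩, hA, hA',
    fun α hα => ?_⟩
  · intro p hp
    obtain ⟨ψ, h1, h2⟩ := seam_primitive hS hΦ (exp_ne_zero p) ((h σ).2 _ hp)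
    exact ⟨fun s => ψ (exp s), h1.comp_of_eq analyticAt_cexp rfl,
      eventually_exp_side (Q := fun z => Φ z = ψ z) h2⟩
  · intro α hα
    obtain ⟨ρ, φ, C, -, -, h3⟩ := hP α hα
    exact ⟨ρ, φ, C, h3⟩
  · obtain ⟨ρ, φ, C, h1, h2, -⟩ := hP α hα
    exact ⟨h1, h2⟩

/-! ### Cauchy's theorem on rectangles in the logarithmic plane -/

/-- The point with real part `x` and imaginary part `sg * y`. -/
noncomputable def cpt (sg x y : ℝ) : ℂ := x + (sg * y : ℝ) * I

@[simp] theorem cpt_re (sg x y : ℝ) : (cpt sg x y).re = x := by simp [cpt]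

@[simp] theorem cpt_im (sg x y : ℝ) : (cpt sg x y).im = sg * y := by simp [cpt]

theorem continuous_cpt_left (sg y : ℝ) : Continuous fun x => cpt sg x y := by
  unfold cpt
  fun_prop

theorem continuous_cpt_right (sg x : ℝ) : Continuous fun y => cpt sg x y := by
  unfold cpt
  fun_prop

variable {sg : ℝ} {g : ℂ → ℂ}

theorem integral_rect (hsg : sg = 1 ∨ sg = -1) {u' u a b : ℝ}
    (hg : ∀ x ∈ Set.uIcc u' u, ∀ y ∈ Set.uIcc a b, DifferentiableAt ℂ g (cpt sg x y)) :
    (∫ y in a..b, g (cpt sg u y)) - ∫ y in a..b, g (cpt sg u' y) =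
      -(I * sg) * ∫ x in u'..u, (g (cpt sg x b) - g (cpt sg x a)) := by
  have h4 : (sg : ℂ) * sg = 1 := by rcases hsg with rfl | rfl <;> simp
  have h0 : sg ≠ 0 := by rcases hsg with rfl | rfl <;> simp
  have h5 : sg * sg = 1 := by exact_mod_cast h4
  have hint : ∀ y ∈ Set.uIcc a b, IntervalIntegrable (fun x => g (cpt sg x y)) volume u' u :=
    fun y hy => ContinuousOn.intervalIntegrable fun x hx => ((hg x hx y hy).continuousAt.comp
      (f := fun x => cpt sg x y) (continuous_cpt_left sg y).continuousAt).continuousWithinAt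
  have h1 := integral_boundary_rect_eq_zero_of_differentiableOn g (cpt sg u' a) (cpt sg u b)
    (fun s hs => by
      obtain ⟨hs1, hs2⟩ := mem_reProdIm.1 hs
      simp only [cpt_re, cpt_im] at hs1 hs2
      have e1 : s = cpt sg s.re (sg * s.im) := by
        apply Complex.ext
        · simp
        · rw [cpt_im, ← mul_assoc, h5, one_mul]
      rw [e1]
      refine (hg _ hs1 _ ?_).differentiableWithinAt
      rcases hsg with rfl | rfl
      · simpa using hs2
      · rw [Set.mem_uIcc] at hs2 ⊢
        rcases hs2 with h | h
        · right
          constructor <;> linarith [h.1, h.2]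
        · left
          constructor <;> linarith [h.1, h.2])
  simp only [cpt_re, cpt_im, smul_eq_mul] at h1
  have h2 : ∀ x : ℝ, ∫ y in sg * a..sg * b, g (x + y * I) = sg * ∫ y in a..b, g (cpt sg x y) := by
    intro x
    have := intervalIntegral.integral_comp_mul_left (a := a) (b := b)
      (fun y : ℝ => g (x + y * I)) h0
    unfold cpt
    rw [this, real_smul, ← mul_assoc, ← ofReal_mul, mul_inv_cancel₀ h0, ofReal_one, one_mul]
  have h3 : ∀ y : ℝ, ∫ x in u'..u, g (x + ((sg * y : ℝ) : ℂ) * I) = ∫ x in u'..u, g (cpt sg x y) :=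
    fun y => rfl
  rw [h2, h2, h3, h3] at h1
  rw [intervalIntegral.integral_sub (hint b Set.right_mem_uIcc) (hint a Set.left_mem_uIcc)]
  linear_combination (-(I * sg)) * h1 - ((∫ y in a..b, g (cpt sg u y)) -
    ∫ y in a..b, g (cpt sg u' y)) * (h4 - sg * sg * I_mul_I)

theorem intervalIntegrable_abs_rpow {a b : ℝ} (ha : a < 0) (hb : 0 < b) :
    IntervalIntegrable (fun y : ℝ => |y| ^ (-(1 / 2) : ℝ)) volume a b := by
  have h1 : ∀ b : ℝ, 0 < b → IntervalIntegrable (fun y : ℝ => |y| ^ (-(1 / 2) : ℝ)) volume 0 b := by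
    intro b hb
    refine (intervalIntegral.intervalIntegrable_rpow' (a := 0) (b := b)
      (r := -(1 / 2)) (by norm_num)).congr ?_
    intro y hy
    rw [Set.uIoc_of_le hb.le] at hy
    simp only
    rw [abs_of_pos hy.1]
  have h2 := (IntervalIntegrable.iff_comp_neg (by finiteness)).1 (h1 (-a) (by linarith))
  simp only [abs_neg, neg_zero, neg_neg] at h2
  exact h2.symm.trans (h1 b hb)

/-- Cauchy's theorem on a rectangle with a weak singularity in the interior of one edge. -/
theorem integral_rect_edge (hsg : sg = 1 ∨ sg = -1) {r C : ℝ}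
    (hg : DifferentiableOn ℂ g {s | s ∈ slitPlane ∧ ‖s‖ < r})
    (hb : ∀ s : ℂ, s ∈ slitPlane → ‖s‖ < r → ‖g s‖ ≤ C * ‖s‖ ^ (-(1 / 2) : ℝ)) {τ a b : ℝ}
    (hτ : 0 < τ) (hτ' : τ < r / 2) (ha : a < 0) (ha' : -(r / 2) < a) (hb0 : 0 < b)
    (hb' : b < r / 2) :
    IntervalIntegrable (fun y => g (cpt sg 0 y)) volume a b ∧
    (∫ y in a..b, g (cpt sg τ y)) - ∫ y in a..b, g (cpt sg 0 y) =
      -(I * sg) * ∫ x in 0..τ, (g (cpt sg x b) - g (cpt sg x a)) := by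
  have h5 : |sg| = 1 := by rcases hsg with rfl | rfl <;> simp
  have h0 : sg ≠ 0 := by rcases hsg with rfl | rfl <;> simp
  have hopen : IsOpen {s : ℂ | s ∈ slitPlane ∧ ‖s‖ < r} :=
    isOpen_slitPlane.inter (isOpen_lt continuous_norm continuous_const)
  have hnorm : ∀ x y : ℝ, ‖cpt sg x y‖ ≤ |x| + |y| := by
    intro x y
    have := norm_le_abs_re_add_abs_im (cpt sg x y)
    simpa [abs_mul, h5] using this
  have hnorm' : ∀ x y : ℝ, |y| ≤ ‖cpt sg x y‖ := by
    intro x y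
    have := abs_im_le_norm (cpt sg x y)
    simpa [abs_mul, h5] using this
  have hmem : ∀ x ∈ Set.Icc 0 τ, ∀ y ∈ Set.Icc a b, (x ≠ 0 ∨ y ≠ 0) →
      cpt sg x y ∈ {s : ℂ | s ∈ slitPlane ∧ ‖s‖ < r} := by
    intro x hx y hy hxy
    refine ⟨?_, (hnorm x y).trans_lt ?_⟩
    · rw [mem_slitPlane_iff, cpt_re, cpt_im]
      rcases hxy with h | h
      · exact Or.inl (lt_of_le_of_ne hx.1 h.symm)
      · exact Or.inr (mul_ne_zero h0 h)
    · rw [abs_of_nonneg hx.1]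
      have : |y| < r / 2 := abs_lt.2 ⟨by linarith [hy.1], by linarith [hy.2]⟩
      linarith [hx.2]
  have hdiff : ∀ x ∈ Set.Icc 0 τ, ∀ y ∈ Set.Icc a b, (x ≠ 0 ∨ y ≠ 0) →
      DifferentiableAt ℂ g (cpt sg x y) := fun x hx y hy hxy =>
    (hg _ (hmem x hx y hy hxy)).differentiableAt (hopen.mem_nhds (hmem x hx y hy hxy))
  have hbound : ∀ x ∈ Set.Icc 0 τ, ∀ y ∈ Set.Icc a b, y ≠ 0 →
      ‖g (cpt sg x y)‖ ≤ |C| * |y| ^ (-(1 / 2) : ℝ) := by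
    intro x hx y hy h
    have h1 := hmem x hx y hy (Or.inr h)
    have h2 := (hb _ h1.1 h1.2).trans (mul_le_mul_of_nonneg_right (le_abs_self C) (by positivity))
    refine h2.trans (mul_le_mul_of_nonneg_left ?_ (abs_nonneg C))
    exact Real.rpow_le_rpow_of_nonpos (abs_pos.2 h) (hnorm' x y) (by norm_num)
  have hab : a ≤ b := by linarith
  have hbi := (intervalIntegrable_abs_rpow ha hb0).const_mul |C|
  have hae : ∀ᵐ y : ℝ, y ≠ 0 := by
    rw [ae_iff]
    simp
  have hmeas : ∀ x ∈ Set.Icc 0 τ,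
      AEStronglyMeasurable (fun y => g (cpt sg x y)) (volume.restrict (Set.uIoc a b)) := by
    intro x hx
    have h1 : ContinuousOn (fun y => g (cpt sg x y)) (Set.Ioc a b \ {0}) := fun y hy =>
      ((hdiff x hx y (Set.Ioc_subset_Icc_self hy.1) (Or.inr hy.2)).continuousAt.comp
        (f := fun y => cpt sg x y) (continuous_cpt_right sg x).continuousAt).continuousWithinAt
    have h2 := h1.aestronglyMeasurable (μ := volume)
      (measurableSet_Ioc.diff (measurableSet_singleton 0))
    rw [Set.uIoc_of_le hab]
    rw [Measure.restrict_congr_set (t := Set.Ioc a b \ {0})]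
    · exact h2
    · exact (sdiff_ae_eq_self.2 (measure_mono_null Set.inter_subset_right (by simp))).symm
  have hI0 : IntervalIntegrable (fun y => g (cpt sg 0 y)) volume a b := by
    refine hbi.mono_fun (hmeas 0 ⟨le_rfl, hτ.le⟩) ?_
    rw [EventuallyLE, ae_restrict_iff' measurableSet_uIoc]
    filter_upwards [hae] with y hy hy'
    rw [Set.uIoc_of_le hab] at hy'
    refine (hbound 0 ⟨le_rfl, hτ.le⟩ y (Set.Ioc_subset_Icc_self hy') hy).trans (le_abs_self _)
  refine ⟨hI0, ?_⟩
  have hside : ∀ y ∈ Set.Icc a b, y ≠ 0 → IntervalIntegrable (fun x => g (cpt sg x y)) volume 0 τ :=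
    fun y hy h => ContinuousOn.intervalIntegrable fun x hx => by
      rw [Set.uIcc_of_le hτ.le] at hx
      exact ((hdiff x hx y hy (Or.inr h)).continuousAt.comp
        (f := fun x => cpt sg x y) (continuous_cpt_left sg y).continuousAt).continuousWithinAt
  have hI1 := (hside b ⟨hab, le_rfl⟩ hb0.ne').sub (hside a ⟨le_rfl, hab⟩ ha.ne)
  have hev : ∀ᶠ κ in 𝓝[>] (0 : ℝ), κ ∈ Set.Ioc 0 τ := Ioc_mem_nhdsGT hτ
  have hL : Tendsto (fun κ => ∫ y in a..b, g (cpt sg κ y)) (𝓝[>] 0)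
      (𝓝 (∫ y in a..b, g (cpt sg 0 y))) := by
    refine intervalIntegral.tendsto_integral_filter_of_dominated_convergence _ ?_ ?_ hbi ?_
    · filter_upwards [hev] with κ hκ using hmeas κ ⟨hκ.1.le, hκ.2⟩
    · filter_upwards [hev] with κ hκ
      filter_upwards [hae] with y hy hy'
      rw [Set.uIoc_of_le hab] at hy'
      exact hbound κ ⟨hκ.1.le, hκ.2⟩ y (Set.Ioc_subset_Icc_self hy') hy
    · filter_upwards [hae] with y hy hy'
      rw [Set.uIoc_of_le hab] at hy'
      exact ((hdiff 0 ⟨le_rfl, hτ.le⟩ y (Set.Ioc_subset_Icc_self hy') (Or.inr hy)).continuousAt.comp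
        (f := fun x => cpt sg x y) (continuous_cpt_left sg y).continuousAt).tendsto.mono_left
          nhdsWithin_le_nhds
  have hR : Tendsto (fun κ => ∫ x in κ..τ, (g (cpt sg x b) - g (cpt sg x a))) (𝓝[>] 0)
      (𝓝 (∫ x in 0..τ, (g (cpt sg x b) - g (cpt sg x a)))) := by
    have hi : IntegrableOn (fun x => g (cpt sg x b) - g (cpt sg x a)) (Set.uIcc τ 0) := by
      rw [Set.uIcc_comm, Set.uIcc_of_le hτ.le, integrableOn_Icc_iff_integrableOn_Ioc,
        ← intervalIntegrable_iff_integrableOn_Ioc_of_le hτ.le]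
      exact hI1
    have h1 := intervalIntegral.continuousOn_primitive_interval hi 0 Set.right_mem_uIcc
    rw [Set.uIcc_comm, Set.uIcc_of_le hτ.le] at h1
    have h2 : Tendsto (fun κ => -∫ x in τ..κ, (g (cpt sg x b) - g (cpt sg x a))) (𝓝[>] 0)
        (𝓝 (-∫ x in τ..0, (g (cpt sg x b) - g (cpt sg x a)))) := by
      refine (Tendsto.mono_left h1 ?_).neg
      refine nhdsWithin_le_iff.2 ?_
      filter_upwards [hev] with κ hκ using ⟨hκ.1.le, hκ.2⟩
    rw [intervalIntegral.integral_symm τ 0]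
    refine h2.congr fun κ => ?_
    rw [intervalIntegral.integral_symm τ κ]
  have hE : ∀ᶠ κ in 𝓝[>] (0 : ℝ), (∫ y in a..b, g (cpt sg τ y)) - ∫ y in a..b, g (cpt sg κ y) =
      -(I * sg) * ∫ x in κ..τ, (g (cpt sg x b) - g (cpt sg x a)) := by
    filter_upwards [hev] with κ hκ
    refine integral_rect hsg fun x hx y hy => ?_
    rw [Set.uIcc_of_le hκ.2] at hx
    rw [Set.uIcc_of_le hab] at hy
    exact hdiff x ⟨hκ.1.le.trans hx.1, hx.2⟩ y hy (Or.inl (hκ.1.trans_le hx.1).ne')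
  exact tendsto_nhds_unique (hL.const_sub _) ((hR.const_mul _).congr' (hE.mono fun κ h => h.symm))

/-- A local relation between the good points of a connected set is a global one. -/
theorem related_of_locally_related {s : Set ℝ} (hs : IsPreconnected s) {G : ℝ → Prop}
    {R : ℝ → ℝ → Prop} (hG : ∀ u ∈ s, ∀ ε > 0, ∃ v ∈ s, |v - u| < ε ∧ G v)
    (symm : ∀ u v, G u → G v → R u v → R v u)
    (trans : ∀ u v w, G u → G v → G w → R u v → R v w → R u w)
    (hR : ∀ u ∈ s, ∃ ε > 0, ∀ v ∈ s, ∀ w ∈ s, |v - u| < ε → |w - u| < ε → G v → G w → R v w) :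
    ∀ u ∈ s, ∀ v ∈ s, G u → G v → R u v := by
  intro u hu v hv
  suffices h : ∃ ε > 0, ∀ u' ∈ s, ∀ v' ∈ s, |u' - u| < ε → |v' - v| < ε → G u' → G v' →
      R u' v' by
    obtain ⟨ε, hε, h⟩ := h
    exact h u hu v hv (by simpa) (by simpa)
  refine hs.induction₂ (fun u v => ∃ ε > 0, ∀ u' ∈ s, ∀ v' ∈ s, |u' - u| < ε → |v' - v| < ε →
    G u' → G v' → R u' v') ?_ ?_ ?_ hu hv
  · intro u hu
    obtain ⟨ε, hε, h⟩ := hR u hu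
    have h1 : ∀ᶠ v in 𝓝[s] u, |v - u| < ε / 2 := by
      refine nhdsWithin_le_nhds (Metric.eventually_nhds_iff.2 ⟨ε / 2, by linarith, fun v hv => ?_⟩)
      rwa [← Real.dist_eq]
    filter_upwards [h1] with v hv
    refine ⟨ε / 2, by linarith, fun u' hu' v' hv' h2 h3 => h u' hu' v' hv' (by linarith) ?_⟩
    have := abs_sub_le v' v u
    linarith
  · rintro u v w _ hv _ ⟨ε, hε, h⟩ ⟨ε', hε', h'⟩
    refine ⟨min ε ε', lt_min hε hε', fun u' hu' w' hw' h2 h3 hGu hGw => ?_⟩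
    obtain ⟨v', hv', h4, hGv⟩ := hG v hv (min ε ε') (lt_min hε hε')
    exact trans u' v' w' hGu hGv hGw
      (h u' hu' v' hv' (h2.trans_le (min_le_left _ _)) (h4.trans_le (min_le_left _ _)) hGu hGv)
      (h' v' hv' w' hw' (h4.trans_le (min_le_right _ _)) (h3.trans_le (min_le_right _ _)) hGv hGw)
  · rintro u v _ _ ⟨ε, hε, h⟩
    exact ⟨ε, hε, fun v' hv' u' hu' h2 h3 hGv hGu => symm u' v' hGu hGv
      (h u' hu' v' hv' h3 h2 hGu hGv)⟩

/-! ### Moving a contour across the rays through the singular points -/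

/-- The points beyond radius `R`, and the points of radius at least `δ` on rays slightly beyond the
rays through the points of `A`. -/
def wedge (sg R δ η : ℝ) (A : Set ℂ) : Set ℂ :=
  {z | R ≤ ‖z‖} ∪ {z | δ ≤ ‖z‖ ∧ ∃ γ ∈ A, ∃ y ∈ Set.Ioc 0 η, ∃ t : ℝ, 0 < t ∧ z = t * slitPt sg γ y}

/-- The integrand whose contour integrals in the logarithmic plane are the Taylor coefficients. -/
noncomputable def mom (φ : ℂ → ℂ) (n : ℕ) (s : ℂ) : ℂ := φ s * (exp s)⁻¹ ^ n

/-- The function `φ` continues `Φ ∘ exp` to a neighbourhood of `p` from the side of sign `sg`. -/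
def IsSeam (sg : ℝ) (Φ φ : ℂ → ℂ) (p : ℂ) : Prop :=
  AnalyticAt ℂ φ p ∧ ∀ᶠ s in 𝓝 p, 0 < sg * (s - p).im → Φ (exp s) = φ s

theorem differentiableAt_mom {φ : ℂ → ℂ} {s : ℂ} (h : DifferentiableAt ℂ φ s) (n : ℕ) :
    DifferentiableAt ℂ (mom φ n) s :=
  h.mul ((differentiableAt_exp.inv (exp_ne_zero s)).pow n)

theorem continuousAt_mom {φ : ℂ → ℂ} {s : ℂ} (h : ContinuousAt φ s) (n : ℕ) :
    ContinuousAt (mom φ n) s :=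
  h.mul ((continuous_exp.continuousAt.inv₀ (exp_ne_zero s)).pow n)

variable {sg : ℝ} {Φ : ℂ → ℂ}

theorem norm_exp_cpt (sg x y : ℝ) : ‖exp (cpt sg x y)‖ = Real.exp x := by
  rw [norm_exp, cpt_re]

theorem exp_cpt_mem_wedge {R δ η x₁ y₀ x a : ℝ} {A : Set ℂ} (h : exp (cpt sg x₁ y₀) ∈ A)
    (hδ : 0 < δ) (hx : Real.log δ ≤ x) (ha : a < y₀) (ha' : y₀ - η ≤ a) :
    exp (cpt sg x a) ∈ wedge sg R δ η A := by
  refine Or.inr ⟨?_, _, h, y₀ - a, ⟨by linarith, by linarith⟩, Real.exp (x - x₁), Real.exp_pos _, ?_⟩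
  · rw [norm_exp_cpt]
    exact (Real.log_le_iff_le_exp hδ).1 hx
  · rw [slitPt, ofReal_exp, ← exp_add, ← exp_add]
    congr 1
    simp only [cpt]
    push_cast
    ring

theorem intervalIntegrable_left {ψ : ℂ → ℂ} {v' v a : ℝ}
    (h : ∀ x ∈ Set.uIcc v' v, ContinuousAt ψ (cpt sg x a)) :
    IntervalIntegrable (fun x => ψ (cpt sg x a)) volume v' v :=
  ContinuousOn.intervalIntegrable fun x hx => ((h x hx).comp (f := fun x => cpt sg x a)
    (continuous_cpt_left sg a).continuousAt).continuousWithinAt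

theorem intervalIntegrable_right {ψ : ℂ → ℂ} {x a b : ℝ}
    (h : ∀ y ∈ Set.uIcc a b, ContinuousAt ψ (cpt sg x y)) :
    IntervalIntegrable (fun y => ψ (cpt sg x y)) volume a b :=
  ContinuousOn.intervalIntegrable fun y hy => ((h y hy).comp (f := fun y => cpt sg x y)
    (continuous_cpt_right sg x).continuousAt).continuousWithinAt

theorem moments_of_segment_left {W : Set ℂ} {ψ : ℂ → ℂ} {v' v a : ℝ}
    (h : ∀ x ∈ Set.uIcc v' v, ContinuousAt ψ (cpt sg x a))
    (hW : ∀ x ∈ Set.uIcc v' v, exp (cpt sg x a) ∈ W) :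
    (fun n => ∫ x in v'..v, mom ψ n (cpt sg x a)) ∈ moments W :=
  moments_of_interval (intervalIntegrable_left h) (continuous_exp.comp (continuous_cpt_left sg a))
    hW fun _ => exp_ne_zero _

theorem moments_of_segment_right {W : Set ℂ} {ψ : ℂ → ℂ} {x a b : ℝ}
    (h : ∀ y ∈ Set.uIcc a b, ContinuousAt ψ (cpt sg x y))
    (hW : ∀ y ∈ Set.uIcc a b, exp (cpt sg x y) ∈ W) :
    (fun n => ∫ y in a..b, mom ψ n (cpt sg x y)) ∈ moments W :=
  moments_of_interval (intervalIntegrable_right h) (continuous_exp.comp (continuous_cpt_right sg x))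
    hW fun _ => exp_ne_zero _

/-- Replacing a function by a continuation across a ray changes the wall integrals by moments. -/
theorem walls_sub_mem {W : Set ℂ} {f ψ : ℂ → ℂ} {v' v a b : ℝ}
    (hf : ∀ x ∈ Set.uIcc v' v, ContinuousAt f (cpt sg x a))
    (hψ : ∀ x ∈ Set.uIcc v' v, ContinuousAt ψ (cpt sg x a))
    (hψb : ∀ x ∈ Set.uIcc v' v, ContinuousAt ψ (cpt sg x b))
    (he : ∀ x ∈ Set.uIcc v' v, f (cpt sg x b) = ψ (cpt sg x b))
    (hW : ∀ x ∈ Set.uIcc v' v, exp (cpt sg x a) ∈ W) :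
    (fun n => (I * sg) * (∫ x in v'..v, (mom f n (cpt sg x b) - mom f n (cpt sg x a))) -
      (I * sg) * ∫ x in v'..v, (mom ψ n (cpt sg x b) - mom ψ n (cpt sg x a))) ∈ moments W := by
  have h1 := (moments W).smul_mem (I * sg) ((moments W).sub_mem (moments_of_segment_left hψ hW)
    (moments_of_segment_left hf hW))
  convert h1 using 1
  funext n
  have i1 : IntervalIntegrable (fun x => mom ψ n (cpt sg x b)) volume v' v :=
    intervalIntegrable_left fun x hx => continuousAt_mom (hψb x hx) n
  have i2 : IntervalIntegrable (fun x => mom ψ n (cpt sg x a)) volume v' v :=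
    intervalIntegrable_left fun x hx => continuousAt_mom (hψ x hx) n
  have i3 : IntervalIntegrable (fun x => mom f n (cpt sg x a)) volume v' v :=
    intervalIntegrable_left fun x hx => continuousAt_mom (hf x hx) n
  have e1 : ∫ x in v'..v, (mom f n (cpt sg x b) - mom f n (cpt sg x a)) =
      ∫ x in v'..v, (mom ψ n (cpt sg x b) - mom f n (cpt sg x a)) :=
    intervalIntegral.integral_congr fun x hx => by simp only [mom, he x hx]
  rw [e1, intervalIntegral.integral_sub i1 i2, intervalIntegral.integral_sub i1 i3]
  simp only [Pi.smul_apply, Pi.sub_apply, smul_eq_mul]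
  ring

theorem IsSeam.eventuallyEq (hsg : sg = 1 ∨ sg = -1) {φ ψ : ℂ → ℂ} {p : ℂ}
    (h1 : IsSeam sg Φ φ p) (h2 : IsSeam sg Φ ψ p) : φ =ᶠ[𝓝 p] ψ := by
  refine (h1.1.frequently_eq_iff_eventually_eq h2.1).1 ?_
  have h3 : Tendsto (fun y : ℝ => p + (sg * y : ℝ) * I) (𝓝[>] 0) (𝓝[≠] p) := by
    refine tendsto_nhdsWithin_iff.2 ⟨?_, ?_⟩
    · have : Continuous (fun y : ℝ => p + (sg * y : ℝ) * I) := by fun_prop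
      simpa using (this.tendsto 0).mono_left nhdsWithin_le_nhds
    · filter_upwards [self_mem_nhdsWithin] with y hy
      have : sg ≠ 0 := by rcases hsg with rfl | rfl <;> simp
      simpa [this] using (ne_of_gt hy)
  refine h3.frequently (Eventually.frequently ?_)
  filter_upwards [(h3.mono_right nhdsWithin_le_nhds).eventually h1.2,
    (h3.mono_right nhdsWithin_le_nhds).eventually h2.2, self_mem_nhdsWithin] with y e1 e2 hy
  have h4 : 0 < sg * (p + (sg * y : ℝ) * I - p).im := by
    rw [add_sub_cancel_left, im_ofReal_mul, I_im, mul_one, ← mul_assoc]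
    have : sg * sg = 1 := by rcases hsg with rfl | rfl <;> simp
    rw [this, one_mul]
    exact hy
  rw [← e1 h4, e2 h4]

theorem eventually_cpt_of_nhds {Q : ℂ → Prop} {v y₀ : ℝ} (h : ∀ᶠ s in 𝓝 (cpt sg v y₀), Q s) :
    ∃ h > 0, ∀ y, |y - y₀| < h → Q (cpt sg v y) := by
  have h1 := (continuous_cpt_right sg v).continuousAt (x := y₀)
  obtain ⟨ε, hε, h2⟩ := Metric.eventually_nhds_iff.1 (h1.eventually h)
  exact ⟨ε, hε, fun y hy => h2 (by rwa [Real.dist_eq])⟩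

theorem abs_sub_lt_of_mem_uIcc {a b y y₀ h : ℝ} (ha : a ∈ Set.Ioo (y₀ - h) y₀)
    (hb : b ∈ Set.Ioo y₀ (y₀ + h)) (hy : y ∈ Set.uIcc a b) : |y - y₀| < h := by
  rw [Set.uIcc_of_le (ha.2.trans hb.1).le] at hy
  rw [abs_lt]
  constructor <;> linarith [hy.1, hy.2, ha.1, hb.2]

theorem integral_mom_eq_of_eventuallyEq {φ ψ : ℂ → ℂ} {v y₀ : ℝ}
    (he : φ =ᶠ[𝓝 (cpt sg v y₀)] ψ) :
    ∃ h > 0, ∀ a ∈ Set.Ioo (y₀ - h) y₀, ∀ b ∈ Set.Ioo y₀ (y₀ + h), ∀ n,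
      ∫ y in a..b, mom φ n (cpt sg v y) = ∫ y in a..b, mom ψ n (cpt sg v y) := by
  obtain ⟨h, h0, h1⟩ := eventually_cpt_of_nhds he
  refine ⟨h, h0, fun a ha b hb n => intervalIntegral.integral_congr fun y hy => ?_⟩
  simp only [mom, h1 y (abs_sub_lt_of_mem_uIcc ha hb hy)]

/-! ### The two seam functions at a singular point -/

/-- The continuation to the right of a singular point. -/
noncomputable def seamRight (sg : ℝ) (φ : ℂ → ℂ) (p s : ℂ) : ℂ :=
  φ (log (s - p) + (Real.pi * (1 - sg) : ℝ) * I)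

/-- The continuation to the left of a singular point. -/
noncomputable def seamLeft (φ : ℂ → ℂ) (p s : ℂ) : ℂ := φ (log (p - s) + (Real.pi : ℝ) * I)

variable {φ : ℂ → ℂ} {p : ℂ} {ρ C : ℝ}

theorem log_norm_lt {z : ℂ} (hz : z ∈ slitPlane) (h : ‖z‖ < Real.exp ρ) : Real.log ‖z‖ < ρ :=
  (Real.log_lt_iff_lt_exp (norm_pos_iff.2 (slitPlane_ne_zero hz))).2 h

theorem differentiableAt_comp_log {c : ℝ} (hφ : DifferentiableOn ℂ φ {w | w.re < ρ}) {z : ℂ}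
    (hz : z ∈ slitPlane) (h : ‖z‖ < Real.exp ρ) :
    DifferentiableAt ℂ (fun z => φ (log z + (c : ℝ) * I)) z := by
  have h1 : log z + (c : ℝ) * I ∈ {w : ℂ | w.re < ρ} := by
    simpa [log_re] using log_norm_lt hz h
  have h2 : DifferentiableAt ℂ φ (log z + (c : ℝ) * I) :=
    (hφ _ h1).differentiableAt ((isOpen_re_lt ρ).mem_nhds h1)
  exact h2.comp z ((differentiableAt_id.clog hz).add_const _)

theorem norm_comp_log_le {c : ℝ} (hc : |c| ≤ 2 * Real.pi)
    (hb : ∀ w : ℂ, w.re < ρ → |w.im| ≤ 3 * Real.pi → ‖φ w‖ ≤ C * Real.exp (-w.re / 2)) {z : ℂ}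
    (hz : z ∈ slitPlane) (h : ‖z‖ < Real.exp ρ) :
    ‖φ (log z + (c : ℝ) * I)‖ ≤ C * ‖z‖ ^ (-(1 / 2) : ℝ) := by
  have h1 := hb (log z + (c : ℝ) * I) (by simpa [log_re] using log_norm_lt hz h) (by
    have := abs_arg_le_pi z
    have e : (log z + (c : ℝ) * I).im = arg z + c := by simp [log_im]
    rw [e]
    exact (abs_add_le _ _).trans (by linarith))
  refine h1.trans_eq ?_
  congr 1
  rw [Real.rpow_def_of_pos (norm_pos_iff.2 (slitPlane_ne_zero hz))]
  congr 1
  simp [log_re]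
  ring

theorem args_mem_right {σ : Side} {z : ℂ} (h : 0 < σ.sgn * z.im) :
    (log z + (Real.pi * (1 - σ.sgn) : ℝ) * I).im ∈ σ.args := by
  have e : (log z + (Real.pi * (1 - σ.sgn) : ℝ) * I).im = arg z + Real.pi * (1 - σ.sgn) := by
    simp [log_im]
  rw [e]
  cases σ <;> simp only [Side.sgn, Side.args, Set.mem_Ioo] at h ⊢
  · rw [one_mul] at h
    have h1 := arg_lt_pi_iff.2 (Or.inr h.ne')
    have h2 := arg_nonneg_iff.2 h.le
    have h3 : arg z ≠ 0 := fun h' => h.ne' (arg_eq_zero_iff.1 h').2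
    have := lt_of_le_of_ne h2 h3.symm
    constructor <;> linarith
  · have h1 := arg_neg_iff.2 (show z.im < 0 by linarith)
    have h2 := neg_pi_lt_arg z
    constructor <;> linarith

theorem args_mem_left {σ : Side} {z : ℂ} (h : 0 < σ.sgn * (-z).im) :
    (log z + (Real.pi : ℝ) * I).im ∈ σ.args := by
  have e : (log z + (Real.pi : ℝ) * I).im = arg z + Real.pi := by
    simp [log_im]
  rw [e]
  cases σ <;> simp only [Side.sgn, Side.args, Set.mem_Ioo, neg_im] at h ⊢
  · have h1 := arg_neg_iff.2 (show z.im < 0 by linarith)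
    have h2 := neg_pi_lt_arg z
    constructor <;> linarith
  · have h0 : 0 < z.im := by linarith
    have h1 := arg_lt_pi_iff.2 (Or.inr h0.ne')
    have h2 := arg_nonneg_iff.2 h0.le
    have h3 : arg z ≠ 0 := fun h' => h0.ne' (arg_eq_zero_iff.1 h').2
    have := lt_of_le_of_ne h2 h3.symm
    constructor <;> linarith

theorem exp_exp_right (hsg : sg = 1 ∨ sg = -1) {s : ℂ} (h : s - p ≠ 0) :
    exp p * exp (exp (log (s - p) + (Real.pi * (1 - sg) : ℝ) * I)) = exp s := by
  have h1 : exp ((Real.pi * (1 - sg) : ℝ) * I) = 1 := by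
    rcases hsg with rfl | rfl
    · simp
    · rw [← exp_two_pi_mul_I]
      congr 1
      push_cast
      ring
  rw [exp_add (log _), h1, mul_one, exp_log h, ← exp_add, add_sub_cancel]

theorem exp_exp_left {s : ℂ} (h : p - s ≠ 0) :
    exp p * exp (exp (log (p - s) + (Real.pi : ℝ) * I)) = exp s := by
  rw [exp_add (log _), exp_pi_mul_I, exp_log h, ← exp_add]
  congr 1
  ring

theorem seam_jump (hsg : sg = 1 ∨ sg = -1) {Q : ℂ → ℂ}
    (hQ : ∀ w : ℂ, w.re < ρ → φ (w + 2 * Real.pi * I) - φ w = Q w) {v : ℝ} (hv : 0 < v)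
    (hv' : v < Real.exp ρ) :
    seamLeft φ p (p + ((-(sg * v) : ℝ) : ℂ) * I) -
      seamRight sg φ p (p + ((-(sg * v) : ℝ) : ℂ) * I) = sg * slitVal sg Q v := by
  have hl := (Real.log_lt_iff_lt_exp hv).2 hv'
  have e1 : log ((v : ℂ) * I) = Real.log v + (Real.pi / 2 : ℝ) * I := by
    rw [log_ofReal_mul hv I_ne_zero, log_I]
    push_cast
    ring
  have e2 : log ((v : ℂ) * -I) = Real.log v - (Real.pi / 2 : ℝ) * I := by
    rw [log_ofReal_mul hv (neg_ne_zero.2 I_ne_zero), log_neg_I]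
    push_cast
    ring
  simp only [seamLeft, seamRight, slitVal, add_sub_cancel_left, sub_add_cancel_left]
  rcases hsg with rfl | rfl
  · have a1 : -(((-(1 * v) : ℝ) : ℂ) * I) = v * I := by push_cast; ring
    have a2 : ((-(1 * v) : ℝ) : ℂ) * I = v * -I := by push_cast; ring
    rw [a1, a2, e1, e2, ofReal_one, one_mul, ← hQ _ (by simpa using hl)]
    congr 2 <;> push_cast <;> ring
  · have a1 : -(((-(-1 * v) : ℝ) : ℂ) * I) = v * -I := by push_cast; ring
    have a2 : ((-(-1 * v) : ℝ) : ℂ) * I = v * I := by push_cast; ring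
    rw [a1, a2, e1, e2, ← hQ _ (by simpa using hl)]
    have b1 : ((Real.log v : ℂ) - (Real.pi / 2 : ℝ) * I + (Real.pi : ℝ) * I) =
      (Real.log v + (-(-1 * (Real.pi / 2)) : ℝ) * I) := by push_cast; ring
    have b2 : ((Real.log v : ℂ) + (Real.pi / 2 : ℝ) * I + (Real.pi * (1 - -1) : ℝ) * I) =
      (Real.log v + (-(-1 * (Real.pi / 2)) : ℝ) * I) + 2 * Real.pi * I := by push_cast; ring
    rw [b1, b2]
    push_cast
    ring

variable {sg : ℝ}

/-- Cauchy's theorem on a rectangle with a weak singularity on its left (`e = 1`) or right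
(`e = -1`) edge, for the integrands of Taylor coefficients. -/
theorem integral_mom_edge (hsg : sg = 1 ∨ sg = -1) {e : ℝ} (he : e = 1 ∨ e = -1) {ψ : ℂ → ℂ}
    {r C u₀ y₀ : ℝ}
    (hd : ∀ ζ : ℂ, ζ ∈ slitPlane → ‖ζ‖ < r → DifferentiableAt ℂ ψ (cpt sg u₀ y₀ + e * ζ))
    (hb : ∀ ζ : ℂ, ζ ∈ slitPlane → ‖ζ‖ < r →
      ‖ψ (cpt sg u₀ y₀ + e * ζ)‖ ≤ C * ‖ζ‖ ^ (-(1 / 2) : ℝ))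
    (n : ℕ) {τ a b : ℝ} (hτ : 0 < τ) (hτ' : τ < r / 2) (ha : a ∈ Set.Ioo (y₀ - r / 2) y₀)
    (hb' : b ∈ Set.Ioo y₀ (y₀ + r / 2)) :
    IntervalIntegrable (fun y => mom ψ n (cpt sg u₀ y)) volume a b ∧
    (∫ y in a..b, mom ψ n (cpt sg (u₀ + e * τ) y)) - ∫ y in a..b, mom ψ n (cpt sg u₀ y) =
      -(I * sg) * ∫ x in u₀..u₀ + e * τ, (mom ψ n (cpt sg x b) - mom ψ n (cpt sg x a)) := by
  have hee : (e : ℂ) * e = 1 := by rcases he with rfl | rfl <;> simp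
  have heR : e * e = 1 := by exact_mod_cast hee
  have he0 : e ≠ 0 := by rcases he with rfl | rfl <;> simp
  have hne : ‖(e : ℂ)‖ = 1 := by rcases he with rfl | rfl <;> simp
  have hsg' : e * sg = 1 ∨ e * sg = -1 := by
    rcases he with rfl | rfl <;> rcases hsg with rfl | rfl <;> simp
  set p := cpt sg u₀ y₀ with hp
  set G : ℂ → ℂ := fun ζ => mom ψ n (p + e * ζ) with hG
  have hcpt : ∀ x y : ℝ, p + e * cpt (e * sg) x (y - y₀) = cpt sg (u₀ + e * x) y := by
    intro x y
    simp only [hp, cpt]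
    push_cast
    linear_combination (sg * (y - y₀) * I) * hee
  have hGd : DifferentiableOn ℂ G {s | s ∈ slitPlane ∧ ‖s‖ < r} := by
    intro ζ hζ
    have h1 := differentiableAt_mom (hd ζ hζ.1 hζ.2) n
    have h2 : DifferentiableAt ℂ (fun ζ : ℂ => p + e * ζ) ζ := by fun_prop
    exact (h1.comp ζ h2).differentiableWithinAt
  have hGb : ∀ s : ℂ, s ∈ slitPlane → ‖s‖ < r →
      ‖G s‖ ≤ (C * Real.exp (n * (|p.re| + r))) * ‖s‖ ^ (-(1 / 2) : ℝ) := by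
    intro s hs hs'
    have h1 := hb s hs hs'
    have h2 : ‖(exp (p + e * s))⁻¹ ^ n‖ ≤ Real.exp (n * (|p.re| + r)) := by
      rw [norm_pow, norm_inv, norm_exp, ← Real.exp_neg, ← Real.exp_nat_mul]
      refine Real.exp_le_exp.2 (mul_le_mul_of_nonneg_left ?_ (Nat.cast_nonneg n))
      have h3 := abs_re_le_norm ((e : ℂ) * s)
      rw [norm_mul, hne, one_mul] at h3
      have h4 := abs_le.1 h3
      have h5 := neg_abs_le p.re
      rw [add_re]
      linarith [h4.1]
    change ‖ψ (p + e * s) * (exp (p + e * s))⁻¹ ^ n‖ ≤ _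
    rw [norm_mul]
    refine (mul_le_mul h1 h2 (norm_nonneg _) ((norm_nonneg _).trans h1)).trans_eq (by ring)
  obtain ⟨k1, k2⟩ := integral_rect_edge hsg' hGd hGb hτ hτ' (a := a - y₀) (b := b - y₀)
    (by linarith [ha.2]) (by linarith [ha.1]) (by linarith [hb'.1]) (by linarith [hb'.2])
  have hv : ∀ x : ℝ, ∫ y in a - y₀..b - y₀, G (cpt (e * sg) x y) =
      ∫ y in a..b, mom ψ n (cpt sg (u₀ + e * x) y) := by
    intro x
    rw [← intervalIntegral.integral_comp_sub_right (fun y => G (cpt (e * sg) x y))]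
    simp only [hG, hcpt]
  have hh : ∫ x in 0..τ, (G (cpt (e * sg) x (b - y₀)) - G (cpt (e * sg) x (a - y₀))) =
      e * ∫ x in u₀..u₀ + e * τ, (mom ψ n (cpt sg x b) - mom ψ n (cpt sg x a)) := by
    have h1 := intervalIntegral.integral_comp_add_mul (a := 0) (b := τ)
      (fun x => mom ψ n (cpt sg x b) - mom ψ n (cpt sg x a)) he0 u₀
    rw [mul_zero, add_zero] at h1
    have h2 : e⁻¹ = e := by
      field_simp
      linarith
    rw [h2, real_smul] at h1
    simp only [hG, hcpt]
    exact h1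
  refine ⟨?_, ?_⟩
  · have h1 := k1.comp_sub_right y₀
    simp only [sub_add_cancel] at h1
    refine h1.congr fun y _ => ?_
    simp only [hG, hcpt]
    simp
  · rw [hv, hv, hh] at k2
    rw [mul_zero, add_zero] at k2
    rw [k2]
    push_cast
    linear_combination (-(I * sg) * ∫ x in u₀..u₀ + e * τ,
      (mom ψ n (cpt sg x b) - mom ψ n (cpt sg x a))) * hee

variable {σ : Side} {Φ φ Q : ℂ → ℂ} {ρ ρ' C u₀ y₀ η η₁ R δ : ℝ} {A : Set ℂ}

theorem apply_seamRight {p s : ℂ}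
    (hΦ : ∀ w : ℂ, w.re < ρ → w.im ∈ σ.args → Φ (exp p * exp (exp w)) = φ w)
    (hs : ‖s - p‖ < Real.exp ρ) (h : 0 < σ.sgn * (s - p).im) :
    Φ (exp s) = seamRight σ.sgn φ p s := by
  have h1 : s - p ∈ slitPlane := mem_slitPlane_iff.2 (Or.inr fun h' => by simp [h'] at h)
  rw [seamRight, ← hΦ _ (by simpa [log_re] using log_norm_lt h1 hs) (args_mem_right h),
    exp_exp_right σ.sgn_eq (slitPlane_ne_zero h1)]

theorem apply_seamLeft {p s : ℂ}
    (hΦ : ∀ w : ℂ, w.re < ρ → w.im ∈ σ.args → Φ (exp p * exp (exp w)) = φ w)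
    (hs : ‖s - p‖ < Real.exp ρ) (h : 0 < σ.sgn * (s - p).im) :
    Φ (exp s) = seamLeft φ p s := by
  rw [norm_sub_rev] at hs
  have h1 : p - s ∈ slitPlane := mem_slitPlane_iff.2 (Or.inr fun h' => by
    rw [← neg_sub, neg_im, h'] at h
    simp at h)
  rw [seamLeft, ← hΦ _ (by simpa [log_re] using log_norm_lt h1 hs)
    (args_mem_left (by rwa [neg_sub])), exp_exp_left (slitPlane_ne_zero h1)]

theorem differentiableAt_seamRight (hφ : DifferentiableOn ℂ φ {w | w.re < ρ}) {p s : ℂ}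
    (h1 : s - p ∈ slitPlane) (hs : ‖s - p‖ < Real.exp ρ) :
    DifferentiableAt ℂ (seamRight sg φ p) s :=
  DifferentiableAt.comp (f := fun s => s - p) (g := fun z => φ (log z + (Real.pi * (1 - sg) : ℝ) * I))
    s (differentiableAt_comp_log hφ h1 hs) (by fun_prop)

theorem differentiableAt_seamLeft (hφ : DifferentiableOn ℂ φ {w | w.re < ρ}) {p s : ℂ}
    (h1 : p - s ∈ slitPlane) (hs : ‖p - s‖ < Real.exp ρ) :
    DifferentiableAt ℂ (seamLeft φ p) s :=
  DifferentiableAt.comp (f := fun s => p - s) (g := fun z => φ (log z + (Real.pi : ℝ) * I))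
    s (differentiableAt_comp_log hφ h1 hs) (by fun_prop)

/-- The jump of the contour integral at a singular point is a slit. -/
theorem integral_seam_sub (hsg : sg = 1 ∨ sg = -1) {p : ℂ} (hp : p = cpt sg u₀ y₀) {f : ℂ → ℂ}
    (hQ : ∀ w : ℂ, w.re < ρ → φ (w + 2 * Real.pi * I) - φ w = Q w)
    (n : ℕ) {a b : ℝ} (ha : a ∈ Set.Ioo (y₀ - Real.exp ρ / 2) y₀) (hb : y₀ < b)
    (hL : ∀ y ∈ Set.Ioc y₀ b, f (cpt sg u₀ y) = seamLeft φ p (cpt sg u₀ y))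
    (hR : ∀ y ∈ Set.Ioc y₀ b, f (cpt sg u₀ y) = seamRight sg φ p (cpt sg u₀ y))
    (iL : IntervalIntegrable (fun y => mom (seamLeft φ p) n (cpt sg u₀ y)) volume a b)
    (iR : IntervalIntegrable (fun y => mom (seamRight sg φ p) n (cpt sg u₀ y)) volume a b) :
    (∫ y in a..b, mom (seamLeft φ p) n (cpt sg u₀ y)) -
      ∫ y in a..b, mom (seamRight sg φ p) n (cpt sg u₀ y) =
      sg * ∫ v in 0..y₀ - a, slitVal sg Q v * (slitPt sg (exp p) v)⁻¹ ^ n := by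
  rw [← intervalIntegral.integral_sub iL iR]
  have i1 := (iL.sub iR).mono_set (c := a) (d := y₀) (by
    rw [Set.uIcc_of_le ha.2.le, Set.uIcc_of_le (ha.2.trans hb).le]
    exact Set.Icc_subset_Icc_right hb.le)
  have i2 := (iL.sub iR).mono_set (c := y₀) (d := b) (by
    rw [Set.uIcc_of_le hb.le, Set.uIcc_of_le (ha.2.trans hb).le]
    exact Set.Icc_subset_Icc_left ha.2.le)
  rw [← intervalIntegral.integral_add_adjacent_intervals i1 i2]
  have e2 : ∫ y in y₀..b, (mom (seamLeft φ p) n (cpt sg u₀ y) -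
      mom (seamRight sg φ p) n (cpt sg u₀ y)) = 0 := by
    rw [intervalIntegral.integral_of_le hb.le]
    refine setIntegral_eq_zero_of_forall_eq_zero fun y hy => ?_
    rw [mom, mom, ← hL y hy, ← hR y hy, sub_self]
  have e3 := intervalIntegral.integral_comp_sub_left (a := a) (b := y₀)
    (fun v => slitVal sg Q v * (slitPt sg (exp p) v)⁻¹ ^ n) y₀
  rw [sub_self] at e3
  rw [e2, add_zero, ← e3, ← intervalIntegral.integral_const_mul,
    intervalIntegral.integral_of_le ha.2.le, intervalIntegral.integral_of_le ha.2.le,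
    integral_Ioc_eq_integral_Ioo, integral_Ioc_eq_integral_Ioo]
  refine setIntegral_congr_fun measurableSet_Ioo fun y hy => ?_
  have e4 : cpt sg u₀ y = p + ((-(sg * (y₀ - y)) : ℝ) : ℂ) * I := by
    rw [hp]
    simp only [cpt]
    push_cast
    ring
  have e5 := seam_jump (p := p) hsg hQ (v := y₀ - y) (by linarith [hy.2])
    (by linarith [hy.1, ha.1, Real.exp_pos ρ])
  have e6 : exp (cpt sg u₀ y) = slitPt sg (exp p) (y₀ - y) := by
    rw [e4, exp_add, slitPt]
    push_cast
    ring_nf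
  simp only [mom]
  rw [← sub_mul, e6, e4, e5, mul_assoc]

/-- Crossing a singular point of a ray changes the contour integral by a slit, up to moments. -/
theorem crossing_mem {p : ℂ} (hp : p = cpt σ.sgn u₀ y₀) (hA : exp p ∈ A)
    (hφ : DifferentiableOn ℂ φ {w | w.re < ρ})
    (hb : ∀ w : ℂ, w.re < ρ → |w.im| ≤ 3 * Real.pi → ‖φ w‖ ≤ C * Real.exp (-w.re / 2))
    (hQ : ∀ w : ℂ, w.re < ρ → φ (w + 2 * Real.pi * I) - φ w = Q w)
    (hΦ : ∀ w : ℂ, w.re < ρ → w.im ∈ σ.args → Φ (exp p * exp (exp w)) = φ w)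
    (hQd : DifferentiableOn ℂ Q {w | w.re < ρ'}) (hQ0 : StolzZero Q) (hη : 0 < η₁) (hη' : η₁ ≤ η)
    (hηρ : Real.log η₁ < ρ') (hδ : 0 < δ) {v' v h₀ : ℝ} (hv' : v' < u₀) (hv : u₀ < v)
    (hv'r : u₀ - v' < Real.exp ρ / 2) (hvr : v - u₀ < Real.exp ρ / 2) (hδv : Real.log δ ≤ v')
    (hh₀ : 0 < h₀)
    (hf : ∀ x ∈ Set.Icc v' v, ∀ y, y ≠ y₀ → |y - y₀| < h₀ →
      ContinuousAt (fun s => Φ (exp s)) (cpt σ.sgn x y)) :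
    ∃ h > 0, ∀ a ∈ Set.Ioo (y₀ - h) y₀, ∀ b ∈ Set.Ioo y₀ (y₀ + h),
      (fun n => (∫ y in a..b, mom (seamRight σ.sgn φ p) n (cpt σ.sgn v y)) -
        (∫ y in a..b, mom (seamLeft φ p) n (cpt σ.sgn v' y)) +
        (I * σ.sgn) * (∫ x in v'..v, (mom (fun s => Φ (exp s)) n (cpt σ.sgn x b) -
          mom (fun s => Φ (exp s)) n (cpt σ.sgn x a))) +
        2 * Real.pi * slit σ.sgn η₁ Q (exp p) n) ∈ moments (wedge σ.sgn R δ η A) := by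
  set sg := σ.sgn with hsgdef
  have hsg : sg = 1 ∨ sg = -1 := σ.sgn_eq
  have hss : sg * sg = 1 := σ.sgn_mul_self
  have hsg0 : sg ≠ 0 := fun h => by simp [h] at hss
  have hr : 0 < Real.exp ρ := Real.exp_pos ρ
  refine ⟨min h₀ (min (Real.exp ρ / 2) η₁), lt_min hh₀ (lt_min (by linarith) hη), fun a ha b hb1 => ?_⟩
  have hm1 := min_le_left h₀ (min (Real.exp ρ / 2) η₁)
  have hm2 := (min_le_right h₀ (min (Real.exp ρ / 2) η₁)).trans (min_le_left _ _)
  have hm3 := (min_le_right h₀ (min (Real.exp ρ / 2) η₁)).trans (min_le_right _ _)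
  have ha' : a ∈ Set.Ioo (y₀ - Real.exp ρ / 2) y₀ := ⟨by linarith [ha.1], ha.2⟩
  have hb' : b ∈ Set.Ioo y₀ (y₀ + Real.exp ρ / 2) := ⟨hb1.1, by linarith [hb1.2]⟩
  have hsub : ∀ x y : ℝ, cpt sg x y - p = cpt sg (x - u₀) (y - y₀) := by
    intro x y
    rw [hp]
    simp only [cpt]
    push_cast
    ring
  have hnorm : ∀ x ∈ Set.Icc v' v, ∀ y, |y - y₀| < Real.exp ρ / 2 →
      ‖cpt sg x y - p‖ < Real.exp ρ := by
    intro x hx y hy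
    rw [hsub]
    have h1 := norm_le_abs_re_add_abs_im (cpt sg (x - u₀) (y - y₀))
    have h2 : |sg| = 1 := by rcases hsg with h | h <;> simp [h]
    rw [cpt_re, cpt_im, abs_mul, h2, one_mul] at h1
    have h3 : |x - u₀| < Real.exp ρ / 2 := abs_lt.2 ⟨by linarith [hx.1], by linarith [hx.2]⟩
    linarith
  have him : ∀ x y : ℝ, sg * (cpt sg x y - p).im = y - y₀ := by
    intro x y
    rw [hsub, cpt_im, ← mul_assoc, hss, one_mul]
  have hslit : ∀ x y : ℝ, y ≠ y₀ → cpt sg x y - p ∈ slitPlane := by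
    intro x y hy
    rw [hsub, mem_slitPlane_iff, cpt_im]
    exact Or.inr (mul_ne_zero hsg0 (sub_ne_zero.2 hy))
  have hslit' : ∀ x y : ℝ, y ≠ y₀ → p - cpt sg x y ∈ slitPlane := by
    intro x y hy
    rw [← neg_sub, hsub, mem_slitPlane_iff, neg_im, cpt_im]
    exact Or.inr (neg_ne_zero.2 (mul_ne_zero hsg0 (sub_ne_zero.2 hy)))
  have hya : |a - y₀| < Real.exp ρ / 2 := abs_lt.2 ⟨by linarith [ha'.1], by linarith [ha'.2]⟩
  have hyb : |b - y₀| < Real.exp ρ / 2 := abs_lt.2 ⟨by linarith [hb'.1], by linarith [hb'.2]⟩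
  have hya0 : |a - y₀| < h₀ := abs_lt.2 ⟨by linarith [ha.1], by linarith [ha.2]⟩
  have hyb0 : |b - y₀| < h₀ := abs_lt.2 ⟨by linarith [hb1.1], by linarith [hb1.2]⟩
  have cR : ∀ x ∈ Set.Icc v' v, ∀ y, y ≠ y₀ → |y - y₀| < Real.exp ρ / 2 →
      ContinuousAt (seamRight sg φ p) (cpt sg x y) := fun x hx y hy hy' =>
    (differentiableAt_seamRight hφ (hslit x y hy) (hnorm x hx y hy')).continuousAt
  have cL : ∀ x ∈ Set.Icc v' v, ∀ y, y ≠ y₀ → |y - y₀| < Real.exp ρ / 2 →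
      ContinuousAt (seamLeft φ p) (cpt sg x y) := fun x hx y hy hy' =>
    (differentiableAt_seamLeft hφ (hslit' x y hy)
      (by rw [norm_sub_rev]; exact hnorm x hx y hy')).continuousAt
  have eR : ∀ x ∈ Set.Icc v' v, ∀ y, y₀ < y → |y - y₀| < Real.exp ρ / 2 →
      Φ (exp (cpt sg x y)) = seamRight sg φ p (cpt sg x y) := fun x hx y hy hy' =>
    apply_seamRight hΦ (hnorm x hx y hy') (by rw [← hsgdef, him]; linarith)
  have eL : ∀ x ∈ Set.Icc v' v, ∀ y, y₀ < y → |y - y₀| < Real.exp ρ / 2 →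
      Φ (exp (cpt sg x y)) = seamLeft φ p (cpt sg x y) := fun x hx y hy hy' =>
    apply_seamLeft hΦ (hnorm x hx y hy') (by rw [← hsgdef, him]; linarith)
  have hu₀ : u₀ ∈ Set.Icc v' v := ⟨hv'.le, hv.le⟩
  have hW : ∀ x, v' ≤ x → exp (cpt sg x a) ∈ wedge sg R δ η A := fun x hx =>
    exp_cpt_mem_wedge (x₁ := u₀) (y₀ := y₀) (by rw [← hp]; exact hA) hδ (hδv.trans hx) ha.2
      (by linarith [ha.1])
  -- walls
  have sR : ∀ x ∈ Set.uIcc u₀ v, x ∈ Set.Icc v' v := fun x hx => by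
    rw [Set.uIcc_of_le hv.le] at hx
    exact ⟨hv'.le.trans hx.1, hx.2⟩
  have sL : ∀ x ∈ Set.uIcc v' u₀, x ∈ Set.Icc v' v := fun x hx => by
    rw [Set.uIcc_of_le hv'.le] at hx
    exact ⟨hx.1, hx.2.trans hv.le⟩
  have wR := walls_sub_mem (sg := sg) (W := wedge sg R δ η A) (f := fun s => Φ (exp s))
    (ψ := seamRight sg φ p) (v' := u₀) (v := v) (a := a) (b := b)
    (fun x hx => hf x (sR x hx) a ha.2.ne hya0) (fun x hx => cR x (sR x hx) a ha.2.ne hya)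
    (fun x hx => cR x (sR x hx) b hb1.1.ne' hyb) (fun x hx => eR x (sR x hx) b hb1.1 hyb)
    (fun x hx => hW x (sR x hx).1)
  have wL := walls_sub_mem (sg := sg) (W := wedge sg R δ η A) (f := fun s => Φ (exp s))
    (ψ := seamLeft φ p) (v' := v') (v := u₀) (a := a) (b := b)
    (fun x hx => hf x (sL x hx) a ha.2.ne hya0) (fun x hx => cL x (sL x hx) a ha.2.ne hya)
    (fun x hx => cL x (sL x hx) b hb1.1.ne' hyb) (fun x hx => eL x (sL x hx) b hb1.1 hyb)
    (fun x hx => hW x (sL x hx).1)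
  -- the part of the slit beyond the wall
  have hsl := (moments (wedge sg R δ η A)).smul_mem (sg : ℂ) (moments_of_interval
    (W := wedge sg R δ η A) (a := y₀ - a) (b := η₁) (k := slitVal sg Q) (U := slitPt sg (exp p))
    (((continuousOn_slitVal hQd hηρ sg).mono fun x hx => by
      rw [Set.uIcc_of_le (by linarith [ha.1])] at hx
      exact ⟨by linarith [hx.1, ha.2], hx.2⟩).intervalIntegrable)
    (continuous_slitPt sg _) (fun x hx => by
      rw [Set.uIcc_of_le (by linarith [ha.1])] at hx
      refine Or.inr ⟨?_, exp p, hA, x, ⟨by linarith [hx.1, ha.2], hx.2.trans hη'⟩, 1, one_pos, by simp⟩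
      have e1 : ‖slitPt sg (exp p) x‖ = Real.exp u₀ := by
        rw [slitPt, norm_mul, norm_exp, norm_exp, hp]
        simp
      rw [e1]
      exact (Real.log_le_iff_le_exp hδ).1 (hδv.trans hv'.le))
    (slitPt_ne_zero (exp_ne_zero p)))
  convert (moments (wedge sg R δ η A)).add_mem ((moments _).add_mem wR wL) hsl using 1
  funext n
  obtain ⟨iR, E1⟩ := integral_mom_edge hsg (e := 1) (Or.inl rfl) (ψ := seamRight sg φ p)
    (r := Real.exp ρ) (C := C) (u₀ := u₀) (y₀ := y₀) (fun ζ h1 h2 => by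
      rw [← hp]
      exact differentiableAt_seamRight hφ (by simpa using h1) (by simpa using h2)) (fun ζ h1 h2 => by
      rw [← hp, ofReal_one, one_mul, seamRight, add_sub_cancel_left]
      refine norm_comp_log_le ?_ hb h1 h2
      have := Real.pi_pos
      rcases hsg with h | h <;> rw [h, abs_of_nonneg] <;> nlinarith) n
    (τ := v - u₀) (by linarith) hvr ha' hb'
  obtain ⟨iL, E2⟩ := integral_mom_edge hsg (e := -1) (Or.inr rfl) (ψ := seamLeft φ p)
    (r := Real.exp ρ) (C := C) (u₀ := u₀) (y₀ := y₀) (fun ζ h1 h2 => by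
      rw [← hp]
      exact differentiableAt_seamLeft hφ (by simpa using h1) (by simpa using h2)) (fun ζ h1 h2 => by
      rw [← hp, ofReal_neg, ofReal_one, neg_one_mul, seamLeft, sub_add_cancel_left, neg_neg]
      refine norm_comp_log_le ?_ hb h1 h2
      have := Real.pi_pos
      rw [abs_of_pos this]
      linarith) n
    (τ := u₀ - v') (by linarith) hv'r ha' hb'
  have t1 : u₀ + 1 * (v - u₀) = v := by ring
  have t2 : u₀ + -1 * (u₀ - v') = v' := by ring
  rw [t1] at E1
  rw [t2, intervalIntegral.integral_symm v' u₀] at E2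
  have hyn : ∀ y ∈ Set.Ioc y₀ b, |y - y₀| < Real.exp ρ / 2 := fun y hy =>
    abs_lt.2 ⟨by linarith [hy.1], by linarith [hy.2, hb'.2]⟩
  have J := integral_seam_sub (f := fun s => Φ (exp s)) hsg hp hQ n ha' hb1.1
    (fun y hy => eL u₀ hu₀ y hy.1 (hyn y hy)) (fun y hy => eR u₀ hu₀ y hy.1 (hyn y hy)) iL iR
  have hfi : ∀ y, y ≠ y₀ → |y - y₀| < h₀ → ∀ c d : ℝ, c ∈ Set.Icc v' v → d ∈ Set.Icc v' v →
      IntervalIntegrable (fun x => mom (fun s => Φ (exp s)) n (cpt sg x y)) volume c d :=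
    fun y hy hy' c d hc hd => intervalIntegrable_left fun x hx =>
      continuousAt_mom (hf x ((Set.ordConnected_Icc.uIcc_subset hc hd) hx) y hy hy') n
  have hvm : v ∈ Set.Icc v' v := ⟨(hv'.trans hv).le, le_rfl⟩
  have hvm' : v' ∈ Set.Icc v' v := ⟨le_rfl, (hv'.trans hv).le⟩
  have S1 := intervalIntegral.integral_add_adjacent_intervals
    ((hfi b hb1.1.ne' hyb0 v' u₀ hvm' hu₀).sub (hfi a ha.2.ne hya0 v' u₀ hvm' hu₀))
    ((hfi b hb1.1.ne' hyb0 u₀ v hu₀ hvm).sub (hfi a ha.2.ne hya0 u₀ v hu₀ hvm))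
  have iS := integrableOn_slitVal hQd hQ0 hηρ sg
  have iS' : IntervalIntegrable (fun v => slitVal sg Q v * (slitPt sg (exp p) v)⁻¹ ^ n) volume 0 η₁ := by
    refine IntervalIntegrable.mul_continuousOn ?_ (Continuous.continuousOn
      (((continuous_slitPt sg _).inv₀ (slitPt_ne_zero (exp_ne_zero p))).pow n))
    rwa [intervalIntegrable_iff_integrableOn_Ioc_of_le hη.le]
  have S2 := intervalIntegral.integral_add_adjacent_intervals
    (iS'.mono_set (c := 0) (d := y₀ - a) (by
      rw [Set.uIcc_of_le (by linarith [ha.2]), Set.uIcc_of_le hη.le]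
      exact Set.Icc_subset_Icc_right (by linarith [ha.1])))
    (iS'.mono_set (c := y₀ - a) (d := η₁) (by
      rw [Set.uIcc_of_le (by linarith [ha.1]), Set.uIcc_of_le hη.le]
      exact Set.Icc_subset_Icc_left (by linarith [ha.2])))
  have S3 : 2 * Real.pi * slit sg η₁ Q (exp p) n =
      sg * ∫ v in 0..η₁, slitVal sg Q v * (slitPt sg (exp p) v)⁻¹ ^ n := by
    rw [slit, intervalIntegral.integral_of_le hη.le, integral_Ioc_eq_integral_Ioo]
    have := Real.pi_ne_zero
    have : (Real.pi : ℂ) ≠ 0 := ofReal_ne_zero.2 this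
    field_simp
  simp only [Pi.add_apply, Pi.smul_apply, smul_eq_mul]
  rw [S3, ← S1, ← S2]
  linear_combination E1 - E2 - J

section row
variable {σ : Side} {S : Set ℂ} {Φ : ℂ → ℂ} {P : ℂ → ℂ → ℂ} {R δ η η₁ y₀ h₀ : ℝ} {A : Set ℂ}

theorem norm_cpt_le {sg : ℝ} (hsg : sg = 1 ∨ sg = -1) (x y : ℝ) : ‖cpt sg x y‖ ≤ |x| + |y| := by
  have h1 := norm_le_abs_re_add_abs_im (cpt sg x y)
  have h2 : |sg| = 1 := by rcases hsg with rfl | rfl <;> simp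
  rwa [cpt_re, cpt_im, abs_mul, h2, one_mul] at h1

theorem cpt_sub_cpt (sg x y x' y' : ℝ) : cpt sg x y - cpt sg x' y' = cpt sg (x - x') (y - y') := by
  simp only [cpt]
  push_cast
  ring

theorem isSeam_of_isOpen {ψ : ℂ → ℂ} {U : Set ℂ} (hU : IsOpen U) (hψ : DifferentiableOn ℂ ψ U)
    {u v : ℝ} (he : ∀ s ∈ U, 0 < σ.sgn * (s - cpt σ.sgn u y₀).im → Φ (exp s) = ψ s)
    (hv : cpt σ.sgn v y₀ ∈ U) : IsSeam σ.sgn Φ ψ (cpt σ.sgn v y₀) := by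
  refine ⟨hψ.analyticAt (hU.mem_nhds hv), ?_⟩
  filter_upwards [hU.mem_nhds hv] with s hs h
  refine he s hs ?_
  simpa using h

/-- Moving the contour along a part of a ray without singular points. -/
theorem box_mem {ψ : ℂ → ℂ} {x₁ v w r : ℝ} (hα : exp (cpt σ.sgn x₁ y₀) ∈ A) (hδ : 0 < δ)
    (hη : 0 < η) (hwv : w ≤ v) (hw : Real.log δ ≤ w) (hr : 0 < r) (hh₀ : 0 < h₀)
    (hf : ∀ x ∈ Set.Icc w v, ∀ y, y ≠ y₀ → |y - y₀| < h₀ →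
      ContinuousAt (fun s => Φ (exp s)) (cpt σ.sgn x y))
    (hψ : ∀ x ∈ Set.Icc w v, ∀ y, |y - y₀| < r → DifferentiableAt ℂ ψ (cpt σ.sgn x y))
    (he : ∀ x ∈ Set.Icc w v, ∀ y, y₀ < y → |y - y₀| < r →
      Φ (exp (cpt σ.sgn x y)) = ψ (cpt σ.sgn x y)) :
    ∃ h > 0, ∀ a ∈ Set.Ioo (y₀ - h) y₀, ∀ b ∈ Set.Ioo y₀ (y₀ + h),
      (fun n => (∫ y in a..b, mom ψ n (cpt σ.sgn v y)) - (∫ y in a..b, mom ψ n (cpt σ.sgn w y)) +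
        (I * σ.sgn) * (∫ x in w..v, (mom (fun s => Φ (exp s)) n (cpt σ.sgn x b) -
          mom (fun s => Φ (exp s)) n (cpt σ.sgn x a)))) ∈ moments (wedge σ.sgn R δ η A) := by
  refine ⟨min h₀ (min r η), lt_min hh₀ (lt_min hr hη), fun a ha b hb => ?_⟩
  have hm1 := min_le_left h₀ (min r η)
  have hm2 := (min_le_right h₀ (min r η)).trans (min_le_left _ _)
  have hm3 := (min_le_right h₀ (min r η)).trans (min_le_right _ _)
  have ha0 : |a - y₀| < min h₀ (min r η) := abs_lt.2 ⟨by linarith [ha.1], by linarith [ha.2, hb.1, hb.2]⟩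
  have hb0 : |b - y₀| < min h₀ (min r η) := abs_lt.2 ⟨by linarith [hb.1, ha.1, ha.2], by linarith [hb.2]⟩
  have hs : ∀ x ∈ Set.uIcc w v, x ∈ Set.Icc w v := fun x hx => by rwa [Set.uIcc_of_le hwv] at hx
  have h1 := walls_sub_mem (sg := σ.sgn) (W := wedge σ.sgn R δ η A) (f := fun s => Φ (exp s))
    (ψ := ψ) (v' := w) (v := v) (a := a) (b := b)
    (fun x hx => hf x (hs x hx) a ha.2.ne (ha0.trans_le hm1))
    (fun x hx => (hψ x (hs x hx) a (ha0.trans_le hm2)).continuousAt)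
    (fun x hx => (hψ x (hs x hx) b (hb0.trans_le hm2)).continuousAt)
    (fun x hx => he x (hs x hx) b hb.1 (hb0.trans_le hm2))
    (fun x hx => exp_cpt_mem_wedge hα hδ (hw.trans (hs x hx).1) ha.2 (by linarith [ha.1]))
  convert h1 using 1
  funext n
  have h2 := integral_rect (g := mom ψ n) σ.sgn_eq (u' := w) (u := v) (a := a) (b := b)
    fun x hx y hy => differentiableAt_mom
      (hψ x (hs x hx) y ((abs_sub_lt_of_mem_uIcc ha hb hy).trans_le hm2)) n
  linear_combination h2

theorem exp_cpt_mem_principalStar {sg x y : ℝ} (h0 : (0 : ℂ) ∉ S)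
    (h : ∀ x' ≤ x, exp (cpt sg x' y) ∉ S) : exp (cpt sg x y) ∈ principalStar S := by
  rw [mem_principalStar]
  intro t ht
  rcases ht.1.eq_or_lt with rfl | ht0
  · simpa
  · have e : (t : ℂ) * exp (cpt sg x y) = exp (cpt sg (x + Real.log t) y) := by
      rw [← Real.exp_log ht0, Real.log_exp, ofReal_exp, ← exp_add]
      congr 1
      simp only [cpt]
      push_cast
      ring
    rw [e]
    exact h _ (by linarith [Real.log_nonpos ht.1 ht.2])

theorem differentiableAt_comp_exp (hD : DifferentiableOn ℂ Φ (principalStar S)) (hS : IsSingularSet S)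
    {s : ℂ} (hs : exp s ∈ principalStar S) : DifferentiableAt ℂ (fun s => Φ (exp s)) s :=
  ((hD _ hs).differentiableAt ((isOpen_principalStar hS.isClosed).mem_nhds hs)).comp s
    differentiableAt_exp

open Classical in
/-- The total slit at the points of a ray of radius less than `exp u`. -/
noncomputable def rowSlits (sg η₁ y₀ : ℝ) (P : ℂ → ℂ → ℂ) (SR : Finset ℂ) (u : ℝ) (n : ℕ) : ℂ :=
  ∑ α ∈ SR, if Real.log ‖α‖ < u ∧ exp (cpt sg (Real.log ‖α‖) y₀) = α then slit sg η₁ (P α) α n else 0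

theorem rowSlits_congr {sg : ℝ} {SR : Finset ℂ} {u v : ℝ}
    (h : ∀ α ∈ SR, exp (cpt sg (Real.log ‖α‖) y₀) = α → (Real.log ‖α‖ < u ↔ Real.log ‖α‖ < v)) :
    rowSlits sg η₁ y₀ P SR u = rowSlits sg η₁ y₀ P SR v := by
  funext n
  refine Finset.sum_congr rfl fun α hα => ?_
  by_cases h1 : exp (cpt sg (Real.log ‖α‖) y₀) = α
  · simp only [h1, and_true, h α hα h1]
  · simp only [h1, and_false]

theorem rowSlits_cross {sg : ℝ} {SR : Finset ℂ} {u v w : ℝ} (hα : exp (cpt sg u y₀) ∈ SR)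
    (hw : w < u) (hv : u < v)
    (h : ∀ α ∈ SR, Real.log ‖α‖ ≠ u → (Real.log ‖α‖ < v ↔ Real.log ‖α‖ < w)) (n : ℕ) :
    rowSlits sg η₁ y₀ P SR v n - rowSlits sg η₁ y₀ P SR w n =
      slit sg η₁ (P (exp (cpt sg u y₀))) (exp (cpt sg u y₀)) n := by
  rw [rowSlits, rowSlits, ← Finset.sum_sub_distrib]
  have hl : Real.log ‖exp (cpt sg u y₀)‖ = u := by rw [norm_exp_cpt, Real.log_exp]
  rw [Finset.sum_eq_single_of_mem _ hα]
  · rw [hl, if_pos ⟨hv, rfl⟩, if_neg (by simp [hw.le]), sub_zero]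
  · intro β hβ hne
    by_cases h1 : Real.log ‖β‖ = u
    · have h2 : exp (cpt sg (Real.log ‖β‖) y₀) ≠ β := by
        rw [h1]
        exact hne.symm
      simp [h2]
    · simp only [h β hβ h1, sub_self]

/-- The contour integral over a small arc, in terms of walls on both sides of the ray and of slits at
the singular points on the ray. -/
theorem row_mem (hS : IsSingularSet S) (hD : SeamData σ S Φ P) (hP : ∀ α ∈ S, Tame (P α))
    {SR : Finset ℂ} (hSR : ∀ α, α ∈ SR ↔ α ∈ S ∧ ‖α‖ < R) (hR : ∀ α ∈ S, ‖α‖ ≠ R)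
    (hδ0 : 0 < δ) (hδ : ∀ α ∈ S, δ < ‖α‖) (hδR : δ < R) (hη₁ : 0 < η₁) (hη : η₁ ≤ η)
    (hηρ : ∀ α ∈ SR, ∃ ρ, Real.log η₁ < ρ ∧ DifferentiableOn ℂ (P α) {w | w.re < ρ})
    (hh₀ : 0 < h₀)
    (hrow : ∀ y, y ≠ y₀ → |y - y₀| < h₀ → ∀ x ≤ Real.log R, exp (cpt σ.sgn x y) ∉ S)
    {x₁ : ℝ} (hα : exp (cpt σ.sgn x₁ y₀) ∈ SR) :
    ∃ h > 0, ∀ a ∈ Set.Ioo (y₀ - h) y₀, ∀ b ∈ Set.Ioo y₀ (y₀ + h),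
      (fun n => (∫ y in a..b, mom (fun s => Φ (exp s)) n (cpt σ.sgn (Real.log δ) y)) -
        (I * σ.sgn) * (∫ x in Real.log δ..Real.log R, (mom (fun s => Φ (exp s)) n (cpt σ.sgn x b) -
          mom (fun s => Φ (exp s)) n (cpt σ.sgn x a))) -
        2 * Real.pi * rowSlits σ.sgn η₁ y₀ P SR (Real.log R) n) ∈
      moments (wedge σ.sgn R δ η SR) := by
  classical
  have hlt : Real.log δ < Real.log R := Real.log_lt_log hδ0 hδR
  have h0S : (0 : ℂ) ∉ S := fun h => by simpa using (hδ 0 h).trans' hδ0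
  have hf : ∀ x ≤ Real.log R, ∀ y, y ≠ y₀ → |y - y₀| < h₀ →
      ContinuousAt (fun s => Φ (exp s)) (cpt σ.sgn x y) := fun x hx y hy hy' =>
    (differentiableAt_comp_exp hD.differentiableOn hS (exp_cpt_mem_principalStar h0S
      fun x' hx' => hrow y hy hy' x' (hx'.trans hx))).continuousAt
  set M := moments (wedge σ.sgn R δ η SR) with hM
  set f : ℂ → ℂ := fun s => Φ (exp s) with hfdef
  set T := rowSlits σ.sgn η₁ y₀ P SR with hT
  set G : ℝ → Prop := fun u => exp (cpt σ.sgn u y₀) ∉ S with hG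
  have hex : ∀ u, ∃ φ, G u → IsSeam σ.sgn Φ φ (cpt σ.sgn u y₀) := by
    intro u
    by_cases h : G u
    · obtain ⟨φ, h1⟩ := hD.seam _ h
      exact ⟨φ, fun _ => h1⟩
    · exact ⟨0, fun h' => absurd h' h⟩
  choose φ hφ using hex
  set wall : ℝ → ℝ → ℝ → ℝ → ℕ → ℂ := fun w v a b n =>
    ∫ x in w..v, (mom f n (cpt σ.sgn x b) - mom f n (cpt σ.sgn x a)) with hwall
  set V : (ℂ → ℂ) → ℝ → ℝ → ℝ → ℕ → ℂ := fun ψ u a b n =>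
    ∫ y in a..b, mom ψ n (cpt σ.sgn u y) with hV
  set K : ℝ → ℝ → Prop := fun v w => ∃ h > 0, ∀ a ∈ Set.Ioo (y₀ - h) y₀, ∀ b ∈ Set.Ioo y₀ (y₀ + h),
    (fun n => V (φ v) v a b n - V (φ w) w a b n +
      (I * σ.sgn) * (wall (Real.log δ) v a b n - wall (Real.log δ) w a b n) +
      2 * Real.pi * (T v n - T w n)) ∈ M with hK
  have shrink : ∀ {h h' a : ℝ}, a ∈ Set.Ioo (y₀ - min h h') y₀ →
      a ∈ Set.Ioo (y₀ - h) y₀ ∧ a ∈ Set.Ioo (y₀ - h') y₀ := fun {h h' a} ha =>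
    ⟨⟨by linarith [ha.1, min_le_left h h'], ha.2⟩, ⟨by linarith [ha.1, min_le_right h h'], ha.2⟩⟩
  have shrink' : ∀ {h h' a : ℝ}, a ∈ Set.Ioo y₀ (y₀ + min h h') →
      a ∈ Set.Ioo y₀ (y₀ + h) ∧ a ∈ Set.Ioo y₀ (y₀ + h') := fun {h h' a} ha =>
    ⟨⟨ha.1, by linarith [ha.2, min_le_left h h']⟩, ⟨ha.1, by linarith [ha.2, min_le_right h h']⟩⟩
  have symm : ∀ u v, K u v → K v u := by
    rintro u v ⟨h, h0, h1⟩
    refine ⟨h, h0, fun a ha b hb => ?_⟩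
    convert M.neg_mem (h1 a ha b hb) using 1
    funext n
    simp only [Pi.neg_apply]
    ring
  have trans : ∀ u v w, K u v → K v w → K u w := by
    rintro u v w ⟨h, h0, h1⟩ ⟨h', h0', h1'⟩
    refine ⟨min h h', lt_min h0 h0', fun a ha b hb => ?_⟩
    convert M.add_mem (h1 a (shrink ha).1 b (shrink' hb).1) (h1' a (shrink ha).2 b (shrink' hb).2) using 1
    funext n
    simp only [Pi.add_apply]
    ring
  have hKof : ∀ v w, v ∈ Set.Icc (Real.log δ) (Real.log R) → w ∈ Set.Icc (Real.log δ) (Real.log R) →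
      w ≤ v → G v → G w → (∃ ψ ψ', IsSeam σ.sgn Φ ψ (cpt σ.sgn v y₀) ∧
      IsSeam σ.sgn Φ ψ' (cpt σ.sgn w y₀) ∧ ∃ h > 0, ∀ a ∈ Set.Ioo (y₀ - h) y₀,
      ∀ b ∈ Set.Ioo y₀ (y₀ + h), (fun n => V ψ v a b n - V ψ' w a b n +
        (I * σ.sgn) * wall w v a b n + 2 * Real.pi * (T v n - T w n)) ∈ M) → K v w := by
    rintro v w hv hw hwv hGv hGw ⟨ψ, ψ', hψ, hψ', h, h0, h1⟩
    obtain ⟨k, k0, k1⟩ := integral_mom_eq_of_eventuallyEq ((hφ v hGv).eventuallyEq σ.sgn_eq hψ)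
    obtain ⟨l, l0, l1⟩ := integral_mom_eq_of_eventuallyEq ((hφ w hGw).eventuallyEq σ.sgn_eq hψ')
    refine ⟨min (min h h₀) (min k l), lt_min (lt_min h0 hh₀) (lt_min k0 l0), fun a ha b hb => ?_⟩
    convert h1 a (shrink (shrink ha).1).1 b (shrink' (shrink' hb).1).1 using 1
    funext n
    have e1 := k1 a (shrink (shrink ha).2).1 b (shrink' (shrink' hb).2).1 n
    have e2 := l1 a (shrink (shrink ha).2).2 b (shrink' (shrink' hb).2).2 n
    have ha0 := (shrink (shrink ha).1).2
    have hb0 := (shrink' (shrink' hb).1).2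
    have hi : ∀ c d, c ∈ Set.Icc (Real.log δ) (Real.log R) → d ∈ Set.Icc (Real.log δ) (Real.log R) →
        IntervalIntegrable (fun x => mom f n (cpt σ.sgn x b) - mom f n (cpt σ.sgn x a)) volume c d := by
      intro c d hc hd
      have hs := Set.ordConnected_Icc.uIcc_subset hc hd
      refine IntervalIntegrable.sub (intervalIntegrable_left fun x hx => continuousAt_mom
        (hf x (hs hx).2 b hb.1.ne' (abs_lt.2 ⟨by linarith [hb.1], by linarith [hb0.2]⟩)) n)
        (intervalIntegrable_left fun x hx => continuousAt_mom
        (hf x (hs hx).2 a ha.2.ne (abs_lt.2 ⟨by linarith [ha0.1], by linarith [ha.2]⟩)) n)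
    have e3 := intervalIntegral.integral_add_adjacent_intervals (hi _ _ ⟨le_rfl, hlt.le⟩ hw) (hi _ _ hw hv)
    simp only [hV, hwall]
    rw [e1, e2, ← e3]
    ring
  have hloc : ∀ u ∈ Set.Icc (Real.log δ) (Real.log R), ∃ ε > 0,
      ∀ v ∈ Set.Icc (Real.log δ) (Real.log R), ∀ w ∈ Set.Icc (Real.log δ) (Real.log R),
        |v - u| < ε → |w - u| < ε → G v → G w → w ≤ v → K v w := by
    intro u hu
    have hgap : ∀ᶠ ε in 𝓝[>] (0 : ℝ), ∀ α ∈ SR, Real.log ‖α‖ ≠ u → ε < |Real.log ‖α‖ - u| := by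
      refine (Finset.eventually_all SR).2 fun α _ => ?_
      by_cases h : Real.log ‖α‖ = u
      · exact Eventually.of_forall fun ε h' => absurd h h'
      · filter_upwards [Ioo_mem_nhdsGT (abs_pos.2 (sub_ne_zero.2 h))] with ε hε _ using hε.2
    have hT' : ∀ ε, (∀ α ∈ SR, Real.log ‖α‖ ≠ u → ε < |Real.log ‖α‖ - u|) → ∀ v w,
        |v - u| < ε → |w - u| < ε → ∀ α ∈ SR, Real.log ‖α‖ ≠ u →
        (Real.log ‖α‖ < v ↔ Real.log ‖α‖ < w) := by
      intro ε hε v w hv hw α hα hne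
      have h1 := hε α hα hne
      rw [abs_lt] at hv hw
      rcases lt_abs.1 h1 with h | h
      · constructor <;> intro h' <;> linarith [hv.1, hv.2, hw.1, hw.2]
      · constructor <;> intro h' <;> linarith [hv.1, hv.2, hw.1, hw.2]
    by_cases hGu : G u
    · have hseam := hφ u hGu
      obtain ⟨r, hr, h1⟩ := Metric.eventually_nhds_iff_ball.1
        (hseam.1.eventually_analyticAt.and hseam.2)
      obtain ⟨ε, hε, hε0, hεr⟩ := (hgap.and (Ioo_mem_nhdsGT (show (0 : ℝ) < r / 2 by linarith))).exists
      have hball : ∀ x y, |x - u| < ε → |y - y₀| < r / 2 →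
          cpt σ.sgn x y ∈ Metric.ball (cpt σ.sgn u y₀) r := by
        intro x y hx hy
        rw [mem_ball_iff_norm, cpt_sub_cpt]
        exact (norm_cpt_le σ.sgn_eq _ _).trans_lt (by linarith)
      have hsm : ∀ v, |v - u| < ε → IsSeam σ.sgn Φ (φ u) (cpt σ.sgn v y₀) := fun v hv =>
        isSeam_of_isOpen (u := u) Metric.isOpen_ball
          (fun s hs => (h1 s hs).1.differentiableAt.differentiableWithinAt)
          (fun s hs => (h1 s hs).2) (hball v y₀ hv (by simpa using hr))
      refine ⟨ε, hε0, fun v hv w hw hvu hwu hGv hGw hwv => hKof v w hv hw hwv hGv hGw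
        ⟨φ u, φ u, hsm v hvu, hsm w hwu, ?_⟩⟩
      have hbx : ∀ x ∈ Set.Icc w v, |x - u| < ε := fun x hx => by
        rw [abs_lt] at *
        constructor <;> linarith [hx.1, hx.2]
      obtain ⟨h, h0, h2⟩ := box_mem (R := R) (ψ := φ u) (h₀ := h₀) (r := r / 2) hα hδ0
        (hη₁.trans_le hη) hwv hw.1 (by linarith) hh₀ (fun x hx => hf x (hx.2.trans hv.2))
        (fun x hx y hy => (h1 _ (hball x y (hbx x hx) hy)).1.differentiableAt)
        (fun x hx y hy hy' => (h1 _ (hball x y (hbx x hx) hy')).2 (by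
          rw [cpt_sub_cpt, cpt_im, ← mul_assoc, σ.sgn_mul_self, one_mul]
          linarith))
      refine ⟨h, h0, fun a ha b hb => ?_⟩
      have e : T v = T w := rowSlits_congr fun α hα' hrw => hT' ε hε v w hvu hwu α hα' fun h' => by
        rw [h'] at hrw
        exact hGu (by rw [hrw]; exact ((hSR α).1 hα').1)
      convert h2 a ha b hb using 1
      funext n
      rw [e, sub_self, mul_zero, add_zero]
    · have hGu' : exp (cpt σ.sgn u y₀) ∈ S := not_not.1 hGu
      have hnrm := norm_exp_cpt σ.sgn u y₀
      have huR : exp (cpt σ.sgn u y₀) ∈ SR := by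
        refine (hSR _).2 ⟨hGu', lt_of_le_of_ne ?_ (hR _ hGu')⟩
        rw [hnrm]
        exact (Real.le_log_iff_exp_le (hδ0.trans hδR)).1 hu.2
      obtain ⟨ρ, ψ, C, t1, t2, t3, t4, t5⟩ := hD.tip _ hGu'
      obtain ⟨ε, hε, hε0, hεr⟩ := (hgap.and (Ioo_mem_nhdsGT (show (0 : ℝ) < Real.exp ρ / 2 by
        have := Real.exp_pos ρ
        linarith))).exists
      set p := cpt σ.sgn u y₀ with hp
      have hnp : ∀ x y, |x - u| < ε → |y - y₀| < Real.exp ρ / 2 → ‖cpt σ.sgn x y - p‖ < Real.exp ρ := by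
        intro x y hx hy
        rw [hp, cpt_sub_cpt]
        exact (norm_cpt_le σ.sgn_eq _ _).trans_lt (by linarith)
      have hre : ∀ x y, (cpt σ.sgn x y - p).re = x - u := fun x y => by rw [hp, cpt_sub_cpt, cpt_re]
      have him : ∀ x y, σ.sgn * (cpt σ.sgn x y - p).im = y - y₀ := fun x y => by
        rw [hp, cpt_sub_cpt, cpt_im, ← mul_assoc, σ.sgn_mul_self, one_mul]
      have hy0 : |y₀ - y₀| < Real.exp ρ / 2 := by simpa using Real.exp_pos ρ
      have hopen : IsOpen {s : ℂ | 0 < (s - p).re ∧ ‖s - p‖ < Real.exp ρ} := by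
        have c1 : Continuous fun s : ℂ => (s - p).re := by fun_prop
        have c2 : Continuous fun s : ℂ => ‖s - p‖ := by fun_prop
        exact (isOpen_lt continuous_const c1).inter (isOpen_lt c2 continuous_const)
      have hopen' : IsOpen {s : ℂ | 0 < (p - s).re ∧ ‖p - s‖ < Real.exp ρ} := by
        have c1 : Continuous fun s : ℂ => (p - s).re := by fun_prop
        have c2 : Continuous fun s : ℂ => ‖p - s‖ := by fun_prop
        exact (isOpen_lt continuous_const c1).inter (isOpen_lt c2 continuous_const)
      have hsr : ∀ v, u < v → |v - u| < ε → IsSeam σ.sgn Φ (seamRight σ.sgn ψ p) (cpt σ.sgn v y₀) :=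
        fun v hv hvu => isSeam_of_isOpen (u := u) (U := {s | 0 < (s - p).re ∧ ‖s - p‖ < Real.exp ρ})
          hopen
          (fun s hs => (differentiableAt_seamRight t1 (mem_slitPlane_iff.2 (Or.inl hs.1))
            hs.2).differentiableWithinAt)
          (fun s hs h => apply_seamRight t5 hs.2 h)
          ⟨by rw [hre]; linarith, hnp v y₀ hvu hy0⟩
      have hsl : ∀ v, v < u → |v - u| < ε → IsSeam σ.sgn Φ (seamLeft ψ p) (cpt σ.sgn v y₀) :=
        fun v hv hvu => isSeam_of_isOpen (u := u) (U := {s | 0 < (p - s).re ∧ ‖p - s‖ < Real.exp ρ})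
          hopen'
          (fun s hs => (differentiableAt_seamLeft t1 (mem_slitPlane_iff.2 (Or.inl hs.1))
            hs.2).differentiableWithinAt)
          (fun s hs h => apply_seamLeft t5 (by rw [norm_sub_rev]; exact hs.2) h)
          ⟨by rw [← neg_sub, neg_re, hre]; linarith, by rw [norm_sub_rev]; exact hnp v y₀ hvu hy0⟩
      refine ⟨ε, hε0, fun v hv w hw hvu hwu hGv hGw hwv => hKof v w hv hw hwv hGv hGw ?_⟩
      have hvne : v ≠ u := fun h => by rw [h] at hGv; exact hGu hGv
      have hwne : w ≠ u := fun h => by rw [h] at hGw; exact hGu hGw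
      have hbx : ∀ x ∈ Set.Icc w v, |x - u| < ε := fun x hx => by
        rw [abs_lt] at *
        constructor <;> linarith [hx.1, hx.2]
      have hexp : 0 < Real.exp ρ / 2 := by have := Real.exp_pos ρ; linarith
      rcases hvne.lt_or_gt with hvlt | hvgt
      · obtain ⟨h, h0, h2⟩ := box_mem (R := R) (ψ := seamLeft ψ p) (h₀ := h₀) (r := Real.exp ρ / 2) hα
          hδ0 (hη₁.trans_le hη) hwv hw.1 hexp hh₀ (fun x hx => hf x (hx.2.trans hv.2))
          (fun x hx y hy => differentiableAt_seamLeft t1 (mem_slitPlane_iff.2 (Or.inl (by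
            rw [← neg_sub, neg_re, hre]
            linarith [hx.2]))) (by rw [norm_sub_rev]; exact hnp x y (hbx x hx) hy))
          (fun x hx y hy hy' => apply_seamLeft t5 (hnp x y (hbx x hx) hy') (by rw [him]; linarith))
        refine ⟨_, _, hsl v hvlt hvu, hsl w (by linarith) hwu, h, h0, fun a ha b hb => ?_⟩
        have e : T v = T w := rowSlits_congr fun α hα' hrw => by
          by_cases h' : Real.log ‖α‖ = u
          · rw [h']
            exact iff_of_false (by linarith) (by linarith)
          · exact hT' ε hε v w hvu hwu α hα' h'
        convert h2 a ha b hb using 1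
        funext n
        rw [e, sub_self, mul_zero, add_zero]
      · rcases hwne.lt_or_gt with hwlt | hwgt
        · obtain ⟨ρ', hρ', hρd⟩ := hηρ _ huR
          rw [abs_lt] at hvu hwu
          obtain ⟨h, h0, h2⟩ := crossing_mem (R := R) (A := (SR : Set ℂ)) hp (by exact_mod_cast huR)
            t1 t3 t4 t5 hρd
            (hP _ hGu').2 hη₁ hη hρ' hδ0 hwlt hvgt (by linarith [hwu.1]) (by linarith [hvu.2]) hw.1
            hh₀ (fun x hx => hf x (hx.2.trans hv.2))
          rw [← abs_lt] at hvu hwu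
          refine ⟨_, _, hsr v hvgt hvu, hsl w hwlt hwu, h, h0, fun a ha b hb => ?_⟩
          convert h2 a ha b hb using 1
          funext n
          rw [hT, rowSlits_cross huR hwlt hvgt (hT' ε hε v w hvu hwu) n]
        · obtain ⟨h, h0, h2⟩ := box_mem (R := R) (ψ := seamRight σ.sgn ψ p) (h₀ := h₀)
            (r := Real.exp ρ / 2) hα
            hδ0 (hη₁.trans_le hη) hwv hw.1 hexp hh₀ (fun x hx => hf x (hx.2.trans hv.2))
            (fun x hx y hy => differentiableAt_seamRight t1 (mem_slitPlane_iff.2 (Or.inl (by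
              rw [hre]
              linarith [hx.1]))) (hnp x y (hbx x hx) hy))
            (fun x hx y hy hy' => apply_seamRight t5 (hnp x y (hbx x hx) hy') (by rw [him]; linarith))
          refine ⟨_, _, hsr v hvgt hvu, hsr w hwgt hwu, h, h0, fun a ha b hb => ?_⟩
          have e : T v = T w := rowSlits_congr fun α hα' hrw => by
            by_cases h' : Real.log ‖α‖ = u
            · rw [h']
              exact iff_of_true (by linarith) (by linarith)
            · exact hT' ε hε v w hvu hwu α hα' h'
          convert h2 a ha b hb using 1
          funext n
          rw [e, sub_self, mul_zero, add_zero]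
  have hGdense : ∀ u ∈ Set.Icc (Real.log δ) (Real.log R), ∀ ε > 0,
      ∃ v ∈ Set.Icc (Real.log δ) (Real.log R), |v - u| < ε ∧ G v := by
    intro u hu ε hε
    have hne : (Set.Ioo (max (Real.log δ) (u - ε)) (min (Real.log R) (u + ε))).Infinite := by
      refine Set.Ioo_infinite (max_lt (lt_min hlt (by linarith [hu.1])) (lt_min ?_ (by linarith)))
      linarith [hu.2]
    obtain ⟨v, hv, hv'⟩ := hne.exists_notMem_finset (SR.image fun α => Real.log ‖α‖)
    have h1 := max_lt_iff.1 hv.1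
    have h2 := lt_min_iff.1 hv.2
    refine ⟨v, ⟨h1.1.le, h2.1.le⟩, abs_lt.2 ⟨by linarith, by linarith⟩, fun h => hv' ?_⟩
    refine Finset.mem_image.2 ⟨_, (hSR _).2 ⟨h, ?_⟩, by rw [norm_exp_cpt, Real.log_exp]⟩
    rw [norm_exp_cpt]
    exact (Real.lt_log_iff_exp_lt (hδ0.trans hδR)).1 h2.1
  have hmain := related_of_locally_related (s := Set.Icc (Real.log δ) (Real.log R)) isPreconnected_Icc
    hGdense (fun u v _ _ => symm u v) (fun u v w _ _ _ => trans u v w) (fun u hu => by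
      obtain ⟨ε, hε, h⟩ := hloc u hu
      refine ⟨ε, hε, fun v hv w hw h1 h2 h3 h4 => ?_⟩
      rcases le_total w v with h5 | h5
      · exact h v hv w hw h1 h2 h3 h4 h5
      · exact symm _ _ (h w hw v hv h2 h1 h4 h3 h5))
  have hGR : G (Real.log R) := fun h => hR _ h (by
    rw [norm_exp_cpt, Real.exp_log (hδ0.trans hδR)])
  have hstar : exp (cpt σ.sgn (Real.log δ) y₀) ∈ principalStar S :=
    exp_cpt_mem_principalStar h0S fun x hx h => by
      have h1 := hδ _ h
      rw [norm_exp_cpt] at h1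
      exact absurd ((Real.log_lt_iff_lt_exp hδ0).2 h1) (not_lt.2 hx)
  have hGδ : G (Real.log δ) := fun h => by
    have := mem_principalStar.1 hstar 1 ⟨zero_le_one, le_rfl⟩
    rw [ofReal_one, one_mul] at this
    exact this h
  have hseamδ : IsSeam σ.sgn Φ f (cpt σ.sgn (Real.log δ) y₀) :=
    isSeam_of_isOpen (u := Real.log δ) (U := {s | exp s ∈ principalStar S})
      ((isOpen_principalStar hS.isClosed).preimage continuous_exp)
      (fun s hs => (differentiableAt_comp_exp hD.differentiableOn hS hs).differentiableWithinAt)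
      (fun s _ _ => rfl) hstar
  obtain ⟨h, h0, h1⟩ := hmain _ ⟨hlt.le, le_rfl⟩ _ ⟨le_rfl, hlt.le⟩ hGR hGδ
  obtain ⟨k, k0, k1⟩ := integral_mom_eq_of_eventuallyEq
    ((hφ _ hGδ).eventuallyEq σ.sgn_eq hseamδ)
  obtain ⟨l, l0, l1⟩ := eventually_cpt_of_nhds (hφ _ hGR).1.eventually_analyticAt
  refine ⟨min h (min k l), lt_min h0 (lt_min k0 l0), fun a ha b hb => ?_⟩
  have hc : V (φ (Real.log R)) (Real.log R) a b ∈ M :=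
    moments_of_segment_right (fun y hy => (l1 y (abs_sub_lt_of_mem_uIcc (shrink (shrink ha).2).2
      (shrink' (shrink' hb).2).2 hy)).continuousAt) fun y _ => Or.inl (by
        rw [Set.mem_ofPred_eq, norm_exp_cpt, Real.exp_log (hδ0.trans hδR)])
  convert M.sub_mem hc (h1 a (shrink ha).1 b (shrink' hb).1) using 1
  funext n
  have e1 := k1 a (shrink (shrink ha).2).1 b (shrink' (shrink' hb).2).1 n
  have e2 : T (Real.log δ) n = 0 := Finset.sum_eq_zero fun α hα' => if_neg fun h' =>
    absurd (Real.log_lt_log hδ0 (hδ α ((hSR α).1 hα').1)) (not_lt.2 h'.1.le)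
  simp only [Pi.sub_apply, hV, hwall]
  rw [e1, e2, intervalIntegral.integral_same]
  ring

end row

section coeff
variable {σ : Side} {S : Set ℂ} {Φ : ℂ → ℂ} {P : ℂ → ℂ → ℂ} {R δ η η₁ : ℝ}

theorem integral_circle_eq {F : ℕ → ℂ} (hδ : 0 < δ)
    (hF : ∀ᶠ z in 𝓝 (0 : ℂ), HasSum (fun n => F n * z ^ n) (Φ z))
    (hΦ : DifferentiableOn ℂ Φ (Metric.closedBall 0 δ)) (n : ℕ) :
    ∫ θ in (0 : ℝ)..2 * Real.pi, mom (fun s => Φ (exp s)) n (Real.log δ + θ * I) =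
      2 * Real.pi * F n := by
  lift δ to NNReal using hδ.le
  have hδ' : 0 < δ := by exact_mod_cast hδ
  have h1 := (hΦ.hasFPowerSeriesOnBall hδ').hasFPowerSeriesAt
  have h2 : HasFPowerSeriesAt Φ (FormalMultilinearSeries.ofScalars ℂ F) 0 := by
    rw [hasFPowerSeriesAt_iff]
    filter_upwards [hF] with z hz
    simpa [FormalMultilinearSeries.coeff_ofScalars, mul_comm] using hz
  have h3 := h1.eq_formalMultilinearSeries h2
  have h4 : F n = (2 * Real.pi * I)⁻¹ • ∮ z in C(0, δ), (1 / (z - 0)) ^ n • (z - 0)⁻¹ • Φ z := by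
    rw [← cauchyPowerSeries_apply, h3]
    have := FormalMultilinearSeries.coeff_ofScalars (𝕜 := ℂ) (p := F) (n := n)
    rw [← this, FormalMultilinearSeries.coeff]
    rfl
  have h5 : ∮ z in C(0, δ), (1 / (z - 0)) ^ n • (z - 0)⁻¹ • Φ z =
      I * ∫ θ in (0 : ℝ)..2 * Real.pi, mom (fun s => Φ (exp s)) n (Real.log δ + θ * I) := by
    rw [circleIntegral, ← intervalIntegral.integral_const_mul]
    refine intervalIntegral.integral_congr fun θ _ => ?_
    have h6 : circleMap 0 δ θ = exp (Real.log δ + θ * I) := by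
      rw [circleMap_zero, exp_add, ← ofReal_exp, Real.exp_log hδ]
    have h7 := exp_ne_zero ((Real.log δ : ℂ) + θ * I)
    simp only [deriv_circleMap, sub_zero, smul_eq_mul, mom, one_div]
    rw [h6]
    field_simp
  rw [h4, h5, smul_eq_mul]
  generalize (∫ θ in (0 : ℝ)..2 * Real.pi, mom (fun s => Φ (exp s)) n (Real.log δ + θ * I)) = J
  have := Real.pi_ne_zero
  have : (Real.pi : ℂ) ≠ 0 := ofReal_ne_zero.2 this
  field_simp

theorem integral_circle_cpt {sg : ℝ} (hsg : sg = 1 ∨ sg = -1) {F : ℕ → ℂ} (hδ : 0 < δ)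
    (hF : ∀ᶠ z in 𝓝 (0 : ℂ), HasSum (fun n => F n * z ^ n) (Φ z))
    (hΦ : DifferentiableOn ℂ Φ (Metric.closedBall 0 δ)) (n : ℕ) (a : ℝ) :
    ∫ y in a..a + 2 * Real.pi, mom (fun s => Φ (exp s)) n (cpt sg (Real.log δ) y) =
      2 * Real.pi * F n := by
  have hper : Function.Periodic
      (fun θ : ℝ => mom (fun s => Φ (exp s)) n (Real.log δ + θ * I)) (2 * Real.pi) := by
    intro θ
    have : exp ((Real.log δ : ℂ) + (θ + 2 * Real.pi : ℝ) * I) = exp (Real.log δ + θ * I) := by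
      rw [← exp_periodic (Real.log δ + θ * I)]
      congr 1
      push_cast
      ring
    simp only [mom, this]
  have h0 : sg ≠ 0 := by rcases hsg with rfl | rfl <;> simp
  have h1 := intervalIntegral.integral_comp_mul_left (a := a) (b := a + 2 * Real.pi)
    (fun θ : ℝ => mom (fun s => Φ (exp s)) n (Real.log δ + θ * I)) h0
  have h2 := integral_circle_eq hδ hF hΦ n
  refine (Eq.trans ?_ h1).trans ?_
  · rfl
  · rw [← h2, ← zero_add (2 * Real.pi)]
    rcases hsg with rfl | rfl
    · rw [inv_one, one_smul, one_mul, one_mul]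
      exact (by simpa using hper.intervalIntegral_add_eq a 0)
    · rw [intervalIntegral.integral_symm, ← hper.intervalIntegral_add_eq (-(a + 2 * Real.pi)) 0]
      rw [show -1 * (a + (0 + 2 * Real.pi)) = -(a + 2 * Real.pi) by ring,
        show -1 * a = -(a + 2 * Real.pi) + 2 * Real.pi by ring]
      norm_num

theorem exists_int_of_exp_cpt {sg x y : ℝ} (hsg : sg = 1 ∨ sg = -1) {α : ℂ}
    (h : exp (cpt sg x y) = α) : ∃ m : ℤ, (y - sg * arg α) / (2 * Real.pi) = m := by
  have hα : α ≠ 0 := h ▸ exp_ne_zero _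
  have h1 := h
  rw [← exp_log hα, exp_eq_exp_iff_exists_int] at h1
  obtain ⟨n, hn⟩ := h1
  have h2 := congrArg Complex.im hn
  have h3 : sg * y = arg α + n * (2 * Real.pi) := by simpa [log_im] using h2
  have hpi := Real.pi_ne_zero
  rcases hsg with rfl | rfl
  · refine ⟨n, ?_⟩
    field_simp
    linarith
  · refine ⟨-n, ?_⟩
    push_cast
    field_simp
    linarith

theorem exp_cpt_of_int {sg y : ℝ} (hsg : sg = 1 ∨ sg = -1) {α : ℂ} (hα : α ≠ 0) {m : ℤ}
    (h : (y - sg * arg α) / (2 * Real.pi) = m) : exp (cpt sg (Real.log ‖α‖) y) = α := by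
  have hpi := Real.pi_ne_zero
  have h1 : y = sg * arg α + m * (2 * Real.pi) := by
    field_simp at h
    linarith
  conv_rhs => rw [← exp_log hα]
  rw [exp_eq_exp_iff_exists_int]
  have h2 : log α = Real.log ‖α‖ + arg α * I := rfl
  rcases hsg with rfl | rfl
  · refine ⟨m, ?_⟩
    rw [h2, cpt, h1]
    push_cast
    ring
  · refine ⟨-m, ?_⟩
    rw [h2, cpt, h1]
    push_cast
    ring

/-- Taylor coefficients are sums of slits at the singular points of radius less than `R`, up to
moments of measures in `wedge`. -/
theorem coeff_sub_mem (hS : IsSingularSet S) (hD : SeamData σ S Φ P) (hP : ∀ α ∈ S, Tame (P α))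
    {F : ℕ → ℂ} (hF : ∀ᶠ z in 𝓝 (0 : ℂ), HasSum (fun n => F n * z ^ n) (Φ z))
    {SR : Finset ℂ} (hSR : ∀ α, α ∈ SR ↔ α ∈ S ∧ ‖α‖ < R) (hR : ∀ α ∈ S, ‖α‖ ≠ R)
    (hδ0 : 0 < δ) (hδ : ∀ α ∈ S, δ < ‖α‖) (hδR : δ < R) (hη₁ : 0 < η₁) (hη : η₁ ≤ η)
    (hηρ : ∀ α ∈ SR, ∃ ρ, Real.log η₁ < ρ ∧ DifferentiableOn ℂ (P α) {w | w.re < ρ}) :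
    (fun n => F n - ∑ α ∈ SR, slit σ.sgn η₁ (P α) α n) ∈ moments (wedge σ.sgn R δ η SR) := by
  have hlt : Real.log δ < Real.log R := Real.log_lt_log hδ0 hδR
  have hR0 := hδ0.trans hδR
  have h0S : (0 : ℂ) ∉ S := fun h => by simpa using (hδ 0 h).trans' hδ0
  have hpi := Real.pi_pos
  set M := moments (wedge σ.sgn R δ η SR) with hM
  set f : ℂ → ℂ := fun s => Φ (exp s) with hfdef
  set G : ℝ → Prop := fun y => ∀ x ≤ Real.log R, exp (cpt σ.sgn x y) ∉ S with hG
  set t : ℂ → ℝ → ℝ := fun α y => (y - σ.sgn * arg α) / (2 * Real.pi) with ht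
  have hGt : ∀ y, (∀ α ∈ SR, ∀ m : ℤ, t α y ≠ m) → G y := by
    intro y h x hx hxS
    have h1 : exp (cpt σ.sgn x y) ∈ SR := by
      refine (hSR _).2 ⟨hxS, lt_of_le_of_ne ?_ (hR _ hxS)⟩
      rw [norm_exp_cpt]
      exact (Real.le_log_iff_exp_le hR0).1 hx
    obtain ⟨m, hm⟩ := exists_int_of_exp_cpt σ.sgn_eq (α := exp (cpt σ.sgn x y)) rfl
    exact h _ h1 m hm
  have hne0 : ∀ α ∈ SR, α ≠ 0 := fun α hα h => h0S (h ▸ ((hSR α).1 hα).1)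
  have htG : ∀ y, G y → ∀ α ∈ SR, ∀ m : ℤ, t α y ≠ m := by
    intro y hy α hα m hm
    have h1 := exp_cpt_of_int σ.sgn_eq (hne0 α hα) hm
    refine hy (Real.log ‖α‖) ?_ ?_
    · exact Real.log_le_log (norm_pos_iff.2 (hne0 α hα)) ((hSR α).1 hα).2.le
    · rw [h1]
      exact ((hSR α).1 hα).1
  have hdf : ∀ x ≤ Real.log R, ∀ y, G y → DifferentiableAt ℂ f (cpt σ.sgn x y) := fun x hx y hy =>
    differentiableAt_comp_exp hD.differentiableOn hS (exp_cpt_mem_principalStar h0S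
      fun x' hx' => hy x' (hx'.trans hx))
  have hball : Metric.closedBall 0 δ ⊆ principalStar S := by
    intro z hz
    rw [mem_principalStar]
    intro r hr h
    have h1 := hδ _ h
    rw [norm_mul, norm_real, Real.norm_of_nonneg hr.1] at h1
    rw [mem_closedBall_zero_iff] at hz
    nlinarith [hr.1, hr.2, norm_nonneg z]
  have hcirc : ∀ y, DifferentiableAt ℂ f (cpt σ.sgn (Real.log δ) y) := fun y =>
    differentiableAt_comp_exp hD.differentiableOn hS (hball (by
      rw [mem_closedBall_zero_iff, norm_exp_cpt, Real.exp_log hδ0]))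
  have hci : ∀ n a b, IntervalIntegrable (fun y => mom f n (cpt σ.sgn (Real.log δ) y)) volume a b :=
    fun n a b => intervalIntegrable_right fun y _ => continuousAt_mom (hcirc y).continuousAt n
  have hwi : ∀ n a, G a →
      IntervalIntegrable (fun x => mom f n (cpt σ.sgn x a)) volume (Real.log δ) (Real.log R) :=
    fun n a ha => intervalIntegrable_left fun x hx => continuousAt_mom (hdf x (by
      rw [Set.uIcc_of_le hlt.le] at hx
      exact hx.2) a ha).continuousAt n
  set Q : ℝ → ℕ → ℂ := fun a n => (∫ y in 0..a, mom f n (cpt σ.sgn (Real.log δ) y)) -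
    (I * σ.sgn) * (∫ x in Real.log δ..Real.log R, mom f n (cpt σ.sgn x a)) -
    2 * Real.pi * ∑ α ∈ SR, (⌊t α a⌋ : ℂ) * slit σ.sgn η₁ (P α) α n with hQ
  have hQsub : ∀ a b, G a → G b → ∀ n, Q b n - Q a n =
      (∫ y in a..b, mom f n (cpt σ.sgn (Real.log δ) y)) -
      (I * σ.sgn) * (∫ x in Real.log δ..Real.log R, (mom f n (cpt σ.sgn x b) -
        mom f n (cpt σ.sgn x a))) -
      2 * Real.pi * ∑ α ∈ SR, ((⌊t α b⌋ : ℂ) - ⌊t α a⌋) * slit σ.sgn η₁ (P α) α n := by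
    intro a b ha hb n
    have e1 := intervalIntegral.integral_add_adjacent_intervals (hci n 0 a) (hci n a b)
    have e2 := intervalIntegral.integral_sub (hwi n b hb) (hwi n a ha)
    simp only [hQ, sub_mul, Finset.sum_sub_distrib]
    rw [e2, ← e1]
    ring
  set K : ℝ → ℝ → Prop := fun a b => (fun n => Q b n - Q a n) ∈ M with hK
  have symm : ∀ a b, K a b → K b a := by
    intro a b h
    convert M.neg_mem h using 1
    funext n
    simp
  have trans : ∀ a b c, K a b → K b c → K a c := by
    intro a b c h h'
    convert M.add_mem h h' using 1
    funext n
    simp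
  have hplain : ∀ a b, a ≤ b → (∀ y ∈ Set.Icc a b, G y) → (∀ α ∈ SR, ⌊t α a⌋ = ⌊t α b⌋) → K a b := by
    intro a b hab hg hfl
    have h1 : (fun n => ∫ y in a..b, mom f n (cpt σ.sgn (Real.log R) y)) ∈ M :=
      moments_of_segment_right (fun y hy => (hdf _ le_rfl y (hg y (by
        rwa [Set.uIcc_of_le hab] at hy))).continuousAt) fun y _ => Or.inl (by
        rw [Set.mem_ofPred_eq, norm_exp_cpt, Real.exp_log hR0])
    change (fun n => Q b n - Q a n) ∈ M
    convert h1 using 1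
    funext n
    rw [hQsub a b (hg a ⟨le_rfl, hab⟩) (hg b ⟨hab, le_rfl⟩), Finset.sum_eq_zero fun α hα => by
      rw [hfl α hα, sub_self, zero_mul]]
    have h2 := integral_rect (g := mom f n) σ.sgn_eq (u' := Real.log δ) (u := Real.log R) (a := a)
      (b := b) fun x hx y hy => differentiableAt_mom (hdf x (by
        rw [Set.uIcc_of_le hlt.le] at hx
        exact hx.2) y (hg y (by rwa [Set.uIcc_of_le hab] at hy))) n
    linear_combination -h2
  have hnear : ∀ y₀, ∃ h > 0, ∀ y, |y - y₀| < h → ∀ α ∈ SR,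
      ((⌈t α y₀⌉ : ℝ) - 1 < t α y ∧ t α y < ⌊t α y₀⌋ + 1) := by
    intro y₀
    have h1 : ∀ᶠ y in 𝓝 y₀, ∀ α ∈ SR, ((⌈t α y₀⌉ : ℝ) - 1 < t α y ∧ t α y < ⌊t α y₀⌋ + 1) := by
      refine (Finset.eventually_all SR).2 fun α _ => ?_
      have hc : ContinuousAt (t α) y₀ := by
        simp only [ht]
        fun_prop
      exact (hc.eventually (lt_mem_nhds (by linarith [Int.ceil_lt_add_one (t α y₀)]))).and
        (hc.eventually (gt_mem_nhds (Int.lt_floor_add_one _)))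
    obtain ⟨h, h0, h2⟩ := Metric.eventually_nhds_iff.1 h1
    exact ⟨h, h0, fun y hy => h2 (by rwa [Real.dist_eq])⟩
  have hmono : ∀ α {y y' : ℝ}, y < y' → t α y < t α y' := by
    intro α y y' h
    simp only [ht]
    gcongr
  have hbelow : ∀ {y₀ y : ℝ} {α : ℂ}, ((⌈t α y₀⌉ : ℝ) - 1 < t α y ∧ t α y < ⌊t α y₀⌋ + 1) → y < y₀ →
      ⌊t α y⌋ = ⌈t α y₀⌉ - 1 ∧ ∀ m : ℤ, t α y ≠ m := by
    intro y₀ y α h hy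
    have h1 := (hmono α hy).trans_le (Int.le_ceil (t α y₀))
    have h2 : ⌊t α y⌋ = ⌈t α y₀⌉ - 1 := Int.floor_eq_iff.2 ⟨by push_cast; exact h.1.le, by
      push_cast
      linarith⟩
    refine ⟨h2, fun m hm => ?_⟩
    have h3 := h.1
    rw [hm] at h1 h3
    have h4 : ⌈t α y₀⌉ - 1 < m := by exact_mod_cast h3
    have h5 : m < ⌈t α y₀⌉ := by exact_mod_cast h1
    omega
  have habove : ∀ {y₀ y : ℝ} {α : ℂ}, ((⌈t α y₀⌉ : ℝ) - 1 < t α y ∧ t α y < ⌊t α y₀⌋ + 1) → y₀ < y →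
      ⌊t α y⌋ = ⌊t α y₀⌋ ∧ ∀ m : ℤ, t α y ≠ m := by
    intro y₀ y α h hy
    have h1 := (Int.floor_le (t α y₀)).trans_lt (hmono α hy)
    refine ⟨Int.floor_eq_iff.2 ⟨h1.le, h.2⟩, fun m hm => ?_⟩
    have h3 := h.2
    rw [hm] at h1 h3
    have h4 : ⌊t α y₀⌋ < m := by exact_mod_cast h1
    have h5 : m < ⌊t α y₀⌋ + 1 := by exact_mod_cast h3
    omega
  have hloc : ∀ y₀ : ℝ, ∃ ε > 0, ∀ a b : ℝ, |a - y₀| < ε → |b - y₀| < ε → G a → G b → a ≤ b →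
      K a b := by
    intro y₀
    obtain ⟨h, h0, h1⟩ := hnear y₀
    have hint : ∀ {a b y : ℝ}, |a - y₀| < h → |b - y₀| < h → y ∈ Set.Icc a b → |y - y₀| < h :=
      fun ha hb hy => by
        rw [abs_lt] at *
        constructor <;> linarith [hy.1, hy.2]
    by_cases hy₀ : G y₀
    · refine ⟨h, h0, fun a b ha hb _ _ hab => ?_⟩
      have h2 : ∀ α ∈ SR, ∀ y, |y - y₀| < h → ⌊t α y⌋ = ⌊t α y₀⌋ := by
        intro α hα y hy
        have h3 := h1 y hy α hα
        have h4 : ⌈t α y₀⌉ - 1 = ⌊t α y₀⌋ := by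
          have h5 := htG y₀ hy₀ α hα ⌊t α y₀⌋
          have h6 := lt_of_le_of_ne (Int.floor_le (t α y₀)) (Ne.symm h5)
          have h7 : ⌈t α y₀⌉ = ⌊t α y₀⌋ + 1 := Int.ceil_eq_iff.2 ⟨by push_cast; linarith, by
            push_cast
            exact (Int.lt_floor_add_one _).le⟩
          omega
        refine Int.floor_eq_iff.2 ⟨?_, h3.2⟩
        rw [← h4]
        push_cast
        exact h3.1.le
      refine hplain a b hab (fun y hy => ?_) fun α hα => (h2 α hα a ha).trans (h2 α hα b hb).symm
      rcases lt_trichotomy y y₀ with h3 | rfl | h3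
      · exact hGt y fun α hα => (hbelow (h1 y (hint ha hb hy) α hα) h3).2
      · exact hy₀
      · exact hGt y fun α hα => (habove (h1 y (hint ha hb hy) α hα) h3).2
    · have hGne : ∀ y, y ≠ y₀ → |y - y₀| < h → G y := by
        intro y hy hy'
        rcases hy.lt_or_gt with h3 | h3
        · exact hGt y fun α hα => (hbelow (h1 y hy' α hα) h3).2
        · exact hGt y fun α hα => (habove (h1 y hy' α hα) h3).2
      obtain ⟨x₁, hx₁, hx₁S⟩ : ∃ x₁ ≤ Real.log R, exp (cpt σ.sgn x₁ y₀) ∈ S := by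
        by_contra h'
        push Not at h'
        exact hy₀ h'
      have hx₁R : exp (cpt σ.sgn x₁ y₀) ∈ SR := by
        refine (hSR _).2 ⟨hx₁S, lt_of_le_of_ne ?_ (hR _ hx₁S)⟩
        rw [norm_exp_cpt]
        exact (Real.le_log_iff_exp_le hR0).1 hx₁
      obtain ⟨k, k0, k1⟩ := row_mem hS hD hP hSR hR hδ0 hδ hδR hη₁ hη hηρ h0
        (fun y hy hy' => hGne y hy hy') hx₁R
      refine ⟨min h k, lt_min h0 k0, fun a b ha hb hGa hGb hab => ?_⟩
      have ha' := ha.trans_le (min_le_left h k)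
      have hb' := hb.trans_le (min_le_left h k)
      have hane : a ≠ y₀ := fun h' => hy₀ (h' ▸ hGa)
      have hbne : b ≠ y₀ := fun h' => hy₀ (h' ▸ hGb)
      rcases hane.lt_or_gt with h2 | h2
      · rcases hbne.lt_or_gt with h3 | h3
        · refine hplain a b hab (fun y hy => hGne y (hy.2.trans_lt h3).ne (hint ha' hb' hy))
            fun α hα => ?_
          rw [(hbelow (h1 a ha' α hα) h2).1, (hbelow (h1 b hb' α hα) h3).1]
        · have h4 := k1 a ⟨by linarith [(abs_lt.1 (ha.trans_le (min_le_right h k))).1], h2⟩ b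
            ⟨h3, by linarith [(abs_lt.1 (hb.trans_le (min_le_right h k))).2]⟩
          change (fun n => Q b n - Q a n) ∈ M
          convert h4 using 1
          funext n
          rw [hQsub a b hGa hGb, rowSlits]
          congr 2
          refine Finset.sum_congr rfl fun α hα => ?_
          have hlα : Real.log ‖α‖ < Real.log R :=
            Real.log_lt_log (norm_pos_iff.2 (hne0 α hα)) ((hSR α).1 hα).2
          rw [(hbelow (h1 a ha' α hα) h2).1, (habove (h1 b hb' α hα) h3).1]
          by_cases h5 : exp (cpt σ.sgn (Real.log ‖α‖) y₀) = α
          · obtain ⟨m, hm⟩ := exists_int_of_exp_cpt σ.sgn_eq h5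
            have hm' : t α y₀ = m := hm
            rw [if_pos ⟨hlα, h5⟩, hm', Int.floor_intCast, Int.ceil_intCast]
            push_cast
            ring
          · rw [if_neg fun h' => h5 h'.2]
            have h6 : t α y₀ ≠ ⌊t α y₀⌋ := fun h' => h5 (exp_cpt_of_int σ.sgn_eq (hne0 α hα) h')
            have h7 := lt_of_le_of_ne (Int.floor_le (t α y₀)) (Ne.symm h6)
            have h8 : ⌈t α y₀⌉ = ⌊t α y₀⌋ + 1 := Int.ceil_eq_iff.2 ⟨by push_cast; linarith, by
              push_cast
              exact (Int.lt_floor_add_one _).le⟩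
            rw [h8]
            push_cast
            ring
      · have h3 : y₀ < b := h2.trans_le hab
        refine hplain a b hab (fun y hy => hGne y (h2.trans_le hy.1).ne' (hint ha' hb' hy))
          fun α hα => ?_
        rw [(habove (h1 a ha' α hα) h2).1, (habove (h1 b hb' α hα) h3).1]
  have hdense : ∀ u ∈ (Set.univ : Set ℝ), ∀ ε > 0, ∃ v ∈ Set.univ, |v - u| < ε ∧ G v := by
    intro u _ ε hε
    obtain ⟨h, h0, h1⟩ := hnear u
    have h2 : 0 < min h ε := lt_min h0 hε
    have h3 : |u + min h ε / 2 - u| < min h ε := by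
      rw [add_sub_cancel_left, abs_of_pos (by linarith)]
      linarith
    exact ⟨u + min h ε / 2, trivial, h3.trans_le (min_le_right _ _), hGt _ fun α hα =>
      (habove (h1 _ (h3.trans_le (min_le_left _ _)) α hα) (by linarith)).2⟩
  have hmain := related_of_locally_related (s := Set.univ) isPreconnected_univ
    hdense (fun u v _ _ => symm u v) (fun u v w _ _ _ => trans u v w) (fun u _ => by
      obtain ⟨ε, hε, h⟩ := hloc u
      refine ⟨ε, hε, fun v _ w _ h1 h2 h3 h4 => ?_⟩
      rcases le_total v w with h5 | h5
      · exact h v w h1 h2 h3 h4 h5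
      · exact symm _ _ (h w v h2 h1 h4 h3 h5))
  obtain ⟨a, -, -, ha⟩ := hdense 0 trivial 1 one_pos
  have hper : ∀ x, exp (cpt σ.sgn x (a + 2 * Real.pi)) = exp (cpt σ.sgn x a) := by
    intro x
    rw [exp_eq_exp_iff_exists_int]
    rcases σ.sgn_eq with h | h
    · refine ⟨1, ?_⟩
      rw [cpt, cpt, h]
      push_cast
      ring
    · refine ⟨-1, ?_⟩
      rw [cpt, cpt, h]
      push_cast
      ring
  have ha' : G (a + 2 * Real.pi) := fun x hx => by
    rw [hper]
    exact ha x hx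
  have hfin := M.smul_mem (2 * Real.pi : ℂ)⁻¹ (hmain a trivial _ trivial ha ha')
  convert hfin using 1
  funext n
  have hpi0 : (Real.pi : ℂ) ≠ 0 := ofReal_ne_zero.2 hpi.ne'
  have e1 := integral_circle_cpt σ.sgn_eq hδ0 hF (hD.differentiableOn.mono hball) n a
  have e2 : ∀ x, mom f n (cpt σ.sgn x (a + 2 * Real.pi)) - mom f n (cpt σ.sgn x a) = 0 := fun x => by
    simp only [mom, hfdef, hper, sub_self]
  have e3 : ∀ α, ((⌊t α (a + 2 * Real.pi)⌋ : ℂ) - ⌊t α a⌋) = 1 := by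
    intro α
    have : t α (a + 2 * Real.pi) = t α a + 1 := by
      simp only [ht]
      field_simp
      ring
    rw [this, Int.floor_add_one]
    push_cast
    ring
  simp only [Pi.smul_apply, smul_eq_mul]
  rw [hQsub a _ ha ha', e1]
  simp only [e2, e3, one_mul, intervalIntegral.integral_zero]
  field_simp
  ring

end coeff

/-! ### Rays avoiding the wedges -/

/-- The points of radius at least `r`, and those on rays slightly beyond the rays through `Γ`. -/
def sector (sg r η : ℝ) (Γ : Set ℂ) : Set ℂ :=
  {z | r ≤ ‖z‖} ∪ {z | ∃ γ ∈ Γ, ∃ y ∈ Set.Ioc 0 η, ∃ t : ℝ, 0 < t ∧ z = t * slitPt sg γ y}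

/-- The ray through `z₀` either contains `γ` or is well separated from it. -/
def Separated (η : ℝ) (z₀ γ : ℂ) : Prop :=
  (∃ s : ℝ, 0 < s ∧ z₀ = s * γ) ∨ 2 * η * (z₀ / γ).re < |(z₀ / γ).im|

theorem eventually_separated {z₀ γ : ℂ} (hz₀ : z₀ ≠ 0) (hγ : γ ≠ 0) :
    ∀ᶠ η in 𝓝[>] (0 : ℝ), Separated η z₀ γ := by
  by_cases h : (z₀ / γ).im = 0
  · rcases lt_trichotomy (z₀ / γ).re 0 with h1 | h1 | h1
    · filter_upwards [self_mem_nhdsWithin] with η hη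
      have : (0 : ℝ) < η := hη
      right
      rw [h, abs_zero]
      nlinarith
    · exact absurd (Complex.ext h1 h : z₀ / γ = 0) (div_ne_zero hz₀ hγ)
    · refine Eventually.of_forall fun η => Or.inl ⟨_, h1, ?_⟩
      have : ((z₀ / γ).re : ℂ) = z₀ / γ := Complex.ext (by simp) (by simp [h])
      rw [this, div_mul_cancel₀ _ hγ]
  · have h1 : Tendsto (fun η : ℝ => 2 * η * (z₀ / γ).re) (𝓝[>] 0) (𝓝 0) := by
      have : Continuous fun η : ℝ => 2 * η * (z₀ / γ).re := by fun_prop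
      simpa using (this.tendsto 0).mono_left nhdsWithin_le_nhds
    filter_upwards [h1.eventually (gt_mem_nhds (abs_pos.2 h))] with η hη using Or.inr hη

section separated
variable {sg r η : ℝ} {z₀ γ : ℂ} {Γ : Set ℂ}

theorem ray_div_re (sg : ℝ) (hγ : γ ≠ 0) (t y : ℝ) (hsg : sg = 1 ∨ sg = -1) :
    (t * slitPt sg γ y / γ).re = t * Real.cos y := by
  have h : t * slitPt sg γ y / γ = t * exp ((-(sg * y) : ℝ) * I) := by
    rw [slitPt]
    field_simp
    push_cast
    ring_nf
  rw [h, re_ofReal_mul, exp_ofReal_mul_I_re]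
  rcases hsg with rfl | rfl <;> simp

theorem ray_div_im (sg : ℝ) (hγ : γ ≠ 0) (t y : ℝ) (hsg : sg = 1 ∨ sg = -1) :
    sg * (t * slitPt sg γ y / γ).im = -(t * Real.sin y) := by
  have h : t * slitPt sg γ y / γ = t * exp ((-(sg * y) : ℝ) * I) := by
    rw [slitPt]
    field_simp
    push_cast
    ring_nf
  rw [h, im_ofReal_mul, exp_ofReal_mul_I_im]
  rcases hsg with rfl | rfl <;> simp

theorem not_separated_right (hsg : sg = 1 ∨ sg = -1) (hγ : γ ≠ 0) (hη : η ≤ 1) {t y : ℝ} (ht : 0 < t)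
    (hy : y ∈ Set.Icc 0 η) {z : ℂ} (hz : z = t * slitPt sg γ y) :
    ¬ 2 * η * (z / γ).re < |(z / γ).im| := by
  have h1 := ray_div_re sg hγ t y hsg
  have h2 := ray_div_im sg hγ t y hsg
  rw [← hz] at h1 h2
  have h3 : |(z / γ).im| = t * Real.sin y := by
    have h4 : 0 ≤ Real.sin y := Real.sin_nonneg_of_nonneg_of_le_pi hy.1
      (by linarith [hy.2, Real.pi_gt_three])
    have h5 : |sg * (z / γ).im| = |(z / γ).im| := by
      rcases hsg with rfl | rfl <;> simp
    rw [← h5, h2, abs_neg, abs_of_nonneg (by positivity)]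
  rw [h1, h3, not_lt]
  have h6 := Real.sin_le hy.1
  have h7 := Real.one_sub_sq_div_two_le_cos (x := y)
  have h8 : 1 / 2 ≤ Real.cos y := by nlinarith [hy.1, hy.2]
  have h9 : Real.sin y ≤ 2 * η * Real.cos y := by nlinarith [hy.1, hy.2]
  nlinarith

theorem Separated.ne (h : Separated η z₀ γ) (hsg : sg = 1 ∨ sg = -1) (hγ : γ ≠ 0) (hη : η ≤ 1)
    {t y : ℝ} (ht : 0 < t) (hy : y ∈ Set.Ioc 0 η) : z₀ ≠ t * slitPt sg γ y := by
  intro hz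
  rcases h with ⟨s, hs, h⟩ | h
  · have h2 := ray_div_im sg hγ t y hsg
    have h3 : 0 < Real.sin y := Real.sin_pos_of_pos_of_lt_pi hy.1 (by linarith [hy.2, Real.pi_gt_three])
    rw [← hz, h, mul_div_cancel_right₀ _ hγ, ofReal_im, mul_zero] at h2
    have := mul_pos ht h3
    linarith
  · exact not_separated_right hsg hγ hη ht ⟨hy.1.le, hy.2⟩ hz h

theorem Separated.eventually_ne (h : Separated η z₀ γ) (hsg : sg = 1 ∨ sg = -1) (hγ : γ ≠ 0)
    (hη : η ≤ 1) : ∀ᶠ z in 𝓝 z₀, 0 < sg * (z / z₀).im →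
      ∀ t : ℝ, 0 < t → ∀ y ∈ Set.Icc 0 η, z ≠ t * slitPt sg γ y := by
  rcases h with ⟨s, hs, h⟩ | h
  · refine Eventually.of_forall fun z hz t ht y hy he => ?_
    have h2 := ray_div_im sg hγ t y hsg
    have h3 : 0 ≤ Real.sin y := Real.sin_nonneg_of_nonneg_of_le_pi hy.1
      (by linarith [hy.2, Real.pi_gt_three])
    rw [← he] at h2
    have h4 : z / γ = s * (z / z₀) := by
      have : (s : ℂ) ≠ 0 := ofReal_ne_zero.2 hs.ne'
      rw [h]
      field_simp
    rw [h4, im_ofReal_mul, mul_left_comm] at h2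
    have := mul_pos hs hz
    have := mul_nonneg ht.le h3
    linarith
  · have hc1 : Continuous fun z : ℂ => 2 * η * (z / γ).re := by fun_prop
    have hc2 : Continuous fun z : ℂ => |(z / γ).im| := by fun_prop
    filter_upwards [(isOpen_lt hc1 hc2).mem_nhds h] with z hz _ t ht y hy he
    exact not_separated_right hsg hγ hη ht hy he hz

theorem eventually_mem_principalStar_of_separated (hsg : sg = 1 ∨ sg = -1) (hΓ : Γ.Finite)
    (hΓ0 : (0 : ℂ) ∉ Γ) (h0η : 0 ≤ η) (hη : η ≤ 1) (h : ∀ γ ∈ Γ, Separated η z₀ γ)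
    (hr : ‖z₀‖ < r) {K : Set ℂ} (hK0 : (0 : ℂ) ∉ K) (hK : K ⊆ sector sg r η Γ ∪ Γ) :
    ∀ᶠ z in 𝓝 z₀, 0 < sg * (z / z₀).im → z ∈ principalStar K := by
  have h1 : ∀ᶠ z in 𝓝 z₀, ∀ γ ∈ Γ, 0 < sg * (z / z₀).im →
      ∀ t : ℝ, 0 < t → ∀ y ∈ Set.Icc 0 η, z ≠ t * slitPt sg γ y :=
    (hΓ.eventually_all).2 fun γ hγ => (h γ hγ).eventually_ne hsg (fun h => hΓ0 (h ▸ hγ)) hη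
  have h2 : ∀ᶠ z in 𝓝 z₀, ‖z‖ < r := continuous_norm.continuousAt.eventually (gt_mem_nhds hr)
  filter_upwards [h1, h2] with z h1 h2 hz
  rw [mem_principalStar]
  intro t ht htz
  rcases ht.1.eq_or_lt with rfl | ht0
  · exact hK0 (by simpa using htz)
  have h3 : ∀ γ ∈ Γ, ∀ y ∈ Set.Icc 0 η, ∀ t' : ℝ, 0 < t' → (t : ℂ) * z ≠ t' * slitPt sg γ y := by
    intro γ hγ y hy t' ht' he
    refine h1 γ hγ hz (t' / t) (div_pos ht' ht0) y hy ?_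
    have : (t : ℂ) ≠ 0 := ofReal_ne_zero.2 ht0.ne'
    push_cast
    field_simp
    rw [mul_comm] at he
    exact he
  rcases hK htz with (h4 | ⟨γ, hγ, y, hy, t', ht', he⟩) | h4
  · rw [Set.mem_ofPred_eq, norm_mul, norm_real, Real.norm_of_nonneg ht.1] at h4
    nlinarith [ht.2, norm_nonneg z]
  · exact h3 γ hγ y ⟨hy.1.le, hy.2⟩ t' ht' he
  · exact h3 _ h4 0 ⟨le_rfl, h0η⟩ 1 one_pos (by simp [slitPt_zero])

theorem mul_notMem_sector (hsg : sg = 1 ∨ sg = -1) (hΓ0 : (0 : ℂ) ∉ Γ) (hη : η ≤ 1)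
    (h : ∀ γ ∈ Γ, Separated η z₀ γ) (hr : ‖z₀‖ < r) {t : ℝ} (ht : 0 < t) (ht1 : t ≤ 1) :
    (t : ℂ) * z₀ ∉ sector sg r η Γ := by
  rintro (h4 | ⟨γ, hγ, y, hy, t', ht', he⟩)
  · rw [Set.mem_ofPred_eq, norm_mul, norm_real, Real.norm_of_nonneg ht.le] at h4
    nlinarith [norm_nonneg z₀]
  · refine (h γ hγ).ne hsg (fun h => hΓ0 (h ▸ hγ)) hη (div_pos ht' ht) hy ?_
    have : (t : ℂ) ≠ 0 := ofReal_ne_zero.2 ht.ne'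
    push_cast
    field_simp
    rw [mul_comm] at he
    exact he

theorem mem_principalStar_of_separated (hsg : sg = 1 ∨ sg = -1)
    (hΓ0 : (0 : ℂ) ∉ Γ) (hη : η ≤ 1) (h : ∀ γ ∈ Γ, Separated η z₀ γ) (hr : ‖z₀‖ < r)
    {K X : Set ℂ} (hK0 : (0 : ℂ) ∉ K) (hK : K ⊆ sector sg r η Γ ∪ Γ) (hΓX : Γ ⊆ X)
    (hz : z₀ ∈ principalStar X) : z₀ ∈ principalStar K := by
  rw [mem_principalStar] at hz ⊢
  intro t ht htz
  rcases ht.1.eq_or_lt with rfl | ht0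
  · exact hK0 (by simpa using htz)
  · rcases hK htz with h1 | h1
    · exact mul_notMem_sector hsg hΓ0 hη h hr ht0 ht.2 h1
    · exact hz t ht (hΓX h1)

end separated

/-! ### Local targets -/

/-- The sequence `a` has a generating function with a continuation to points of the star of `X`,
with an integrable branch at `z₀` of variation `D`, regular if `z₀ ∉ X`. -/
def LocalTarget (σ : Side) (z₀ : ℂ) (X : Set ℂ) (a : ℕ → ℂ) (D : LogGerm) : Prop :=
  ∃ (K : Set ℂ) (h : ℂ → ℂ), Continues a K h ∧ (z₀ ∈ principalStar X → z₀ ∈ principalStar K) ∧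
    (∀ᶠ w in logFilter, w.im ∈ σ.args → pt z₀ w ∈ principalStar K) ∧
    (∃ L ∈ integrableGerms, IsBranchAt h σ z₀ L ∧ Del L = D) ∧ (z₀ ∉ X → IsRegularAt h σ z₀)

theorem principalStar_union (K L : Set ℂ) :
    principalStar (K ∪ L) = principalStar K ∩ principalStar L := by
  ext z
  simp [principalStar, Set.disjoint_union_right]

theorem LocalTarget.add {σ : Side} {z₀ : ℂ} {X : Set ℂ} {a b : ℕ → ℂ} {D E : LogGerm}
    (ha : LocalTarget σ z₀ X a D) (hb : LocalTarget σ z₀ X b E) :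
    LocalTarget σ z₀ X (a + b) (D + E) := by
  obtain ⟨K, h, h1, h2, h3, ⟨L, h4, h5, h6⟩, h7⟩ := ha
  obtain ⟨K', h', h1', h2', h3', ⟨L', h4', h5', h6'⟩, h7'⟩ := hb
  refine ⟨K ∪ K', _, h1.add h1', fun hz => ?_, ?_,
    ⟨L + L', integrableGerms.add_mem h4 h4', h5.add h5', by rw [map_add, h6, h6']⟩,
    fun hz => (h7 hz).add (h7' hz)⟩
  · rw [principalStar_union]
    exact ⟨h2 hz, h2' hz⟩
  · rw [principalStar_union]
    filter_upwards [h3, h3'] with w e1 e2 hw using ⟨e1 hw, e2 hw⟩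

/-- A generating function analytic at `z₀` is a local target without variation. -/
theorem Continues.localTarget {σ : Side} {z₀ : ℂ} {X K : Set ℂ} {a : ℕ → ℂ} {h : ℂ → ℂ}
    (ha : Continues a K h) (h1 : z₀ ∈ principalStar X → z₀ ∈ principalStar K)
    (h2 : ∀ᶠ w in logFilter, w.im ∈ σ.args → pt z₀ w ∈ principalStar K) (h3 : z₀ ∉ K) :
    LocalTarget σ z₀ X a 0 := by
  have h4 : IsRegularAt h σ z₀ := ⟨h, ha.analytic.analyticAt
    (ha.compact.isClosed.isOpen_compl.mem_nhds h3), Eventually.of_forall fun w _ => rfl⟩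
  obtain ⟨L, h5, h6, h7⟩ := h4.exists_branch
  refine ⟨K, h, ha, h1, h2, ⟨L, h5, h6, ?_⟩, fun _ => h4⟩
  change turn 1 L - L = 0
  rw [h7, sub_self]

theorem LocalTarget.sum {σ : Side} {z₀ : ℂ} {X : Set ℂ} {ι : Type*} (s : Finset ι)
    {a : ι → ℕ → ℂ} {D : ι → LogGerm} (h : ∀ i ∈ s, LocalTarget σ z₀ X (a i) (D i)) :
    LocalTarget σ z₀ X (∑ i ∈ s, a i) (∑ i ∈ s, D i) := by
  classical
  induction s using Finset.induction_on with
  | empty =>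
    rw [Finset.sum_empty, Finset.sum_empty]
    have h1 : ∀ z, z ∈ principalStar ∅ := fun z => mem_principalStar.2 fun _ _ => id
    exact continues_zero.localTarget (fun _ => h1 _) (Eventually.of_forall fun _ _ => h1 _) id
  | insert i s hi ih =>
    rw [Finset.sum_insert hi, Finset.sum_insert hi]
    exact (h i (Finset.mem_insert_self i s)).add
      (ih fun j hj => h j (Finset.mem_insert_of_mem hj))

/-- The operator `z d/dz` on generating functions. -/
theorem Continues.theta {a : ℕ → ℂ} {K : Set ℂ} {h : ℂ → ℂ} (ha : Continues a K h) :
    Continues (fun n => n * a n) K (fun z => z * deriv h z) where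
  compact := ha.compact
  zero := ha.zero
  analytic := differentiableOn_id.mul (ha.analytic.deriv ha.compact.isClosed.isOpen_compl)
  hasSum := by
    obtain ⟨r, hr, h1⟩ := Metric.eventually_nhds_iff_ball.1 ha.hasSum
    have hr2 : 0 < r / 2 := by linarith
    have h2 : Summable fun n => ‖a n‖ * (r / 2) ^ n := by
      have := (h1 ((r / 2 : ℝ) : ℂ) (by
        rw [mem_ball_zero_iff, norm_real, Real.norm_of_nonneg hr2.le]
        linarith)).summable.norm
      simpa [abs_of_pos hr] using this
    filter_upwards [Metric.ball_mem_nhds (0 : ℂ) hr2] with z hz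
    have h3 := Complex.hasSum_deriv_of_summable_norm (U := Metric.ball 0 (r / 2)) h2
      (F := fun n z => a n * z ^ n) (fun n => by fun_prop) Metric.isOpen_ball (fun n w hw => by
        rw [norm_mul, norm_pow]
        rw [mem_ball_zero_iff] at hw
        gcongr) hz
    have h4 : (fun w => ∑' n, a n * w ^ n) =ᶠ[𝓝 z] h := by
      filter_upwards [Metric.isOpen_ball.mem_nhds hz] with w hw
      exact (h1 w (Metric.ball_subset_ball (by linarith) hw)).tsum_eq
    rw [h4.deriv_eq] at h3
    refine (h3.mul_left z).congr_fun fun n => ?_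
    have h5 : deriv (fun z => a n * z ^ n) z = a n * (n * z ^ (n - 1)) := by
      rw [deriv_const_mul _ (by fun_prop), deriv_pow_field]
    rw [h5]
    rcases n with _ | n
    · simp
    · simp only [Nat.add_sub_cancel, pow_succ]
      ring

section target
variable {sg r η η₁ R δ : ℝ} {z₀ γ : ℂ} {Γ X : Set ℂ} {σ : Side} {N : ℂ → ℂ}

/-- Near its tip, `z d/dz` of the generating function of a slit is a branch of variation
`logDer N`. -/
theorem exists_branch_of_tip {h A : ℂ → ℂ} {K : Set ℂ} (hK : IsCompact K)
    {ρ : ℝ} (hN : DifferentiableOn ℂ N {w | w.re < ρ}) (hN0 : StolzZero N) (hη1 : η₁ ≤ 1)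
    (hη : 0 < η₁) (hρ : Real.log η₁ < ρ) (hh : DifferentiableOn ℂ h Kᶜ)
    (hA : DifferentiableOn ℂ A (Metric.ball 0 1))
    (he : ∀ s : ℂ, s.re < Real.log η₁ → -(σ.sgn * (Real.pi / 2)) < s.im →
      s.im < -(σ.sgn * (Real.pi / 2)) + 2 * Real.pi →
        h (z₀ * exp (exp s)) = cousin N (Real.log η₁) (-(σ.sgn * (Real.pi / 2))) s + A (exp s))
    (hs : ∀ᶠ w in logFilter, w.im ∈ σ.args → pt z₀ w ∈ principalStar K) :
    ∃ L ∈ integrableGerms, IsBranchAt (fun z => z * deriv h z) σ z₀ L ∧ Del L = chart (logDer N) := by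
  set θ₀ : ℝ := -(σ.sgn * (Real.pi / 2)) with hθ₀
  set χ := cousin N (Real.log η₁) θ₀ with hχ
  have hlog : Real.log η₁ ≤ 0 := Real.log_nonpos hη.le hη1
  have hχd : DifferentiableOn ℂ χ {w | w.re < Real.log η₁} := differentiableOn_cousin hN hN0 hρ θ₀
  have hAd : ∀ s : ℂ, s.re < 0 → AnalyticAt ℂ A (exp s) := fun s hs =>
    hA.analyticAt (Metric.isOpen_ball.mem_nhds (by
      rw [mem_ball_zero_iff, norm_exp]
      exact Real.exp_lt_one_iff.2 hs))
  set f₀ : ℂ → ℂ := fun s => logDer χ s + deriv A (exp s) with hf₀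
  have h1 : ∀ᶠ w in logFilter, AnalyticAt ℂ (logDer χ) w :=
    eventually_analyticAt_logDer (eventually_analyticAt_iff.2 ⟨_, hχd⟩)
  have h2 : ∀ᶠ w in logFilter, AnalyticAt ℂ f₀ w := by
    filter_upwards [h1, eventually_re_lt 0] with w h1 h2
    exact h1.add ((hAd w h2).deriv.comp_of_eq analyticAt_cexp rfl)
  have h3 : StolzZero fun w => exp w * f₀ w := by
    have e1 : Tendsto (fun w => exp w * deriv A (exp w)) logFilter (𝓝 0) := by
      have hc : ContinuousAt (fun u => u * deriv A u) 0 :=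
        continuousAt_id.mul (hA.analyticAt (Metric.ball_mem_nhds 0 one_pos)).deriv.continuousAt
      have := hc.tendsto.comp tendsto_exp_logFilter
      simpa [Function.comp_def] using this
    have e2 := (stolzZero_exp_mul_logDer (stolzZero_deriv_cousin hN hN0 hρ θ₀)).add
      (stolzZero_of_tendsto e1)
    refine e2.congr (Eventually.of_forall fun w => ?_)
    simp only [hf₀]
    ring
  refine ⟨chart f₀, chart_mem_integrableGerms h2 h3, ⟨_, rfl, ?_⟩, ?_⟩
  · filter_upwards [eventually_analyticAt_comp h2 eventually_analyticAt_sOf tendsto_sOf, hs,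
      tendsto_sOf.eventually (eventually_pt_wOf z₀), eventually_wOf_sOf,
      tendsto_sOf.eventually (eventually_re_lt (Real.log η₁)), eventually_sOf_sub_le one_pos]
      with w k1 k2 k3 k4 k5 k6
    refine ⟨k1, fun hw => ?_⟩
    rw [k4] at k3
    have k7 := (abs_im_le_norm (sOf w - w)).trans k6
    rw [sub_im, abs_le] at k7
    have hpi := Real.pi_gt_three
    have k8 : θ₀ < (sOf w).im ∧ (sOf w).im < θ₀ + 2 * Real.pi := by
      rw [hθ₀]
      cases σ <;> simp only [Side.args, Side.sgn, Set.mem_Ioo] at hw ⊢ <;>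
        constructor <;> linarith [k7.1, k7.2, hw.1, hw.2]
    generalize sOf w = s at *
    have hK' : z₀ * exp (exp s) ∈ Kᶜ := by
      have := mem_principalStar.1 (k2 hw) 1 ⟨zero_le_one, le_rfl⟩
      rwa [ofReal_one, one_mul, k3] at this
    have d1 : HasDerivAt (fun s => z₀ * exp (exp s)) (z₀ * (exp (exp s) * exp s)) s :=
      ((hasDerivAt_exp (exp s)).comp s (hasDerivAt_exp s)).const_mul z₀
    have d2 : HasDerivAt (fun s => h (z₀ * exp (exp s)))
        (deriv h (z₀ * exp (exp s)) * (z₀ * (exp (exp s) * exp s))) s :=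
      ((hh _ hK').differentiableAt (hK.isClosed.isOpen_compl.mem_nhds hK')).hasDerivAt.comp
        (h := fun s => z₀ * exp (exp s)) s d1
    have d3 : HasDerivAt χ (deriv χ s) s :=
      ((hχd s k5).differentiableAt ((isOpen_re_lt _).mem_nhds k5)).hasDerivAt
    have d4 : HasDerivAt (fun s => A (exp s)) (deriv A (exp s) * exp s) s :=
      (hAd s (k5.trans_le hlog)).differentiableAt.hasDerivAt.comp s (hasDerivAt_exp s)
    have hev : (fun s => h (z₀ * exp (exp s))) =ᶠ[𝓝 s] fun s => χ s + A (exp s) := by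
      have o1 : ∀ᶠ s' : ℂ in 𝓝 s, s'.re < Real.log η₁ :=
        continuous_re.continuousAt.eventually (gt_mem_nhds k5)
      have o2 : ∀ᶠ s' : ℂ in 𝓝 s, θ₀ < s'.im :=
        continuous_im.continuousAt.eventually (lt_mem_nhds k8.1)
      have o3 : ∀ᶠ s' : ℂ in 𝓝 s, s'.im < θ₀ + 2 * Real.pi :=
        continuous_im.continuousAt.eventually (gt_mem_nhds k8.2)
      filter_upwards [o1, o2, o3] with s' p1 p2 p3 using he s' p1 p2 p3
    have d5 := d2.unique ((d3.add d4).congr_of_eventuallyEq hev)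
    have d6 : exp (-s) * exp s = 1 := by rw [← exp_add, neg_add_cancel, exp_zero]
    simp only [hf₀, logDer]
    rw [k3]
    linear_combination (-exp (-s)) * d5 +
      (z₀ * exp (exp s) * deriv h (z₀ * exp (exp s)) - deriv A (exp s)) * d6
  · rw [Del_chart, chart_eq_iff]
    filter_upwards [eventually_re_lt (Real.log η₁)] with s hs
    rw [← logDer_turn_sub hχd (fun s hs => cousin_turn_sub hN hN0 hρ θ₀ hs) hs]
    have : exp (s + 2 * Real.pi * I) = exp s := exp_periodic s
    simp only [hf₀, this]
    ring

open Classical in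
theorem slit_localTarget (hz₀ : z₀ ≠ 0) (hΓ : Γ.Finite) (hΓ0 : (0 : ℂ) ∉ Γ) (hη : η ≤ 1)
    (h : ∀ γ ∈ Γ, Separated η z₀ γ) (hr : ‖z₀‖ < r) (hΓX : Γ ⊆ X) (hγ : γ ∈ Γ)
    {ρ : ℝ} (hN : DifferentiableOn ℂ N {w | w.re < ρ}) (hN0 : StolzZero N) (hη₁ : 0 < η₁)
    (hη' : η₁ ≤ η) (hρ : Real.log η₁ < ρ) :
    LocalTarget σ z₀ X (fun n => n * slit σ.sgn η₁ N γ n)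
      (if γ = z₀ then chart (logDer N) else 0) := by
  have hγ0 : γ ≠ 0 := fun h => hΓ0 (h ▸ hγ)
  obtain ⟨f, A, hc, hA, hf⟩ := exists_continues_slit σ.sgn_eq hN hN0 hη₁ (hη'.trans hη) hρ hγ0
  have hK : slitPt σ.sgn γ '' Set.Icc 0 η₁ ⊆ sector σ.sgn r η Γ ∪ Γ := by
    rintro _ ⟨v, hv, rfl⟩
    rcases hv.1.eq_or_lt with rfl | hv0
    · rw [slitPt_zero]
      exact Or.inr hγ
    · exact Or.inl (Or.inr ⟨γ, hγ, v, ⟨hv0, hv.2.trans hη'⟩, 1, one_pos, by simp⟩)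
  have hs := eventually_pt_of_eventually_side hz₀ (eventually_mem_principalStar_of_separated
    σ.sgn_eq hΓ hΓ0 (hη₁.le.trans hη') hη h hr hc.zero hK)
  have hst := mem_principalStar_of_separated σ.sgn_eq hΓ0 hη h hr hc.zero hK hΓX
  by_cases hγz : γ = z₀
  · subst hγz
    rw [if_pos rfl]
    exact ⟨_, _, hc.theta, hst, hs, exists_branch_of_tip hc.compact hN hN0 (hη'.trans hη) hη₁ hρ
      hc.analytic hA hf hs, fun h' => absurd (hΓX hγ) h'⟩
  · rw [if_neg hγz]
    refine hc.theta.localTarget hst hs ?_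
    rintro ⟨v, hv, he⟩
    rcases hv.1.eq_or_lt with rfl | hv0
    · rw [slitPt_zero] at he
      exact hγz he
    · exact (h γ hγ).ne σ.sgn_eq hγ0 hη one_pos ⟨hv0, hv.2.trans hη'⟩ (by simpa using he.symm)

theorem moments_localTarget (hz₀ : z₀ ≠ 0) (hΓ : Γ.Finite) (hΓ0 : (0 : ℂ) ∉ Γ) (h0η : 0 ≤ η)
    (hη : η ≤ 1) (h : ∀ γ ∈ Γ, Separated η z₀ γ) (hr : ‖z₀‖ < r) (hΓX : Γ ⊆ X) {m : ℕ → ℂ}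
    (hm : m ∈ moments (sector σ.sgn r η Γ)) :
    LocalTarget σ z₀ X (fun n => n * m n) 0 ∧ LocalTarget σ z₀ X (fun n => n * (n * m n)) 0 := by
  obtain ⟨K, hK, f, hc⟩ := exists_continues_of_mem_moments hm
  have hK' := hK.trans (Set.subset_union_left (t := Γ))
  have hs := eventually_pt_of_eventually_side hz₀ (eventually_mem_principalStar_of_separated
    σ.sgn_eq hΓ hΓ0 h0η hη h hr hc.zero hK')
  have hst := mem_principalStar_of_separated σ.sgn_eq hΓ0 hη h hr hc.zero hK' hΓX
  have hz : z₀ ∉ K := fun h' => mul_notMem_sector σ.sgn_eq hΓ0 hη h hr one_pos le_rfl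
    (by rw [ofReal_one, one_mul]; exact hK h')
  exact ⟨hc.theta.localTarget hst hs hz, hc.theta.theta.localTarget hst hs hz⟩

theorem single_localTarget (σ : Side) (z₀ : ℂ) (X : Set ℂ) (c : ℂ) :
    LocalTarget σ z₀ X (Pi.single 0 c) 0 := by
  have h1 : ∀ z, z ∈ principalStar ∅ := fun z => mem_principalStar.2 fun _ _ => id
  have hc : Continues (Pi.single 0 c) ∅ (fun _ => c) :=
    ⟨isCompact_empty, id, differentiableOn_const c, Eventually.of_forall fun z => by
      have := hasSum_single (f := fun n => (Pi.single 0 c : ℕ → ℂ) n * z ^ n) 0 fun n hn => by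
        simp [hn]
      simpa using this⟩
  exact hc.localTarget (fun _ => h1 _) (Eventually.of_forall fun _ _ => h1 _) id

/-! ### Products of the decompositions of Taylor coefficients -/

/-- The points of the slits of length `η` at the points of `A`. -/
def arcs (sg η : ℝ) (A : Set ℂ) : Set ℂ := {z | ∃ α ∈ A, ∃ v ∈ Set.Icc 0 η, z = slitPt sg α v}

theorem norm_slitPt (sg : ℝ) (γ : ℂ) (v : ℝ) : ‖slitPt sg γ v‖ = ‖γ‖ := by
  have : ‖exp (-(sg * v) * I)‖ = 1 := by
    rw [norm_exp]
    simp
  rw [slitPt, norm_mul, this, mul_one]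

variable {A B : Set ℂ}

theorem wedge_mul_wedge_subset (hδ : 0 < δ) (hδR : δ ≤ R) :
    wedge sg R δ η A * wedge sg R δ η B ⊆ sector sg (R * δ) (2 * η) (A * B) := by
  have key : ∀ {C : Set ℂ} {z : ℂ}, z ∈ wedge sg R δ η C → δ ≤ ‖z‖ := fun {C z} hz =>
    hz.elim (fun h => hδR.trans h) fun h => h.1
  rintro _ ⟨z, hz, z', hz', rfl⟩
  have h1 := key hz
  have h2 := key hz'
  rcases hz with h | ⟨_, α, hα, y, hy, t, ht, rfl⟩
  · left
    change R * δ ≤ ‖z * z'‖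
    rw [norm_mul]
    exact mul_le_mul h h2 hδ.le (norm_nonneg z)
  rcases hz' with h | ⟨_, β, hβ, y', hy', t', ht', rfl⟩
  · left
    change R * δ ≤ ‖t * slitPt sg α y * z'‖
    rw [norm_mul, mul_comm R δ]
    exact mul_le_mul h1 h (hδ.le.trans hδR) (norm_nonneg _)
  · right
    refine ⟨α * β, Set.mul_mem_mul hα hβ, y + y', ⟨by linarith [hy.1, hy'.1], by
      linarith [hy.2, hy'.2]⟩, t * t', mul_pos ht ht', ?_⟩
    change t * slitPt sg α y * (t' * slitPt sg β y') = _
    rw [← slitPt_mul]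
    push_cast
    ring

theorem arcs_mul_wedge_subset (hδ : 0 < δ) (hδR : δ ≤ R) (hA : ∀ α ∈ A, δ ≤ ‖α‖) :
    arcs sg η A * wedge sg R δ η B ⊆ sector sg (R * δ) (2 * η) (A * B) := by
  rintro _ ⟨_, ⟨α, hα, v, hv, rfl⟩, z', hz', rfl⟩
  rcases hz' with h | ⟨_, β, hβ, y', hy', t', ht', rfl⟩
  · left
    change R * δ ≤ ‖slitPt sg α v * z'‖
    rw [norm_mul, mul_comm R δ, norm_slitPt]
    exact mul_le_mul (hA α hα) h (hδ.le.trans hδR) (norm_nonneg _)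
  · right
    refine ⟨α * β, Set.mul_mem_mul hα hβ, v + y', ⟨by linarith [hv.1, hy'.1], by
      linarith [hv.2, hy'.2]⟩, t', ht', ?_⟩
    change slitPt sg α v * (t' * slitPt sg β y') = _
    rw [← slitPt_mul]
    ring

/-- `P` is holomorphic on a half-plane containing the logarithm of `η`. -/
def HolomorphicBelow (η : ℝ) (P : ℂ → ℂ) : Prop :=
  ∃ ρ, Real.log η < ρ ∧ DifferentiableOn ℂ P {w | w.re < ρ}

theorem eventually_holomorphicBelow {P : ℂ → ℂ} (hP : ∀ᶠ w in logFilter, AnalyticAt ℂ P w) :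
    ∀ᶠ η in 𝓝[>] (0 : ℝ), HolomorphicBelow η P := by
  obtain ⟨ρ, hρ⟩ := eventually_analyticAt_iff.1 hP
  filter_upwards [Real.tendsto_log_nhdsGT_zero.eventually (eventually_lt_atBot ρ)] with η hη
    using ⟨ρ, hη, hρ⟩

theorem HolomorphicBelow.common {P Q : ℂ → ℂ} (hP : HolomorphicBelow η P)
    (hQ : HolomorphicBelow η Q) : ∃ ρ, Real.log η < ρ ∧ DifferentiableOn ℂ P {w | w.re < ρ} ∧
      DifferentiableOn ℂ Q {w | w.re < ρ} := by
  obtain ⟨ρ, h1, h2⟩ := hP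
  obtain ⟨ρ', h1', h2'⟩ := hQ
  exact ⟨min ρ ρ', lt_min h1 h1',
    h2.mono fun w (hw : w.re < min ρ ρ') => lt_of_lt_of_le hw (min_le_left ρ ρ'),
    h2'.mono fun w (hw : w.re < min ρ ρ') => lt_of_lt_of_le hw (min_le_right ρ ρ')⟩

theorem stolzZero_nconv {P Q : ℂ → ℂ} (hP : Tame P) (hQ : Tame Q) : StolzZero (nconv P Q) := by
  intro M
  have h1 := (tendsto_exp_logFilter.mono_left inf_le_left).mul
    ((tame_exp_neg_mul_conv hP hQ).stolz M)
  rw [mul_zero] at h1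
  have h2 := h1.const_mul (-(1 / (2 * Real.pi * I)))
  rw [mul_zero] at h2
  refine h2.congr fun w => ?_
  rw [nconv, ← mul_assoc (exp w), ← exp_add, add_neg_cancel, exp_zero, one_mul]

/-- The product of two sums of slits and moments. -/
theorem mul_decomposition {P Q : ℂ → ℂ → ℂ} {SR TR : Finset ℂ} {a b : ℕ → ℂ}
    (hsg : sg = 1 ∨ sg = -1)
    (hP : ∀ α ∈ SR, Tame (P α) ∧ HolomorphicBelow η (P α))
    (hQ : ∀ β ∈ TR, Tame (Q β) ∧ HolomorphicBelow η (Q β)) (hη : 0 < η)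
    (hδ : 0 < δ) (hδR : δ ≤ R) (hS : ∀ α ∈ SR, δ ≤ ‖α‖) (hT : ∀ β ∈ TR, δ ≤ ‖β‖)
    (ha : (fun n => a n - ∑ α ∈ SR, slit sg η (P α) α n) ∈ moments (wedge sg R δ η SR))
    (hb : (fun n => b n - ∑ β ∈ TR, slit sg η (Q β) β n) ∈ moments (wedge sg R δ η TR)) :
    (fun n => a n * b n - ∑ p ∈ SR ×ˢ TR, slit sg η (nconv (P p.1) (Q p.2)) (p.1 * p.2) n) ∈
      moments (sector sg (R * δ) (2 * η) ((SR : Set ℂ) * TR)) := by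
  set M := moments (sector sg (R * δ) (2 * η) ((SR : Set ℂ) * TR)) with hM
  have hne : ∀ {z : ℂ}, δ ≤ ‖z‖ → z ≠ 0 := fun h => norm_pos_iff.1 (hδ.trans_le h)
  have hsum : ∀ {C : Finset ℂ} {P : ℂ → ℂ → ℂ}, (∀ α ∈ C, Tame (P α) ∧ HolomorphicBelow η (P α)) →
      (∀ α ∈ C, δ ≤ ‖α‖) → (∑ α ∈ C, slit sg η (P α) α) ∈ moments (arcs sg η C) := by
    intro C P hP hC
    refine Submodule.sum_mem _ fun α hα => ?_
    obtain ⟨h1, ρ, h2, h3⟩ := hP α hα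
    exact slit_mem_moments h3 h1.stolz h2 sg (hne (hC α hα)) fun v hv => ⟨α, hα, v, hv, rfl⟩
  have k1 := moments_mono (wedge_mul_wedge_subset hδ hδR) (moments_mul ha hb)
  have k2 := moments_mono (arcs_mul_wedge_subset hδ hδR (fun α hα => hS α hα))
    (moments_mul (hsum hP hS) hb)
  have k3 := moments_mono (arcs_mul_wedge_subset hδ hδR (fun α hα => hT α hα))
    (moments_mul (hsum hQ hT) ha)
  rw [mul_comm (TR : Set ℂ)] at k3
  have k4 : (∑ p ∈ SR ×ˢ TR, (slit sg η (P p.1) p.1 * slit sg η (Q p.2) p.2 -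
      slit sg η (nconv (P p.1) (Q p.2)) (p.1 * p.2))) ∈ M := by
    refine Submodule.sum_mem _ fun p hp => ?_
    obtain ⟨hp1, hp2⟩ := Finset.mem_product.1 hp
    obtain ⟨ρ, h1, h2, h3⟩ := (hP _ hp1).2.common (hQ _ hp2).2
    exact slit_mul_slit_sub_mem hsg h2 (hP _ hp1).1.stolz h3 (hQ _ hp2).1.stolz h1
      (hne (hS _ hp1)) (hne (hT _ hp2)) fun v hv => Or.inr ⟨p.1 * p.2, Set.mul_mem_mul hp1 hp2, v,
        ⟨hη.trans_le hv.1, hv.2⟩, 1, one_pos, by simp⟩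
  convert M.add_mem (M.add_mem k1 k2) (M.add_mem k3 k4) using 1
  funext n
  have e1 : (∑ α ∈ SR, slit sg η (P α) α n) * ∑ β ∈ TR, slit sg η (Q β) β n =
      ∑ p ∈ SR ×ˢ TR, slit sg η (P p.1) p.1 n * slit sg η (Q p.2) p.2 n := by
    rw [Finset.sum_mul_sum, Finset.sum_product]
  simp only [Pi.add_apply, Pi.mul_apply, Finset.sum_apply, Pi.sub_apply, Finset.sum_sub_distrib]
  rw [← e1]
  ring

end target

theorem HolomorphicBelow.mono {η η' : ℝ} {P : ℂ → ℂ} (h : HolomorphicBelow η' P) (hη : 0 < η)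
    (hη' : η ≤ η') : HolomorphicBelow η P := by
  obtain ⟨ρ, h1, h2⟩ := h
  exact ⟨ρ, (Real.log_le_log hη hη').trans_lt h1, h2⟩

/-- Near any nonzero point, the Hadamard product continues with the expected variation. -/
theorem hadamardProduct_localTarget {F G : PowerSeries ℂ} {S T : Set ℂ}
    (hF : HasIntegrableSingularities F S) (hG : HasIntegrableSingularities G T) (σ : Side) {z₀ : ℂ}
    (hz₀ : z₀ ≠ 0) : LocalTarget σ z₀ (S * T)
      (fun n => PowerSeries.coeff n (hadamardProduct F G))
      (∑ᶠ p ∈ {p : ℂ × ℂ | p.1 ∈ S ∧ p.2 ∈ T ∧ p.1 * p.2 = z₀},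
        intConv (Del (localBranch σ p.1 F)) (Del (localBranch σ p.2 G))) := by
  classical
  obtain ⟨Φ, A, P, hΦ, hA, hA', hP⟩ := hF.exists_seamData σ
  obtain ⟨Ψ, B, Q, hΨ, hB, hB', hQ⟩ := hG.exists_seamData σ
  obtain ⟨δ₁, hδ₁, hS⟩ := hF.1.exists_lower_bound
  obtain ⟨δ₂, hδ₂, hT⟩ := hG.1.exists_lower_bound
  obtain ⟨δ, hδ, hδ1, hδ2⟩ : ∃ δ : ℝ, 0 < δ ∧ δ < δ₁ ∧ δ < δ₂ := by
    obtain ⟨δ, h1, h2⟩ := exists_between (lt_min hδ₁ hδ₂)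
    exact ⟨δ, h1, h2.trans_le (min_le_left _ _), h2.trans_le (min_le_right _ _)⟩
  have hS' : ∀ α ∈ S, δ < ‖α‖ := fun α hα => hδ1.trans_le (hS α hα)
  have hT' : ∀ α ∈ T, δ < ‖α‖ := fun α hα => hδ2.trans_le (hT α hα)
  obtain ⟨R, hδR, hR, hRS, hRT⟩ : ∃ R : ℝ, δ < R ∧ ‖z₀‖ < R * δ ∧ (∀ α ∈ S, ‖α‖ ≠ R) ∧
      ∀ α ∈ T, ‖α‖ ≠ R := by
    set c := max δ (‖z₀‖ / δ)
    obtain ⟨R, h1, h2⟩ := (Set.Ioo_infinite (lt_add_one c)).exists_notMem_finite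
      (((hF.1.union hG.1).2 (c + 1)).image norm)
    have h3 : ∀ α ∈ S ∪ T, ‖α‖ ≠ R := fun α hα he =>
      h2 ⟨α, ⟨hα, by simpa [he] using h1.2.le⟩, he⟩
    exact ⟨R, (le_max_left _ _).trans_lt h1.1,
      (div_lt_iff₀ hδ).1 ((le_max_right _ _).trans_lt h1.1), fun α hα => h3 α (Or.inl hα),
      fun α hα => h3 α (Or.inr hα)⟩
  have hfin : ∀ {S : Set ℂ}, IsSingularSet S → ∃ SR : Finset ℂ, ∀ α, α ∈ SR ↔ α ∈ S ∧ ‖α‖ < R := by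
    intro S hS
    have : {α | α ∈ S ∧ ‖α‖ < R}.Finite :=
      (hS.2 R).subset fun α hα => ⟨hα.1, by simpa using hα.2.le⟩
    exact ⟨this.toFinset, fun α => this.mem_toFinset⟩
  obtain ⟨SR, hSR⟩ := hfin hF.1
  obtain ⟨TR, hTR⟩ := hfin hG.1
  set Γ : Set ℂ := (SR : Set ℂ) * TR with hΓ
  have hΓX : Γ ⊆ S * T := Set.mul_subset_mul (fun α h => ((hSR α).1 h).1) fun β h => ((hTR β).1 h).1
  have hΓ0 : (0 : ℂ) ∉ Γ := fun h => (hF.1.mul hG.1).1 (hΓX h)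
  have hΓf : Γ.Finite := SR.finite_toSet.mul TR.finite_toSet
  have hPt : ∀ α ∈ SR, Tame (P α) := fun α h => (hP α ((hSR α).1 h).1).1
  have hQt : ∀ β ∈ TR, Tame (Q β) := fun β h => (hQ β ((hTR β).1 h).1).1
  obtain ⟨e, he0, he1, he2, he3, he4, he5⟩ : ∃ e : ℝ, 0 < e ∧ e ≤ 1 ∧ (∀ γ ∈ Γ, Separated e z₀ γ) ∧
      (∀ α ∈ SR, HolomorphicBelow e (P α)) ∧ (∀ β ∈ TR, HolomorphicBelow e (Q β)) ∧
      ∀ p ∈ SR ×ˢ TR, HolomorphicBelow e (nconv (P p.1) (Q p.2)) := by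
    have h1 : ∀ᶠ e : ℝ in 𝓝[>] 0, e ∈ Set.Ioo (0 : ℝ) 1 := Ioo_mem_nhdsGT one_pos
    have h2 : ∀ᶠ e : ℝ in 𝓝[>] 0, ∀ γ ∈ Γ, Separated e z₀ γ := (hΓf.eventually_all).2
      fun γ hγ => eventually_separated hz₀ fun h => hΓ0 (h ▸ hγ)
    have h3 : ∀ᶠ e : ℝ in 𝓝[>] 0, ∀ α ∈ SR, HolomorphicBelow e (P α) :=
      (Finset.eventually_all SR).2 fun α h => eventually_holomorphicBelow (hPt α h).analytic
    have h4 : ∀ᶠ e : ℝ in 𝓝[>] 0, ∀ β ∈ TR, HolomorphicBelow e (Q β) :=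
      (Finset.eventually_all TR).2 fun β h => eventually_holomorphicBelow (hQt β h).analytic
    have h5 : ∀ᶠ e : ℝ in 𝓝[>] 0, ∀ p ∈ SR ×ˢ TR, HolomorphicBelow e (nconv (P p.1) (Q p.2)) :=
      (Finset.eventually_all _).2 fun p hp => eventually_holomorphicBelow
        (eventually_analyticAt_nconv (hPt _ (Finset.mem_product.1 hp).1)
          (hQt _ (Finset.mem_product.1 hp).2))
    obtain ⟨e, k1, k2, k3, k4, k5⟩ := (h1.and (h2.and (h3.and (h4.and h5)))).exists
    exact ⟨e, k1.1, k1.2.le, k2, k3, k4, k5⟩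
  obtain ⟨η, rfl⟩ : ∃ η, e = 2 * η := ⟨e / 2, by ring⟩
  have hη : 0 < η := by linarith
  have hηe : η ≤ 2 * η := by linarith
  have hm := mul_decomposition σ.sgn_eq
    (fun α h => ⟨hPt α h, (he3 α h).mono hη hηe⟩) (fun β h => ⟨hQt β h, (he4 β h).mono hη hηe⟩)
    hη hδ hδR.le (fun α h => (hS' α ((hSR α).1 h).1).le) (fun β h => (hT' β ((hTR β).1 h).1).le)
    (coeff_sub_mem hF.1 hΦ (fun α h => (hP α h).1) hA' hSR hRS hδ hS' hδR hη le_rfl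
      fun α h => (he3 α h).mono hη hηe)
    (coeff_sub_mem hG.1 hΨ (fun α h => (hQ α h).1) hB' hTR hRT hδ hT' hδR hη le_rfl
      fun α h => (he4 α h).mono hη hηe)
  have hslit : ∀ p ∈ SR ×ˢ TR, LocalTarget σ z₀ (S * T)
      (fun n => (n : ℂ) * (n * slit σ.sgn η (nconv (P p.1) (Q p.2)) (p.1 * p.2) n))
      (if p.1 * p.2 = z₀ then chart (logDer (logDer (nconv (P p.1) (Q p.2)))) else 0) := by
    intro p hp
    obtain ⟨h1, h2⟩ := Finset.mem_product.1 hp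
    have hγ : p.1 * p.2 ∈ Γ := Set.mul_mem_mul h1 h2
    obtain ⟨ρ, h3, h4⟩ := (he5 p hp).mono hη hηe
    have h5 := tame_logDer_nconv (hPt _ h1) (hQt _ h2)
    have h6 := slit_localTarget (σ := σ) hz₀ hΓf hΓ0 he1 he2 hR hΓX hγ (differentiableOn_logDer h4)
      h5.stolz hη hηe h3
    have h7 := (moments_localTarget (σ := σ) hz₀ hΓf hΓ0 he0.le he1 he2 hR hΓX
      (mul_slit_sub_mem σ.sgn_eq h4 (stolzZero_nconv (hPt _ h1) (hQt _ h2)) h5.stolz hη h3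
        (fun h => hΓ0 (h ▸ hγ)) (W := sector σ.sgn (R * δ) (2 * η) Γ)
        (Or.inr ⟨p.1 * p.2, hγ, η, ⟨hη, hηe⟩, 1, one_pos, by simp⟩))).1
    convert h6.add h7 using 1
    · funext n
      simp only [Pi.add_apply, Pi.sub_apply]
      ring
    · rw [add_zero]
  convert ((LocalTarget.sum _ hslit).add (moments_localTarget hz₀ hΓf hΓ0 he0.le he1 he2 hR hΓX
    hm).2).add (single_localTarget σ z₀ (S * T) (PowerSeries.coeff 0 F * PowerSeries.coeff 0 G))
    using 1
  · funext n
    rw [Pi.add_apply, Pi.add_apply, Finset.sum_apply, ← Finset.mul_sum, ← Finset.mul_sum, ← mul_add,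
      ← mul_add, add_sub_cancel, hadamardProduct, PowerSeries.coeff_mk]
    rcases eq_or_ne n 0 with rfl | hn
    · simp
    · rw [hA n hn, hB n hn, Pi.single_eq_of_ne hn]
      ring
  · have hset : {p : ℂ × ℂ | p.1 ∈ S ∧ p.2 ∈ T ∧ p.1 * p.2 = z₀} =
        ((SR ×ˢ TR).filter fun p => p.1 * p.2 = z₀ : Finset (ℂ × ℂ)) := by
      ext p
      simp only [Set.mem_ofPred_eq, Finset.coe_filter, Finset.mem_product, hSR, hTR]
      refine ⟨fun h => ⟨⟨⟨h.1, ?_⟩, h.2.1, ?_⟩, h.2.2⟩, fun h => ⟨h.1.1.1, h.1.2.1, h.2⟩⟩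
      · by_contra hc
        push Not at hc
        rw [← h.2.2, norm_mul] at hR
        exact hR.not_ge (mul_le_mul hc (hT' _ h.2.1).le hδ.le (norm_nonneg _))
      · by_contra hc
        push Not at hc
        rw [← h.2.2, norm_mul, mul_comm R] at hR
        exact hR.not_ge (mul_le_mul (hS' _ h.1).le hc (hδ.trans hδR).le (norm_nonneg _))
    rw [hset, finsum_mem_coe_finset, Finset.sum_filter, add_zero, add_zero]
    refine Finset.sum_congr rfl fun p hp => ?_
    obtain ⟨h1, h2⟩ := Finset.mem_product.1 hp
    have h1 := hP _ ((hSR _).1 h1).1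
    have h2 := hQ _ ((hTR _).1 h2).1
    rw [← h1.2, ← h2.2, intConv_chart h1.1 h2.1]

theorem Continues.eqOn {a : ℕ → ℂ} {K L : Set ℂ} {h k : ℂ → ℂ} (hh : Continues a K h)
    (hk : Continues a L k) : Set.EqOn h k (principalStar K ∩ principalStar L) := by
  have hsub : ∀ {M : Set ℂ}, principalStar M ⊆ Mᶜ := fun {M z} hz h =>
    (mem_principalStar.1 hz 1 ⟨zero_le_one, le_rfl⟩) (by simpa using h)
  have han : ∀ {M : Set ℂ} {f : ℂ → ℂ}, Continues a M f → AnalyticOnNhd ℂ f (principalStar M) :=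
    fun hf => (hf.analytic.analyticOnNhd hf.compact.isClosed.isOpen_compl).mono hsub
  have h0 : ∀ {M : Set ℂ}, (0 : ℂ) ∉ M → (0 : ℂ) ∈ principalStar M := fun h =>
    mem_principalStar.2 fun t _ => by simpa using h
  have h0' : (0 : ℂ) ∈ principalStar (K ∪ L) := h0 fun h => h.elim hh.zero hk.zero
  rw [← principalStar_union]
  refine AnalyticOnNhd.eqOn_of_preconnected_of_eventuallyEq (z₀ := 0)
    ((han hh).mono (star_anti Set.subset_union_left))
    ((han hk).mono (star_anti Set.subset_union_right))
    ((starConvex_principalStar _).isPathConnected h0').isConnected.isPreconnected h0' ?_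
  filter_upwards [hh.hasSum, hk.hasSum] with z h1 h2 using h1.unique h2

/-- Functions which continue the same power series and whose stars cover `U` define a holomorphic
function on `U`. -/
theorem exists_glue {a : ℕ → ℂ} {ι : Type*} {K : ι → Set ℂ} {h : ι → ℂ → ℂ}
    (hc : ∀ i, Continues a (K i) (h i)) :
    ∃ Φ : ℂ → ℂ, ∀ i, Set.EqOn Φ (h i) (principalStar (K i)) := by
  classical
  refine ⟨fun z => if hz : ∃ i, z ∈ principalStar (K i) then h hz.choose z else 0, fun i z hz => ?_⟩
  have hex : ∃ i, z ∈ principalStar (K i) := ⟨i, hz⟩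
  simp only [dif_pos hex]
  exact (hc _).eqOn (hc i) ⟨hex.choose_spec, hz⟩

theorem hadamardProductFormula : HadamardProductFormula := by
  intro F G S T hF hG
  have hST := hF.1.mul hG.1
  choose K h hc hst hs hL hreg using fun i : Side × {z : ℂ // z ≠ 0} =>
    hadamardProduct_localTarget hF hG i.1 i.2.2
  obtain ⟨Φ, hΦ⟩ := exists_glue hc
  have han : ∀ i, AnalyticOnNhd ℂ Φ (principalStar (K i)) := by
    intro i z hz
    have ho := isOpen_principalStar (hc i).compact.isClosed
    have hz' : z ∈ (K i)ᶜ := fun h' =>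
      mem_principalStar.1 hz 1 ⟨zero_le_one, le_rfl⟩ (by simpa using h')
    refine ((hc i).analytic.analyticAt
      ((hc i).compact.isClosed.isOpen_compl.mem_nhds hz')).congr ?_
    filter_upwards [ho.mem_nhds hz] with y hy using (hΦ i hy).symm
  have h0 : ∀ i, (0 : ℂ) ∈ principalStar (K i) := fun i =>
    mem_principalStar.2 fun t _ => by simpa using (hc i).zero
  have i₀ : Side × {z : ℂ // z ≠ 0} := (.left, ⟨1, one_ne_zero⟩)
  have hbr : IsPrincipalBranch (hadamardProduct F G) (S * T) Φ := by
    refine ⟨fun z hz => ?_, ?_⟩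
    · rcases eq_or_ne z 0 with rfl | hz0
      · exact han i₀ 0 (h0 i₀)
      · exact han (.left, ⟨z, hz0⟩) z (hst _ hz)
    · filter_upwards [(hc i₀).hasSum,
        (isOpen_principalStar (hc i₀).compact.isClosed).mem_nhds (h0 i₀)] with z h1 h2
      rwa [hΦ i₀ h2]
  have hbranch : ∀ (σ : Side) {z : ℂ}, z ≠ 0 → ∃ L ∈ integrableGerms, IsBranchAt Φ σ z L ∧
      Del L = ∑ᶠ p ∈ {p : ℂ × ℂ | p.1 ∈ S ∧ p.2 ∈ T ∧ p.1 * p.2 = z},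
        intConv (Del (localBranch σ p.1 F)) (Del (localBranch σ p.2 G)) := by
    intro σ z hz
    obtain ⟨L, h1, ⟨f, rfl, h2⟩, h3⟩ := hL (σ, ⟨z, hz⟩)
    refine ⟨_, h1, ⟨f, rfl, ?_⟩, h3⟩
    filter_upwards [h2, hs (σ, ⟨z, hz⟩)] with w k1 k2
    exact ⟨k1.1, fun hw => by rw [k1.2 hw, hΦ _ (k2 hw)]⟩
  have hH : HasIntegrableSingularities (hadamardProduct F G) (S * T) := by
    refine ⟨hST, Φ, hbr, fun σ => ⟨fun z hz => ?_, fun z hz => ?_⟩⟩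
    · obtain ⟨L, h1, h2, -⟩ := hbranch σ fun h => hST.1 (h ▸ hz)
      exact ⟨L, h1, h2⟩
    · rcases eq_or_ne z 0 with rfl | hz0
      · exact ⟨fun _ => Φ 0, analyticAt_const, Eventually.of_forall fun w _ => by simp [pt]⟩
      · obtain ⟨φ, h1, h2⟩ := hreg (σ, ⟨z, hz0⟩) hz
        refine ⟨φ, h1, ?_⟩
        filter_upwards [h2, hs (σ, ⟨z, hz0⟩)] with w k1 k2 hw
        rw [hΦ _ (k2 hw)]
        exact k1 hw
  refine ⟨hH, fun σ γ => ?_⟩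
  rcases eq_or_ne γ 0 with rfl | hγ
  · have h1 : {p : ℂ × ℂ | p.1 ∈ S ∧ p.2 ∈ T ∧ p.1 * p.2 = 0} = ∅ :=
      Set.eq_empty_of_forall_notMem fun p hp => hST.1 ⟨p.1, hp.1, p.2, hp.2.1, hp.2.2⟩
    rw [h1, finsum_mem_empty]
    change turn 1 _ - _ = 0
    rw [(localBranch_spec hH σ 0).2.2 hST.1]
    exact sub_self _
  · obtain ⟨L, -, h2, h3⟩ := hbranch σ hγ
    rw [IsLocalBranch.localBranch_eq ⟨S * T, Φ, hST, hbr, h2⟩, h3]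

end HadamardMonodromy

theorem mainTheorem2 :
    (∀ (F G : PowerSeries ℂ) (S T : Set ℂ),
      HasIntegrableSingularities F S → HasIntegrableSingularities G T →
        HasIntegrableSingularities (hadamardProduct F G) (S * T) ∧
        ∀ (σ : Side) (k : ℤ),
          (∀ α ∈ S, ∀ β ∈ T,
            HasConv (iteratedMonodromy σ k α F) (iteratedMonodromy σ k β G)
              (intConv (iteratedMonodromy σ k α F) (iteratedMonodromy σ k β G))) ∧
          ∀ γ : ℂ,
            {p : ℂ × ℂ | p.1 ∈ S ∧ p.2 ∈ T ∧ p.1 * p.2 = γ}.Finite ∧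
            iteratedMonodromy σ k γ (hadamardProduct F G) =
              ∑ᶠ p ∈ {p : ℂ × ℂ | p.1 ∈ S ∧ p.2 ∈ T ∧ p.1 * p.2 = γ},
                intConv (iteratedMonodromy σ k p.1 F) (iteratedMonodromy σ k p.2 G)) ∧
    (∀ f ∈ monodromySpace, ∀ g ∈ monodromySpace,
      HasConv f g (intConv f g) ∧ intConv f g ∈ monodromySpace) ∧
    ∃ (mulH : hadamardSpace →ₗ[ℂ] hadamardSpace →ₗ[ℂ] hadamardSpace)
      (mulC : convolutionSpace →ₗ[ℂ] convolutionSpace →ₗ[ℂ] convolutionSpace),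
      (∀ F G : hadamardSpace,
        (mulH F G : PowerSeries ℂ) = hadamardProduct (F : PowerSeries ℂ) (G : PowerSeries ℂ)) ∧
      (∀ (m n : convolutionSpace) (γ : ℂ),
        (mulC m n : ℂ → LogGerm) γ =
          ∑ᶠ p ∈ {p : ℂ × ℂ | p.1 * p.2 = γ},
            intConv ((m : ℂ → LogGerm) p.1) ((n : ℂ → LogGerm) p.2)) ∧
      ∀ (σ : Side) (k : ℤ) (F G : hadamardSpace),
        monodromyOperator σ k (mulH F G) =
          mulC (monodromyOperator σ k F) (monodromyOperator σ k G) := by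
  refine ⟨fun F G S T hF hG => ⟨(hadamardProductFormula F G S T hF hG).1, fun σ k =>
    ⟨fun α _ β _ => (hasConv_intConv (iteratedMonodromy_mem hF σ k α)
      (iteratedMonodromy_mem hG σ k β)).1, fun γ => ⟨hF.1.finite_mul_eq hG.1 γ,
        hadamardProductFormula.iteratedMonodromy_eq hF hG σ k γ⟩⟩⟩,
    fun f hf g hg => hasConv_intConv hf hg, hadamardProductFormula.mul, convolutionMul,
    fun F G => rfl, fun m n γ => rfl, fun σ k F G => hadamardProductFormula.monodromyOperator_mul σ k F G⟩
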